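/- **Setting.** Let $d,r\in\mathbb N_0$, $\Gamma=\mathbb Z^d$ with $\ell^1$-distance $d(\cdot,\cdot)$, and $\Lambda_k=\{-k,\dots,k\}^d$. Let $d^{\Lambda_k}$ be metrics on $\Lambda_k$ with $d^{\Lambda_k}\le d$ and $d^{\Lambda_k}(x,y)=d(x,y)$ whenever $d(x,y)\le k$. For finite $X\subset\Gamma$ let $\mathcal A_X$ be the algebra generated by $1$ and the fermionic operators $a_{x,i},a_{x,i}^*$, $x\in X$, $1\le i\le r$ (acting on Fock space), $a_x^*a_x=\sum_i a_{x,i}^*a_{x,i}$, and $\mathcal A_X^N$ the elements of $\mathcal A_X$ commuting with $N_X=\sum_{x\in X}a_x^*a_x$. Let $\mathcal S$ be the set of bounded, non-increasing $\zeta:[0,\infty)\to(0,\infty)$ with $\zeta(s)\zeta(t)\le\zeta(s+t)$ that decay faster than any polynomial, and $F_\zeta(s)=\zeta(s)(1+s)^{-(d+1)}$. An interaction is a family $\Phi^{\Lambda_k}(X)=\Phi^{\Lambda_k}(X)^*\in\mathcal A_X^N$, $X\subset\Lambda_k$, $k\in\mathbb N_0$; an infinite volume interaction is a family $\Psi(X)=\Psi(X)^*\in\mathcal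 A^N_X$, $X\subset\Gamma$ finite. Put $$\|\Phi\|_{\zeta,n}=\sup_k\sup_{x,y\in\Lambda_k}\sum_{x,y\in X\subset\Lambda_k}\operatorname{diam}^{\Lambda_k}(X)^n\frac{\|\Phi^{\Lambda_k}(X)\|}{F_\zeta(d^{\Lambda_k}(x,y))},\qquad \|\phi\|_{\zeta,n,\Lambda_M}=\sup_{x,y\in\Lambda_M}\sum_{x,y\in X\subset\Lambda_M}\operatorname{diam}(X)^n\frac{\|\phi(X)\|}{F_\zeta(d(x,y))},$$ the latter with the $\ell^1$-distance; $\|\cdot\|^\circ_{\zeta,n}$ is $\|\cdot\|_{\zeta,n}$ for $d^{\Lambda_k}=d$. Let $I\subset\mathbb R$ be an open interval. A time-dependent interaction $\Phi$ is in $\mathcal B_{I,\zeta,n}$ if each $\Phi^{\Lambda_k}(X)$ is smooth on $I$ and there are $\zeta^{(i)}\in\mathcal S$, $i\in\mathbb N_0$, $\zeta^{(0)}=\zeta$, with $\sup_{t\in I}\|\partial_t^i\Phi(t)\|_{\zeta^{(i)},n}<\infty$ for all $i$. It has a rapid thermodynamic limit with exponent $\gamma\in(0,1)$ in $\mathcal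 B_{I,\zeta,n}$ if, for such $\zeta^{(i)}$, there is a time-dependent infinite volume interaction $\Psi$, termwise smooth with $\sup_{t\in I}\|\partial_t^i\Psi(t)\|^\circ_{\zeta^{(i)},n}<\infty$ for all $i$, such that for every $i$ there are $\lambda,C>0$ with $$\sup_{t\in I}\|\partial_t^i(\Psi-\Phi^{\Lambda_k})(t)\|_{\zeta^{(i)},n,\Lambda_M}\le C\,\zeta^{(i)}(M^\gamma)\qquad\text{for all } M\in\mathbb N_0,\ k\ge M+\lambda M^\gamma.$$ An operator family $A=(A^{\Lambda_k}(t))$ is in $\mathcal L_{I,\zeta,\infty}$ (resp. $\mathcal L_{I,\mathcal S,\infty}$) if $A^{\Lambda_k}(t)=\sum_{X\subset\Lambda_k}\Phi^{\Lambda_k}(t,X)$ for an interaction $\Phi$ with $\Phi\in\mathcal B_{I,\zeta,n}$ for every $n\in\mathbb N_0$ (resp. for every $n\in\mathbb N_0$ there is $\zeta_n\in\mathcal S$ with $\Phi\in\mathcal B_{I,\zeta_n,n}$), and it has a rapid thermodynamic limit with exponent $\gamma$ there if $\Phi$ can be chosen to have one in $\mathcal B_{I,\zeta,n}$ (resp.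 $\mathcal B_{I,\zeta_n,n}$ for some $\zeta_n\in\mathcal S$) for every $n$. A skew-adjoint family $A$ is said to have these properties if $\mathrm iA$ does. A Lipschitz potential is a family $v^{\Lambda_k}(t,\cdot):\Lambda_k\to\mathbb R$, smooth in $t\in I$, such that for each $i$ the functions $\partial_t^iv^{\Lambda_k}(t,\cdot)$ are Lipschitz with respect to $d^{\Lambda_k}$ with a constant independent of $k$ and $t$; it is identified with the family $V_v^{\Lambda_k}(t)=\sum_{x\in\Lambda_k}v^{\Lambda_k}(t,x)\,a_x^*a_x$. Let $w\in L^1(\mathbb R)$ be non-negative and even with $\|w\|_1=1$, $\sup_s|s|^n|w(s)|<\infty$ for all $n\in\mathbb N_0$ and $\operatorname{supp}\hat w\subset[-1,1]$; let $g>0$, $w_g(s)=g\,w(gs)$, and $$\mathcal I_H(B)^{\Lambda_k}(t)=\int_{\mathbb R}\mathrm ds\,w_g(s)\int_0^s\mathrm du\;\mathrm e^{\mathrm iuH^{\Lambda_k}(t)}\,B^{\Lambda_k}(t)\,\mathrm e^{-\mathrm iuH^{\Lambda_k}(t)}.$$ **Lemma.** Let $a>0$, $\gamma\in(0,1)$,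 $H\in\mathcal L_{I,\exp(-a\,\cdot),\infty}$, and let $B$ be either an operator family in $\mathcal L_{I,\mathcal S,\infty}$ or a Lipschitz potential. Assume that $H$ (in $\mathcal L_{I,\exp(-a\,\cdot),\infty}$) and $[H,B]$ (in $\mathcal L_{I,\mathcal S,\infty}$) have a rapid thermodynamic limit with exponent $\gamma$. Then $\mathcal I_H(B)\in\mathcal L_{I,\mathcal S,\infty}$, and it has a rapid thermodynamic limit with exponent $\gamma$. -/

import Mathlib

open scoped ENNReal NNReal ContDiff

noncomputable section

namespace FermionLattice

/-! ### Lattice, boxes and box metrics -/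

/-- The lattice `ℤ^d`. -/
abbrev Site (d : ℕ) : Type := Fin d → ℤ

/-- The centred box `{-k, …, k}^d`. -/
def box (d k : ℕ) : Finset (Site d) :=
  Fintype.piFinset fun _ => Finset.Icc (-(k : ℤ)) (k : ℤ)

/-- The `ℓ¹`-distance on `ℤ^d`. -/
def l1Dist {d : ℕ} (x y : Site d) : ℝ :=
  ∑ j, |((x j - y j : ℤ) : ℝ)|

/-- A sequence of metrics, one on each box, compatible with the `ℓ¹`-distance in the bulk.
Values outside the boxes are irrelevant. -/
structure BoxMetrics (d : ℕ) where
  dist : ℕ → Site d → Site d → ℝ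
  dist_eq_zero_iff : ∀ k, ∀ x ∈ box d k, ∀ y ∈ box d k, dist k x y = 0 ↔ x = y
  dist_comm : ∀ k, ∀ x ∈ box d k, ∀ y ∈ box d k, dist k x y = dist k y x
  dist_triangle : ∀ k, ∀ x ∈ box d k, ∀ y ∈ box d k, ∀ z ∈ box d k,
    dist k x z ≤ dist k x y + dist k y z
  dist_le_l1 : ∀ k, ∀ x ∈ box d k, ∀ y ∈ box d k, dist k x y ≤ l1Dist x y
  dist_eq_l1 : ∀ k, ∀ x ∈ box d k, ∀ y ∈ box d k, l1Dist x y ≤ k → dist k x y = l1Dist x y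

theorem l1Dist_eq_zero_iff {d : ℕ} (x y : Site d) : l1Dist x y = 0 ↔ x = y := by
  unfold l1Dist
  rw [Finset.sum_eq_zero_iff_of_nonneg (fun _ _ => abs_nonneg _)]
  constructor
  · intro h
    funext j
    have := h j (Finset.mem_univ j)
    rw [abs_eq_zero, Int.cast_eq_zero] at this
    omega
  · rintro rfl j -
    simp

theorem l1Dist_comm {d : ℕ} (x y : Site d) : l1Dist x y = l1Dist y x := by
  unfold l1Dist
  refine Finset.sum_congr rfl fun j _ => ?_
  push_cast
  exact abs_sub_comm _ _

theorem l1Dist_triangle {d : ℕ} (x y z : Site d) : l1Dist x z ≤ l1Dist x y + l1Dist y z := by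
  unfold l1Dist
  rw [← Finset.sum_add_distrib]
  refine Finset.sum_le_sum fun j _ => ?_
  push_cast
  exact abs_sub_le _ _ _

/-- Open boundary conditions: the `ℓ¹`-distance on every box. -/
def openMetrics (d : ℕ) : BoxMetrics d where
  dist _ := l1Dist
  dist_eq_zero_iff _ x _ y _ := l1Dist_eq_zero_iff x y
  dist_comm _ x _ y _ := l1Dist_comm x y
  dist_triangle _ x _ y _ z _ := l1Dist_triangle x y z
  dist_le_l1 _ _ _ _ _ := le_rfl
  dist_eq_l1 _ _ _ _ _ _ := rfl

/-- Diameter of a finite set of sites with respect to the distance `δ`. -/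
def finDiam {d : ℕ} (δ : Site d → Site d → ℝ) (X : Finset (Site d)) : ℝ≥0 :=
  (X ×ˢ X).sup fun p => (δ p.1 p.2).toNNReal

/-! ### Fermionic Fock space and local algebras -/

/-- One-particle modes: a site together with an internal index. The lexicographic linear order is
only used to fix the signs in the occupation number representation. -/
abbrev Mode (d r : ℕ) : Type := Lex (Site d) ×ₗ Fin r

/-- The mode at site `x` with internal index `i`. -/
def mode {d r : ℕ} (x : Site d) (i : Fin r) : Mode d r := toLex (toLex x, i)

/-- Fermionic Fock space over `ℓ²(ℤ^d, ℂ^r)` in the occupation number representation: its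
orthonormal basis is indexed by the finite sets of occupied modes. -/
abbrev Fock (d r : ℕ) : Type := lp (fun _ : Finset (Mode d r) => ℂ) 2

/-- The bounded operators on Fock space. All local algebras are subalgebras of this one. -/
abbrev Obs (d r : ℕ) : Type := Fock d r →L[ℂ] Fock d r

/-- Coefficients of `a_j f`: the operator `a_j` maps the basis vector of `insert j S`, `j ∉ S`, to
`(-1)^{#{l ∈ S : l < j}}` times the basis vector of `S`, and the basis vectors of sets not
containing `j` to `0`. -/
def annihCoeff {d r : ℕ} (j : Mode d r) (f : Finset (Mode d r) → ℂ) (S : Finset (Mode d r)) : ℂ :=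
  if j ∈ S then 0 else (-1) ^ (S.filter (· < j)).card * f (insert j S)

theorem norm_annihCoeff_le {d r : ℕ} (j : Mode d r) (f : Finset (Mode d r) → ℂ)
    (S : Finset (Mode d r)) : ‖annihCoeff j f S‖ ≤ ‖f (symmDiff S {j})‖ := by
  unfold annihCoeff
  split_ifs with h
  · simp
  · have : symmDiff S {j} = insert j S := by
      ext l
      simp only [Finset.mem_symmDiff, Finset.mem_singleton, Finset.mem_insert]
      constructor
      · tauto
      · rintro (rfl | hl)
        · exact Or.inr ⟨rfl, h⟩
        · exact Or.inl ⟨hl, fun e => h (e ▸ hl)⟩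
    simp [this]

theorem hasSum_norm_symmDiff {d r : ℕ} (j : Mode d r) (f : Fock d r) :
    HasSum (fun S => ‖f (symmDiff S {j})‖ ^ (2 : ℝ)) (‖f‖ ^ (2 : ℝ)) := by
  have h := lp.hasSum_norm (p := 2) (by norm_num) f
  simp only [ENNReal.toReal_ofNat] at h
  have hinv : Function.Involutive fun S : Finset (Mode d r) => symmDiff S {j} := fun S => by
    simp
  exact (hinv.toPerm.hasSum_iff (f := fun S => ‖f S‖ ^ (2 : ℝ))).2 h

theorem memlp_annihCoeff {d r : ℕ} (j : Mode d r) (f : Fock d r) :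
    Memℓp (annihCoeff j f) 2 := by
  refine memℓp_gen ?_
  simp only [ENNReal.toReal_ofNat]
  refine Summable.of_nonneg_of_le (fun S => by positivity) (fun S => ?_)
    (hasSum_norm_symmDiff j f).summable
  exact Real.rpow_le_rpow (norm_nonneg _) (norm_annihCoeff_le j f S) (by norm_num)

/-- The annihilation operator of the mode `j`. -/
def annih {d r : ℕ} (j : Mode d r) : Obs d r :=
  LinearMap.mkContinuous
    { toFun := fun f => ⟨annihCoeff j f, memlp_annihCoeff j f⟩
      map_add' := fun f g => by
        ext S
        simp only [annihCoeff, lp.coeFn_add, Pi.add_apply]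
        split_ifs <;> ring
      map_smul' := fun c f => by
        ext S
        simp only [annihCoeff, lp.coeFn_smul, Pi.smul_apply, smul_eq_mul, RingHom.id_apply]
        split_ifs <;> ring }
    1 fun f => by
      rw [one_mul]
      have h1 := lp.hasSum_norm (p := 2) (by norm_num)
        (⟨annihCoeff j f, memlp_annihCoeff j f⟩ : Fock d r)
      simp only [ENNReal.toReal_ofNat] at h1
      have h2 := hasSum_le (fun S => Real.rpow_le_rpow (norm_nonneg _)
        (norm_annihCoeff_le j f S) (by norm_num)) h1 (hasSum_norm_symmDiff j f)
      exact (Real.rpow_le_rpow_iff (norm_nonneg _) (norm_nonneg _) (by norm_num)).1 h2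

/-- `𝒜_X`: the unital `*`-algebra generated by the annihilation and creation operators at the
sites of `X`. For finite `X` it is the full algebra of operators on the Fock space over `X`. -/
def localAlg {d : ℕ} (r : ℕ) (X : Finset (Site d)) : StarSubalgebra ℂ (Obs d r) :=
  StarAlgebra.adjoin ℂ {A | ∃ x ∈ X, ∃ i : Fin r, A = annih (mode x i)}

/-- `a_x^* a_x`, summed over the internal index. -/
def siteNumber {d : ℕ} (r : ℕ) (x : Site d) : Obs d r :=
  ∑ i : Fin r, star (annih (mode x i)) * annih (mode x i)

/-- The number operator `N_X`. -/
def numberOp {d : ℕ} (r : ℕ) (X : Finset (Site d)) : Obs d r :=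
  ∑ x ∈ X, siteNumber r x

/-- `A` is a self-adjoint element of `𝒜_X` commuting with `N_X`. -/
def IsLocalTerm {d r : ℕ} (X : Finset (Site d)) (A : Obs d r) : Prop :=
  A ∈ localAlg r X ∧ Commute A (numberOp r X) ∧ IsSelfAdjoint A

/-! ### Weight functions and interaction norms -/

/-- The weight functions `ζ : [0,∞) → (0,∞)` that are bounded, non-increasing, logarithmically
superadditive and decay faster than any polynomial (the class `𝒮`). -/
structure IsRapidWeight (ζ : ℝ → ℝ) : Prop where
  pos : ∀ s, 0 ≤ s → 0 < ζ s
  bounded : ∃ C, ∀ s, 0 ≤ s → ζ s ≤ C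
  antitone : AntitoneOn ζ (Set.Ici 0)
  superadd : ∀ s t, 0 ≤ s → 0 ≤ t → ζ s * ζ t ≤ ζ (s + t)
  decay : ∀ n : ℕ, Filter.Tendsto (fun s => s ^ n * ζ s) Filter.atTop (nhds 0)

/-- `F_ζ(s) = ζ(s) / (1 + s)^{d+1}`. -/
def Fweight (d : ℕ) (ζ : ℝ → ℝ) (s : ℝ) : ℝ := ζ s / (1 + s) ^ (d + 1)

/-- `sup_{x,y ∈ Λ} ∑_{X ⊆ Λ, x,y ∈ X} diam(X)^n ‖φ(X)‖ / F_ζ(δ(x,y))`. -/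
def setNorm {d r : ℕ} (δ : Site d → Site d → ℝ) (ζ : ℝ → ℝ) (n : ℕ) (Λ : Finset (Site d))
    (φ : Finset (Site d) → Obs d r) : ℝ≥0∞ :=
  ⨆ x ∈ Λ, ⨆ y ∈ Λ, ENNReal.ofReal
    (∑ X ∈ Λ.powerset with x ∈ X ∧ y ∈ X,
      (finDiam δ X : ℝ) ^ n * (‖φ X‖ / Fweight d ζ (δ x y)))

/-- Raw data of an interaction: `Φ k X` is the term of the set `X` in the box of size `k`. Only
the values with `X ⊆ box d k` matter. -/
abbrev Interaction (d r : ℕ) : Type := ℕ → Finset (Site d) → Obs d r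

/-- The norm `‖Φ‖_{ζ,n}` of an interaction. -/
def interactionNorm {d r : ℕ} (D : BoxMetrics d) (ζ : ℝ → ℝ) (n : ℕ) (Φ : Interaction d r) :
    ℝ≥0∞ :=
  ⨆ k, setNorm (D.dist k) ζ n (box d k) (Φ k)

/-- The bulk norm `‖φ‖_{ζ,n,Λ_M}`, formed with the `ℓ¹`-distance. -/
def bulkNorm {d r : ℕ} (ζ : ℝ → ℝ) (n M : ℕ) (φ : Finset (Site d) → Obs d r) : ℝ≥0∞ :=
  setNorm l1Dist ζ n (box d M) φ

/-! ### Time-dependent interactions and operator families -/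

/-- All terms are self-adjoint, local and number conserving, at all times in `I`. -/
def IsInteraction {d r : ℕ} (I : Set ℝ) (Φ : ℝ → Interaction d r) : Prop :=
  ∀ t ∈ I, ∀ k, ∀ X, X ⊆ box d k → IsLocalTerm X (Φ t k X)

/-- The same for an infinite volume interaction. -/
def IsInfiniteInteraction {d r : ℕ} (I : Set ℝ) (Ψ : ℝ → Finset (Site d) → Obs d r) : Prop :=
  ∀ t ∈ I, ∀ X, IsLocalTerm X (Ψ t X)

/-- Term-wise smoothness in `t ∈ I`, and boundedness of the `i`-th time derivative in the norm
with weight `ζs i`, uniformly in `t ∈ I`, for every `i`. -/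
def SmoothBounded {d r : ℕ} (D : BoxMetrics d) (I : Set ℝ) (ζs : ℕ → ℝ → ℝ) (n : ℕ)
    (Φ : ℝ → Interaction d r) : Prop :=
  (∀ k, ∀ X, X ⊆ box d k → ContDiffOn ℝ ∞ (fun t => Φ t k X) I) ∧
  ∀ i : ℕ, ⨆ t ∈ I, interactionNorm D (ζs i) n
    (fun k X => iteratedDeriv i (fun τ => Φ τ k X) t) < ⊤

/-- `ζs` is a sequence of weights in `𝒮` for the time derivatives, starting with `ζ`. -/
def IsWeightSequence (ζ : ℝ → ℝ) (ζs : ℕ → ℝ → ℝ) : Prop :=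
  ζs 0 = ζ ∧ ∀ i, IsRapidWeight (ζs i)

/-- `Φ ∈ ℬ_{I,ζ,n}`. -/
def MemB {d r : ℕ} (D : BoxMetrics d) (I : Set ℝ) (ζ : ℝ → ℝ) (n : ℕ)
    (Φ : ℝ → Interaction d r) : Prop :=
  IsInteraction I Φ ∧ ∃ ζs, IsWeightSequence ζ ζs ∧ SmoothBounded D I ζs n Φ

/-- `Φ ∈ ℬ_{I,ζ,n}` has a rapid thermodynamic limit with exponent `γ`. -/
def HasRapidLimit {d r : ℕ} (D : BoxMetrics d) (I : Set ℝ) (ζ : ℝ → ℝ) (n : ℕ) (γ : ℝ)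
    (Φ : ℝ → Interaction d r) : Prop :=
  IsInteraction I Φ ∧ ∃ ζs, IsWeightSequence ζ ζs ∧ SmoothBounded D I ζs n Φ ∧
    ∃ Ψ : ℝ → Finset (Site d) → Obs d r,
      IsInfiniteInteraction I Ψ ∧
      SmoothBounded (openMetrics d) I ζs n (fun t _ X => Ψ t X) ∧
      ∀ i : ℕ, ∃ lam > (0 : ℝ), ∃ C > (0 : ℝ), ∀ M k : ℕ,
        (M : ℝ) + lam * (M : ℝ) ^ γ ≤ k →
        ⨆ t ∈ I, bulkNorm (ζs i) n M
            (fun X => iteratedDeriv i (fun τ => Ψ τ X - Φ τ k X) t)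
          ≤ ENNReal.ofReal (C * ζs i ((M : ℝ) ^ γ))

/-- Raw data of a time-dependent operator family: `A t k` is the operator of the box of size `k`
at time `t`. -/
abbrev OpFamily (d r : ℕ) : Type := ℝ → ℕ → Obs d r

/-- `A^{Λ_k}(t) = ∑_{X ⊆ Λ_k} Φ^{Λ_k}(t, X)` for all `k` and all `t ∈ I`. -/
def IsSumOf {d r : ℕ} (I : Set ℝ) (A : OpFamily d r) (Φ : ℝ → Interaction d r) : Prop :=
  ∀ t ∈ I, ∀ k, A t k = ∑ X ∈ (box d k).powerset, Φ t k X

/-- `A ∈ ℒ_{I,𝒮,∞}`. -/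
def MemLRapid {d r : ℕ} (D : BoxMetrics d) (I : Set ℝ) (A : OpFamily d r) : Prop :=
  ∃ Φ : ℝ → Interaction d r, IsSumOf I A Φ ∧ ∀ n, ∃ ζ, MemB D I ζ n Φ

/-- `A ∈ ℒ_{I,ζ,∞}` has a rapid thermodynamic limit with exponent `γ`. -/
def FamilyHasRapidLimitWith {d r : ℕ} (D : BoxMetrics d) (I : Set ℝ) (ζ : ℝ → ℝ) (γ : ℝ)
    (A : OpFamily d r) : Prop :=
  ∃ Φ : ℝ → Interaction d r, IsSumOf I A Φ ∧ ∀ n, HasRapidLimit D I ζ n γ Φ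

/-- `A ∈ ℒ_{I,𝒮,∞}` has a rapid thermodynamic limit with exponent `γ`. -/
def FamilyHasRapidLimit {d r : ℕ} (D : BoxMetrics d) (I : Set ℝ) (γ : ℝ)
    (A : OpFamily d r) : Prop :=
  ∃ Φ : ℝ → Interaction d r, IsSumOf I A Φ ∧ ∀ n, ∃ ζ, HasRapidLimit D I ζ n γ Φ

/-! ### Lipschitz potentials -/

/-- `v ∈ 𝒱_I`: term-wise smooth, all time derivatives Lipschitz on the boxes with a constant
uniform in the box and in time. -/
def IsLipschitzPotential {d : ℕ} (D : BoxMetrics d) (I : Set ℝ) (v : ℝ → ℕ → Site d → ℝ) : Prop :=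
  (∀ k, ∀ x ∈ box d k, ContDiffOn ℝ ∞ (fun t => v t k x) I) ∧
  ∀ i : ℕ, ∃ C : ℝ, ∀ t ∈ I, ∀ k, ∀ x ∈ box d k, ∀ y ∈ box d k,
    |iteratedDeriv i (fun τ => v τ k x) t - iteratedDeriv i (fun τ => v τ k y) t|
      ≤ C * D.dist k x y

/-- The operator family `V_v^{Λ_k}(t) = ∑_{x ∈ Λ_k} v^{Λ_k}(t,x) a_x^* a_x`. -/
def potentialFamily {d : ℕ} (r : ℕ) (v : ℝ → ℕ → Site d → ℝ) : OpFamily d r :=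
  fun t k => ∑ x ∈ box d k, (v t k x : ℂ) • siteNumber r x

/-! ### The SLT-inverse of the Liouvillian -/

/-- The properties of the integral kernel: non-negative, even, `L¹`-normalised, decaying faster
than any polynomial, with Fourier transform supported in `[-1,1]`. -/
structure IsGapKernel (w : ℝ → ℝ) : Prop where
  nonneg : ∀ s, 0 ≤ w s
  even : ∀ s, w (-s) = w s
  integrable : MeasureTheory.Integrable w
  normalised : ∫ s, w s = 1
  decay : ∀ n : ℕ, ∃ C, ∀ s, |s| ^ n * |w s| ≤ C
  fourier : ∀ κ : ℝ, 1 < |κ| →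
    (1 / Real.sqrt (2 * Real.pi) : ℂ) * ∫ s : ℝ, Complex.exp (-(Complex.I * κ * s)) * w s = 0

/-- `w_g(s) = g w(g s)`. -/
def scaleKernel (w : ℝ → ℝ) (g : ℝ) : ℝ → ℝ := fun s => g * w (g * s)

/-- The Heisenberg evolution `e^{iu ℒ_H}(A) = e^{iuH} A e^{-iuH}`, where `ℒ_H(A) = [H, A]`. -/
def heisenberg {d r : ℕ} (H : Obs d r) (u : ℝ) (A : Obs d r) : Obs d r :=
  NormedSpace.exp ((Complex.I * u) • H) * A * NormedSpace.exp (-(Complex.I * u) • H)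

/-- `ℐ_H(A) = ∫ ds w(s) ∫_0^s du e^{iu ℒ_H}(A)`. -/
def invLiouvillian {d r : ℕ} (w : ℝ → ℝ) (H A : Obs d r) : Obs d r :=
  ∫ s : ℝ, w s • ∫ u in (0 : ℝ)..s, heisenberg H u A

end FermionLattice

end

open scoped ENNReal NNReal ContDiff
open MeasureTheory

noncomputable section

namespace FermionLattice

section

/-! ### Canonical anticommutation relations -/

/-! Write `τ_u` for the Heisenberg evolution. Taylor's formula with integral remainder gives `∫₀ˢ
τ_u(B) du = s B + s² ∫₀¹ (1-θ) τ_{sθ}(i[H,B]) dθ`, and the linear term vanishes against an even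
kernel (`invLiouvillian_eq`). Hence `ℐ_H(B)` is an average of `τ_v(i[H,B])`, `v = sθ`, over a kernel
all of whose moments are finite (`isPolyKernel_strip`).

Membership in `𝒮` means decay faster than any power. All estimates are therefore made with
polynomial weights of arbitrary order `p`; weights in `𝒮` are produced only at the end, by
`exists_dominating_weight`.

The commutator is a sum of parts assigned to sites `x` (`siteTerm`) plus the scalar term of the
empty set. Number conserving local terms commute with the field operators at all other sites, so
locality is measured by the commutators with the field operators at each site (`siteComm`), and
averaging over Majorana operators converts small commutators into good approximations
(`exists_site_approx`). A Gronwall argument yields a Lieb-Robinson bound. As `H` decays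
exponentially, the light cone is linear, and an operator with polynomial tails around `x` keeps them
with constants that grow only polynomially in time (`exists_locBd_heisenberg`); the moments of the
kernel absorb this growth. The derivatives `F_i = ∂_t^i τ_v(c(t))` solve the evolution equation with
a source `∑_{j<i} C(i,j) i[∂^{i-j}H, F_j]`. Duhamel's formula and induction on `i` give their
locality (`IsFlow.polyLoc`) and the comparison of two evolutions whose generators agree near `x`
(`IsFlow.polySmall_sub`).

From the hypotheses one limit `Ψ` and one constant `lam`, valid for all orders of derivatives, are
extracted (`exists_isRapidPair`). The comparison then shows that the evolved parts, computed inside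
a region `R`, depend rapidly less on `R` the farther its boundary is from `x`, and that the box
version is close to the infinite volume version in the bulk (`isSiteFamily_siteAvg`).

It remains to build interactions (`IsSiteFamily.familyHasRapidLimit`). In infinite volume the ball
of radius `l` around `x` carries the increment from radius `l - 1` to radius `l`. In a box the same
terms are used for all sets in the bulk, and the difference between the box and the infinite volume
operators is telescoped over neighbourhoods whose radius starts at the distance at which they leave
the bulk. These additional sets do not lie in the bulk, so there the box interaction equals its
limit exactly on nonempty sets, apart from boxes consisting of a single site; and their terms are
small because the difference is small as long as the boundary is far away. -/

/-- The sign `(-1)^{#{l ∈ S : l < j}}`. -/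
def jwSign {d r : ℕ} (j : Mode d r) (S : Finset (Mode d r)) : ℂ := (-1) ^ (S.filter (· < j)).card

theorem jwSign_mul_self {d r : ℕ} (j : Mode d r) (S : Finset (Mode d r)) :
    jwSign j S * jwSign j S = 1 := by
  unfold jwSign
  rw [← pow_add, ← two_mul, pow_mul]
  simp

theorem jwSign_insert_self {d r : ℕ} (j : Mode d r) (S : Finset (Mode d r)) :
    jwSign j (insert j S) = jwSign j S := by
  unfold jwSign
  simp [Finset.filter_insert]

theorem jwSign_erase_self {d r : ℕ} (j : Mode d r) (S : Finset (Mode d r)) :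
    jwSign j (S.erase j) = jwSign j S := by
  unfold jwSign
  congr 2
  ext l
  simp only [Finset.mem_filter, Finset.mem_erase]
  constructor
  · tauto
  · rintro ⟨h1, h2⟩
    exact ⟨⟨h2.ne, h1⟩, h2⟩

theorem jwSign_insert {d r : ℕ} {i j : Mode d r} {S : Finset (Mode d r)} (hi : i ∉ S) :
    jwSign j (insert i S) = if i < j then -jwSign j S else jwSign j S := by
  unfold jwSign
  rw [Finset.filter_insert]
  split_ifs with h
  · rw [Finset.card_insert_of_notMem (by simp [hi]), pow_succ]
    ring
  · rfl

theorem jwSign_erase {d r : ℕ} {i j : Mode d r} {S : Finset (Mode d r)} (hi : i ∈ S) :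
    jwSign j (S.erase i) = if i < j then -jwSign j S else jwSign j S := by
  have h := jwSign_insert (j := j) (Finset.notMem_erase i S)
  rw [Finset.insert_erase hi] at h
  rw [h]
  split_ifs <;> simp

theorem annih_apply {d r : ℕ} (j : Mode d r) (f : Fock d r) (S : Finset (Mode d r)) :
    annih j f S = if j ∈ S then 0 else jwSign j S * f (insert j S) := rfl

theorem annih_single {d r : ℕ} (j : Mode d r) (S : Finset (Mode d r)) :
    annih j (lp.single 2 S (1 : ℂ)) =
      if j ∈ S then jwSign j S • lp.single 2 (S.erase j) (1 : ℂ) else 0 := by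
  ext T
  rw [annih_apply]
  by_cases hj : j ∈ S
  · rw [if_pos hj]
    simp only [lp.coeFn_smul, Pi.smul_apply, lp.single_apply, smul_eq_mul, Pi.single_apply]
    by_cases hT : j ∈ T
    · have : T ≠ S.erase j := fun e => by simp [e] at hT
      simp [hT, this]
    · rw [if_neg hT]
      by_cases h : T = S.erase j
      · subst h
        simp [Finset.insert_erase hj, jwSign_erase_self]
      · have : insert j T ≠ S := fun e => h (by rw [← e, Finset.erase_insert hT])
        simp [h, this]
  · rw [if_neg hj]
    have : insert j T ≠ S := fun e => hj (by rw [← e]; simp)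
    simp [this]

theorem star_annih_apply {d r : ℕ} (j : Mode d r) (f : Fock d r) (S : Finset (Mode d r)) :
    (star (annih j) : Obs d r) f S = if j ∈ S then jwSign j S * f (S.erase j) else 0 := by
  have h1 : (star (annih j) : Obs d r) f S =
      inner ℂ (lp.single 2 S (1 : ℂ)) ((star (annih j) : Obs d r) f) := by
    rw [lp.inner_single_left]
    simp
  rw [h1, ContinuousLinearMap.star_eq_adjoint, ContinuousLinearMap.adjoint_inner_right,
    annih_single]
  split_ifs with h
  · rw [inner_smul_left, lp.inner_single_left]
    simp [jwSign]
  · simp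

/-- Exactly one of `i < j` and `j < i` holds, so exactly one of the two orders of removal picks up
an additional sign. -/
theorem annih_mul_annih {d r : ℕ} (i j : Mode d r) :
    annih i * annih j + annih j * annih i = (0 : Obs d r) := by
  ext f S
  simp only [add_apply, mul_apply_eq_comp, annih_apply,
    lp.coeFn_add, Pi.add_apply, zero_apply, lp.coeFn_zero, Pi.zero_apply,
    Finset.mem_insert]
  by_cases hij : i = j
  · subst hij
    simp
  · by_cases hi : i ∈ S
    · simp [hi]
    by_cases hj : j ∈ S
    · simp [hj]
    have hji : ¬ j = i := fun e => hij e.symm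
    simp only [hi, hj, hij, hji, or_self, if_false, jwSign_insert hi, jwSign_insert hj,
      Finset.insert_comm j i S]
    rcases lt_or_gt_of_ne hij with h | h
    · simp only [h, h.not_gt, if_true, if_false]
      ring
    · simp only [h, h.not_gt, if_true, if_false]
      ring

/-- For `i = j` the two products are the projections onto configurations with the mode empty and
with the mode occupied. For `i ≠ j` the signs cancel as for two annihilation operators. -/
theorem annih_mul_star_annih {d r : ℕ} (i j : Mode d r) :
    annih i * star (annih j) + star (annih j) * annih i = if i = j then (1 : Obs d r) else 0 := by
  ext f S
  simp only [add_apply, mul_apply_eq_comp, annih_apply,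
    star_annih_apply, lp.coeFn_add, Pi.add_apply, Finset.mem_insert, Finset.mem_erase]
  by_cases hij : i = j
  · subst hij
    by_cases hi : i ∈ S
    · simp only [hi, if_true, Finset.insert_erase hi, jwSign_erase_self, ne_eq, not_true,
        false_and, if_false, zero_add, ← mul_assoc, jwSign_mul_self]
      simp
    · simp only [hi, if_false, true_or, if_true, Finset.erase_insert hi, jwSign_insert_self,
        ← mul_assoc, jwSign_mul_self]
      simp
  · have hji : ¬ j = i := fun e => hij e.symm
    by_cases hi : i ∈ S
    · simp [hi, hij]
    by_cases hj : j ∈ S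
    · simp only [hi, hj, hij, hji, false_or, if_true, if_false, and_false, jwSign_insert hi,
        jwSign_erase hj, Finset.erase_insert_of_ne hij]
      rcases lt_or_gt_of_ne hij with h | h
      · simp only [h, h.not_gt, if_true, if_false]
        simp
        ring
      · simp only [h, h.not_gt, if_true, if_false]
        simp
        ring
    · simp [hi, hj, hij, hji]

theorem norm_annih_le {d r : ℕ} (j : Mode d r) : ‖(annih j : Obs d r)‖ ≤ 1 :=
  LinearMap.mkContinuous_norm_le _ zero_le_one _

theorem norm_star_annih_le {d r : ℕ} (j : Mode d r) : ‖(star (annih j) : Obs d r)‖ ≤ 1 := by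
  exact (norm_star (annih j : Obs d r)).trans_le (norm_annih_le j)

end

section

variable {d r : ℕ}

/-- The real normed algebra structure of `Obs d r`, extending its real normed space structure. -/
instance obsRealAlgebra : NormedAlgebra ℝ (Obs d r) :=
  { Algebra.ofModule (R := ℝ) (A := Obs d r)
      (fun c A B => by ext f; simp)
      (fun c A B => by
        ext1 f
        exact (A.restrictScalars ℝ).map_smul c (B f)) with
    norm_smul_le := fun c A => norm_smul_le c A }

/-! ### Averaging over a pair of Majorana operators -/

/-- Average of `O` over the group generated by `c` and `e`. -/
def pairAvg (c e O : Obs d r) : Obs d r :=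
  (4⁻¹ : ℝ) • (O + c * O * c + e * O * e + (c * e) * O * (e * c))

/-- A pair of anticommuting self-adjoint unitaries. -/
structure IsMajoranaPair (c e : Obs d r) : Prop where
  star_left : star c = c
  star_right : star e = e
  left_sq : c * c = 1
  right_sq : e * e = 1
  anticomm : c * e = -(e * c)

namespace IsMajoranaPair

variable {c e : Obs d r} (h : IsMajoranaPair c e)
include h

theorem left_mem : c ∈ unitary (Obs d r) := by
  rw [Unitary.mem_iff, h.star_left]
  exact ⟨h.left_sq, h.left_sq⟩

theorem right_mem : e ∈ unitary (Obs d r) := by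
  rw [Unitary.mem_iff, h.star_right]
  exact ⟨h.right_sq, h.right_sq⟩

theorem norm_left_mul (O : Obs d r) : ‖c * O‖ = ‖O‖ := CStarRing.norm_mem_unitary_mul O h.left_mem
theorem norm_right_mul (O : Obs d r) : ‖e * O‖ = ‖O‖ :=
  CStarRing.norm_mem_unitary_mul O h.right_mem
theorem norm_mul_left (O : Obs d r) : ‖O * c‖ = ‖O‖ := CStarRing.norm_mul_mem_unitary O h.left_mem
theorem norm_mul_right (O : Obs d r) : ‖O * e‖ = ‖O‖ :=
  CStarRing.norm_mul_mem_unitary O h.right_mem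

theorem norm_pairAvg_le (O : Obs d r) : ‖pairAvg c e O‖ ≤ ‖O‖ := by
  unfold pairAvg
  rw [norm_smul]
  have h1 : ‖c * O * c‖ = ‖O‖ := by rw [h.norm_mul_left, h.norm_left_mul]
  have h2 : ‖e * O * e‖ = ‖O‖ := by rw [h.norm_mul_right, h.norm_right_mul]
  have h3 : ‖(c * e) * O * (e * c)‖ = ‖O‖ := by
    rw [← mul_assoc, h.norm_mul_left, h.norm_mul_right, mul_assoc, h.norm_left_mul,
      h.norm_right_mul]
  have h4 := norm_add_le (O + c * O * c + e * O * e) ((c * e) * O * (e * c))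
  have h5 := norm_add_le (O + c * O * c) (e * O * e)
  have h6 := norm_add_le O (c * O * c)
  norm_num
  linarith

/-- The deviation is a quarter of the sum of the differences between `O` and its conjugates. For the
conjugates by `c` and `e` these are commutators times a unitary; for the conjugate by `ce` the
difference splits as `(O - cOc) + c(O - eOe)c`. Each commutator thus occurs twice with weight `1/4`.
-/
theorem norm_sub_pairAvg_le (O : Obs d r) :
    ‖O - pairAvg c e O‖ ≤ ‖O * c - c * O‖ + ‖O * e - e * O‖ := by
  have key : O - pairAvg c e O = (4⁻¹ : ℝ) • ((O * c - c * O) * c + (O * e - e * O) * e +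
      (O * c - c * O) * c + c * ((O * e - e * O) * e) * c) := by
    have e1 : (O * c - c * O) * c = O - c * O * c := by
      rw [sub_mul, mul_assoc, h.left_sq, mul_one]
    have e2 : (O * e - e * O) * e = O - e * O * e := by
      rw [sub_mul, mul_assoc, h.right_sq, mul_one]
    rw [e1, e2]
    have e3 : c * (O - e * O * e) * c = c * O * c - (c * e) * O * (e * c) := by
      noncomm_ring
    rw [e3, pairAvg]
    module
  rw [key, norm_smul]
  have n1 : ‖(O * c - c * O) * c‖ = ‖O * c - c * O‖ := h.norm_mul_left _
  have n2 : ‖(O * e - e * O) * e‖ = ‖O * e - e * O‖ := h.norm_mul_right _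
  have n3 : ‖c * ((O * e - e * O) * e) * c‖ = ‖O * e - e * O‖ := by
    rw [h.norm_mul_left, h.norm_left_mul, h.norm_mul_right]
  have h4 := norm_add_le ((O * c - c * O) * c + (O * e - e * O) * e + (O * c - c * O) * c)
    (c * ((O * e - e * O) * e) * c)
  have h5 := norm_add_le ((O * c - c * O) * c + (O * e - e * O) * e) ((O * c - c * O) * c)
  have h6 := norm_add_le ((O * c - c * O) * c) ((O * e - e * O) * e)
  have := norm_nonneg (O * c - c * O)
  have := norm_nonneg (O * e - e * O)
  norm_num
  linarith

theorem commute_pairAvg_left (O : Obs d r) : Commute (pairAvg c e O) c := by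
  have e1 : c * (c * O * c) = O * c := by rw [mul_assoc, ← mul_assoc, h.left_sq, one_mul]
  have e2 : (c * O * c) * c = c * O := by rw [mul_assoc, h.left_sq, mul_one]
  have e3 : c * ((c * e) * O * (e * c)) = (e * O * e) * c := by
    rw [mul_assoc c e O, mul_assoc c (e * O), ← mul_assoc c c, h.left_sq, one_mul, mul_assoc,
      mul_assoc, mul_assoc]
  have e4 : ((c * e) * O * (e * c)) * c = c * (e * O * e) := by
    rw [mul_assoc (c * e * O), mul_assoc e c c, h.left_sq, mul_one, mul_assoc c, mul_assoc]
  unfold Commute SemiconjBy pairAvg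
  rw [smul_mul_assoc, mul_smul_comm]
  simp only [mul_add, add_mul, e1, e2, e3, e4]
  congr 1
  abel

theorem pairAvg_symm (O : Obs d r) : pairAvg e c O = pairAvg c e O := by
  unfold pairAvg
  have : e * c * O * (c * e) = c * e * O * (e * c) := by
    rw [h.anticomm]
    simp
  rw [this]
  congr 1
  abel

theorem symm : IsMajoranaPair e c :=
  ⟨h.star_right, h.star_left, h.right_sq, h.left_sq, by rw [h.anticomm, neg_neg]⟩

theorem commute_pairAvg_right (O : Obs d r) : Commute (pairAvg c e O) e := by
  rw [← h.pairAvg_symm]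
  exact h.symm.commute_pairAvg_left O

end IsMajoranaPair

/-- Conjugation by an operator that anticommutes with `b` preserves commutation with `b`, because
two signs cancel. In the application `b` is a field operator of another mode. -/
theorem commute_pairAvg_of_anticomm {c e b O : Obs d r} (hc : b * c = -(c * b))
    (he : b * e = -(e * b)) (hb : Commute O b) : Commute (pairAvg c e O) b := by
  have hb : O * b = b * O := hb
  have conj : ∀ u : Obs d r, b * u = -(u * b) → (u * O * u) * b = b * (u * O * u) := by
    intro u hu
    have hu' : u * b = -(b * u) := by rw [hu, neg_neg]
    calc (u * O * u) * b = u * O * (u * b) := by rw [mul_assoc]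
      _ = -(u * (O * b) * u) := by rw [hu']; noncomm_ring
      _ = -((u * b) * O * u) := by rw [hb]; noncomm_ring
      _ = b * (u * O * u) := by rw [hu']; noncomm_ring
  have hc' : c * b = -(b * c) := by rw [hc, neg_neg]
  have he' : e * b = -(b * e) := by rw [he, neg_neg]
  have e3 : ((c * e) * O * (e * c)) * b = b * ((c * e) * O * (e * c)) := by
    have h1 := conj e he
    calc ((c * e) * O * (e * c)) * b = c * (e * O * e) * (c * b) := by noncomm_ring
      _ = -(c * ((e * O * e) * b) * c) := by rw [hc']; noncomm_ring
      _ = -((c * b) * (e * O * e) * c) := by rw [h1]; noncomm_ring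
      _ = b * ((c * e) * O * (e * c)) := by rw [hc']; noncomm_ring
  unfold Commute SemiconjBy pairAvg
  rw [smul_mul_assoc, mul_smul_comm]
  simp only [mul_add, add_mul, hb, conj c hc, conj e he, e3]

theorem pairAvg_sub (c e O P : Obs d r) : pairAvg c e (O - P) = pairAvg c e O - pairAvg c e P := by
  unfold pairAvg
  rw [← smul_sub]
  congr 1
  noncomm_ring

/-! ### Majorana operators of a mode and averaging over several modes. -/

/-- The self-adjoint operator `a_j + a_j^*`. -/
def majoranaRe (j : Mode d r) : Obs d r := annih j + star (annih j)

/-- The self-adjoint operator `i (a_j - a_j^*)`. -/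
def majoranaIm (j : Mode d r) : Obs d r := Complex.I • (annih j - star (annih j))

theorem annih_sq (j : Mode d r) : annih j * annih j = (0 : Obs d r) := by
  have h := annih_mul_annih j j
  rw [← two_smul ℂ] at h
  exact (smul_eq_zero.1 h).resolve_left two_ne_zero

theorem star_annih_sq (j : Mode d r) : star (annih j) * star (annih j) = (0 : Obs d r) := by
  rw [← star_mul, annih_sq, star_zero]

theorem isMajoranaPair (j : Mode d r) : IsMajoranaPair (majoranaRe j) (majoranaIm j) := by
  have h1 := annih_mul_star_annih j j
  rw [if_pos rfl] at h1
  have h2 := annih_sq j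
  have h3 := star_annih_sq j
  have h4 : star (annih j) * annih j = 1 - annih j * star (annih j) := by
    rw [← h1]; abel
  refine ⟨?_, ?_, ?_, ?_, ?_⟩
  · unfold majoranaRe
    rw [star_add, star_star, add_comm]
  · unfold majoranaIm
    rw [star_smul, star_sub, star_star]
    simp only [RCLike.star_def, Complex.conj_I, neg_smul, smul_sub]
    abel
  · unfold majoranaRe
    rw [add_mul, mul_add, mul_add, h2, h3, h4]
    abel
  · unfold majoranaIm
    rw [smul_mul_smul_comm, sub_mul, mul_sub, mul_sub, h2, h3, h4, Complex.I_mul_I]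
    rw [neg_one_smul]
    abel
  · unfold majoranaRe majoranaIm
    rw [mul_smul_comm, smul_mul_assoc, ← smul_neg]
    congr 1
    rw [add_mul, mul_sub, mul_sub, sub_mul, mul_add, mul_add, h2, h3, h4]
    abel

/-- The commutator of `O` with the operators `a_j`, `a_j^*`, in norm. -/
def modeComm (j : Mode d r) (O : Obs d r) : ℝ :=
  ‖O * annih j - annih j * O‖ + ‖O * star (annih j) - star (annih j) * O‖

/-- The average of `O` over the algebra of the mode `j`. -/
def modeAvg (j : Mode d r) (O : Obs d r) : Obs d r := pairAvg (majoranaRe j) (majoranaIm j) O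

theorem norm_modeAvg_le (j : Mode d r) (O : Obs d r) : ‖modeAvg j O‖ ≤ ‖O‖ :=
  (isMajoranaPair j).norm_pairAvg_le O

theorem norm_sub_modeAvg_le (j : Mode d r) (O : Obs d r) :
    ‖O - modeAvg j O‖ ≤ 2 * modeComm j O := by
  refine ((isMajoranaPair j).norm_sub_pairAvg_le O).trans ?_
  unfold majoranaRe majoranaIm modeComm
  set a : Obs d r := annih j
  have h1 : O * (a + star a) - (a + star a) * O
      = (O * a - a * O) + (O * star a - star a * O) := by noncomm_ring
  have h2 : O * (Complex.I • (a - star a)) - (Complex.I • (a - star a)) * O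
      = Complex.I • ((O * a - a * O) - (O * star a - star a * O)) := by
    rw [mul_smul_comm, smul_mul_assoc, ← smul_sub]
    congr 1
    noncomm_ring
  rw [h1, h2, norm_smul, Complex.norm_I, one_mul]
  have := norm_add_le (O * a - a * O) (O * star a - star a * O)
  have := norm_sub_le (O * a - a * O) (O * star a - star a * O)
  linarith

theorem annih_eq_majorana (j : Mode d r) :
    annih j = (2⁻¹ : ℂ) • (majoranaRe j - Complex.I • majoranaIm j) := by
  unfold majoranaRe majoranaIm
  rw [smul_smul, Complex.I_mul_I]
  module

theorem star_annih_eq_majorana (j : Mode d r) :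
    star (annih j) = (2⁻¹ : ℂ) • (majoranaRe j + Complex.I • majoranaIm j) := by
  unfold majoranaRe majoranaIm
  rw [smul_smul, Complex.I_mul_I]
  module

theorem commute_modeAvg (j : Mode d r) (O : Obs d r) :
    Commute (modeAvg j O) (annih j) ∧ Commute (modeAvg j O) (star (annih j)) := by
  have h1 := (isMajoranaPair j).commute_pairAvg_left O
  have h2 := (isMajoranaPair j).commute_pairAvg_right O
  constructor
  · rw [annih_eq_majorana]
    exact (h1.sub_right (h2.smul_right _)).smul_right _
  · rw [star_annih_eq_majorana]
    exact (h1.add_right (h2.smul_right _)).smul_right _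

theorem anticomm_majorana {i j : Mode d r} (hij : i ≠ j) {b : Obs d r}
    (hb : b = annih i ∨ b = star (annih i)) :
    b * majoranaRe j = -(majoranaRe j * b) ∧ b * majoranaIm j = -(majoranaIm j * b) := by
  have h : b * annih j + annih j * b = 0 ∧ b * star (annih j) + star (annih j) * b = 0 := by
    rcases hb with rfl | rfl
    · refine ⟨annih_mul_annih i j, ?_⟩
      rw [annih_mul_star_annih, if_neg hij]
    · constructor
      · rw [add_comm, annih_mul_star_annih, if_neg hij.symm]
      · rw [← star_mul, ← star_mul, ← star_add, annih_mul_annih, star_zero]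
  have h1 := eq_neg_of_add_eq_zero_left h.1
  have h2 := eq_neg_of_add_eq_zero_left h.2
  unfold majoranaRe majoranaIm
  constructor
  · rw [mul_add, add_mul, h1, h2]
    abel
  · rw [mul_smul_comm, smul_mul_assoc, mul_sub, sub_mul, h1, h2, ← smul_neg]
    congr 1
    abel

/-- This makes successive averaging possible: treating a new mode does not destroy the commutation
already achieved for the earlier ones. -/
theorem commute_modeAvg_of_commute {i j : Mode d r} (hij : i ≠ j) {O : Obs d r}
    (h : Commute O (annih i) ∧ Commute O (star (annih i))) :
    Commute (modeAvg j O) (annih i) ∧ Commute (modeAvg j O) (star (annih i)) := by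
  have h1 := anticomm_majorana hij (Or.inl rfl)
  have h2 := anticomm_majorana hij (Or.inr rfl)
  exact ⟨commute_pairAvg_of_anticomm h1.1 h1.2 h.1, commute_pairAvg_of_anticomm h2.1 h2.2 h.2⟩

/-- For every finite set of modes `O` has an approximation that commutes with these modes, up to
an error controlled by the commutators of `O`. -/
theorem exists_commuting_approx (s : Finset (Mode d r)) (O : Obs d r) :
    ∃ O' : Obs d r, ‖O'‖ ≤ ‖O‖ ∧ ‖O - O'‖ ≤ 2 * ∑ j ∈ s, modeComm j O ∧
      ∀ j ∈ s, Commute O' (annih j) ∧ Commute O' (star (annih j)) := by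
  classical
  induction s using Finset.induction_on with
  | empty => exact ⟨O, le_rfl, by simp, by simp⟩
  | insert j s hj ih =>
    obtain ⟨P, hP1, hP2, hP3⟩ := ih
    refine ⟨modeAvg j P, (norm_modeAvg_le j P).trans hP1, ?_, ?_⟩
    · rw [Finset.sum_insert hj, mul_add]
      -- Averaging is linear and contractive, so the new error is measured on `O` itself;
      -- commutators of the intermediate operator `P` never enter.
      have e : O - modeAvg j P = (O - modeAvg j O) + modeAvg j (O - P) := by
        unfold modeAvg
        rw [pairAvg_sub]
        abel
      rw [e]
      exact (norm_add_le _ _).trans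
        (add_le_add (norm_sub_modeAvg_le j O) ((norm_modeAvg_le j _).trans hP2))
    · intro i hi
      by_cases hij : i = j
      · subst hij
        exact commute_modeAvg i P
      · exact commute_modeAvg_of_commute hij (hP3 i ((Finset.mem_insert.1 hi).resolve_left hij))

end

section

variable {d r : ℕ}

/-! ### Local terms -/

theorem mode_inj {x y : Site d} {i j : Fin r} : mode x i = mode y j ↔ x = y ∧ i = j := by
  unfold mode
  constructor
  · intro h
    have h1 := congrArg (fun p => (ofLex p).1) h
    have h2 := congrArg (fun p => (ofLex p).2) h
    exact ⟨h1, h2⟩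
  · rintro ⟨rfl, rfl⟩
    rfl

/-- The creation and annihilation operators at the sites of `X`. -/
def localGen (r : ℕ) (X : Finset (Site d)) : Set (Obs d r) :=
  {A | ∃ x ∈ X, ∃ i : Fin r, A = annih (mode x i) ∨ A = star (annih (mode x i))}

theorem mem_localAlg_iff {X : Finset (Site d)} {A : Obs d r} :
    A ∈ localAlg r X ↔ A ∈ Algebra.adjoin ℂ (localGen r X) := by
  have h : localGen r X = {A | ∃ x ∈ X, ∃ i : Fin r, A = annih (mode x i)} ∪
      star {A | ∃ x ∈ X, ∃ i : Fin r, A = annih (mode x i)} := by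
    ext B
    simp only [localGen, Set.mem_ofPred_eq, Set.mem_union, Set.mem_star]
    constructor
    · rintro ⟨x, hx, i, h | h⟩
      · exact Or.inl ⟨x, hx, i, h⟩
      · exact Or.inr ⟨x, hx, i, by rw [h, star_star]⟩
    · rintro (⟨x, hx, i, h⟩ | ⟨x, hx, i, h⟩)
      · exact ⟨x, hx, i, Or.inl h⟩
      · exact ⟨x, hx, i, Or.inr (by rw [← h, star_star])⟩
  rw [h, ← StarAlgebra.adjoin_toSubalgebra]
  rfl

theorem localAlg_mono {X Y : Finset (Site d)} (h : X ⊆ Y) : localAlg r X ≤ localAlg r Y :=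
  StarAlgebra.adjoin_mono fun _ ⟨x, hx, i, e⟩ => ⟨x, h hx, i, e⟩

theorem commute_of_mem_localAlg {X : Finset (Site d)} {A Q : Obs d r} (hA : A ∈ localAlg r X)
    (hQ : ∀ g ∈ localGen r X, Commute g Q) : Commute A Q := by
  rw [mem_localAlg_iff] at hA
  induction hA using Algebra.adjoin_induction with
  | mem x hx => exact hQ x hx
  | algebraMap c => exact Algebra.commutes c Q
  | add x y _ _ hx hy => exact hx.add_left hy
  | mul x y _ _ hx hy => exact hx.mul_left hy

theorem modeNumber_comm (i j : Mode d r) :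
    (star (annih i) * annih i) * annih j - annih j * (star (annih i) * annih i) =
      if i = j then -annih j else (0 : Obs d r) := by
  have h1 := annih_mul_annih j i
  have h2 := annih_mul_star_annih j i
  have e : (star (annih i) * annih i) * annih j - annih j * (star (annih i) * annih i) =
      star (annih i) * (annih j * annih i + annih i * annih j) -
      (annih j * star (annih i) + star (annih i) * annih j) * annih i := by noncomm_ring
  rw [e, h1, h2]
  by_cases hij : i = j
  · subst hij; simp
  · simp [hij, Ne.symm hij]

theorem numberOp_comm (X : Finset (Site d)) (y : Site d) (i : Fin r) :
    numberOp r X * annih (mode y i) - annih (mode y i) * numberOp r X =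
      if y ∈ X then -annih (mode y i) else 0 := by
  unfold numberOp siteNumber
  rw [Finset.sum_mul, Finset.mul_sum, ← Finset.sum_sub_distrib]
  have h : ∀ x, (∑ i : Fin r, star (annih (mode x i)) * annih (mode x i)) * annih (mode y i) -
      annih (mode y i) * (∑ i : Fin r, star (annih (mode x i)) * annih (mode x i)) =
      if x = y then -annih (mode y i) else (0 : Obs d r) := by
    intro x
    rw [Finset.sum_mul, Finset.mul_sum, ← Finset.sum_sub_distrib]
    simp only [modeNumber_comm, mode_inj]
    by_cases hxy : x = y <;> simp [hxy]
  rw [Finset.sum_congr rfl fun x _ => h x]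
  simp

theorem star_numberOp (X : Finset (Site d)) : star (numberOp r X) = numberOp r X := by
  unfold numberOp siteNumber
  simp [star_sum]

/-- The intertwining relation passes to powers and hence to the exponential series. It is used with
`x` equal to `y` plus a scalar. -/
theorem exp_semiconj {a x y : Obs d r} (h : a * x = y * a) :
    a * NormedSpace.exp x = NormedSpace.exp y * a := by
  have h1 := (NormedSpace.exp_series_hasSum_exp' (𝕂 := ℂ) x).mul_left a
  have h2 := (NormedSpace.exp_series_hasSum_exp' (𝕂 := ℂ) y).mul_right a
  refine h1.unique ?_
  convert h2 using 2 with n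
  have hn : a * x ^ n = y ^ n * a := (show SemiconjBy a x y from h).pow_right n
  rw [mul_smul_comm, smul_mul_assoc, hn]

/-! ### Parity and commutation with field operators at other sites. -/

/-- The parity operator of the region `X`. -/
def parityOp (r : ℕ) (X : Finset (Site d)) : Obs d r :=
  NormedSpace.exp ((Complex.I * Real.pi) • numberOp r X)

/-- A field operator at a site of `X` changes the particle number by one: `N a = a (N - 1)` and `N
a^* = a^* (N + 1)`. Moving it through `exp(iπN)` therefore produces the factor `exp(∓iπ) = -1`. -/
theorem parityOp_anticomm {X : Finset (Site d)} {g : Obs d r} (hg : g ∈ localGen r X) :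
    parityOp r X * g = -(g * parityOp r X) := by
  have aux : ∀ z : ℂ, Complex.exp z = -1 → ∀ g : Obs d r,
      g * ((Complex.I * Real.pi) • numberOp r X + z • 1) =
        ((Complex.I * Real.pi) • numberOp r X) * g → parityOp r X * g = -(g * parityOp r X) := by
    intro z hz g h
    have h1 := exp_semiconj h
    have hcomm : Commute ((Complex.I * Real.pi) • numberOp r X) (z • (1 : Obs d r)) :=
      (Commute.one_right _).smul_right z
    let _ : NormedAlgebra ℚ (Obs d r) := NormedAlgebra.restrictScalars ℚ ℂ _
    rw [NormedSpace.exp_add_of_commute hcomm] at h1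
    have h2 : NormedSpace.exp (z • (1 : Obs d r)) = -1 := by
      have h3 := NormedSpace.algebraMap_exp_comm (𝔸 := Obs d r) z
      rw [← Complex.exp_eq_exp_ℂ, hz, Algebra.algebraMap_eq_smul_one, Algebra.algebraMap_eq_smul_one] at h3
      rw [← h3]
      simp
    rw [h2] at h1
    unfold parityOp
    rw [← h1]
    simp
  obtain ⟨x, hx, i, rfl | rfl⟩ := hg
  · refine aux (-(Complex.I * Real.pi)) ?_ _ ?_
    · rw [mul_comm, Complex.exp_neg, Complex.exp_pi_mul_I]; norm_num
    · have h := numberOp_comm (r := r) X x i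
      rw [if_pos hx, sub_eq_iff_eq_add] at h
      rw [smul_mul_assoc, h, mul_add, mul_smul_comm, mul_smul_comm, mul_one]
      module
  · refine aux (Complex.I * Real.pi) ?_ _ ?_
    · rw [mul_comm, Complex.exp_pi_mul_I]
    · have h := congrArg star (numberOp_comm (r := r) X x i)
      rw [if_pos hx, star_sub, star_mul, star_mul, star_numberOp, star_neg, sub_eq_iff_eq_add] at h
      rw [smul_mul_assoc, mul_add, mul_smul_comm, mul_smul_comm, mul_one, h]
      module

theorem parityOp_mul_inv (X : Finset (Site d)) :
    parityOp r X * NormedSpace.exp (-((Complex.I * Real.pi) • numberOp r X)) = 1 := by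
  unfold parityOp
  let _ : NormedAlgebra ℚ (Obs d r) := NormedAlgebra.restrictScalars ℚ ℂ _
  rw [← NormedSpace.exp_add_of_commute (Commute.neg_right (Commute.refl _))]
  simp

theorem anticomm_of_notMem {X : Finset (Site d)} {y : Site d} (hy : y ∉ X) (i : Fin r)
    {b g : Obs d r} (hb : b = annih (mode y i) ∨ b = star (annih (mode y i)))
    (hg : g ∈ localGen r X) : g * b = -(b * g) := by
  obtain ⟨x, hx, k, hg⟩ := hg
  have hne : mode x k ≠ mode y i := fun h => hy ((mode_inj.1 h).1 ▸ hx)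
  rw [eq_neg_iff_add_eq_zero]
  rcases hb with rfl | rfl <;> rcases hg with rfl | rfl
  · exact annih_mul_annih _ _
  · rw [add_comm, annih_mul_star_annih, if_neg hne.symm]
  · rw [annih_mul_star_annih, if_neg hne]
  · rw [← star_mul, ← star_mul, ← star_add, annih_mul_annih, star_zero]

/-- Number conserving elements of `𝒜_X` commute with the operators at sites outside `X`. -/
theorem IsLocalTerm.commute_of_notMem {X : Finset (Site d)} {A : Obs d r} (hA : IsLocalTerm X A)
    {y : Site d} (hy : y ∉ X) (i : Fin r) {b : Obs d r}
    (hb : b = annih (mode y i) ∨ b = star (annih (mode y i))) : Commute A b := by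
  -- Both `b` and the parity operator anticommute with every generator of `𝒜_X`, so their product
  -- commutes with the whole algebra. Number conservation makes `A` commute with the parity
  -- operator, which can then be cancelled.
  have h1 : Commute A (b * parityOp r X) := by
    refine commute_of_mem_localAlg hA.1 fun g hg => ?_
    have e1 := anticomm_of_notMem hy i hb hg
    have e2 := parityOp_anticomm hg
    calc g * (b * parityOp r X) = (g * b) * parityOp r X := by rw [mul_assoc]
      _ = -(b * (g * parityOp r X)) := by rw [e1]; noncomm_ring
      _ = b * (parityOp r X * g) := by rw [e2]; noncomm_ring
      _ = _ := by rw [mul_assoc]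
  have h2 : Commute A (parityOp r X) := (hA.2.1.smul_right _).exp_right
  have h3 : A * b * parityOp r X = b * A * parityOp r X := by
    rw [mul_assoc, h1.eq, mul_assoc, ← h2.eq, mul_assoc]
  have h4 := congrArg (· * NormedSpace.exp (-((Complex.I * Real.pi) • numberOp r X))) h3
  simp only [mul_assoc, parityOp_mul_inv, mul_one] at h4
  exact h4

/-- `N_Y - N_X` is built from field operators outside `X`, and a number conserving element of `𝒜_X`
commutes with these. -/
theorem IsLocalTerm.mono {X Y : Finset (Site d)} (h : X ⊆ Y) {A : Obs d r}
    (hA : IsLocalTerm X A) : IsLocalTerm Y A := by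
  classical
  refine ⟨localAlg_mono h hA.1, ?_, hA.2.2⟩
  have e : numberOp r Y = numberOp r X + ∑ y ∈ Y \ X, siteNumber r y := by
    unfold numberOp
    rw [add_comm, Finset.sum_sdiff h]
  rw [e]
  refine hA.2.1.add_right (Commute.sum_right _ _ _ fun y hy => Commute.sum_right _ _ _ fun i _ => ?_)
  have hy' := (Finset.mem_sdiff.1 hy).2
  exact (hA.commute_of_notMem hy' i (Or.inr rfl)).mul_right (hA.commute_of_notMem hy' i (Or.inl rfl))

/-! ### Local algebras are finite-dimensional -/

/-- If `V` is stable under left multiplication for the modes treated so far, then `V + aV + a^*V +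
a^*aV` is stable with one more mode: the anticommutation relations move the other field operators
past `a` and `a^*`, and reduce products of `a` and `a^*` to `1`, `a`, `a^*`, `a^*a`. -/
theorem exists_finiteDimensional_of_modes (s : Finset (Mode d r)) :
    ∃ V : Submodule ℂ (Obs d r), FiniteDimensional ℂ V ∧ (1 : Obs d r) ∈ V ∧
      ∀ j ∈ s, ∀ v ∈ V, annih j * v ∈ V ∧ star (annih j) * v ∈ V := by
  classical
  induction s using Finset.induction_on with
  | empty =>
    exact ⟨Submodule.span ℂ {1}, inferInstance, Submodule.mem_span_singleton_self 1, by simp⟩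
  | insert j s hj ih =>
    obtain ⟨V, hV, h1, hs⟩ := ih
    set a : Obs d r := annih j with ha
    have ha2 : a * a = 0 := annih_sq j
    have ha3 : star a * star a = 0 := star_annih_sq j
    have ha4 : a * star a = 1 - star a * a := by
      have := annih_mul_star_annih j j
      rw [if_pos rfl] at this
      rw [← this]; abel
    let W : Submodule ℂ (Obs d r) := V ⊔ V.map (LinearMap.mulLeft ℂ a) ⊔
      V.map (LinearMap.mulLeft ℂ (star a)) ⊔ V.map (LinearMap.mulLeft ℂ (star a * a))
    have w1 : ∀ v ∈ V, v ∈ W := fun v hv =>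
      Submodule.mem_sup_left (Submodule.mem_sup_left (Submodule.mem_sup_left hv))
    have w2 : ∀ v ∈ V, a * v ∈ W := fun v hv =>
      Submodule.mem_sup_left (Submodule.mem_sup_left (Submodule.mem_sup_right ⟨v, hv, rfl⟩))
    have w3 : ∀ v ∈ V, star a * v ∈ W := fun v hv =>
      Submodule.mem_sup_left (Submodule.mem_sup_right ⟨v, hv, rfl⟩)
    have w4 : ∀ v ∈ V, star a * a * v ∈ W := fun v hv => Submodule.mem_sup_right ⟨v, hv, rfl⟩
    have ext : ∀ b : Obs d r, (∀ v ∈ V, b * v ∈ W) → (∀ v ∈ V, b * (a * v) ∈ W) →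
        (∀ v ∈ V, b * (star a * v) ∈ W) → (∀ v ∈ V, b * (star a * a * v) ∈ W) →
        ∀ v ∈ W, b * v ∈ W := by
      intro b b1 b2 b3 b4
      have : W ≤ W.comap (LinearMap.mulLeft ℂ b) := by
        refine sup_le (sup_le (sup_le b1 ?_) ?_) ?_
        · rintro _ ⟨v, hv, rfl⟩; exact b2 v hv
        · rintro _ ⟨v, hv, rfl⟩; exact b3 v hv
        · rintro _ ⟨v, hv, rfl⟩; exact b4 v hv
      exact this
    refine ⟨W, inferInstance, w1 1 h1, fun i hi => ?_⟩
    have main : ∀ b : Obs d r, (b = annih i ∨ b = star (annih i)) → ∀ v ∈ W, b * v ∈ W := by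
      intro b hb
      by_cases hij : i = j
      · subst hij
        rcases hb with rfl | rfl
        · refine ext a w2 ?_ ?_ ?_
          · intro v hv
            rw [← mul_assoc, ha2, zero_mul]
            exact W.zero_mem
          · intro v hv
            rw [← mul_assoc, ha4, sub_mul, one_mul]
            exact W.sub_mem (w1 v hv) (w4 v hv)
          · intro v hv
            rw [← mul_assoc, ← mul_assoc, ha4, sub_mul, mul_assoc (star a), ha2, mul_zero, sub_zero,
              one_mul]
            exact w2 v hv
        · refine ext (star a) w3 ?_ ?_ ?_
          · intro v hv
            rw [← mul_assoc]
            exact w4 v hv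
          · intro v hv
            rw [← mul_assoc, ha3, zero_mul]
            exact W.zero_mem
          · intro v hv
            rw [← mul_assoc, ← mul_assoc, ha3, zero_mul, zero_mul]
            exact W.zero_mem
      · have his := (Finset.mem_insert.1 hi).resolve_left hij
        have bV : ∀ v ∈ V, b * v ∈ V := by
          rcases hb with rfl | rfl
          · exact fun v hv => (hs i his v hv).1
          · exact fun v hv => (hs i his v hv).2
        have ac : b * a = -(a * b) ∧ b * star a = -(star a * b) := by
          rw [eq_neg_iff_add_eq_zero, eq_neg_iff_add_eq_zero]
          rcases hb with rfl | rfl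
          · refine ⟨annih_mul_annih i j, ?_⟩
            rw [annih_mul_star_annih, if_neg hij]
          · constructor
            · rw [add_comm, annih_mul_star_annih, if_neg (Ne.symm hij)]
            · rw [← star_mul, ← star_mul, ← star_add, annih_mul_annih, star_zero]
        refine ext b (fun v hv => w1 _ (bV v hv)) ?_ ?_ ?_
        · intro v hv
          rw [← mul_assoc, ac.1, neg_mul, mul_assoc]
          exact W.neg_mem (w2 _ (bV v hv))
        · intro v hv
          rw [← mul_assoc, ac.2, neg_mul, mul_assoc]
          exact W.neg_mem (w3 _ (bV v hv))
        · intro v hv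
          have : b * (star a * a * v) = star a * a * (b * v) := by
            rw [← mul_assoc, ← mul_assoc, ac.2, neg_mul, mul_assoc (star a), ac.1]
            noncomm_ring
          rw [this]
          exact w4 _ (bV v hv)
    exact fun v hv => ⟨main _ (Or.inl rfl) v hv, main _ (Or.inr rfl) v hv⟩

/-- The algebra maps `V` to itself and `1 ∈ V`, so it is contained in the finite-dimensional space
`V`. Closedness is what keeps exponentials, integrals and time derivatives of local operators local.
-/
theorem isClosed_localAlg (X : Finset (Site d)) : IsClosed (localAlg r X : Set (Obs d r)) := by
  classical
  obtain ⟨V, hV, h1, hs⟩ := exists_finiteDimensional_of_modes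
    (X.biUnion fun x => Finset.univ.image fun i : Fin r => mode x i)
  have key : ∀ A ∈ localAlg r X, ∀ v ∈ V, A * v ∈ V := by
    intro A hA
    rw [mem_localAlg_iff] at hA
    induction hA using Algebra.adjoin_induction with
    | mem g hg =>
      obtain ⟨x, hx, i, hg⟩ := hg
      have hm : mode x i ∈ X.biUnion fun x => Finset.univ.image fun i : Fin r => mode x i := by
        simp only [Finset.mem_biUnion, Finset.mem_image]
        exact ⟨x, hx, i, Finset.mem_univ i, rfl⟩
      intro v hv
      rcases hg with rfl | rfl
      · exact (hs _ hm v hv).1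
      · exact (hs _ hm v hv).2
    | algebraMap c =>
      intro v hv
      rw [Algebra.algebraMap_eq_smul_one, smul_mul_assoc, one_mul]
      exact V.smul_mem c hv
    | add x y _ _ hx hy => exact fun v hv => by rw [add_mul]; exact V.add_mem (hx v hv) (hy v hv)
    | mul x y _ _ hx hy => exact fun v hv => by rw [mul_assoc]; exact hx _ (hy v hv)
  have hle : (localAlg r X).toSubalgebra.toSubmodule ≤ V := fun A hA => by
    have := key A hA 1 h1
    rwa [mul_one] at this
  have := Submodule.finiteDimensional_of_le hle
  exact Submodule.closed_of_finiteDimensional (localAlg r X).toSubalgebra.toSubmodule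

/-- The real vector space of self-adjoint number conserving elements of `𝒜_X`. -/
def localTerms (r : ℕ) (X : Finset (Site d)) : Submodule ℝ (Obs d r) where
  carrier := {A | IsLocalTerm X A}
  add_mem' ha hb := ⟨add_mem ha.1 hb.1, ha.2.1.add_left hb.2.1, ha.2.2.add hb.2.2⟩
  zero_mem' := ⟨zero_mem _, Commute.zero_left _, IsSelfAdjoint.zero _⟩
  smul_mem' c A hA := by
    have e : c • A = (c : ℂ) • A := (Complex.coe_smul c A).symm
    refine ⟨?_, hA.2.1.smul_left c, ?_⟩
    · rw [e]
      exact SMulMemClass.smul_mem (c : ℂ) hA.1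
    · have := hA.2.2
      unfold IsSelfAdjoint at this ⊢
      rw [e, star_smul, this]
      simp

theorem isClosed_localTerms (X : Finset (Site d)) :
    IsClosed (localTerms r X : Set (Obs d r)) := by
  have e : (localTerms r X : Set (Obs d r)) = (localAlg r X : Set (Obs d r)) ∩
      ({A | A * numberOp r X = numberOp r X * A} ∩ {A | star A = A}) := rfl
  rw [e]
  refine (isClosed_localAlg X).inter (IsClosed.inter ?_ ?_)
  · exact isClosed_eq (by fun_prop) (by fun_prop)
  · exact isClosed_eq (continuous_star (R := Obs d r)) continuous_id

end

section

variable {d r : ℕ}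

/-! ### Heisenberg evolution -/

/-- The quotient map `E → E/S` is continuous and linear and kills the integrand; closedness of `S`
makes the quotient a normed space. An undefined integral is zero by convention. -/
theorem integral_mem_of_isClosed {E : Type*} [NormedAddCommGroup E] [NormedSpace ℝ E]
    [CompleteSpace E] {α : Type*} [MeasurableSpace α] {μ : Measure α} {S : Submodule ℝ E}
    (hS : IsClosed (S : Set E)) {f : α → E} (hf : ∀ x, f x ∈ S) : ∫ x, f x ∂μ ∈ S := by
  by_cases hi : Integrable f μ
  · have h := (S.mkQL).integral_comp_comm hi
    have h0 : ∀ x, S.mkQL (f x) = 0 := fun x => (Submodule.Quotient.mk_eq_zero S).2 (hf x)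
    simp only [h0, integral_zero] at h
    exact (Submodule.Quotient.mk_eq_zero S).1 h.symm
  · rw [integral_undef hi]
    exact S.zero_mem

/-- The one-parameter group `e^{iuH}`. -/
def expI (H : Obs d r) (u : ℝ) : Obs d r := NormedSpace.exp ((Complex.I * u) • H)

theorem heisenberg_eq (H : Obs d r) (u : ℝ) (A : Obs d r) :
    heisenberg H u A = expI H u * A * expI H (-u) := by
  unfold heisenberg expI
  simp

theorem expI_zero (H : Obs d r) : expI H 0 = 1 := by
  unfold expI
  simp

theorem expI_add (H : Obs d r) (u v : ℝ) : expI H (u + v) = expI H u * expI H v := by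
  unfold expI
  let _ : NormedAlgebra ℚ (Obs d r) := NormedAlgebra.restrictScalars ℚ ℂ _
  rw [← NormedSpace.exp_add_of_commute (((Commute.refl H).smul_left _).smul_right _), ← add_smul]
  congr 2
  push_cast
  ring

theorem star_expI {H : Obs d r} (hH : IsSelfAdjoint H) (u : ℝ) : star (expI H u) = expI H (-u) := by
  unfold expI
  rw [NormedSpace.star_exp, star_smul, hH.star_eq]
  simp

theorem expI_mem_unitary {H : Obs d r} (hH : IsSelfAdjoint H) (u : ℝ) :
    expI H u ∈ unitary (Obs d r) := by
  rw [Unitary.mem_iff, star_expI hH, ← expI_add, ← expI_add]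
  simp [expI_zero]

theorem hasDerivAt_expI (H : Obs d r) (u : ℝ) :
    HasDerivAt (expI H) (Complex.I • (H * expI H u)) u := by
  have h := hasDerivAt_exp_smul_const' (𝕂 := ℝ) (Complex.I • H) u
  have e : expI H = fun u : ℝ => NormedSpace.exp (u • (Complex.I • H)) := by
    funext v
    unfold expI
    congr 1
    rw [mul_comm, mul_smul]
    exact Complex.coe_smul v (Complex.I • H)
  rw [e]
  exact h.congr_deriv (smul_mul_assoc _ _ _)

theorem commute_expI (H : Obs d r) (u : ℝ) : Commute H (expI H u) :=
  ((Commute.refl H).smul_right _).exp_right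

theorem continuous_expI (H : Obs d r) : Continuous (expI H) :=
  continuous_iff_continuousAt.2 fun u => (hasDerivAt_expI H u).continuousAt

theorem heisenberg_zero (H A : Obs d r) : heisenberg H 0 A = A := by
  rw [heisenberg_eq]
  simp [expI_zero]

theorem heisenberg_heisenberg (H : Obs d r) (u v : ℝ) (A : Obs d r) :
    heisenberg H u (heisenberg H v A) = heisenberg H (u + v) A := by
  simp only [heisenberg_eq]
  rw [neg_add, add_comm (-u), expI_add, expI_add]
  noncomm_ring

theorem norm_heisenberg {H : Obs d r} (hH : IsSelfAdjoint H) (u : ℝ) (A : Obs d r) :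
    ‖heisenberg H u A‖ = ‖A‖ := by
  rw [heisenberg_eq]
  exact (CStarRing.norm_mul_mem_unitary (expI H u * A) (expI_mem_unitary hH _)).trans
    (CStarRing.norm_mem_unitary_mul A (expI_mem_unitary hH _))

theorem heisenberg_sub (H : Obs d r) (u : ℝ) (A B : Obs d r) :
    heisenberg H u (A - B) = heisenberg H u A - heisenberg H u B := by
  simp only [heisenberg_eq]
  noncomm_ring

theorem heisenberg_add (H : Obs d r) (u : ℝ) (A B : Obs d r) :
    heisenberg H u (A + B) = heisenberg H u A + heisenberg H u B := by
  simp only [heisenberg_eq]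
  noncomm_ring

theorem heisenberg_sum {ι : Type*} (H : Obs d r) (u : ℝ) (s : Finset ι) (f : ι → Obs d r) :
    heisenberg H u (∑ i ∈ s, f i) = ∑ i ∈ s, heisenberg H u (f i) := by
  simp only [heisenberg_eq, Finset.mul_sum, Finset.sum_mul]

theorem heisenberg_neg_left (H : Obs d r) (u : ℝ) (A : Obs d r) :
    heisenberg (-H) u A = heisenberg H (-u) A := by
  unfold heisenberg
  simp

theorem IsLocalTerm.heisenberg {X : Finset (Site d)} {H A : Obs d r} (hH : IsLocalTerm X H)
    (hA : IsLocalTerm X A) (u : ℝ) : IsLocalTerm X (heisenberg H u A) := by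
  have hexp : ∀ v : ℝ, expI H v ∈ localAlg r X := fun v =>
    NormedSpace.exp_mem (R := ℂ) (isClosed_localAlg X) (SMulMemClass.smul_mem _ hH.1)
  have hcomm : ∀ v : ℝ, Commute (expI H v) (numberOp r X) := fun v =>
    ((hH.2.1.smul_left _).symm.exp_right).symm
  rw [heisenberg_eq]
  refine ⟨mul_mem (mul_mem (hexp _) hA.1) (hexp _),
    ((hcomm _).mul_left hA.2.1).mul_left (hcomm _), ?_⟩
  unfold IsSelfAdjoint
  rw [star_mul, star_mul, star_expI hH.2.2, star_expI hH.2.2, hA.2.2.star_eq, neg_neg, mul_assoc]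

/-- Derivative of the evolution applied to a curve. -/
theorem hasDerivAt_heisenberg (H : Obs d r) {f : ℝ → Obs d r} {f' : Obs d r} {v : ℝ}
    (hf : HasDerivAt f f' v) : HasDerivAt (fun u => heisenberg H u (f u))
      (heisenberg H v (f' + Complex.I • (H * f v - f v * H))) v := by
  simp only [heisenberg_eq]
  have h2 : HasDerivAt (fun u => expI H (-u)) (-(Complex.I • (H * expI H (-v)))) v := by
    exact ((hasDerivAt_expI H (-v)).scomp v (hasDerivAt_neg v)).congr_deriv (neg_one_smul ℝ _)
  refine (((hasDerivAt_expI H v).mul hf).mul h2).congr_deriv ?_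
  have c1 := (commute_expI H v).eq
  rw [c1]
  simp only [mul_add, add_mul, mul_sub, sub_mul, smul_sub, mul_smul_comm, smul_mul_assoc, mul_neg,
    mul_assoc, Pi.mul_apply]
  abel

theorem continuous_heisenberg (H : Obs d r) {f : ℝ → Obs d r} (hf : Continuous f) :
    Continuous (fun u => heisenberg H u (f u)) := by
  simp only [heisenberg_eq]
  exact ((continuous_expI H).mul hf).mul ((continuous_expI H).comp continuous_neg)

/-- Duhamel's formula. -/
theorem duhamel (H : Obs d r) {f b : ℝ → Obs d r} (hb : Continuous b)
    (hf : ∀ v, HasDerivAt f (Complex.I • (H * f v - f v * H) + b v) v) (v : ℝ) :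
    f v = heisenberg H v (f 0) + ∫ u in (0 : ℝ)..v, heisenberg H (v - u) (b u) := by
  -- Interaction picture: after undoing the free evolution only the inhomogeneity remains in the
  -- derivative.
  have h1 : ∀ u, HasDerivAt (fun u => heisenberg H (-u) (f u)) (heisenberg H (-u) (b u)) u := by
    intro u
    have := hasDerivAt_heisenberg (-H) (hf u)
    simp only [heisenberg_neg_left] at this
    refine this.congr_deriv ?_
    congr 1
    rw [neg_mul, mul_neg]
    module
  have hc : Continuous fun u => heisenberg H (-u) (b u) := by
    have := continuous_heisenberg (-H) hb
    simpa only [heisenberg_neg_left] using this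
  have h2 := intervalIntegral.integral_eq_sub_of_hasDerivAt (a := 0) (b := v)
    (fun u _ => h1 u) (hc.intervalIntegrable 0 v)
  have h3 : ∫ u in (0 : ℝ)..v, heisenberg H (v - u) (b u) =
      heisenberg H v (∫ u in (0 : ℝ)..v, heisenberg H (-u) (b u)) := by
    have := (ContinuousLinearMap.mulLeftRight ℝ (Obs d r) (expI H v)
      (expI H (-v))).intervalIntegral_comp_comm (hc.intervalIntegrable (μ := volume) 0 v)
    simp only [ContinuousLinearMap.mulLeftRight_apply, ← heisenberg_eq, heisenberg_heisenberg]
      at this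
    rw [← this]
    rfl
  rw [h3, h2, heisenberg_sub, heisenberg_heisenberg, heisenberg_heisenberg]
  simp [heisenberg_zero]

/-- The evolution generated by a self-adjoint operator is isometric, so only the source makes the
norm grow, and no factor exponential in time appears. -/
theorem norm_le_of_hasDerivAt {H : Obs d r} (hH : IsSelfAdjoint H) {f b : ℝ → Obs d r}
    (hb : Continuous b) (hf : ∀ v, HasDerivAt f (Complex.I • (H * f v - f v * H) + b v) v)
    (v : ℝ) : ‖f v‖ ≤ ‖f 0‖ + |∫ u in (0 : ℝ)..v, ‖b u‖| := by
  rw [duhamel H hb hf v]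
  refine (norm_add_le _ _).trans (add_le_add (norm_heisenberg hH _ _).le ?_)
  refine (intervalIntegral.norm_integral_le_abs_integral_norm).trans ?_
  simp only [norm_heisenberg hH, le_refl]

theorem norm_le_of_hasDerivAt_of_le {H : Obs d r} (hH : IsSelfAdjoint H) {f b : ℝ → Obs d r}
    (hb : Continuous b) (hf : ∀ v, HasDerivAt f (Complex.I • (H * f v - f v * H) + b v) v)
    {v B : ℝ} (hB : ∀ u, |u| ≤ |v| → ‖b u‖ ≤ B) : ‖f v‖ ≤ ‖f 0‖ + |v| * B := by
  rw [duhamel H hb hf v]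
  refine (norm_add_le _ _).trans (add_le_add (norm_heisenberg hH _ _).le ?_)
  have := intervalIntegral.norm_integral_le_of_norm_le_const (a := 0) (b := v) (C := B)
    (f := fun u => heisenberg H (v - u) (b u)) (fun u hu => by
      rw [norm_heisenberg hH]
      refine hB u ?_
      rcases Set.mem_uIoc.1 hu with ⟨h1, h2⟩ | ⟨h1, h2⟩
      · rw [abs_of_pos h1, abs_of_pos (h1.trans_le h2)]; exact h2
      · rw [abs_of_nonpos h2, abs_of_neg (h1.trans_le h2)]; linarith)
  rw [sub_zero, mul_comm] at this
  exact this

end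

section

variable {d r : ℕ}

/-! ### Commutators with single sites and the Lieb-Robinson bound -/

/-- The commutators of an operator with the operators at the site `y`. -/
def siteCommMap (r : ℕ) (y : Site d) : Obs d r →L[ℝ] (Fin r → Obs d r × Obs d r) :=
  ContinuousLinearMap.pi fun i =>
    (((ContinuousLinearMap.mul ℝ (Obs d r)).flip (annih (mode y i)) -
      ContinuousLinearMap.mul ℝ (Obs d r) (annih (mode y i))).prod
    ((ContinuousLinearMap.mul ℝ (Obs d r)).flip (star (annih (mode y i))) -
      ContinuousLinearMap.mul ℝ (Obs d r) (star (annih (mode y i)))))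

/-- The maximal norm of a commutator of `A` with an operator at the site `y`. -/
def siteComm (y : Site d) (A : Obs d r) : ℝ := ‖siteCommMap r y A‖

theorem siteCommMap_apply (y : Site d) (A : Obs d r) (i : Fin r) :
    siteCommMap r y A i = (A * annih (mode y i) - annih (mode y i) * A,
      A * star (annih (mode y i)) - star (annih (mode y i)) * A) := rfl

theorem siteComm_le_iff {y : Site d} {A : Obs d r} {c : ℝ} (hc : 0 ≤ c) :
    siteComm y A ≤ c ↔ ∀ i : Fin r, ∀ b : Obs d r,
      (b = annih (mode y i) ∨ b = star (annih (mode y i))) → ‖A * b - b * A‖ ≤ c := by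
  unfold siteComm
  rw [pi_norm_le_iff_of_nonneg hc]
  refine forall_congr' fun i => ?_
  rw [siteCommMap_apply, Prod.norm_def, max_le_iff]
  constructor
  · rintro ⟨h1, h2⟩ b (rfl | rfl)
    · exact h1
    · exact h2
  · exact fun h => ⟨h _ (Or.inl rfl), h _ (Or.inr rfl)⟩

theorem siteComm_nonneg (y : Site d) (A : Obs d r) : 0 ≤ siteComm y A := norm_nonneg _

theorem norm_comm_le_siteComm (y : Site d) (A : Obs d r) (i : Fin r) {b : Obs d r}
    (hb : b = annih (mode y i) ∨ b = star (annih (mode y i))) :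
    ‖A * b - b * A‖ ≤ siteComm y A :=
  (siteComm_le_iff (siteComm_nonneg y A)).1 le_rfl i b hb

theorem siteComm_add_le (y : Site d) (A B : Obs d r) :
    siteComm y (A + B) ≤ siteComm y A + siteComm y B := by
  unfold siteComm
  rw [map_add]
  exact norm_add_le _ _

theorem siteComm_sub_le (y : Site d) (A B : Obs d r) :
    siteComm y (A - B) ≤ siteComm y A + siteComm y B := by
  unfold siteComm
  rw [map_sub]
  exact norm_sub_le _ _

theorem siteComm_smul (y : Site d) (c : ℝ) (A : Obs d r) :
    siteComm y (c • A) = |c| * siteComm y A := by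
  unfold siteComm
  rw [map_smul, norm_smul, Real.norm_eq_abs]

theorem norm_annih_or_star_le {j : Mode d r} {b : Obs d r}
    (hb : b = annih j ∨ b = star (annih j)) : ‖b‖ ≤ 1 := by
  rcases hb with rfl | rfl
  · exact norm_annih_le _
  · exact norm_star_annih_le _

theorem norm_comm_le (A b : Obs d r) : ‖A * b - b * A‖ ≤ 2 * ‖A‖ * ‖b‖ := by
  have h1 := norm_sub_le (A * b) (b * A)
  have h2 := norm_mul_le A b
  have h3 := norm_mul_le b A
  linarith

theorem siteComm_le (y : Site d) (A : Obs d r) : siteComm y A ≤ 2 * ‖A‖ := by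
  rw [siteComm_le_iff (by positivity)]
  intro i b hb
  refine (norm_comm_le A b).trans ?_
  have := norm_annih_or_star_le hb
  nlinarith [norm_nonneg A]

theorem siteComm_I_smul (y : Site d) (A : Obs d r) :
    siteComm y (Complex.I • A) ≤ siteComm y A := by
  rw [siteComm_le_iff (siteComm_nonneg y A)]
  intro i b hb
  have : (Complex.I • A) * b - b * (Complex.I • A) = Complex.I • (A * b - b * A) := by
    rw [smul_mul_assoc, mul_smul_comm, smul_sub]
  rw [this, norm_smul, Complex.norm_I, one_mul]
  exact norm_comm_le_siteComm y A i hb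

theorem continuous_siteComm (y : Site d) : Continuous (siteComm (r := r) y) :=
  (siteCommMap r y).continuous.norm

theorem siteComm_eq_zero {y : Site d} {A : Obs d r}
    (h : ∀ i : Fin r, Commute A (annih (mode y i)) ∧ Commute A (star (annih (mode y i)))) :
    siteComm y A = 0 := by
  refine le_antisymm ((siteComm_le_iff le_rfl).2 fun i b hb => ?_) (siteComm_nonneg y A)
  rcases hb with rfl | rfl
  · rw [(h i).1.eq, sub_self, norm_zero]
  · rw [(h i).2.eq, sub_self, norm_zero]

theorem IsLocalTerm.siteComm_eq_zero {X : Finset (Site d)} {A : Obs d r} (hA : IsLocalTerm X A)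
    {y : Site d} (hy : y ∉ X) : siteComm y A = 0 :=
  FermionLattice.siteComm_eq_zero fun i =>
    ⟨hA.commute_of_notMem hy i (Or.inl rfl), hA.commute_of_notMem hy i (Or.inr rfl)⟩

theorem siteComm_integral_le (y : Site d) {f : ℝ → Obs d r} (hf : Continuous f) {v B : ℝ}
    (hB : ∀ u, |u| ≤ |v| → siteComm y (f u) ≤ B) :
    siteComm y (∫ u in (0 : ℝ)..v, f u) ≤ |v| * B := by
  unfold siteComm at *
  rw [← (siteCommMap r y).intervalIntegral_comp_comm (hf.intervalIntegrable (μ := volume) 0 v)]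
  have := intervalIntegral.norm_integral_le_of_norm_le_const (a := 0) (b := v) (C := B)
    (f := fun u => siteCommMap r y (f u)) (fun u hu => by
      refine hB u ?_
      rcases Set.mem_uIoc.1 hu with ⟨h1, h2⟩ | ⟨h1, h2⟩
      · rw [abs_of_pos h1, abs_of_pos (h1.trans_le h2)]; exact h2
      · rw [abs_of_nonpos h2, abs_of_neg (h1.trans_le h2)]; linarith)
  rw [sub_zero, mul_comm] at this
  exact this

theorem modeComm_le_siteComm (y : Site d) (i : Fin r) (A : Obs d r) :
    modeComm (mode y i) A ≤ 2 * siteComm y A := by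
  unfold modeComm
  have h1 := norm_comm_le_siteComm y A i (Or.inl rfl)
  have h2 := norm_comm_le_siteComm y A i (Or.inr rfl)
  linarith

/-- Approximation by operators commuting with the sites of `S`. -/
theorem exists_site_approx (S : Finset (Site d)) (O : Obs d r) :
    ∃ O' : Obs d r, ‖O'‖ ≤ ‖O‖ ∧ ‖O - O'‖ ≤ 4 * r * ∑ y ∈ S, siteComm y O ∧
      ∀ y ∈ S, ∀ i : Fin r, Commute O' (annih (mode y i)) ∧ Commute O' (star (annih (mode y i))) := by
  classical
  obtain ⟨O', h1, h2, h3⟩ := exists_commuting_approx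
    ((S ×ˢ (Finset.univ : Finset (Fin r))).image fun p => mode p.1 p.2) O
  refine ⟨O', h1, h2.trans ?_, fun y hy i => h3 _ ?_⟩
  · rw [Finset.sum_image, Finset.sum_product]
    · have : ∀ y ∈ S, ∑ i : Fin r, modeComm (mode y i) O ≤ 2 * r * siteComm y O := by
        intro y _
        refine (Finset.sum_le_sum fun i _ => modeComm_le_siteComm y i O).trans ?_
        simp only [Finset.sum_const, Finset.card_univ, Fintype.card_fin, nsmul_eq_mul]
        linarith
      have := Finset.sum_le_sum this
      rw [← Finset.mul_sum] at this
      linarith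
    · rintro ⟨x, i⟩ _ ⟨y, j⟩ _ h
      have := mode_inj.1 h
      exact Prod.ext this.1 this.2
  · exact Finset.mem_image.2 ⟨(y, i), by simp [hy], rfl⟩

/-- `h` commutes with an approximation `G'` of `G` that commutes with the field operators at all
sites of `X`, so only `G - G'` contributes. The constant is `2` from the commutator times `4r` from
the approximation. -/
theorem IsLocalTerm.norm_comm_le {X : Finset (Site d)} {h : Obs d r} (hh : IsLocalTerm X h)
    (G : Obs d r) : ‖h * G - G * h‖ ≤ 8 * r * ‖h‖ * ∑ y ∈ X, siteComm y G := by
  obtain ⟨G', -, h2, h3⟩ := exists_site_approx X G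
  have hc : Commute h G' := by
    refine commute_of_mem_localAlg hh.1 ?_
    rintro g ⟨x, hx, i, rfl | rfl⟩
    · exact (h3 x hx i).1.symm
    · exact (h3 x hx i).2.symm
  have e : h * G - G * h = h * (G - G') - (G - G') * h := by
    rw [mul_sub, sub_mul, hc.eq]
    abel
  rw [e]
  refine (FermionLattice.norm_comm_le _ _).trans ?_
  have := mul_le_mul_of_nonneg_left h2 (norm_nonneg h)
  linarith

/-- `∑ ‖h Y‖` over the sets `Y ⊆ Λ` containing `y` and `z`. -/
def pairSum (Λ : Finset (Site d)) (h : Finset (Site d) → Obs d r) (y z : Site d) : ℝ :=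
  ∑ Y ∈ Λ.powerset with y ∈ Y ∧ z ∈ Y, ‖h Y‖

theorem pairSum_nonneg (Λ : Finset (Site d)) (h : Finset (Site d) → Obs d r) (y z : Site d) :
    0 ≤ pairSum Λ h y z := Finset.sum_nonneg fun _ _ => norm_nonneg _

/-- The operator `∑_{Y ⊆ Λ} h Y`. -/
def totalOp (Λ : Finset (Site d)) (h : Finset (Site d) → Obs d r) : Obs d r :=
  ∑ Y ∈ Λ.powerset, h Y

theorem sum_comm_le {Λ : Finset (Site d)} {h : Finset (Site d) → Obs d r}
    (hh : ∀ Y ⊆ Λ, IsLocalTerm Y (h Y)) (y : Site d) (G : Obs d r) :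
    ∑ Y ∈ Λ.powerset with y ∈ Y, ‖h Y * G - G * h Y‖ ≤
      8 * r * ∑ z ∈ Λ, pairSum Λ h y z * siteComm z G := by
  have h1 : ∀ Y ∈ Λ.powerset.filter (y ∈ ·), ‖h Y * G - G * h Y‖ ≤
      8 * r * ∑ z ∈ Λ, if z ∈ Y then ‖h Y‖ * siteComm z G else 0 := by
    intro Y hY
    have hY' := Finset.mem_powerset.1 (Finset.mem_filter.1 hY).1
    refine ((hh Y hY').norm_comm_le G).trans (le_of_eq ?_)
    rw [← Finset.sum_filter, Finset.filter_mem_eq_inter, Finset.inter_eq_right.2 hY',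
      mul_assoc, Finset.mul_sum]
  refine (Finset.sum_le_sum h1).trans (le_of_eq ?_)
  rw [← Finset.mul_sum, Finset.sum_comm]
  congr 1
  refine Finset.sum_congr rfl fun z _ => ?_
  rw [← Finset.sum_filter, Finset.filter_filter, pairSum, Finset.sum_mul]

/-- The integral form is needed because norms of commutators are continuous but not differentiable
in time. With `g` the right-hand side, `g(u) exp(-κu)` is nonincreasing. -/
theorem gronwall_of_integral {m : ℝ → ℝ} (hm : Continuous m) {m0 κ : ℝ} (hκ : 0 ≤ κ)
    (h : ∀ u, 0 ≤ u → m u ≤ m0 + κ * ∫ s in (0 : ℝ)..u, m s) {u : ℝ} (hu : 0 ≤ u) :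
    m u ≤ m0 * Real.exp (κ * u) := by
  set g : ℝ → ℝ := fun u => m0 + κ * ∫ s in (0 : ℝ)..u, m s with hg
  have hd : ∀ u, HasDerivAt g (κ * m u) u := fun u =>
    ((intervalIntegral.integral_hasDerivAt_right (hm.intervalIntegrable _ _)
      (hm.stronglyMeasurableAtFilter _ _) hm.continuousAt).const_mul κ).const_add m0
  have hφ : ∀ u, HasDerivAt (fun u => g u * Real.exp (-(κ * u)))
      (κ * m u * Real.exp (-(κ * u)) + g u * (Real.exp (-(κ * u)) * -(κ * 1))) u := fun u =>
    (hd u).mul ((((hasDerivAt_id u).const_mul κ).neg).exp)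
  have hanti : AntitoneOn (fun u => g u * Real.exp (-(κ * u))) (Set.Ici 0) := by
    refine antitoneOn_of_deriv_nonpos (convex_Ici 0)
      (fun u _ => (hφ u).continuousAt.continuousWithinAt)
      (fun u _ => (hφ u).differentiableAt.differentiableWithinAt) fun u hu => ?_
    rw [interior_Ici] at hu
    rw [(hφ u).deriv]
    have h1 := h u (le_of_lt hu)
    have h2 := Real.exp_pos (-(κ * u))
    have : κ * Real.exp (-(κ * u)) * (m u - g u) ≤ 0 :=
      mul_nonpos_of_nonneg_of_nonpos (by positivity) (by simp only [hg]; linarith)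
    linarith
  have h3 := hanti Set.self_mem_Ici hu hu
  simp only [hg, intervalIntegral.integral_same, mul_zero, add_zero, neg_zero, Real.exp_zero,
    mul_one] at h3
  refine (h u hu).trans ?_
  have h4 := mul_le_mul_of_nonneg_right h3 (Real.exp_pos (κ * u)).le
  rw [mul_assoc, ← Real.exp_add, neg_add_cancel, Real.exp_zero, mul_one] at h4
  exact h4

/-- The integral inequality for the commutators of an evolved operator with the site `y`. -/
theorem siteComm_heisenberg_le_integral {Λ : Finset (Site d)} {h : Finset (Site d) → Obs d r}
    (hh : ∀ Y ⊆ Λ, IsLocalTerm Y (h Y)) (O : Obs d r) (y : Site d) {v : ℝ} (hv : 0 ≤ v) :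
    siteComm y (heisenberg (totalOp Λ h) v O) ≤ siteComm y O + ∫ u in (0 : ℝ)..v,
      16 * r * ∑ z ∈ Λ, pairSum Λ h y z * siteComm z (heisenberg (totalOp Λ h) u O) := by
  set H := totalOp Λ h with hH
  set A : ℝ → Obs d r := fun u => heisenberg H u O with hA
  have hAc : Continuous A := continuous_heisenberg H continuous_const
  have hAd : ∀ u, HasDerivAt A (Complex.I • (H * A u - A u * H)) u := by
    intro u
    refine (hasDerivAt_heisenberg H (hasDerivAt_const u O)).congr_deriv ?_
    simp only [hA, heisenberg_eq, zero_add, mul_smul_comm, smul_mul_assoc, mul_sub, sub_mul]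
    have c1 := (commute_expI H u).eq
    have c2 := (commute_expI H (-u)).eq
    rw [← mul_assoc H, ← mul_assoc H, c1, mul_assoc _ _ H, ← c2]
    simp only [mul_assoc]
  have hint : Continuous fun u => 16 * (r : ℝ) * ∑ z ∈ Λ, pairSum Λ h y z * siteComm z (A u) := by
    refine continuous_const.mul (continuous_finsetSum _ fun z _ => continuous_const.mul ?_)
    exact (continuous_siteComm z).comp hAc
  have hint0 : 0 ≤ ∫ u in (0 : ℝ)..v,
      16 * (r : ℝ) * ∑ z ∈ Λ, pairSum Λ h y z * siteComm z (A u) :=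
    intervalIntegral.integral_nonneg hv fun u _ => mul_nonneg (by positivity)
      (Finset.sum_nonneg fun z _ => mul_nonneg (pairSum_nonneg _ _ _ _) (siteComm_nonneg _ _))
  rw [siteComm_le_iff (add_nonneg (siteComm_nonneg _ _) hint0)]
  intro i b hb
  -- Terms whose sets avoid `y` commute with the field operator `b`. They generate an isometric
  -- evolution of `[A(u), b]` and drop out of the estimate; the terms containing `y` form the
  -- source.
  set H1 := ∑ Y ∈ Λ.powerset with y ∉ Y, h Y with hH1
  set H2 := ∑ Y ∈ Λ.powerset with y ∈ Y, h Y with hH2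
  have hsplit : H = H2 + H1 := by
    rw [hH, totalOp, ← Finset.sum_filter_add_sum_filter_not _ (y ∈ ·)]
  have hH1b : Commute H1 b := Commute.sum_left _ _ _ fun Y hY => by
    rw [Finset.mem_filter, Finset.mem_powerset] at hY
    exact (hh Y hY.1).commute_of_notMem hY.2 i hb
  have hH1s : IsSelfAdjoint H1 := by
    refine isSelfAdjoint_sum _ fun Y hY => ?_
    rw [Finset.mem_filter, Finset.mem_powerset] at hY
    exact (hh Y hY.1).2.2
  have hfd : ∀ u, HasDerivAt (fun u => A u * b - b * A u)
      (Complex.I • (H1 * (A u * b - b * A u) - (A u * b - b * A u) * H1) +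
        Complex.I • ((H2 * A u - A u * H2) * b - b * (H2 * A u - A u * H2))) u := by
    intro u
    refine (((hAd u).mul_const b).sub ((hAd u).const_mul b)).congr_deriv ?_
    rw [smul_mul_assoc, mul_smul_comm, ← smul_sub, ← smul_add, hsplit]
    congr 1
    have e1 := hH1b.eq
    have e2 : H1 * (b * A u) = b * (H1 * A u) := by rw [← mul_assoc, e1, mul_assoc]
    have e3 : A u * b * H1 = A u * (H1 * b) := by rw [mul_assoc, ← e1]
    rw [mul_sub H1, sub_mul (A u * b), e2, e3]
    noncomm_ring
  have hbc : Continuous fun u =>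
      Complex.I • ((H2 * A u - A u * H2) * b - b * (H2 * A u - A u * H2)) := by fun_prop
  have hle := norm_le_of_hasDerivAt hH1s hbc hfd v
  have hA0 : A 0 = O := heisenberg_zero H O
  refine hle.trans (add_le_add ?_ ?_)
  · rw [hA0]
    exact norm_comm_le_siteComm y O i hb
  · rw [abs_of_nonneg (intervalIntegral.integral_nonneg hv fun u _ => norm_nonneg _)]
    refine intervalIntegral.integral_mono_on hv (hbc.norm.intervalIntegrable _ _)
      (hint.intervalIntegrable _ _) fun u _ => ?_
    rw [norm_smul, Complex.norm_I, one_mul]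
    refine (norm_comm_le _ _).trans ?_
    have h1 : ‖H2 * A u - A u * H2‖ ≤ ∑ Y ∈ Λ.powerset with y ∈ Y, ‖h Y * A u - A u * h Y‖ := by
      rw [hH2, Finset.sum_mul, Finset.mul_sum, ← Finset.sum_sub_distrib]
      exact norm_sum_le _ _
    have h2 := h1.trans (sum_comm_le hh y (A u))
    have h3 := norm_annih_or_star_le hb
    have h4 : 2 * ‖H2 * A u - A u * H2‖ * ‖b‖ ≤ 2 * ‖H2 * A u - A u * H2‖ :=
      mul_le_of_le_one_right (by positivity) h3
    linarith

/-- The largest ratio of a commutator to `wt` over the sites reduces the system of integral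
inequalities to one scalar Gronwall inequality. For this `wt` must be a supersolution of the matrix
`pairSum`, with factor `k0`. -/
theorem siteComm_heisenberg_le_of_nonneg {Λ : Finset (Site d)} {h : Finset (Site d) → Obs d r}
    (hh : ∀ Y ⊆ Λ, IsLocalTerm Y (h Y)) {wt : Site d → ℝ} (hwt : ∀ z, 0 < wt z) {k0 : ℝ}
    (hk0 : 0 ≤ k0) (hk : ∀ y ∈ Λ, ∑ z ∈ Λ, pairSum Λ h y z * wt z ≤ k0 * wt y)
    {O : Obs d r} {c0 : ℝ} (hO : ∀ y ∈ Λ, siteComm y O ≤ c0 * wt y) {v : ℝ} (hv : 0 ≤ v)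
    {y : Site d} (hy : y ∈ Λ) :
    siteComm y (heisenberg (totalOp Λ h) v O) ≤ c0 * Real.exp (16 * r * k0 * v) * wt y := by
  set A : ℝ → Obs d r := fun u => heisenberg (totalOp Λ h) u O with hA
  have hAc : Continuous A := continuous_heisenberg _ continuous_const
  have hne : Λ.Nonempty := ⟨y, hy⟩
  set m : ℝ → ℝ := fun u => Λ.sup' hne fun z => siteComm z (A u) / wt z with hm
  have hmc : Continuous m := by
    refine Continuous.finset_sup'_apply hne fun z _ => ?_
    exact ((continuous_siteComm z).comp hAc).div_const _
  have hle : ∀ u, ∀ z ∈ Λ, siteComm z (A u) ≤ m u * wt z := by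
    intro u z hz
    rw [← div_le_iff₀ (hwt z)]
    exact Finset.le_sup' (fun z => siteComm z (A u) / wt z) hz
  have hm0 : ∀ u, 0 ≤ m u := fun u =>
    (div_nonneg (siteComm_nonneg _ _) (hwt y).le).trans
      (Finset.le_sup' (fun z => siteComm z (A u) / wt z) hy)
  have key : ∀ u, 0 ≤ u → m u ≤ c0 + 16 * r * k0 * ∫ s in (0 : ℝ)..u, m s := by
    intro u hu
    refine Finset.sup'_le _ _ fun z hz => ?_
    rw [div_le_iff₀ (hwt z)]
    refine (siteComm_heisenberg_le_integral hh O z hu).trans ?_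
    rw [add_mul, mul_right_comm _ _ (wt z), ← intervalIntegral.integral_const_mul]
    refine add_le_add (hO z hz) ?_
    refine intervalIntegral.integral_mono_on hu ?_ ?_ fun s _ => ?_
    · refine Continuous.intervalIntegrable ?_ _ _
      refine continuous_const.mul (continuous_finsetSum _ fun z _ => continuous_const.mul ?_)
      exact (continuous_siteComm z).comp hAc
    · exact (continuous_const.mul hmc).intervalIntegrable _ _
    · have h1 : ∑ z' ∈ Λ, pairSum Λ h z z' * siteComm z' (A s) ≤ m s * (k0 * wt z) := by
        refine le_trans ?_ (mul_le_mul_of_nonneg_left (hk z hz) (hm0 s))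
        rw [Finset.mul_sum]
        refine Finset.sum_le_sum fun z' hz' => ?_
        have := mul_le_mul_of_nonneg_left (hle s z' hz') (pairSum_nonneg Λ h z z')
        linarith
      have := mul_le_mul_of_nonneg_left h1 (by positivity : (0 : ℝ) ≤ 16 * r)
      linarith
  have h1 := gronwall_of_integral hmc (by positivity) key hv
  exact (hle v y hy).trans (mul_le_mul_of_nonneg_right h1 (hwt y).le)

theorem totalOp_neg (Λ : Finset (Site d)) (h : Finset (Site d) → Obs d r) :
    totalOp Λ (fun Y => -h Y) = -totalOp Λ h := by
  unfold totalOp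
  rw [Finset.sum_neg_distrib]

/-- Lieb-Robinson bound with a general weight `wt`. -/
theorem siteComm_heisenberg_le {Λ : Finset (Site d)} {h : Finset (Site d) → Obs d r}
    (hh : ∀ Y ⊆ Λ, IsLocalTerm Y (h Y)) {wt : Site d → ℝ} (hwt : ∀ z, 0 < wt z) {k0 : ℝ}
    (hk0 : 0 ≤ k0) (hk : ∀ y ∈ Λ, ∑ z ∈ Λ, pairSum Λ h y z * wt z ≤ k0 * wt y)
    {O : Obs d r} {c0 : ℝ} (hO : ∀ y ∈ Λ, siteComm y O ≤ c0 * wt y) (v : ℝ)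
    {y : Site d} (hy : y ∈ Λ) :
    siteComm y (heisenberg (totalOp Λ h) v O) ≤ c0 * Real.exp (16 * r * k0 * |v|) * wt y := by
  rcases le_total 0 v with hv | hv
  · rw [abs_of_nonneg hv]
    exact siteComm_heisenberg_le_of_nonneg hh hwt hk0 hk hO hv hy
  · rw [abs_of_nonpos hv]
    -- Negative times are positive times for the interaction `-h`, whose terms have the same norms.
    have hk' : ∀ y ∈ Λ, ∑ z ∈ Λ, pairSum Λ (fun Y => -h Y) y z * wt z ≤ k0 * wt y := by
      intro y hy
      have e : ∀ z, pairSum Λ (fun Y => -h Y) y z = pairSum Λ h y z := fun z =>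
        Finset.sum_congr rfl fun Y _ => norm_neg _
      simp only [e]
      exact hk y hy
    have := siteComm_heisenberg_le_of_nonneg (h := fun Y => -h Y)
      (fun Y hY => (localTerms r Y).neg_mem (hh Y hY)) hwt hk0 hk' hO (neg_nonneg.2 hv) hy
    rwa [totalOp_neg, heisenberg_neg_left, neg_neg] at this

end

section

variable {d r : ℕ}

/-! ### Polynomial locality -/

/-- `δ` is a (pseudo-)metric on `Λ` such that `∑_y (1 + δ(x,y))^{-s} ≤ ν`. -/
structure IsRegularMetric (Λ : Finset (Site d)) (δ : Site d → Site d → ℝ) (s : ℕ) (ν : ℝ) :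
    Prop where
  self : ∀ x ∈ Λ, δ x x = 0
  symm : ∀ x ∈ Λ, ∀ y ∈ Λ, δ x y = δ y x
  triangle : ∀ x ∈ Λ, ∀ y ∈ Λ, ∀ z ∈ Λ, δ x z ≤ δ x y + δ y z
  sum_le : ∀ x ∈ Λ, ∑ y ∈ Λ, ((1 + δ x y) ^ s)⁻¹ ≤ ν

theorem IsRegularMetric.nonneg {Λ : Finset (Site d)} {δ : Site d → Site d → ℝ} {s : ℕ} {ν : ℝ}
    (hm : IsRegularMetric Λ δ s ν) {x y : Site d} (hx : x ∈ Λ) (hy : y ∈ Λ) : 0 ≤ δ x y := by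
  have h1 := hm.triangle x hx y hy x hx
  rw [hm.self x hx, hm.symm y hy x hx] at h1
  linarith

theorem IsRegularMetric.sum_nonneg {Λ : Finset (Site d)} {δ : Site d → Site d → ℝ} {s : ℕ} {ν : ℝ}
    (hm : IsRegularMetric Λ δ s ν) {x : Site d} (hx : x ∈ Λ) : 0 ≤ ν :=
  (Finset.sum_nonneg fun y hy => inv_nonneg.2
    (pow_nonneg (by have := hm.nonneg hx hy; linarith) s)).trans (hm.sum_le x hx)

/-- A sum bounded termwise by `c (1 + δ(x,z))^{-s}`. -/
theorem IsRegularMetric.sum_le_of_le {Λ : Finset (Site d)} {δ : Site d → Site d → ℝ} {s : ℕ}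
    {ν : ℝ} (hm : IsRegularMetric Λ δ s ν) {x : Site d} (hx : x ∈ Λ) {f : Site d → ℝ} {c : ℝ}
    (hc : 0 ≤ c) (hf : ∀ z ∈ Λ, f z * (1 + δ x z) ^ s ≤ c) : ∑ z ∈ Λ, f z ≤ c * ν := by
  calc ∑ z ∈ Λ, f z ≤ ∑ z ∈ Λ, c * ((1 + δ x z) ^ s)⁻¹ := Finset.sum_le_sum fun z hz => by
        have : 0 < (1 + δ x z) ^ s := pow_pos (by have := hm.nonneg hx hz; linarith) s
        rw [← div_eq_mul_inv, le_div_iff₀ this]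
        exact hf z hz
    _ = c * ∑ z ∈ Λ, ((1 + δ x z) ^ s)⁻¹ := by rw [Finset.mul_sum]
    _ ≤ c * ν := mul_le_mul_of_nonneg_left (hm.sum_le x hx) hc

/-- `O` is bounded by `B` and its commutators with the sites of `Λ` decay with order `p` in the
distance from `x`. -/
def LocBd (Λ : Finset (Site d)) (δ : Site d → Site d → ℝ) (x : Site d) (p : ℕ) (O : Obs d r)
    (B : ℝ) : Prop :=
  ‖O‖ ≤ B ∧ ∀ z ∈ Λ, siteComm z O * (1 + δ x z) ^ p ≤ B

namespace LocBd

variable {Λ : Finset (Site d)} {δ : Site d → Site d → ℝ} {x : Site d} {p : ℕ} {O O' : Obs d r}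
  {B B' : ℝ}

theorem nonneg (h : LocBd Λ δ x p O B) : 0 ≤ B := (norm_nonneg _).trans h.1

theorem mono (h : LocBd Λ δ x p O B) (hB : B ≤ B') : LocBd Λ δ x p O B' :=
  ⟨h.1.trans hB, fun z hz => (h.2 z hz).trans hB⟩

theorem add (h : LocBd Λ δ x p O B) (h' : LocBd Λ δ x p O' B') (hδ : ∀ z ∈ Λ, 0 ≤ δ x z) :
    LocBd Λ δ x p (O + O') (B + B') := by
  refine ⟨(norm_add_le _ _).trans (add_le_add h.1 h'.1), fun z hz => ?_⟩
  have h0 : 0 ≤ (1 + δ x z) ^ p := pow_nonneg (by have := hδ z hz; linarith) p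
  have h1 := mul_le_mul_of_nonneg_right (siteComm_add_le z O O') h0
  have h2 := h.2 z hz
  have h3 := h'.2 z hz
  linarith

theorem sub (h : LocBd Λ δ x p O B) (h' : LocBd Λ δ x p O' B') (hδ : ∀ z ∈ Λ, 0 ≤ δ x z) :
    LocBd Λ δ x p (O - O') (B + B') := by
  refine ⟨(norm_sub_le _ _).trans (add_le_add h.1 h'.1), fun z hz => ?_⟩
  have h0 : 0 ≤ (1 + δ x z) ^ p := pow_nonneg (by have := hδ z hz; linarith) p
  have h1 := mul_le_mul_of_nonneg_right (siteComm_sub_le z O O') h0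
  have h2 := h.2 z hz
  have h3 := h'.2 z hz
  linarith

theorem smul (h : LocBd Λ δ x p O B) (c : ℝ) : LocBd Λ δ x p (c • O) (|c| * B) := by
  refine ⟨?_, fun z hz => ?_⟩
  · rw [norm_smul, Real.norm_eq_abs]
    exact mul_le_mul_of_nonneg_left h.1 (abs_nonneg c)
  · rw [siteComm_smul, mul_assoc]
    exact mul_le_mul_of_nonneg_left (h.2 z hz) (abs_nonneg c)

theorem I_smul (h : LocBd Λ δ x p O B) (hδ : ∀ z ∈ Λ, 0 ≤ δ x z) :
    LocBd Λ δ x p (Complex.I • O) B := by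
  refine ⟨?_, fun z hz => (mul_le_mul_of_nonneg_right (siteComm_I_smul z O) ?_).trans (h.2 z hz)⟩
  · rw [norm_smul, Complex.norm_I, one_mul]
    exact h.1
  · exact pow_nonneg (by have := hδ z hz; linarith) p

theorem zero (hB : 0 ≤ B) : LocBd Λ δ x p (0 : Obs d r) B := by
  refine ⟨by simpa using hB, fun z _ => ?_⟩
  rw [siteComm_eq_zero fun i => ⟨Commute.zero_left _, Commute.zero_left _⟩, zero_mul]
  exact hB

theorem sum {ι : Type*} (s : Finset ι) {O : ι → Obs d r} {B : ι → ℝ}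
    (h : ∀ i ∈ s, LocBd Λ δ x p (O i) (B i)) (hδ : ∀ z ∈ Λ, 0 ≤ δ x z) :
    LocBd Λ δ x p (∑ i ∈ s, O i) (∑ i ∈ s, B i) := by
  classical
  induction s using Finset.induction_on with
  | empty => simpa using zero le_rfl
  | insert i s hi ih =>
    rw [Finset.sum_insert hi, Finset.sum_insert hi]
    exact (h i (Finset.mem_insert_self i s)).add
      (ih fun j hj => h j (Finset.mem_insert_of_mem hj)) hδ

theorem integral {f : ℝ → Obs d r} (hf : Continuous f) {v : ℝ} (hδ : ∀ z ∈ Λ, 0 ≤ δ x z)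
    (h : ∀ u, |u| ≤ |v| → LocBd Λ δ x p (f u) B) :
    LocBd Λ δ x p (∫ u in (0 : ℝ)..v, f u) (|v| * B) := by
  constructor
  · have := intervalIntegral.norm_integral_le_of_norm_le_const (a := 0) (b := v) (C := B)
      (f := f) (fun u hu => by
        refine (h u ?_).1
        rcases Set.mem_uIoc.1 hu with ⟨h1, h2⟩ | ⟨h1, h2⟩
        · rw [abs_of_pos h1, abs_of_pos (h1.trans_le h2)]; exact h2
        · rw [abs_of_nonpos h2, abs_of_neg (h1.trans_le h2)]; linarith)
    rwa [sub_zero, mul_comm] at this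
  · intro z hz
    have h0 : 0 < (1 + δ x z) ^ p := pow_pos (by have := hδ z hz; linarith) p
    rw [← le_div_iff₀ h0, mul_div_assoc]
    refine siteComm_integral_le z hf fun u hu => ?_
    rw [le_div_iff₀ h0]
    exact (h u hu).2 z hz

end LocBd

theorem exists_pow_mul_exp_neg_le {b : ℝ} (hb : 0 < b) (s : ℕ) :
    ∃ M : ℝ, 0 ≤ M ∧ ∀ t : ℝ, 0 ≤ t → (1 + t) ^ s * Real.exp (-(b * t)) ≤ M := by
  refine ⟨s.factorial * Real.exp b / b ^ s, by positivity, fun t ht => ?_⟩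
  have h := Real.pow_div_factorial_le_exp (b * (1 + t)) (by positivity) s
  rw [div_le_iff₀ (by positivity), mul_pow, mul_add, mul_one, Real.exp_add] at h
  rw [le_div_iff₀ (by positivity), Real.exp_neg, ← div_eq_mul_inv, div_mul_eq_mul_div,
    div_le_iff₀ (Real.exp_pos _)]
  linarith

/-- Inside the light cone `bρ ≤ 2κv` the bound `1` is used, and `1 + ρ` is at most a multiple of `1
+ v`. Outside, the exponential is at most `exp(-bρ/2)`. This replaces the exponential growth in time
of a Lieb-Robinson bound by a polynomial one. -/
theorem exists_min_exp_bound {b κ : ℝ} (hb : 0 < b) (hκ : 0 ≤ κ) (p : ℕ) :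
    ∃ C : ℝ, 0 ≤ C ∧ ∀ v ρ : ℝ, 0 ≤ v → 0 ≤ ρ →
      min 1 (Real.exp (κ * v - b * ρ)) * (1 + ρ) ^ p ≤ C * (1 + v) ^ p := by
  obtain ⟨M, hM0, hM⟩ := exists_pow_mul_exp_neg_le (half_pos hb) p
  refine ⟨(1 + 2 * κ / b) ^ p + M, by positivity, fun v ρ hv hρ => ?_⟩
  have hv1 : 1 ≤ (1 + v) ^ p := one_le_pow₀ (by linarith)
  have hM' : M ≤ M * (1 + v) ^ p := le_mul_of_one_le_right hM0 hv1
  have hpos : 0 ≤ (1 + 2 * κ / b) ^ p * (1 + v) ^ p := by positivity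
  rw [add_mul]
  rcases le_total (b * ρ) (2 * κ * v) with h | h
  · have h1 : ρ ≤ 2 * κ / b * v := by
      rw [div_mul_eq_mul_div, le_div_iff₀ hb]; linarith
    have h2 : 1 + ρ ≤ (1 + 2 * κ / b) * (1 + v) := by
      have : 0 ≤ 2 * κ / b := by positivity
      nlinarith
    have h3 : (1 + ρ) ^ p ≤ (1 + 2 * κ / b) ^ p * (1 + v) ^ p := by
      rw [← mul_pow]
      exact pow_le_pow_left₀ (by linarith) h2 p
    have h4 : min 1 (Real.exp (κ * v - b * ρ)) * (1 + ρ) ^ p ≤ 1 * (1 + ρ) ^ p :=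
      mul_le_mul_of_nonneg_right (min_le_left _ _) (by positivity)
    linarith [mul_nonneg hM0 (zero_le_one.trans hv1)]
  · have h1 : Real.exp (κ * v - b * ρ) ≤ Real.exp (-(b / 2 * ρ)) :=
      Real.exp_le_exp.2 (by linarith)
    have h4 : min 1 (Real.exp (κ * v - b * ρ)) * (1 + ρ) ^ p
        ≤ Real.exp (-(b / 2 * ρ)) * (1 + ρ) ^ p :=
      mul_le_mul_of_nonneg_right ((min_le_right _ _).trans h1) (by positivity)
    have := hM ρ hρ
    linarith

theorem totalOp_isSelfAdjoint {Λ : Finset (Site d)} {h : Finset (Site d) → Obs d r}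
    (hh : ∀ Y ⊆ Λ, IsLocalTerm Y (h Y)) : IsSelfAdjoint (totalOp Λ h) :=
  isSelfAdjoint_sum _ fun Y hY => (hh Y (Finset.mem_powerset.1 hY)).2.2

/-- Lieb-Robinson bound for operators with polynomial tails: the constant grows polynomially in
time. -/
theorem exists_locBd_heisenberg (r : ℕ) {a K ν : ℝ} (ha : 0 < a) (hK : 0 ≤ K) (hν : 0 ≤ ν)
    (s p : ℕ) : ∃ C : ℝ, 0 ≤ C ∧ ∀ (Λ : Finset (Site d)) (δ : Site d → Site d → ℝ)
      (h : Finset (Site d) → Obs d r) (x : Site d) (O : Obs d r) (B v : ℝ),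
      IsRegularMetric Λ δ s ν → (∀ Y ⊆ Λ, IsLocalTerm Y (h Y)) →
      (∀ y ∈ Λ, ∀ z ∈ Λ, pairSum Λ h y z ≤ K * Real.exp (-(a * δ y z))) → x ∈ Λ →
      LocBd Λ δ x (p + s) O B →
      LocBd Λ δ x p (heisenberg (totalOp Λ h) v O) (C * (1 + |v|) ^ p * B) := by
  obtain ⟨M, hM0, hM⟩ := exists_pow_mul_exp_neg_le (half_pos ha) s
  -- The rate is `a / 4` because the weight chosen below has rate `a / 2`, the other half of `a`
  -- being spent on summing over sites, and it decays only over the distance `ρ / 2`. The value of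
  -- `κ` is the exponent from Gronwall's inequality.
  obtain ⟨C1, hC1, hC1'⟩ := exists_min_exp_bound (b := a / 4) (κ := 16 * r * (K * M * ν))
    (by positivity) (by positivity) p
  refine ⟨1 + (2 * C1 + 8 * r * ν * 2 ^ p), by positivity, ?_⟩
  intro Λ δ h x O B v hm hh hpair hx hO
  have hB := hO.nonneg
  have hsa := totalOp_isSelfAdjoint hh
  have hv1 : 1 ≤ (1 + |v|) ^ p := one_le_pow₀ (by linarith [abs_nonneg v])
  have hX : 0 ≤ 2 * C1 + 8 * r * ν * 2 ^ p := by positivity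
  refine ⟨?_, fun y hy => ?_⟩
  · rw [norm_heisenberg hsa]
    refine hO.1.trans ?_
    have : 1 ≤ (1 + (2 * C1 + 8 * r * ν * 2 ^ p)) * (1 + |v|) ^ p := by nlinarith
    nlinarith
  set ρ := δ x y with hρ
  have hρ0 : 0 ≤ ρ := hm.nonneg hx hy
  -- The tail of `O` beyond half of the distance to `y` is removed. The removed part is small of
  -- order `p` in `ρ`, the additional `s` orders of decay being used up by the sum over sites.
  obtain ⟨O', hO1, hO2, hO3⟩ := exists_site_approx (Λ.filter fun z => ρ / 2 < δ x z) O
  have hdiff : ‖O - O'‖ * (1 + ρ) ^ p ≤ 4 * r * ν * 2 ^ p * B := by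
    have h1 : ∑ z ∈ Λ.filter (fun z => ρ / 2 < δ x z), siteComm z O * (1 + ρ) ^ p
        ≤ 2 ^ p * B * ν := by
      rw [Finset.sum_filter]
      refine hm.sum_le_of_le hx (by positivity) fun z hz => ?_
      have hz0 := hm.nonneg hx hz
      split_ifs with hlt
      · have h2 : (1 + ρ) ^ p ≤ 2 ^ p * (1 + δ x z) ^ p := by
          rw [← mul_pow]
          exact pow_le_pow_left₀ (by linarith) (by linarith) p
        have h3 := hO.2 z hz
        rw [pow_add] at h3
        have h4 : 0 ≤ siteComm z O * (1 + δ x z) ^ s :=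
          mul_nonneg (siteComm_nonneg z O) (pow_nonneg (by linarith) s)
        have h5 := mul_le_mul_of_nonneg_left h2 h4
        have h6 := mul_le_mul_of_nonneg_left h3 (by positivity : (0 : ℝ) ≤ 2 ^ p)
        linarith
      · rw [zero_mul]; positivity
    rw [← Finset.sum_mul] at h1
    have h2 := mul_le_mul_of_nonneg_right hO2 (by positivity : 0 ≤ (1 + ρ) ^ p)
    have h3 := mul_le_mul_of_nonneg_left h1 (by positivity : (0 : ℝ) ≤ 4 * r)
    linarith
  -- The weight is at least `1` where `O'` may fail to commute, and it equals `exp(-aρ/4)` at `y`.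
  set wt : Site d → ℝ := fun z => Real.exp (a / 2 * (ρ / 2 - δ x z)) with hwt
  have hk : ∀ y ∈ Λ, ∑ z ∈ Λ, pairSum Λ h y z * wt z ≤ K * M * ν * wt y := by
    intro y hy
    have : ∑ z ∈ Λ, pairSum Λ h y z * wt z ≤ (K * M * wt y) * ν := by
      refine hm.sum_le_of_le hy (mul_nonneg (by positivity) (Real.exp_pos _).le) fun z hz => ?_
      have hyz := hm.nonneg hy hz
      have h1 := hpair y hy z hz
      have h2 : Real.exp (-(a * δ y z)) * wt z ≤ Real.exp (-(a / 2 * δ y z)) * wt y := by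
        rw [hwt]
        simp only
        rw [← Real.exp_add, ← Real.exp_add, Real.exp_le_exp]
        have := hm.triangle x hx z hz y hy
        rw [hm.symm z hz y hy] at this
        nlinarith
      have h3 := hM (δ y z) hyz
      have hw : 0 < wt z := Real.exp_pos _
      have hw' : 0 < wt y := Real.exp_pos _
      have hp : 0 ≤ (1 + δ y z) ^ s := pow_nonneg (by linarith) s
      calc pairSum Λ h y z * wt z * (1 + δ y z) ^ s
          ≤ K * Real.exp (-(a * δ y z)) * wt z * (1 + δ y z) ^ s := by gcongr
        _ = K * (Real.exp (-(a * δ y z)) * wt z) * (1 + δ y z) ^ s := by ring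
        _ ≤ K * (Real.exp (-(a / 2 * δ y z)) * wt y) * (1 + δ y z) ^ s := by gcongr
        _ = K * ((1 + δ y z) ^ s * Real.exp (-(a / 2 * δ y z))) * wt y := by ring
        _ ≤ K * M * wt y := by gcongr
    linarith
  have hO' : ∀ z ∈ Λ, siteComm z O' ≤ 2 * B * wt z := by
    intro z hz
    have hw : 0 < wt z := Real.exp_pos _
    by_cases hlt : ρ / 2 < δ x z
    · rw [siteComm_eq_zero (hO3 z (Finset.mem_filter.2 ⟨hz, hlt⟩))]
      positivity
    · have h1 : 1 ≤ wt z := Real.one_le_exp (by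
        have : 0 ≤ ρ / 2 - δ x z := by linarith
        positivity)
      have h2 := siteComm_le z O'
      have h3 : 2 * ‖O'‖ ≤ 2 * B := by linarith [hO1.trans hO.1]
      nlinarith
  have hlr := siteComm_heisenberg_le hh (fun z => Real.exp_pos _) (by positivity) hk hO' v hy
  -- The trivial bound is kept along with the Lieb-Robinson bound; only the minimum of both grows
  -- polynomially in time after multiplication with the weight.
  have hlr2 : siteComm y (heisenberg (totalOp Λ h) v O') ≤ 2 * B := by
    refine (siteComm_le y _).trans ?_
    rw [norm_heisenberg hsa]
    linarith [hO1.trans hO.1]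
  have hmin : siteComm y (heisenberg (totalOp Λ h) v O') ≤
      2 * B * min 1 (Real.exp (16 * r * (K * M * ν) * |v| - a / 4 * ρ)) := by
    rcases min_cases (1 : ℝ) (Real.exp (16 * r * (K * M * ν) * |v| - a / 4 * ρ)) with h | h
    · rw [h.1, mul_one]; exact hlr2
    · rw [h.1]
      refine hlr.trans (le_of_eq ?_)
      rw [mul_assoc, ← Real.exp_add]
      congr 2
      ring
  have hfin := hC1' |v| ρ (abs_nonneg v) hρ0
  have hsplit : siteComm y (heisenberg (totalOp Λ h) v O) ≤
      siteComm y (heisenberg (totalOp Λ h) v O') + 2 * ‖O - O'‖ := by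
    have e : heisenberg (totalOp Λ h) v O = heisenberg (totalOp Λ h) v O' +
        heisenberg (totalOp Λ h) v (O - O') := by rw [heisenberg_sub]; abel
    rw [e]
    refine (siteComm_add_le _ _ _).trans (add_le_add le_rfl ?_)
    refine (siteComm_le y _).trans ?_
    rw [norm_heisenberg hsa]
  have hp : 0 ≤ (1 + ρ) ^ p := by positivity
  have h1 := mul_le_mul_of_nonneg_right hsplit hp
  have h2 := mul_le_mul_of_nonneg_right hmin hp
  have h3 := mul_le_mul_of_nonneg_left hfin (by positivity : 0 ≤ 2 * B)
  have h4 : 8 * r * ν * 2 ^ p * B ≤ 8 * r * ν * 2 ^ p * B * (1 + |v|) ^ p :=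
    le_mul_of_one_le_right (by positivity) hv1
  have h5 : 0 ≤ (1 + |v|) ^ p * B := by positivity
  nlinarith

end

section

variable {d r : ℕ}

/-! ### Commutators with sums of local terms -/

theorem le_finDiam {δ : Site d → Site d → ℝ} {Y : Finset (Site d)} {y z : Site d} (hy : y ∈ Y)
    (hz : z ∈ Y) : δ y z ≤ finDiam δ Y := by
  have h : (δ y z).toNNReal ≤ finDiam δ Y :=
    Finset.le_sup (f := fun p : Site d × Site d => (δ p.1 p.2).toNNReal)
      (Finset.mem_product.2 ⟨hy, hz⟩ : (y, z) ∈ Y ×ˢ Y)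
  exact (Real.le_coe_toNNReal _).trans (NNReal.coe_le_coe.2 h)

/-- `∑ (1 + diam Y)^n ‖h Y‖` over the sets `Y ⊆ Λ` containing `z`. -/
def diamSum (Λ : Finset (Site d)) (δ : Site d → Site d → ℝ) (n : ℕ)
    (h : Finset (Site d) → Obs d r) (z : Site d) : ℝ :=
  ∑ Y ∈ Λ.powerset with z ∈ Y, (1 + (finDiam δ Y : ℝ)) ^ n * ‖h Y‖

theorem siteSum_le_diamSum (Λ : Finset (Site d)) (δ : Site d → Site d → ℝ) (n : ℕ)
    (h : Finset (Site d) → Obs d r) (z : Site d) :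
    ∑ Y ∈ Λ.powerset with z ∈ Y, ‖h Y‖ ≤ diamSum Λ δ n h z := by
  refine Finset.sum_le_sum fun Y _ => le_mul_of_one_le_left (norm_nonneg _) (one_le_pow₀ ?_)
  have := (finDiam δ Y).coe_nonneg
  linarith

theorem diamSum_nonneg (Λ : Finset (Site d)) (δ : Site d → Site d → ℝ) (n : ℕ)
    (h : Finset (Site d) → Obs d r) (z : Site d) : 0 ≤ diamSum Λ δ n h z :=
  Finset.sum_nonneg fun Y _ => by positivity

theorem pairSum_mul_le {Λ : Finset (Site d)} {δ : Site d → Site d → ℝ} (n : ℕ)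
    (h : Finset (Site d) → Obs d r) {y z : Site d} (hδ : 0 ≤ δ y z) :
    pairSum Λ h y z * (1 + δ y z) ^ n ≤ diamSum Λ δ n h y := by
  unfold pairSum diamSum
  rw [Finset.sum_mul]
  refine (Finset.sum_le_sum fun Y hY => ?_).trans
    (Finset.sum_le_sum_of_subset_of_nonneg (s := Λ.powerset.filter fun Y => y ∈ Y ∧ z ∈ Y) ?_
      fun Y _ _ => by positivity)
  · rw [mul_comm]
    have h1 := (Finset.mem_filter.1 hY).2
    have := le_finDiam (δ := δ) h1.1 h1.2
    exact mul_le_mul_of_nonneg_right (pow_le_pow_left₀ (by linarith) (by linarith) n)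
      (norm_nonneg _)
  · intro Y hY
    rw [Finset.mem_filter] at hY ⊢
    exact ⟨hY.1, hY.2.1⟩

theorem sum_powerset_swap (Λ : Finset (Site d)) (P : Finset (Site d) → Prop) [DecidablePred P]
    (w : Finset (Site d) → ℝ) (g : Site d → ℝ) :
    ∑ Y ∈ Λ.powerset with P Y, w Y * ∑ z ∈ Y, g z =
      ∑ z ∈ Λ, (∑ Y ∈ Λ.powerset with P Y ∧ z ∈ Y, w Y) * g z := by
  have h1 : ∀ Y ∈ Λ.powerset.filter P, w Y * ∑ z ∈ Y, g z =
      ∑ z ∈ Λ, if z ∈ Y then w Y * g z else 0 := by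
    intro Y hY
    have hY' := Finset.mem_powerset.1 (Finset.mem_filter.1 hY).1
    rw [← Finset.sum_filter, Finset.filter_mem_eq_inter, Finset.inter_eq_right.2 hY',
      Finset.mul_sum]
  rw [Finset.sum_congr rfl h1, Finset.sum_comm]
  refine Finset.sum_congr rfl fun z _ => ?_
  rw [← Finset.sum_filter, Finset.filter_filter, Finset.sum_mul]

theorem norm_comm_totalOp_le {Λ : Finset (Site d)} {h : Finset (Site d) → Obs d r}
    (hh : ∀ Y ⊆ Λ, IsLocalTerm Y (h Y)) (G : Obs d r) :
    ‖totalOp Λ h * G - G * totalOp Λ h‖ ≤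
      8 * r * ∑ z ∈ Λ, (∑ Y ∈ Λ.powerset with z ∈ Y, ‖h Y‖) * siteComm z G := by
  have h0 := sum_powerset_swap Λ (fun _ => True) (fun Y => ‖h Y‖) (fun z => siteComm z G)
  simp only [true_and, Finset.filter_true] at h0
  rw [← h0, totalOp, Finset.sum_mul, Finset.mul_sum, ← Finset.sum_sub_distrib, Finset.mul_sum]
  refine (norm_sum_le _ _).trans (Finset.sum_le_sum fun Y hY => ?_)
  have := (hh Y (Finset.mem_powerset.1 hY)).norm_comm_le G
  linarith

theorem norm_double_comm_le (A b : Obs d r) {j : Mode d r} (hb : b = annih j ∨ b = star (annih j)) :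
    ‖A * b - b * A‖ ≤ 2 * ‖A‖ := by
  refine (norm_comm_le A b).trans ?_
  have := norm_annih_or_star_le hb
  nlinarith [norm_nonneg A]

/-- The commutator with a sum of local terms preserves polynomial locality. -/
theorem LocBd.comm {Λ : Finset (Site d)} {δ : Site d → Site d → ℝ} {s : ℕ} {ν : ℝ}
    (hm : IsRegularMetric Λ δ s ν) {x : Site d} (hx : x ∈ Λ) {h : Finset (Site d) → Obs d r}
    (hh : ∀ Y ⊆ Λ, IsLocalTerm Y (h Y)) {p : ℕ} {D : ℝ}
    (hD : ∀ z ∈ Λ, diamSum Λ δ p h z ≤ D) {G : Obs d r} {B : ℝ}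
    (hG : LocBd Λ δ x (p + s) G B) :
    LocBd Λ δ x p (totalOp Λ h * G - G * totalOp Λ h)
      (ν * (2 + 16 * r * 2 ^ p + 24 * r) * D * B) := by
  have hB := hG.nonneg
  have hν := hm.sum_nonneg hx
  have hD0 : 0 ≤ D := (diamSum_nonneg _ _ _ _ _).trans (hD x hx)
  have hsite : ∀ z ∈ Λ, ∑ Y ∈ Λ.powerset with z ∈ Y, ‖h Y‖ ≤ D := fun z hz =>
    (siteSum_le_diamSum Λ δ p h z).trans (hD z hz)
  have hc0 : ∀ z, 0 ≤ siteComm z G := fun z => siteComm_nonneg z G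
  have hcs : ∀ z ∈ Λ, siteComm z G * (1 + δ x z) ^ s ≤ B := fun z hz => by
    have hz0 := hm.nonneg hx hz
    refine le_trans (mul_le_mul_of_nonneg_left ?_ (hc0 z)) (hG.2 z hz)
    exact pow_le_pow_right₀ (by linarith) (by omega)
  constructor
  · refine (norm_comm_totalOp_le hh G).trans ?_
    have h1 : ∑ z ∈ Λ, (∑ Y ∈ Λ.powerset with z ∈ Y, ‖h Y‖) * siteComm z G ≤ D * B * ν := by
      refine hm.sum_le_of_le hx (by positivity) fun z hz => ?_
      rw [mul_assoc]
      have hz0 := hm.nonneg hx hz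
      exact mul_le_mul (hsite z hz) (hcs z hz)
        (mul_nonneg (hc0 z) (pow_nonneg (by linarith) s)) hD0
    have h2 := mul_le_mul_of_nonneg_left h1 (by positivity : (0 : ℝ) ≤ 8 * r)
    have h3 : 0 ≤ ν * (2 + 16 * r * 2 ^ p + 16 * r) * D * B := by positivity
    linarith
  · intro y hy
    set ρ := δ x y with hρ
    have hρ0 : 0 ≤ ρ := hm.nonneg hx hy
    have hp0 : 0 < (1 + ρ) ^ p := by positivity
    rw [← le_div_iff₀ hp0, siteComm_le_iff (by positivity)]
    intro i b hb
    rw [le_div_iff₀ hp0]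
    set X : Finset (Site d) → ℝ := fun Y =>
      ‖(h Y * G - G * h Y) * b - b * (h Y * G - G * h Y)‖ with hX
    have htri : ‖(totalOp Λ h * G - G * totalOp Λ h) * b - b * (totalOp Λ h * G - G * totalOp Λ h)‖
        ≤ ∑ Y ∈ Λ.powerset with y ∈ Y, X Y + ∑ Y ∈ Λ.powerset with ¬ y ∈ Y, X Y := by
      rw [Finset.sum_filter_add_sum_filter_not]
      have e : (totalOp Λ h * G - G * totalOp Λ h) * b - b * (totalOp Λ h * G - G * totalOp Λ h) =
          ∑ Y ∈ Λ.powerset, ((h Y * G - G * h Y) * b - b * (h Y * G - G * h Y)) := by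
        rw [totalOp, Finset.sum_mul, Finset.mul_sum, ← Finset.sum_sub_distrib, Finset.sum_mul,
          Finset.mul_sum, ← Finset.sum_sub_distrib]
      rw [e]
      exact norm_sum_le _ _
    have hX1 : ∀ Y ⊆ Λ, X Y ≤ 16 * r * (‖h Y‖ * ∑ z ∈ Y, siteComm z G) := by
      intro Y hY
      have h1 := norm_double_comm_le (h Y * G - G * h Y) b hb
      have h2 := (hh Y hY).norm_comm_le G
      simp only [hX]
      linarith
    -- For sets `Y` not containing `y` there are two cases. If all of `Y` is far from `x`, the
    -- commutators of `G` at its sites are small. If some point of `Y` is close to `x`, Jacobi's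
    -- identity and `[h Y, b] = 0` turn the double commutator into `[h Y, [G, b]]`, which is small
    -- because `y` is far from `x`. The function `g` records the bound relevant at each site.
    set g : Site d → ℝ := fun z =>
      if ρ / 2 ≤ δ x z then 8 * r * siteComm z G else siteComm y G with hg
    have hg0 : ∀ z, 0 ≤ g z := fun z => by
      simp only [hg]
      split_ifs
      · exact mul_nonneg (by positivity) (hc0 z)
      · exact hc0 y
    have hX2 : ∀ Y ⊆ Λ, y ∉ Y → X Y ≤ 2 * (‖h Y‖ * ∑ z ∈ Y, g z) := by
      intro Y hY hyY
      by_cases hfar : ∀ z ∈ Y, ρ / 2 ≤ δ x z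
      · have e : ∑ z ∈ Y, g z = 8 * r * ∑ z ∈ Y, siteComm z G := by
          rw [Finset.mul_sum]
          exact Finset.sum_congr rfl fun z hz => if_pos (hfar z hz)
        rw [e]
        have := hX1 Y hY
        linarith
      · push Not at hfar
        obtain ⟨z, hz, hlt⟩ := hfar
        have h1 : siteComm y G ≤ ∑ z ∈ Y, g z := by
          have : g z = siteComm y G := if_neg (not_le.2 hlt)
          rw [← this]
          exact Finset.single_le_sum (fun z _ => hg0 z) hz
        have hcomm := ((hh Y hY).commute_of_notMem hyY i hb).eq
        have e : (h Y * G - G * h Y) * b - b * (h Y * G - G * h Y) =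
            h Y * (G * b - b * G) - (G * b - b * G) * h Y := by
          have e1 : G * h Y * b = G * b * h Y := by rw [mul_assoc, hcomm, mul_assoc]
          have e2 : b * (h Y * G) = h Y * (b * G) := by rw [← mul_assoc, ← hcomm, mul_assoc]
          rw [sub_mul, mul_sub b, e1, e2]
          noncomm_ring
        have h2 : X Y ≤ 2 * ‖h Y‖ * siteComm y G := by
          simp only [hX]
          rw [e]
          refine (norm_comm_le _ _).trans ?_
          exact mul_le_mul_of_nonneg_left (norm_comm_le_siteComm y G i hb) (by positivity)
        have h3 := mul_le_mul_of_nonneg_left h1 (by positivity : 0 ≤ 2 * ‖h Y‖)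
        linarith
    -- For sets containing `y` the weight is split by the triangle inequality: the distance from `y`
    -- to `z` is paid by the diameter of the set, the distance from `x` to `z` by the decay of `G`.
    have hS1 : (∑ Y ∈ Λ.powerset with y ∈ Y, X Y) * (1 + ρ) ^ p ≤ 16 * r * (D * B * ν) := by
      have h1 : ∑ Y ∈ Λ.powerset with y ∈ Y, X Y ≤
          16 * r * ∑ z ∈ Λ, pairSum Λ h y z * siteComm z G := by
        have h0 := sum_powerset_swap Λ (fun Y => y ∈ Y) (fun Y => ‖h Y‖) (fun z => siteComm z G)
        unfold pairSum
        rw [← h0, Finset.mul_sum]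
        exact Finset.sum_le_sum fun Y hY =>
          hX1 Y (Finset.mem_powerset.1 (Finset.mem_filter.1 hY).1)
      have h2 : ∑ z ∈ Λ, pairSum Λ h y z * siteComm z G * (1 + ρ) ^ p ≤ D * B * ν := by
        refine hm.sum_le_of_le hx (by positivity) fun z hz => ?_
        have hz0 := hm.nonneg hx hz
        have hyz := hm.nonneg hy hz
        have h3 : 1 + ρ ≤ (1 + δ y z) * (1 + δ x z) := by
          have := hm.triangle x hx z hz y hy
          rw [hm.symm z hz y hy] at this
          nlinarith
        have h4 : (1 + ρ) ^ p ≤ (1 + δ y z) ^ p * (1 + δ x z) ^ p := by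
          rw [← mul_pow]
          exact pow_le_pow_left₀ (by linarith) h3 p
        have h5 := (pairSum_mul_le (Λ := Λ) p h hyz).trans (hD y hy)
        have h6 := hG.2 z hz
        have hps := pairSum_nonneg Λ h y z
        calc pairSum Λ h y z * siteComm z G * (1 + ρ) ^ p * (1 + δ x z) ^ s
            ≤ pairSum Λ h y z * siteComm z G * ((1 + δ y z) ^ p * (1 + δ x z) ^ p) *
              (1 + δ x z) ^ s := by
                have := mul_nonneg hps (hc0 z)
                gcongr
          _ = (pairSum Λ h y z * (1 + δ y z) ^ p) * (siteComm z G * (1 + δ x z) ^ (p + s)) := by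
                ring
          _ ≤ D * B := mul_le_mul h5 h6
                (mul_nonneg (hc0 z) (pow_nonneg (by linarith) _)) hD0
      rw [← Finset.sum_mul] at h2
      have h3 := mul_le_mul_of_nonneg_right h1 hp0.le
      have h4 := mul_le_mul_of_nonneg_left h2 (by positivity : (0 : ℝ) ≤ 16 * r)
      linarith
    have hS2 : (∑ Y ∈ Λ.powerset with ¬ y ∈ Y, X Y) * (1 + ρ) ^ p ≤
        2 * (D * ((1 + 8 * r * 2 ^ p) * B) * ν) := by
      have h1 : ∑ Y ∈ Λ.powerset with ¬ y ∈ Y, X Y ≤ 2 * ∑ z ∈ Λ, D * g z := by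
        have h0 := sum_powerset_swap Λ (fun Y => ¬ y ∈ Y) (fun Y => ‖h Y‖) g
        have h2 : ∑ Y ∈ Λ.powerset with ¬ y ∈ Y, X Y ≤
            2 * ∑ Y ∈ Λ.powerset with ¬ y ∈ Y, ‖h Y‖ * ∑ z ∈ Y, g z := by
          rw [Finset.mul_sum]
          refine Finset.sum_le_sum fun Y hY => ?_
          rw [Finset.mem_filter, Finset.mem_powerset] at hY
          exact hX2 Y hY.1 hY.2
        refine h2.trans (mul_le_mul_of_nonneg_left ?_ (by norm_num))
        rw [h0]
        refine Finset.sum_le_sum fun z hz => mul_le_mul_of_nonneg_right ?_ (hg0 z)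
        refine le_trans ?_ (hsite z hz)
        refine Finset.sum_le_sum_of_subset_of_nonneg ?_ fun Y _ _ => norm_nonneg _
        intro Y hY
        rw [Finset.mem_filter] at hY ⊢
        exact ⟨hY.1, hY.2.2⟩
      have h2 : ∑ z ∈ Λ, D * g z * (1 + ρ) ^ p ≤ D * ((1 + 8 * r * 2 ^ p) * B) * ν := by
        refine hm.sum_le_of_le hx (by positivity) fun z hz => ?_
        have hz0 := hm.nonneg hx hz
        rw [mul_assoc, mul_assoc]
        refine mul_le_mul_of_nonneg_left ?_ hD0
        simp only [hg]
        split_ifs with hfar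
        · have h3 : (1 + ρ) ^ p ≤ 2 ^ p * (1 + δ x z) ^ p := by
            rw [← mul_pow]
            exact pow_le_pow_left₀ (by linarith) (by linarith) p
          have h6 := hG.2 z hz
          have h7 := hc0 z
          calc 8 * r * siteComm z G * ((1 + ρ) ^ p * (1 + δ x z) ^ s)
              ≤ 8 * r * siteComm z G * ((2 ^ p * (1 + δ x z) ^ p) * (1 + δ x z) ^ s) := by gcongr
            _ = 8 * r * 2 ^ p * (siteComm z G * (1 + δ x z) ^ (p + s)) := by ring
            _ ≤ 8 * r * 2 ^ p * B := by gcongr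
            _ ≤ (1 + 8 * r * 2 ^ p) * B := by nlinarith
        · have h3 : (1 + δ x z) ^ s ≤ (1 + ρ) ^ s :=
            pow_le_pow_left₀ (by linarith) (by linarith) s
          have h6 := hG.2 y hy
          have h7 := hc0 y
          calc siteComm y G * ((1 + ρ) ^ p * (1 + δ x z) ^ s)
              ≤ siteComm y G * ((1 + ρ) ^ p * (1 + ρ) ^ s) := by gcongr
            _ = siteComm y G * (1 + ρ) ^ (p + s) := by ring
            _ ≤ B := h6
            _ ≤ (1 + 8 * r * 2 ^ p) * B := by
                have : 0 ≤ 8 * (r : ℝ) * 2 ^ p * B := by positivity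
                linarith
      rw [← Finset.sum_mul] at h2
      have h3 := mul_le_mul_of_nonneg_right h1 hp0.le
      linarith
    have h1 := mul_le_mul_of_nonneg_right htri hp0.le
    have h3 : 0 ≤ r * (D * B * ν) := by positivity
    nlinarith

theorem totalOp_sub (Λ : Finset (Site d)) (h h' : Finset (Site d) → Obs d r) :
    totalOp Λ (fun Y => h Y - h' Y) = totalOp Λ h - totalOp Λ h' := by
  unfold totalOp
  rw [Finset.sum_sub_distrib]

/-- Commutator of a local operator with an interaction that is small near `x`. -/
theorem norm_comm_le_of_far {Λ : Finset (Site d)} {δ : Site d → Site d → ℝ} {s : ℕ} {ν : ℝ}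
    (hm : IsRegularMetric Λ δ s ν) {x : Site d} (hx : x ∈ Λ) {h : Finset (Site d) → Obs d r}
    (hh : ∀ Y ⊆ Λ, IsLocalTerm Y (h Y)) {p : ℕ} {D L : ℝ} (hD0 : 0 ≤ D) (hL : 0 ≤ L)
    (hD : ∀ z ∈ Λ, (∑ Y ∈ Λ.powerset with z ∈ Y, ‖h Y‖) * (1 + L) ^ p ≤ D * (1 + δ x z) ^ p)
    {G : Obs d r} {B : ℝ} (hG : LocBd Λ δ x (p + s) G B) :
    ‖totalOp Λ h * G - G * totalOp Λ h‖ * (1 + L) ^ p ≤ 8 * r * ν * D * B := by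
  have hB := hG.nonneg
  have hp0 : 0 ≤ (1 + L) ^ p := by positivity
  have h1 : ∑ z ∈ Λ, (∑ Y ∈ Λ.powerset with z ∈ Y, ‖h Y‖) * siteComm z G * (1 + L) ^ p
      ≤ D * B * ν := by
    refine hm.sum_le_of_le hx (by positivity) fun z hz => ?_
    have hz0 := hm.nonneg hx hz
    have h2 := hD z hz
    have h3 := hG.2 z hz
    have h4 := siteComm_nonneg z G
    calc (∑ Y ∈ Λ.powerset with z ∈ Y, ‖h Y‖) * siteComm z G * (1 + L) ^ p * (1 + δ x z) ^ s
        = ((∑ Y ∈ Λ.powerset with z ∈ Y, ‖h Y‖) * (1 + L) ^ p) * siteComm z G *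
            (1 + δ x z) ^ s := by ring
      _ ≤ (D * (1 + δ x z) ^ p) * siteComm z G * (1 + δ x z) ^ s := by gcongr
      _ = D * (siteComm z G * (1 + δ x z) ^ (p + s)) := by ring
      _ ≤ D * B := by gcongr
  rw [← Finset.sum_mul] at h1
  have h2 := mul_le_mul_of_nonneg_right (norm_comm_totalOp_le hh G) hp0
  have h3 := mul_le_mul_of_nonneg_left h1 (by positivity : (0 : ℝ) ≤ 8 * r)
  linarith

/-- Commutator of an interaction with a local operator of small norm. -/
theorem norm_comm_le_of_small {Λ : Finset (Site d)} {δ : Site d → Site d → ℝ} {s : ℕ} {ν : ℝ}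
    (hm : IsRegularMetric Λ δ s ν) {x : Site d} (hx : x ∈ Λ) {h : Finset (Site d) → Obs d r}
    (hh : ∀ Y ⊆ Λ, IsLocalTerm Y (h Y)) {p : ℕ} {D L : ℝ} (hL : 0 ≤ L)
    (hD : ∀ z ∈ Λ, ∑ Y ∈ Λ.powerset with z ∈ Y, ‖h Y‖ ≤ D)
    {G : Obs d r} {B : ℝ} (hG : LocBd Λ δ x (p + s) G B) (hGL : ‖G‖ * (1 + L) ^ (p + s) ≤ B) :
    ‖totalOp Λ h * G - G * totalOp Λ h‖ * (1 + L) ^ p ≤ 16 * r * ν * D * B := by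
  have hB := hG.nonneg
  have hD0 : 0 ≤ D := (Finset.sum_nonneg fun _ _ => norm_nonneg _).trans (hD x hx)
  have hp0 : 0 ≤ (1 + L) ^ p := by positivity
  have h1 : ∑ z ∈ Λ, (∑ Y ∈ Λ.powerset with z ∈ Y, ‖h Y‖) * siteComm z G * (1 + L) ^ p
      ≤ D * (2 * B) * ν := by
    refine hm.sum_le_of_le hx (by positivity) fun z hz => ?_
    have hz0 := hm.nonneg hx hz
    have h3 := hG.2 z hz
    have h4 := siteComm_nonneg z G
    -- Up to distance `L` from `x` the small norm of `G` provides the powers of `1 + L`, beyond that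
    -- distance the decay of its commutators does.
    have h5 : siteComm z G * ((1 + L) ^ p * (1 + δ x z) ^ s) ≤ 2 * B := by
      rcases le_total (δ x z) L with hle | hle
      · calc siteComm z G * ((1 + L) ^ p * (1 + δ x z) ^ s)
            ≤ (2 * ‖G‖) * ((1 + L) ^ p * (1 + L) ^ s) := by
              gcongr
              exact siteComm_le z G
          _ = 2 * (‖G‖ * (1 + L) ^ (p + s)) := by ring
          _ ≤ 2 * B := by linarith
      · calc siteComm z G * ((1 + L) ^ p * (1 + δ x z) ^ s)
            ≤ siteComm z G * ((1 + δ x z) ^ p * (1 + δ x z) ^ s) := by gcongr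
          _ = siteComm z G * (1 + δ x z) ^ (p + s) := by ring
          _ ≤ 2 * B := by linarith
    calc (∑ Y ∈ Λ.powerset with z ∈ Y, ‖h Y‖) * siteComm z G * (1 + L) ^ p * (1 + δ x z) ^ s
        = (∑ Y ∈ Λ.powerset with z ∈ Y, ‖h Y‖) *
            (siteComm z G * ((1 + L) ^ p * (1 + δ x z) ^ s)) := by ring
      _ ≤ D * (2 * B) := mul_le_mul (hD z hz) h5 (by positivity) hD0
  rw [← Finset.sum_mul] at h1
  have h2 := mul_le_mul_of_nonneg_right (norm_comm_totalOp_le hh G) hp0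
  have h3 := mul_le_mul_of_nonneg_left h1 (by positivity : (0 : ℝ) ≤ 8 * r)
  linarith

end

section

variable {d r : ℕ} {β : Type*}

/-! ### Families of evolved operators and their time derivatives -/

/-- Finite regions with uniformly regular metrics and a marked site. -/
structure IsRegularFamily (Λ : β → Finset (Site d)) (δ : β → Site d → Site d → ℝ)
    (x : β → Site d) (s : ℕ) (ν : ℝ) : Prop where
  regular : ∀ b, IsRegularMetric (Λ b) (δ b) s ν
  mem : ∀ b, x b ∈ Λ b

/-- Polynomial locality with polynomially growing constants, uniformly in the family. -/
def PolyLoc (Λ : β → Finset (Site d)) (δ : β → Site d → Site d → ℝ) (x : β → Site d)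
    (G : β → ℝ → Obs d r) : Prop :=
  ∀ p : ℕ, ∃ (C : ℝ) (q : ℕ), 0 ≤ C ∧
    ∀ b v, LocBd (Λ b) (δ b) (x b) p (G b v) (C * (1 + |v|) ^ q)

/-- A sequence of interactions (thought of as the time derivatives of one interaction), each
bounded with arbitrary powers of the diameter, the first one decaying exponentially. -/
structure IsInteractionJet (Λ : β → Finset (Site d)) (δ : β → Site d → Site d → ℝ)
    (h : ℕ → β → Finset (Site d) → Obs d r) : Prop where
  isLocal : ∀ i b, ∀ Y ⊆ Λ b, IsLocalTerm Y (h i b Y)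
  bdd : ∀ i n : ℕ, ∃ C : ℝ, 0 ≤ C ∧ ∀ b, ∀ z ∈ Λ b, diamSum (Λ b) (δ b) n (h i b) z ≤ C
  exp_decay : ∃ a > (0 : ℝ), ∃ K : ℝ, 0 ≤ K ∧ ∀ b, ∀ y ∈ Λ b, ∀ z ∈ Λ b,
    pairSum (Λ b) (h 0 b) y z ≤ K * Real.exp (-(a * δ b y z))

/-- The inhomogeneity in the evolution equation of the `i`-th derivative. -/
def flowSource (Λ : β → Finset (Site d)) (h : ℕ → β → Finset (Site d) → Obs d r)
    (F : ℕ → β → ℝ → Obs d r) (i : ℕ) (b : β) (v : ℝ) : Obs d r :=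
  ∑ j ∈ Finset.range i, (i.choose j : ℝ) • (Complex.I •
    (totalOp (Λ b) (h (i - j) b) * F j b v - F j b v * totalOp (Λ b) (h (i - j) b)))

/-- The evolution equations of the time derivatives of an evolved operator. -/
def IsFlow (Λ : β → Finset (Site d)) (h : ℕ → β → Finset (Site d) → Obs d r)
    (F : ℕ → β → ℝ → Obs d r) : Prop :=
  ∀ i b v, HasDerivAt (F i b)
    (Complex.I • (totalOp (Λ b) (h 0 b) * F i b v - F i b v * totalOp (Λ b) (h 0 b)) +
      flowSource Λ h F i b v) v

theorem one_le_one_add_abs_pow (v : ℝ) (q : ℕ) : 1 ≤ (1 + |v|) ^ q :=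
  one_le_pow₀ (by linarith [abs_nonneg v])

theorem mul_one_add_abs_pow_mono {C C' : ℝ} {q q' : ℕ} (hC : 0 ≤ C) (hCC : C ≤ C') (hq : q ≤ q')
    {u v : ℝ} (huv : |u| ≤ |v|) : C * (1 + |u|) ^ q ≤ C' * (1 + |v|) ^ q' := by
  refine mul_le_mul hCC ?_ (by positivity) (hC.trans hCC)
  calc (1 + |u|) ^ q ≤ (1 + |v|) ^ q := pow_le_pow_left₀ (by positivity) (by linarith) q
    _ ≤ (1 + |v|) ^ q' := pow_le_pow_right₀ (by linarith [abs_nonneg v]) hq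

theorem IsFlow.continuous {Λ : β → Finset (Site d)} {h : ℕ → β → Finset (Site d) → Obs d r}
    {F : ℕ → β → ℝ → Obs d r} (hF : IsFlow Λ h F) (i : ℕ) (b : β) : Continuous (F i b) :=
  continuous_iff_continuousAt.2 fun v => (hF i b v).continuousAt

theorem IsFlow.continuous_source {Λ : β → Finset (Site d)}
    {h : ℕ → β → Finset (Site d) → Obs d r} {F : ℕ → β → ℝ → Obs d r} (hF : IsFlow Λ h F)
    (i : ℕ) (b : β) : Continuous (flowSource Λ h F i b) := by
  unfold flowSource
  refine continuous_finsetSum _ fun j _ => ?_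
  have := hF.continuous j b
  fun_prop

section

variable {Λ : β → Finset (Site d)} {δ : β → Site d → Site d → ℝ} {x : β → Site d} {s : ℕ} {ν : ℝ}

theorem PolyLoc.sum {ι : Type*} (hS : IsRegularFamily Λ δ x s ν) (t : Finset ι)
    {G : ι → β → ℝ → Obs d r} (hG : ∀ i ∈ t, PolyLoc Λ δ x (G i)) :
    PolyLoc Λ δ x (fun b v => ∑ i ∈ t, G i b v) := by
  classical
  intro p
  induction t using Finset.induction_on with
  | empty =>
    refine ⟨0, 0, le_rfl, fun b v => ?_⟩
    simp only [Finset.sum_empty]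
    exact LocBd.zero (by simp)
  | insert i t hi ih =>
    obtain ⟨C1, q1, hC1, h1⟩ := hG i (Finset.mem_insert_self i t) p
    obtain ⟨C2, q2, hC2, h2⟩ := ih fun j hj => hG j (Finset.mem_insert_of_mem hj)
    refine ⟨C1 + C2, q1 + q2, by positivity, fun b v => ?_⟩
    simp only [Finset.sum_insert hi]
    refine ((h1 b v).add (h2 b v) fun z hz => (hS.regular b).nonneg (hS.mem b) hz).mono ?_
    rw [add_mul]
    exact add_le_add (mul_one_add_abs_pow_mono hC1 le_rfl (by omega) le_rfl)
      (mul_one_add_abs_pow_mono hC2 le_rfl (by omega) le_rfl)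

theorem PolyLoc.comm (hS : IsRegularFamily Λ δ x s ν) {h : ℕ → β → Finset (Site d) → Obs d r}
    (hh : IsInteractionJet Λ δ h) (i : ℕ) {G : β → ℝ → Obs d r} (hG : PolyLoc Λ δ x G) (c : ℝ) :
    PolyLoc Λ δ x (fun b v => c • (Complex.I •
      (totalOp (Λ b) (h i b) * G b v - G b v * totalOp (Λ b) (h i b)))) := by
  intro p
  obtain ⟨C, q, hC, hG⟩ := hG (p + s)
  obtain ⟨D, hD0, hD⟩ := hh.bdd i p
  -- For an empty family nothing is known about the sign of `ν`, hence the absolute value.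
  refine ⟨|c| * (|ν| * (2 + 16 * r * 2 ^ p + 24 * r) * D * C), q, by positivity, fun b v => ?_⟩
  have hx := hS.mem b
  have hm := hS.regular b
  have h1 := LocBd.comm hm hx (hh.isLocal i b) (hD b) (hG b v)
  have hν : |ν| = ν := abs_of_nonneg (hm.sum_nonneg hx)
  refine ((h1.I_smul fun z hz => hm.nonneg hx hz).smul c).mono (le_of_eq ?_)
  rw [hν]
  ring

theorem PolyLoc.source (hS : IsRegularFamily Λ δ x s ν) {h : ℕ → β → Finset (Site d) → Obs d r}
    (hh : IsInteractionJet Λ δ h) {F : ℕ → β → ℝ → Obs d r} {i : ℕ}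
    (hF : ∀ j < i, PolyLoc Λ δ x (F j)) : PolyLoc Λ δ x (flowSource Λ h F i) :=
  PolyLoc.sum hS _ fun j hj => PolyLoc.comm hS hh (i - j) (hF j (Finset.mem_range.1 hj)) _

/-- All time derivatives of an evolved local operator are local. -/
theorem IsFlow.polyLoc (hS : IsRegularFamily Λ δ x s ν) {h : ℕ → β → Finset (Site d) → Obs d r}
    (hh : IsInteractionJet Λ δ h) {F : ℕ → β → ℝ → Obs d r} (hF : IsFlow Λ h F)
    (hinit : ∀ i p : ℕ, ∃ C : ℝ, 0 ≤ C ∧ ∀ b, LocBd (Λ b) (δ b) (x b) p (F i b 0) C) (i : ℕ) :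
    PolyLoc Λ δ x (F i) := by
  -- The source of the `i`-th equation involves only lower derivatives. The commutator with an
  -- interaction and the Lieb-Robinson bound each cost `s` orders of decay, which is harmless since
  -- all orders are available.
  induction i using Nat.strong_induction_on with
  | _ i ih =>
    intro p
    obtain ⟨a, ha, K, hK, hpair⟩ := hh.exp_decay
    obtain ⟨C, hC, hLR⟩ := exists_locBd_heisenberg (d := d) r ha hK (abs_nonneg ν) s p
    obtain ⟨C0, hC0, hinit⟩ := hinit i (p + s)
    obtain ⟨C1, q1, hC1, hsrc⟩ := PolyLoc.source hS hh ih (p + s)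
    -- The powers of time come from the Lieb-Robinson bound (`p`), from the source (`q1`) and from
    -- the integration over time (`1`).
    refine ⟨C * C0 + C * 2 ^ p * C1, p + q1 + 1, by positivity, fun b v => ?_⟩
    have hx := hS.mem b
    have hm := hS.regular b
    have hm' : IsRegularMetric (Λ b) (δ b) s |ν| := by
      rw [abs_of_nonneg (hm.sum_nonneg hx)]; exact hm
    have hδ : ∀ z ∈ Λ b, 0 ≤ δ b (x b) z := fun z hz => hm.nonneg hx hz
    have hsc := hF.continuous_source i b
    rw [duhamel _ hsc (hF i b) v]
    have e1 := hLR (Λ b) (δ b) (h 0 b) (x b) (F i b 0) C0 v hm' (hh.isLocal 0 b) (hpair b) hx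
      (hinit b)
    have e2 : LocBd (Λ b) (δ b) (x b) p
        (∫ u in (0 : ℝ)..v, heisenberg (totalOp (Λ b) (h 0 b)) (v - u) (flowSource Λ h F i b u))
        (|v| * (C * 2 ^ p * C1 * (1 + |v|) ^ (p + q1))) := by
      refine LocBd.integral ?_ hδ fun u hu => ?_
      · simp only [heisenberg_eq]
        have := continuous_expI (totalOp (Λ b) (h 0 b))
        fun_prop
      · refine (hLR (Λ b) (δ b) (h 0 b) (x b) _ _ (v - u) hm' (hh.isLocal 0 b) (hpair b) hx
          (hsrc b u)).mono ?_
        have h1 : |v - u| ≤ 2 * |v| := (abs_sub v u).trans (by linarith)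
        have h2 : (1 + |v - u|) ^ p ≤ 2 ^ p * (1 + |v|) ^ p := by
          rw [← mul_pow]
          exact pow_le_pow_left₀ (by positivity) (by linarith [abs_nonneg v]) p
        have h3 : (1 + |u|) ^ q1 ≤ (1 + |v|) ^ q1 :=
          pow_le_pow_left₀ (by positivity) (by linarith) q1
        calc C * (1 + |v - u|) ^ p * (C1 * (1 + |u|) ^ q1)
            ≤ C * (2 ^ p * (1 + |v|) ^ p) * (C1 * (1 + |v|) ^ q1) := by gcongr
          _ = C * 2 ^ p * C1 * (1 + |v|) ^ (p + q1) := by ring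
    refine (e1.add e2 hδ).mono ?_
    rw [add_mul]
    refine add_le_add ?_ ?_
    · have := mul_one_add_abs_pow_mono (C := C * C0) (by positivity) le_rfl
        (by omega : p ≤ p + q1 + 1) (le_refl |v|)
      linarith
    · have h1 : |v| ≤ 1 + |v| := by linarith
      calc |v| * (C * 2 ^ p * C1 * (1 + |v|) ^ (p + q1))
          ≤ (1 + |v|) * (C * 2 ^ p * C1 * (1 + |v|) ^ (p + q1)) := by gcongr
        _ = C * 2 ^ p * C1 * (1 + |v|) ^ (p + q1 + 1) := by ring

/-! ### Comparison of two evolutions. -/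

/-- The interactions `h` and `h'` agree near the marked site, up to the distance `L`. -/
def CloseUpTo (Λ : β → Finset (Site d)) (δ : β → Site d → Site d → ℝ) (x : β → Site d)
    (L : β → ℝ) (h h' : ℕ → β → Finset (Site d) → Obs d r) : Prop :=
  ∀ i p : ℕ, ∃ C : ℝ, 0 ≤ C ∧ ∀ b, ∀ z ∈ Λ b,
    (∑ Y ∈ (Λ b).powerset with z ∈ Y, ‖h i b Y - h' i b Y‖) * (1 + L b) ^ p ≤
      C * (1 + δ b (x b) z) ^ p

/-- `‖G‖` is bounded by arbitrary powers of `1 / (1 + L)`, growing polynomially in time. -/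
def PolySmall (L : β → ℝ) (G : β → ℝ → Obs d r) : Prop :=
  ∀ p : ℕ, ∃ (C : ℝ) (q : ℕ), 0 ≤ C ∧ ∀ b v, ‖G b v‖ * (1 + L b) ^ p ≤ C * (1 + |v|) ^ q

theorem PolySmall.add {L : β → ℝ} (hL : ∀ b, 0 ≤ L b) {G G' : β → ℝ → Obs d r}
    (hG : PolySmall L G) (hG' : PolySmall L G') : PolySmall L (fun b v => G b v + G' b v) := by
  intro p
  obtain ⟨C1, q1, hC1, h1⟩ := hG p
  obtain ⟨C2, q2, hC2, h2⟩ := hG' p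
  refine ⟨C1 + C2, q1 + q2, by positivity, fun b v => ?_⟩
  have h0 : 0 ≤ (1 + L b) ^ p := pow_nonneg (by linarith [hL b]) p
  have h3 := mul_le_mul_of_nonneg_right (norm_add_le (G b v) (G' b v)) h0
  have h4 := mul_one_add_abs_pow_mono hC1 le_rfl (by omega : q1 ≤ q1 + q2) (le_refl |v|)
  have h5 := mul_one_add_abs_pow_mono hC2 le_rfl (by omega : q2 ≤ q1 + q2) (le_refl |v|)
  linarith [h1 b v, h2 b v]

theorem PolySmall.smul_I {L : β → ℝ} {G : β → ℝ → Obs d r} (hG : PolySmall L G) (c : ℝ) :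
    PolySmall L (fun b v => c • (Complex.I • G b v)) := by
  intro p
  obtain ⟨C, q, hC, h⟩ := hG p
  refine ⟨|c| * C, q, by positivity, fun b v => ?_⟩
  rw [norm_smul, norm_smul, Complex.norm_I, one_mul, Real.norm_eq_abs]
  have := mul_le_mul_of_nonneg_left (h b v) (abs_nonneg c)
  linarith

theorem PolySmall.sum {ι : Type*} {L : β → ℝ} (hL : ∀ b, 0 ≤ L b) (t : Finset ι)
    {G : ι → β → ℝ → Obs d r} (hG : ∀ i ∈ t, PolySmall L (G i)) :
    PolySmall L (fun b v => ∑ i ∈ t, G i b v) := by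
  classical
  induction t using Finset.induction_on with
  | empty => exact fun p => ⟨0, 0, le_rfl, fun b v => by simp⟩
  | insert i t hi ih =>
    simp only [Finset.sum_insert hi]
    exact (hG i (Finset.mem_insert_self i t)).add hL
      (ih fun j hj => hG j (Finset.mem_insert_of_mem hj))

/-- The bound on the difference of the interactions deteriorates with the distance from the marked
site; the decay of the commutators of `G` compensates for this. -/
theorem PolySmall.comm_far (hS : IsRegularFamily Λ δ x s ν) {L : β → ℝ} (hL : ∀ b, 0 ≤ L b)
    {h h' : ℕ → β → Finset (Site d) → Obs d r} (hh : IsInteractionJet Λ δ h)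
    (hh' : IsInteractionJet Λ δ h') (hclose : CloseUpTo Λ δ x L h h') (i : ℕ)
    {G : β → ℝ → Obs d r} (hG : PolyLoc Λ δ x G) :
    PolySmall L (fun b v => (totalOp (Λ b) (h i b) - totalOp (Λ b) (h' i b)) * G b v -
      G b v * (totalOp (Λ b) (h i b) - totalOp (Λ b) (h' i b))) := by
  intro p
  obtain ⟨C, q, hC, hG⟩ := hG (p + s)
  obtain ⟨D, hD0, hD⟩ := hclose i p
  refine ⟨8 * r * |ν| * D * C, q, by positivity, fun b v => ?_⟩
  have hx := hS.mem b
  have hm := hS.regular b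
  beta_reduce
  rw [← totalOp_sub, abs_of_nonneg (hm.sum_nonneg hx)]
  have := norm_comm_le_of_far hm hx (h := fun Y => h i b Y - h' i b Y)
    (fun Y hY => (localTerms r Y).sub_mem (hh.isLocal i b Y hY) (hh'.isLocal i b Y hY))
    hD0 (hL b) (hD b) (hG b v)
  linarith

theorem PolySmall.comm_small (hS : IsRegularFamily Λ δ x s ν) {L : β → ℝ} (hL : ∀ b, 0 ≤ L b)
    {h : ℕ → β → Finset (Site d) → Obs d r} (hh : IsInteractionJet Λ δ h) (i : ℕ)
    {G : β → ℝ → Obs d r} (hG : PolyLoc Λ δ x G) (hsmall : PolySmall L G) :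
    PolySmall L (fun b v => totalOp (Λ b) (h i b) * G b v - G b v * totalOp (Λ b) (h i b)) := by
  intro p
  obtain ⟨C, q, hC, hG⟩ := hG (p + s)
  obtain ⟨C', q', hC', hsmall⟩ := hsmall (p + s)
  obtain ⟨D, hD0, hD⟩ := hh.bdd i 0
  refine ⟨16 * r * |ν| * D * (C + C'), q + q', by positivity, fun b v => ?_⟩
  have hx := hS.mem b
  have hm := hS.regular b
  rw [abs_of_nonneg (hm.sum_nonneg hx)]
  have h4 := mul_one_add_abs_pow_mono hC (by linarith : C ≤ C + C')
    (by omega : q ≤ q + q') (le_refl |v|)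
  have h5 := mul_one_add_abs_pow_mono hC' (by linarith : C' ≤ C + C')
    (by omega : q' ≤ q + q') (le_refl |v|)
  have := norm_comm_le_of_small hm hx (hh.isLocal i b) (hL b)
    (fun z hz => (siteSum_le_diamSum _ (δ b) 0 _ z).trans (hD b z hz)) ((hG b v).mono h4)
    ((hsmall b v).trans h5)
  linarith

theorem PolyLoc.sub (hS : IsRegularFamily Λ δ x s ν) {G G' : β → ℝ → Obs d r}
    (hG : PolyLoc Λ δ x G) (hG' : PolyLoc Λ δ x G') :
    PolyLoc Λ δ x (fun b v => G b v - G' b v) := by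
  intro p
  obtain ⟨C1, q1, hC1, h1⟩ := hG p
  obtain ⟨C2, q2, hC2, h2⟩ := hG' p
  refine ⟨C1 + C2, q1 + q2, by positivity, fun b v => ?_⟩
  refine ((h1 b v).sub (h2 b v) fun z hz => (hS.regular b).nonneg (hS.mem b) hz).mono ?_
  rw [add_mul]
  exact add_le_add (mul_one_add_abs_pow_mono hC1 le_rfl (by omega) le_rfl)
    (mul_one_add_abs_pow_mono hC2 le_rfl (by omega) le_rfl)

/-- Two evolutions with interactions that agree near the marked site are close. -/
theorem IsFlow.polySmall_sub (hS : IsRegularFamily Λ δ x s ν) {L : β → ℝ} (hL : ∀ b, 0 ≤ L b)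
    {h h' : ℕ → β → Finset (Site d) → Obs d r} (hh : IsInteractionJet Λ δ h)
    (hh' : IsInteractionJet Λ δ h') (hclose : CloseUpTo Λ δ x L h h')
    {F F' : ℕ → β → ℝ → Obs d r} (hF : IsFlow Λ h F) (hF' : IsFlow Λ h' F')
    (hinit : ∀ i p : ℕ, ∃ C : ℝ, 0 ≤ C ∧ ∀ b, LocBd (Λ b) (δ b) (x b) p (F i b 0) C)
    (hinit' : ∀ i p : ℕ, ∃ C : ℝ, 0 ≤ C ∧ ∀ b, LocBd (Λ b) (δ b) (x b) p (F' i b 0) C)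
    (hdiff : ∀ i p : ℕ, ∃ C : ℝ, 0 ≤ C ∧ ∀ b, ‖F i b 0 - F' i b 0‖ * (1 + L b) ^ p ≤ C)
    (i : ℕ) : PolySmall L (fun b v => F i b v - F' i b v) := by
  have hloc := hF.polyLoc hS hh hinit
  have hloc' := hF'.polyLoc hS hh' hinit'
  induction i using Nat.strong_induction_on with
  | _ i ih =>
    -- The difference of the flows solves the evolution equation of the second interaction with
    -- source `T`. The commutators with the difference of the interactions are small because `F` is
    -- local, those with differences of lower order by induction. Since only the norm of the
    -- difference is estimated, no propagation bound for it is needed at this point.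
    set T : β → ℝ → Obs d r := fun b v => (1 : ℝ) • (Complex.I •
      ((totalOp (Λ b) (h 0 b) - totalOp (Λ b) (h' 0 b)) * F i b v -
        F i b v * (totalOp (Λ b) (h 0 b) - totalOp (Λ b) (h' 0 b)))) +
      ∑ j ∈ Finset.range i, (i.choose j : ℝ) • (Complex.I •
        (((totalOp (Λ b) (h (i - j) b) - totalOp (Λ b) (h' (i - j) b)) * F j b v -
          F j b v * (totalOp (Λ b) (h (i - j) b) - totalOp (Λ b) (h' (i - j) b))) +
        (totalOp (Λ b) (h' (i - j) b) * (F j b v - F' j b v) -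
          (F j b v - F' j b v) * totalOp (Λ b) (h' (i - j) b)))) with hT
    have hTs : PolySmall L T := by
      refine ((PolySmall.comm_far hS hL hh hh' hclose 0 (hloc i)).smul_I 1).add hL
        (PolySmall.sum hL _ fun j hj => PolySmall.smul_I ?_ _)
      refine (PolySmall.comm_far hS hL hh hh' hclose (i - j) (hloc j)).add hL ?_
      exact PolySmall.comm_small hS hL hh' (i - j) ((hloc j).sub hS (hloc' j))
        (ih j (Finset.mem_range.1 hj))
    have hTc : ∀ b, Continuous (T b) := by
      intro b
      have c1 := hF.continuous i b
      have c2 := fun j => hF.continuous j b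
      have c3 := fun j => hF'.continuous j b
      simp only [hT]
      refine Continuous.add (by fun_prop) (continuous_finsetSum _ fun j _ => ?_)
      have := c2 j
      have := c3 j
      fun_prop
    have hTd : ∀ b v, HasDerivAt (fun v => F i b v - F' i b v)
        (Complex.I • (totalOp (Λ b) (h' 0 b) * (F i b v - F' i b v) -
          (F i b v - F' i b v) * totalOp (Λ b) (h' 0 b)) + T b v) v := by
      intro b v
      refine ((hF i b v).sub (hF' i b v)).congr_deriv ?_
      have e1 : flowSource Λ h F i b v - flowSource Λ h' F' i b v =
          ∑ j ∈ Finset.range i, (i.choose j : ℝ) • (Complex.I •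
        (((totalOp (Λ b) (h (i - j) b) - totalOp (Λ b) (h' (i - j) b)) * F j b v -
          F j b v * (totalOp (Λ b) (h (i - j) b) - totalOp (Λ b) (h' (i - j) b))) +
        (totalOp (Λ b) (h' (i - j) b) * (F j b v - F' j b v) -
          (F j b v - F' j b v) * totalOp (Λ b) (h' (i - j) b)))) := by
        unfold flowSource
        rw [← Finset.sum_sub_distrib]
        refine Finset.sum_congr rfl fun j _ => ?_
        rw [← smul_sub, ← smul_sub]
        congr 2
        noncomm_ring
      simp only [hT]
      rw [← e1, one_smul]
      have e2 : totalOp (Λ b) (h 0 b) * F i b v - F i b v * totalOp (Λ b) (h 0 b) =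
          (totalOp (Λ b) (h' 0 b) * (F i b v - F' i b v) -
            (F i b v - F' i b v) * totalOp (Λ b) (h' 0 b)) +
          ((totalOp (Λ b) (h 0 b) - totalOp (Λ b) (h' 0 b)) * F i b v -
            F i b v * (totalOp (Λ b) (h 0 b) - totalOp (Λ b) (h' 0 b))) +
          (totalOp (Λ b) (h' 0 b) * F' i b v - F' i b v * totalOp (Λ b) (h' 0 b)) := by
        noncomm_ring
      rw [e2, smul_add, smul_add]
      abel
    intro p
    obtain ⟨C, q, hC, hTs⟩ := hTs p
    obtain ⟨C0, hC0, hdiff⟩ := hdiff i p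
    refine ⟨C0 + C, q + 1, by positivity, fun b v => ?_⟩
    have hL1 : 0 < (1 + L b) ^ p := pow_pos (by linarith [hL b]) p
    have h1 := norm_le_of_hasDerivAt_of_le (totalOp_isSelfAdjoint (hh'.isLocal 0 b)) (hTc b)
      (hTd b) (v := v) (B := C * (1 + |v|) ^ q / (1 + L b) ^ p) (fun u hu => by
        rw [le_div_iff₀ hL1]
        exact (hTs b u).trans (mul_one_add_abs_pow_mono hC le_rfl le_rfl hu))
    have h2 := mul_le_mul_of_nonneg_right h1 hL1.le
    rw [add_mul, mul_assoc, div_mul_cancel₀ _ hL1.ne'] at h2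
    refine h2.trans ?_
    rw [add_mul]
    refine add_le_add ?_ ?_
    · exact (hdiff b).trans (le_mul_of_one_le_right hC0 (one_le_one_add_abs_pow v _))
    · calc |v| * (C * (1 + |v|) ^ q) ≤ (1 + |v|) * (C * (1 + |v|) ^ q) := by
            gcongr
            linarith
        _ = C * (1 + |v|) ^ (q + 1) := by ring

end

end

section

/-! ### Smooth curves and their derivatives -/

section

variable {E : Type*} [NormedAddCommGroup E] [NormedSpace ℝ E] {I : Set ℝ}

theorem iteratedDeriv_eq_of_hasDerivAt (hI : IsOpen I) {F : ℕ → ℝ → E}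
    (hF : ∀ i, ∀ t ∈ I, HasDerivAt (F i) (F (i + 1) t) t) (i : ℕ) {t : ℝ} (ht : t ∈ I) :
    iteratedDeriv i (F 0) t = F i t := by
  induction i generalizing t with
  | zero => simp
  | succ i ih =>
    rw [iteratedDeriv_succ]
    have h : iteratedDeriv i (F 0) =ᶠ[nhds t] F i :=
      Filter.eventually_of_mem (hI.mem_nhds ht) fun u hu => ih hu
    rw [h.deriv_eq]
    exact (hF i t ht).deriv

theorem contDiffOn_of_hasDerivAt (hI : IsOpen I) {F : ℕ → ℝ → E}
    (hF : ∀ i, ∀ t ∈ I, HasDerivAt (F i) (F (i + 1) t) t) : ContDiffOn ℝ ∞ (F 0) I := by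
  rw [contDiffOn_infty]
  intro n
  have h : ∀ i, ContDiffOn ℝ n (F i) I := by
    induction n with
    | zero =>
      intro i
      exact contDiffOn_zero.2 fun t ht => (hF i t ht).continuousAt.continuousWithinAt
    | succ n ih =>
      intro i
      have := contDiffOn_succ_iff_deriv_of_isOpen (𝕜 := ℝ) (n := n) (f := F i) hI
      push_cast
      rw [this]
      refine ⟨fun t ht => (hF i t ht).differentiableAt.differentiableWithinAt, by simp, ?_⟩
      exact (ih (i + 1)).congr fun t ht => (hF i t ht).deriv
  exact h 0

theorem hasDerivAt_iteratedDeriv (hI : IsOpen I) {f : ℝ → E} (hf : ContDiffOn ℝ ∞ f I) (i : ℕ)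
    {t : ℝ} (ht : t ∈ I) :
    HasDerivAt (iteratedDeriv i f) (iteratedDeriv (i + 1) f t) t := by
  rw [iteratedDeriv_succ]
  refine DifferentiableAt.hasDerivAt ?_
  have h := hf.differentiableOn_iteratedDerivWithin (m := i)
    (by exact_mod_cast WithTop.coe_lt_top i) hI.uniqueDiffOn
  refine ((h t ht).differentiableAt (hI.mem_nhds ht)).congr_of_eventuallyEq ?_
  exact Filter.eventually_of_mem (hI.mem_nhds ht)
    fun u hu => (iteratedDerivWithin_of_isOpen hI hu).symm

theorem iteratedDeriv_sum_of_contDiffOn {ι : Type*} (hI : IsOpen I) (s : Finset ι)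
    {f : ι → ℝ → E} (hf : ∀ j ∈ s, ContDiffOn ℝ ∞ (f j) I) (i : ℕ) {t : ℝ} (ht : t ∈ I) :
    iteratedDeriv i (fun τ => ∑ j ∈ s, f j τ) t = ∑ j ∈ s, iteratedDeriv i (f j) t := by
  have h := iteratedDeriv_eq_of_hasDerivAt hI (F := fun i τ => ∑ j ∈ s, iteratedDeriv i (f j) τ)
    (fun i t ht => HasDerivAt.fun_sum fun j hj => hasDerivAt_iteratedDeriv hI (hf j hj) i ht) i ht
  simpa only [iteratedDeriv_zero] using h

theorem iteratedDeriv_sub_of_contDiffOn (hI : IsOpen I) {f f' : ℝ → E} (hf : ContDiffOn ℝ ∞ f I)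
    (hf' : ContDiffOn ℝ ∞ f' I) (i : ℕ) {t : ℝ} (ht : t ∈ I) :
    iteratedDeriv i (fun τ => f τ - f' τ) t = iteratedDeriv i f t - iteratedDeriv i f' t := by
  have h := iteratedDeriv_eq_of_hasDerivAt hI
    (F := fun i τ => iteratedDeriv i f τ - iteratedDeriv i f' τ)
    (fun i t ht => (hasDerivAt_iteratedDeriv hI hf i ht).sub
      (hasDerivAt_iteratedDeriv hI hf' i ht)) i ht
  simpa only [iteratedDeriv_zero] using h

theorem iteratedDeriv_add_of_contDiffOn (hI : IsOpen I) {f f' : ℝ → E} (hf : ContDiffOn ℝ ∞ f I)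
    (hf' : ContDiffOn ℝ ∞ f' I) (i : ℕ) {t : ℝ} (ht : t ∈ I) :
    iteratedDeriv i (fun τ => f τ + f' τ) t = iteratedDeriv i f t + iteratedDeriv i f' t := by
  have h := iteratedDeriv_eq_of_hasDerivAt hI
    (F := fun i τ => iteratedDeriv i f τ + iteratedDeriv i f' τ)
    (fun i t ht => (hasDerivAt_iteratedDeriv hI hf i ht).add
      (hasDerivAt_iteratedDeriv hI hf' i ht)) i ht
  simpa only [iteratedDeriv_zero] using h

theorem iteratedDeriv_smul_of_contDiffOn (hI : IsOpen I) {f : ℝ → E} (hf : ContDiffOn ℝ ∞ f I)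
    (c : ℝ) (i : ℕ) {t : ℝ} (ht : t ∈ I) :
    iteratedDeriv i (fun τ => c • f τ) t = c • iteratedDeriv i f t := by
  have h := iteratedDeriv_eq_of_hasDerivAt hI (F := fun i τ => c • iteratedDeriv i f τ)
    (fun i t ht => (hasDerivAt_iteratedDeriv hI hf i ht).const_smul c) i ht
  simpa only [iteratedDeriv_zero] using h

/-- The derivative of a curve in a closed subspace lies in that subspace. -/
theorem iteratedDeriv_mem_of_isClosed (hI : IsOpen I) {f : ℝ → E} (hf : ContDiffOn ℝ ∞ f I)
    {S : Submodule ℝ E} (hS : IsClosed (S : Set E)) (hfS : ∀ t ∈ I, f t ∈ S) (i : ℕ) {t : ℝ}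
    (ht : t ∈ I) : iteratedDeriv i f t ∈ S := by
  induction i generalizing t with
  | zero => simpa using hfS t ht
  | succ i ih =>
    have h := (hasDerivAt_iteratedDeriv hI hf i ht).tendsto_slope
    refine hS.mem_of_tendsto h ?_
    filter_upwards [nhdsWithin_le_nhds (hI.mem_nhds ht)] with u hu
    rw [slope_def_module]
    exact S.smul_mem _ (S.sub_mem (ih hu) (ih ht))

end

section

/-! ### Curves depending on two variables and mixed derivatives. -/

variable {E : Type*} [NormedAddCommGroup E] [NormedSpace ℝ E] {I : Set ℝ}

/-- Iterated partial derivative in the first variable. -/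
def partialIter (G : ℝ × ℝ → E) : ℕ → ℝ × ℝ → E
  | 0 => G
  | i + 1 => fun p => fderiv ℝ (partialIter G i) p (1, 0)

theorem contDiffOn_partialIter (hI : IsOpen I) {G : ℝ × ℝ → E}
    (hG : ContDiffOn ℝ ∞ G (I ×ˢ Set.univ)) (i : ℕ) :
    ContDiffOn ℝ ∞ (partialIter G i) (I ×ˢ Set.univ) := by
  induction i with
  | zero => exact hG
  | succ i ih =>
    exact (ih.fderiv_of_isOpen (hI.prod isOpen_univ) (by simp)).clm_apply contDiffOn_const

theorem hasDerivAt_fst_of_contDiffOn (hI : IsOpen I) {G : ℝ × ℝ → E}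
    (hG : ContDiffOn ℝ ∞ G (I ×ˢ Set.univ)) {t : ℝ} (ht : t ∈ I) (v : ℝ) :
    HasDerivAt (fun τ => G (τ, v)) (fderiv ℝ G (t, v) (1, 0)) t := by
  have h : DifferentiableAt ℝ G (t, v) :=
    ((hG.differentiableOn (by simp)) (t, v) ⟨ht, trivial⟩).differentiableAt
      ((hI.prod isOpen_univ).mem_nhds ⟨ht, trivial⟩)
  exact h.hasFDerivAt.comp_hasDerivAt t ((hasDerivAt_id t).prodMk (hasDerivAt_const t v))

theorem hasDerivAt_snd_of_contDiffOn (hI : IsOpen I) {G : ℝ × ℝ → E}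
    (hG : ContDiffOn ℝ ∞ G (I ×ˢ Set.univ)) {t : ℝ} (ht : t ∈ I) (v : ℝ) :
    HasDerivAt (fun u => G (t, u)) (fderiv ℝ G (t, v) (0, 1)) v := by
  have h : DifferentiableAt ℝ G (t, v) :=
    ((hG.differentiableOn (by simp)) (t, v) ⟨ht, trivial⟩).differentiableAt
      ((hI.prod isOpen_univ).mem_nhds ⟨ht, trivial⟩)
  exact h.hasFDerivAt.comp_hasDerivAt v ((hasDerivAt_const v t).prodMk (hasDerivAt_id v))

theorem iteratedDeriv_eq_partialIter (hI : IsOpen I) {G : ℝ × ℝ → E}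
    (hG : ContDiffOn ℝ ∞ G (I ×ˢ Set.univ)) (i : ℕ) {t : ℝ} (ht : t ∈ I) (v : ℝ) :
    iteratedDeriv i (fun τ => G (τ, v)) t = partialIter G i (t, v) :=
  iteratedDeriv_eq_of_hasDerivAt hI (F := fun i τ => partialIter G i (τ, v))
    (fun i _ ht => hasDerivAt_fst_of_contDiffOn hI (contDiffOn_partialIter hI hG i) ht v) i ht

/-- Interchange of the derivatives in the two variables. -/
theorem fderiv_partial_comm (hI : IsOpen I) {G : ℝ × ℝ → E}
    (hG : ContDiffOn ℝ ∞ G (I ×ˢ Set.univ)) {t : ℝ} (ht : t ∈ I) (v : ℝ) :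
    fderiv ℝ (fun p => fderiv ℝ G p (1, 0)) (t, v) (0, 1) =
      fderiv ℝ (fun p => fderiv ℝ G p (0, 1)) (t, v) (1, 0) := by
  have hU := (hI.prod isOpen_univ).mem_nhds (⟨ht, trivial⟩ : (t, v) ∈ I ×ˢ Set.univ)
  have hat := (hG (t, v) ⟨ht, trivial⟩).contDiffAt hU
  have hd : DifferentiableAt ℝ (fderiv ℝ G) (t, v) :=
    (hat.fderiv_right (m := 1) (by norm_cast)).differentiableAt (by simp)
  have key : ∀ a b : ℝ × ℝ, fderiv ℝ (fun p => fderiv ℝ G p a) (t, v) b =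
      fderiv ℝ (fderiv ℝ G) (t, v) b a := by
    intro a b
    have h := hd.hasFDerivAt.clm_apply (hasFDerivAt_const a (t, v))
    rw [h.fderiv]
    simp
  rw [key, key]
  exact (hat.isSymmSndFDerivAt (by
    rw [minSmoothness_of_isRCLikeNormedField]; exact WithTop.coe_le_coe.2 (le_top : (2 : ℕ∞) ≤ ⊤))) _ _

end

/-- Pascal's rule in the form of the inductive step of Leibniz' formula; `K m j` stands for the term
with `m` derivatives on one factor and `j` on the other. -/
theorem sum_choose_pascal {E : Type*} [AddCommGroup E] [Module ℝ E] (K : ℕ → ℕ → E) (i : ℕ) :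
    ∑ j ∈ Finset.range (i + 1), (i.choose j : ℝ) • (K (i - j + 1) j + K (i - j) (j + 1)) =
      ∑ j ∈ Finset.range (i + 1 + 1), ((i + 1).choose j : ℝ) • K (i + 1 - j) j := by
  rw [Finset.sum_range_succ' _ (i + 1)]
  simp only [Nat.choose_succ_succ, Nat.cast_add, add_smul, smul_add, Finset.sum_add_distrib,
    Nat.add_sub_add_right]
  have h : ∑ j ∈ Finset.range (i + 1), (i.choose j : ℝ) • K (i - j + 1) j =
      ∑ j ∈ Finset.range (i + 1), (i.choose j.succ : ℝ) • K (i - j) (j + 1) +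
        (i.choose 0 : ℝ) • K (i + 1) 0 := by
    rw [Finset.sum_range_succ', Finset.sum_range_succ _ i, Nat.choose_succ_self]
    simp only [Nat.cast_zero, zero_smul, add_zero, Nat.sub_zero]
    congr 1
    refine Finset.sum_congr rfl fun j hj => ?_
    have := Finset.mem_range.1 hj
    rw [show i - (j + 1) + 1 = i - j by omega]
  rw [h]
  simp only [Nat.choose_zero_right, Nat.sub_zero]
  abel

variable {d r : ℕ} {I : Set ℝ}

theorem contDiff_exp : ContDiff ℝ ∞ (NormedSpace.exp : Obs d r → Obs d r) := by
  rw [contDiff_iff_contDiffAt]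
  intro x
  exact (NormedSpace.exp_analytic (𝕂 := ℝ) x).contDiffAt

theorem contDiffOn_heisenberg {H C : ℝ → Obs d r} (hH : ContDiffOn ℝ ∞ H I)
    (hC : ContDiffOn ℝ ∞ C I) :
    ContDiffOn ℝ ∞ (fun p : ℝ × ℝ => heisenberg (H p.1) p.2 (C p.1)) (I ×ˢ Set.univ) := by
  have h1 : ContDiffOn ℝ ∞ (fun p : ℝ × ℝ => H p.1) (I ×ˢ Set.univ) :=
    hH.comp contDiff_fst.contDiffOn fun p hp => hp.1
  have h2 : ContDiffOn ℝ ∞ (fun p : ℝ × ℝ => C p.1) (I ×ˢ Set.univ) :=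
    hC.comp contDiff_fst.contDiffOn fun p hp => hp.1
  have h3 : ∀ c : ℝ, ContDiffOn ℝ ∞ (fun p : ℝ × ℝ => expI (H p.1) (c * p.2))
      (I ×ˢ Set.univ) := by
    intro c
    refine contDiff_exp.comp_contDiffOn ?_
    have e : (fun p : ℝ × ℝ => (Complex.I * ((c * p.2 : ℝ) : ℂ)) • H p.1) =
        fun p : ℝ × ℝ => (c * p.2) • (Complex.I • H p.1) := by
      funext p
      rw [mul_comm, mul_smul]
      exact Complex.coe_smul (c * p.2) (Complex.I • H p.1)
    rw [e]
    exact (contDiff_const.mul contDiff_snd).contDiffOn.smul (h1.const_smul Complex.I)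
  have := ((h3 1).mul h2).mul (h3 (-1))
  refine this.congr fun p _ => ?_
  rw [heisenberg_eq]
  simp

theorem hasDerivAt_heisenberg_time (H C : Obs d r) (v : ℝ) :
    HasDerivAt (fun u => heisenberg H u C)
      (Complex.I • (H * heisenberg H v C - heisenberg H v C * H)) v := by
  refine (hasDerivAt_heisenberg H (hasDerivAt_const v C)).congr_deriv ?_
  have c1 := (commute_expI H v).eq
  have c2 := (commute_expI H (-v)).eq
  simp only [heisenberg_eq, zero_add, mul_smul_comm, smul_mul_assoc, mul_sub, sub_mul]
  congr 2
  · simp only [← mul_assoc]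
    rw [c1]
  · simp only [mul_assoc]
    rw [c2]

/-- The evolution equation of the time derivatives of an evolved operator. -/
theorem hasDerivAt_iteratedDeriv_heisenberg (hI : IsOpen I) {H C : ℝ → Obs d r}
    (hH : ContDiffOn ℝ ∞ H I) (hC : ContDiffOn ℝ ∞ C I) (i : ℕ) {t : ℝ} (ht : t ∈ I) (v : ℝ) :
    HasDerivAt (fun u => iteratedDeriv i (fun τ => heisenberg (H τ) u (C τ)) t)
      (∑ j ∈ Finset.range (i + 1), (i.choose j : ℝ) • (Complex.I •
        (iteratedDeriv (i - j) H t * iteratedDeriv j (fun τ => heisenberg (H τ) v (C τ)) t -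
          iteratedDeriv j (fun τ => heisenberg (H τ) v (C τ)) t * iteratedDeriv (i - j) H t))) v := by
  set G : ℝ × ℝ → Obs d r := fun p => heisenberg (H p.1) p.2 (C p.1) with hGdef
  have hG : ContDiffOn ℝ ∞ G (I ×ˢ Set.univ) := contDiffOn_heisenberg hH hC
  have e : ∀ j u, ∀ τ ∈ I, iteratedDeriv j (fun τ => heisenberg (H τ) u (C τ)) τ =
      partialIter G j (τ, u) := fun j u τ hτ => iteratedDeriv_eq_partialIter hI hG j hτ u
  simp only [fun j u => e j u t ht]
  -- Induction on `i`: the derivative in the evolution time is interchanged with the one in `t`, the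
  -- formula of order `i` is inserted and differentiated by the product rule. It must hold near `t`
  -- to be differentiated, hence the quantifier over `t ∈ I`.
  have key : ∀ i v, ∀ t ∈ I, fderiv ℝ (partialIter G i) (t, v) (0, 1) =
      ∑ j ∈ Finset.range (i + 1), (i.choose j : ℝ) • (Complex.I •
        (iteratedDeriv (i - j) H t * partialIter G j (t, v) -
          partialIter G j (t, v) * iteratedDeriv (i - j) H t)) := by
    clear ht t i v
    intro i v
    induction i with
    | zero =>
      intro t ht
      have h1 := hasDerivAt_snd_of_contDiffOn hI hG ht v
      have h2 := h1.unique (hasDerivAt_heisenberg_time (H t) (C t) v)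
      change fderiv ℝ G (t, v) (0, 1) = _
      rw [h2]
      simp [partialIter, hGdef]
    | succ i ih =>
      intro t ht
      have h1 : fderiv ℝ (partialIter G (i + 1)) (t, v) (0, 1) =
          fderiv ℝ (fun p => fderiv ℝ (partialIter G i) p (0, 1)) (t, v) (1, 0) :=
        fderiv_partial_comm hI (contDiffOn_partialIter hI hG i) ht v
      rw [h1]
      have hsm : ContDiffOn ℝ ∞ (fun p => fderiv ℝ (partialIter G i) p ((0 : ℝ), (1 : ℝ)))
          (I ×ˢ Set.univ) :=
        ((contDiffOn_partialIter hI hG i).fderiv_of_isOpen (hI.prod isOpen_univ)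
          (by simp)).clm_apply contDiffOn_const
      have h2 := hasDerivAt_fst_of_contDiffOn hI hsm ht v
      have h3 : HasDerivAt (fun τ => ∑ j ∈ Finset.range (i + 1), (i.choose j : ℝ) • (Complex.I •
          (iteratedDeriv (i - j) H τ * partialIter G j (τ, v) -
            partialIter G j (τ, v) * iteratedDeriv (i - j) H τ)))
          (∑ j ∈ Finset.range (i + 1), (i.choose j : ℝ) • (Complex.I •
          ((iteratedDeriv (i - j + 1) H t * partialIter G j (t, v) +
              iteratedDeriv (i - j) H t * partialIter G (j + 1) (t, v)) -
            (partialIter G (j + 1) (t, v) * iteratedDeriv (i - j) H t +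
              partialIter G j (t, v) * iteratedDeriv (i - j + 1) H t)))) t := by
        refine HasDerivAt.fun_sum fun j _ => ?_
        have d1 := hasDerivAt_iteratedDeriv hI hH (i - j) ht
        have d2 := hasDerivAt_fst_of_contDiffOn hI (contDiffOn_partialIter hI hG j) ht v
        exact (((d1.mul d2).sub (d2.mul d1)).const_smul Complex.I).const_smul (i.choose j : ℝ)
      have h4 := h2.unique (h3.congr_of_eventuallyEq
        (Filter.eventually_of_mem (hI.mem_nhds ht) fun τ hτ => ih τ hτ))
      rw [h4]
      set K : ℕ → ℕ → Obs d r := fun m j => Complex.I •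
        (iteratedDeriv m H t * partialIter G j (t, v) -
          partialIter G j (t, v) * iteratedDeriv m H t) with hK
      have h5 : ∀ j, Complex.I •
          ((iteratedDeriv (i - j + 1) H t * partialIter G j (t, v) +
              iteratedDeriv (i - j) H t * partialIter G (j + 1) (t, v)) -
            (partialIter G (j + 1) (t, v) * iteratedDeriv (i - j) H t +
              partialIter G j (t, v) * iteratedDeriv (i - j + 1) H t)) =
          K (i - j + 1) j + K (i - j) (j + 1) := by
        intro j
        simp only [hK]
        rw [← smul_add]
        congr 1
        abel
      simp only [h5]
      exact sum_choose_pascal K i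
  rw [← key i v t ht]
  exact hasDerivAt_snd_of_contDiffOn hI (contDiffOn_partialIter hI hG i) ht v

theorem hasDerivAt_iteratedDeriv_heisenberg_time (hI : IsOpen I) {H C : ℝ → Obs d r}
    (hH : ContDiffOn ℝ ∞ H I) (hC : ContDiffOn ℝ ∞ C I) (i : ℕ) {t : ℝ} (ht : t ∈ I) (v : ℝ) :
    HasDerivAt (iteratedDeriv i (fun τ => heisenberg (H τ) v (C τ)))
      (iteratedDeriv (i + 1) (fun τ => heisenberg (H τ) v (C τ)) t) t := by
  refine hasDerivAt_iteratedDeriv hI ?_ i ht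
  exact (contDiffOn_heisenberg hH hC).comp (f := fun τ : ℝ => (τ, v))
    (contDiff_prodMk_left v).contDiffOn fun τ hτ => ⟨hτ, trivial⟩

end

section

/-! ### Averages of evolved operators -/

section

variable {α : Type*} [MeasurableSpace α]

/-- A weight function `κ` all of whose moments with respect to the function `V` are finite. -/
structure IsPolyKernel (μ : Measure α) (κ V : α → ℝ) : Prop where
  aestronglyMeasurable : AEStronglyMeasurable κ μ
  measurable : Measurable V
  moment : ∀ q : ℕ, Integrable (fun p => |κ p| * (1 + |V p|) ^ q) μ

variable {μ : Measure α} {κ V : α → ℝ} {E : Type*} [NormedAddCommGroup E] [NormedSpace ℝ E]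

theorem IsPolyKernel.aestronglyMeasurable_smul (hκ : IsPolyKernel μ κ V) {G : ℝ → E}
    (hG : Continuous G) : AEStronglyMeasurable (fun p => κ p • G (V p)) μ :=
  hκ.aestronglyMeasurable.smul
    (hG.stronglyMeasurable.comp_measurable hκ.measurable).aestronglyMeasurable

theorem IsPolyKernel.integrable_smul (hκ : IsPolyKernel μ κ V) {G : ℝ → E} (hG : Continuous G)
    {C : ℝ} {q : ℕ} (hC : ∀ v, ‖G v‖ ≤ C * (1 + |v|) ^ q) :
    Integrable (fun p => κ p • G (V p)) μ := by
  refine ((hκ.moment q).const_mul C).mono' (hκ.aestronglyMeasurable_smul hG)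
    (Filter.Eventually.of_forall fun p => ?_)
  rw [norm_smul, Real.norm_eq_abs]
  calc |κ p| * ‖G (V p)‖ ≤ |κ p| * (C * (1 + |V p|) ^ q) := by gcongr; exact hC _
    _ = _ := by ring

theorem IsPolyKernel.norm_integral_le (hκ : IsPolyKernel μ κ V) {G : ℝ → E} {C : ℝ} {q : ℕ}
    (hC : ∀ v, ‖G v‖ ≤ C * (1 + |v|) ^ q) :
    ‖∫ p, κ p • G (V p) ∂μ‖ ≤ C * ∫ p, |κ p| * (1 + |V p|) ^ q ∂μ := by
  rw [← integral_const_mul]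
  refine norm_integral_le_of_norm_le ((hκ.moment q).const_mul C)
    (Filter.Eventually.of_forall fun p => ?_)
  rw [norm_smul, Real.norm_eq_abs]
  calc |κ p| * ‖G (V p)‖ ≤ |κ p| * (C * (1 + |V p|) ^ q) := by gcongr; exact hC _
    _ = _ := by ring

theorem IsPolyKernel.moment_nonneg (q : ℕ) : 0 ≤ ∫ p, |κ p| * (1 + |V p|) ^ q ∂μ :=
  integral_nonneg fun p => by positivity

theorem IsPolyKernel.hasDerivAt_integral (hκ : IsPolyKernel μ κ V) {I : Set ℝ} (hI : IsOpen I)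
    {G G' : ℝ → ℝ → E} (hG : ∀ t ∈ I, Continuous (G t)) (hG' : ∀ t ∈ I, Continuous (G' t))
    {C C' : ℝ} {q q' : ℕ} (hC : ∀ t ∈ I, ∀ v, ‖G t v‖ ≤ C * (1 + |v|) ^ q)
    (hC' : ∀ t ∈ I, ∀ v, ‖G' t v‖ ≤ C' * (1 + |v|) ^ q')
    (hd : ∀ t ∈ I, ∀ v, HasDerivAt (fun τ => G τ v) (G' t v) t) {t : ℝ} (ht : t ∈ I) :
    HasDerivAt (fun τ => ∫ p, κ p • G τ (V p) ∂μ) (∫ p, κ p • G' t (V p) ∂μ) t := by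
  refine (hasDerivAt_integral_of_dominated_loc_of_deriv_le (hI.mem_nhds ht)
    (F := fun τ p => κ p • G τ (V p)) (F' := fun τ p => κ p • G' τ (V p))
    (bound := fun p => C' * (|κ p| * (1 + |V p|) ^ q'))
    (Filter.eventually_of_mem (hI.mem_nhds ht)
      fun τ hτ => hκ.aestronglyMeasurable_smul (hG τ hτ))
    (hκ.integrable_smul (hG t ht) (hC t ht)) (hκ.aestronglyMeasurable_smul (hG' t ht))
    (Filter.Eventually.of_forall fun p τ hτ => ?_) ((hκ.moment q').const_mul C')
    (Filter.Eventually.of_forall fun p τ hτ => (hd τ hτ (V p)).const_smul (κ p))).2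
  rw [norm_smul, Real.norm_eq_abs]
  calc |κ p| * ‖G' τ (V p)‖ ≤ |κ p| * (C' * (1 + |V p|) ^ q') := by gcongr; exact hC' τ hτ _
    _ = _ := by ring

end

variable {d r : ℕ} {α : Type*} [MeasurableSpace α]

/-- The average `∫ κ(p) e^{iV(p)ℒ_H}(C) dμ(p)`. -/
def evolvedAvg (μ : Measure α) (κ V : α → ℝ) (H C : Obs d r) : Obs d r :=
  ∫ p, κ p • heisenberg H (V p) C ∂μ

/-- The part of `∑ c(X)` assigned to the site `x`. -/
def siteTerm (Λ : Finset (Site d)) (c : Finset (Site d) → Obs d r) (x : Site d) : Obs d r :=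
  ∑ X ∈ Λ.powerset with x ∈ X, (X.card : ℝ)⁻¹ • c X

/-- The averaged evolution of the part of `∑ c(X)` assigned to the site `x`, for the Hamiltonian
with interaction `h`. -/
def siteAvg (μ : Measure α) (κ V : α → ℝ) (Λ : Finset (Site d)) (h c : Finset (Site d) → Obs d r)
    (x : Site d) : Obs d r :=
  evolvedAvg μ κ V (totalOp Λ h) (siteTerm Λ c x)

/-- Every nonempty set shares its term equally among its sites. The empty set belongs to no site and
is kept apart. -/
theorem totalOp_eq_sum_siteTerm (Λ : Finset (Site d)) (c : Finset (Site d) → Obs d r) :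
    totalOp Λ c = c ∅ + ∑ x ∈ Λ, siteTerm Λ c x := by
  unfold totalOp siteTerm
  have h1 : ∀ X ∈ Λ.powerset, c X = (if X = ∅ then c ∅ else 0) +
      ∑ x ∈ Λ, if x ∈ X then (X.card : ℝ)⁻¹ • c X else 0 := by
    intro X hX
    rw [← Finset.sum_filter, Finset.filter_mem_eq_inter,
      Finset.inter_eq_right.2 (Finset.mem_powerset.1 hX), Finset.sum_const]
    split_ifs with h
    · subst h; simp
    · rw [zero_add, ← Nat.cast_smul_eq_nsmul ℝ, smul_smul, mul_inv_cancel₀, one_smul]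
      exact_mod_cast (Finset.card_pos.2 (Finset.nonempty_iff_ne_empty.2 h)).ne'
  rw [Finset.sum_congr rfl h1, Finset.sum_add_distrib, Finset.sum_comm]
  congr 1
  · simp
  · exact Finset.sum_congr rfl fun x _ => by rw [Finset.sum_filter]

theorem IsLocalTerm.siteTerm {Λ : Finset (Site d)} {c : Finset (Site d) → Obs d r}
    (hc : ∀ Y ⊆ Λ, IsLocalTerm Y (c Y)) (x : Site d) : IsLocalTerm Λ (siteTerm Λ c x) := by
  refine (localTerms r Λ).sum_mem fun X hX => (localTerms r Λ).smul_mem _ ?_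
  have hX := Finset.mem_powerset.1 (Finset.mem_filter.1 hX).1
  exact (hc X hX).mono hX

theorem IsLocalTerm.totalOp {Λ : Finset (Site d)} {c : Finset (Site d) → Obs d r}
    (hc : ∀ Y ⊆ Λ, IsLocalTerm Y (c Y)) : IsLocalTerm Λ (totalOp Λ c) := by
  refine (localTerms r Λ).sum_mem fun X hX => ?_
  have hX := Finset.mem_powerset.1 hX
  exact (hc X hX).mono hX

theorem IsLocalTerm.siteAvg {Λ : Finset (Site d)} {h c : Finset (Site d) → Obs d r}
    (hh : ∀ Y ⊆ Λ, IsLocalTerm Y (h Y)) (hc : ∀ Y ⊆ Λ, IsLocalTerm Y (c Y)) (x : Site d)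
    (μ : Measure α) (κ V : α → ℝ) : IsLocalTerm Λ (siteAvg μ κ V Λ h c x) :=
  integral_mem_of_isClosed (isClosed_localTerms Λ) fun _ =>
    (localTerms r Λ).smul_mem _ ((IsLocalTerm.totalOp hh).heisenberg (IsLocalTerm.siteTerm hc x) _)

/-- A term commutes with the sites outside its set, and inside the set the distance to `x` is at
most the diameter. The factor `2` is that of the trivial bound for commutators. -/
theorem siteTerm_locBd {Λ : Finset (Site d)} {δ : Site d → Site d → ℝ}
    {c : Finset (Site d) → Obs d r} (hc : ∀ Y ⊆ Λ, IsLocalTerm Y (c Y)) {x : Site d}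
    (hδ : ∀ z ∈ Λ, 0 ≤ δ x z) (p : ℕ) :
    LocBd Λ δ x p (siteTerm Λ c x) (2 * diamSum Λ δ p c x) := by
  have hinv : ∀ X : Finset (Site d), x ∈ X → |(X.card : ℝ)⁻¹| ≤ 1 := by
    intro X hX
    rw [abs_of_nonneg (by positivity)]
    exact inv_le_one_of_one_le₀ (by exact_mod_cast Finset.card_pos.2 ⟨x, hX⟩)
  have key : ∀ X ∈ Λ.powerset.filter (fun X => x ∈ X), LocBd Λ δ x p ((X.card : ℝ)⁻¹ • c X)
      (2 * ((1 + (finDiam δ X : ℝ)) ^ p * ‖c X‖)) := by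
    intro X hX
    obtain ⟨hX1, hX2⟩ := Finset.mem_filter.1 hX
    have h1 : 1 ≤ (1 + (finDiam δ X : ℝ)) ^ p := one_le_pow₀ (by
      have := (finDiam δ X).coe_nonneg; linarith)
    have h2 : ‖c X‖ ≤ (1 + (finDiam δ X : ℝ)) ^ p * ‖c X‖ :=
      le_mul_of_one_le_left (norm_nonneg _) h1
    have h3 : LocBd Λ δ x p (c X) (2 * ((1 + (finDiam δ X : ℝ)) ^ p * ‖c X‖)) := by
      refine ⟨by have := norm_nonneg (c X); linarith, fun z hz => ?_⟩
      by_cases hzX : z ∈ X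
      · have h4 := siteComm_le z (c X)
        have h5 : (1 + δ x z) ^ p ≤ (1 + (finDiam δ X : ℝ)) ^ p :=
          pow_le_pow_left₀ (by linarith [hδ z hz]) (by linarith [le_finDiam (δ := δ) hX2 hzX]) p
        calc siteComm z (c X) * (1 + δ x z) ^ p
            ≤ (2 * ‖c X‖) * (1 + (finDiam δ X : ℝ)) ^ p :=
              mul_le_mul h4 h5 (pow_nonneg (by linarith [hδ z hz]) p) (by positivity)
          _ = _ := by ring
      · rw [(hc X (Finset.mem_powerset.1 hX1)).siteComm_eq_zero hzX, zero_mul]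
        positivity
    refine (h3.smul _).mono (mul_le_of_le_one_left ?_ (hinv X hX2))
    positivity
  have := LocBd.sum _ key hδ
  unfold siteTerm diamSum
  rwa [Finset.mul_sum]

theorem norm_siteTerm_sub_le (Λ : Finset (Site d)) (c c' : Finset (Site d) → Obs d r)
    (x : Site d) : ‖siteTerm Λ c x - siteTerm Λ c' x‖ ≤
      ∑ Y ∈ Λ.powerset with x ∈ Y, ‖c Y - c' Y‖ := by
  unfold siteTerm
  rw [← Finset.sum_sub_distrib]
  refine (norm_sum_le _ _).trans (Finset.sum_le_sum fun X hX => ?_)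
  rw [← smul_sub, norm_smul, Real.norm_eq_abs, abs_of_nonneg (by positivity)]
  refine mul_le_of_le_one_left (norm_nonneg _) (inv_le_one_of_one_le₀ ?_)
  exact_mod_cast Finset.card_pos.2 ⟨x, (Finset.mem_filter.1 hX).2⟩

/-! ### Families of time-dependent interactions -/

section

variable {σ : Type*}

/-- A family of smooth time-dependent interactions, all of whose time derivatives are uniformly
bounded, with arbitrary powers of the diameter. -/
structure IsTimeFamily (I : Set ℝ) (Λ : σ → Finset (Site d)) (δ : σ → Site d → Site d → ℝ)
    (h : σ → ℝ → Finset (Site d) → Obs d r) : Prop where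
  isLocal : ∀ b, ∀ t ∈ I, ∀ Y ⊆ Λ b, IsLocalTerm Y (h b t Y)
  smooth : ∀ b, ∀ Y ⊆ Λ b, ContDiffOn ℝ ∞ (fun t => h b t Y) I
  bdd : ∀ i n : ℕ, ∃ C : ℝ, 0 ≤ C ∧ ∀ b, ∀ t ∈ I, ∀ z ∈ Λ b,
    diamSum (Λ b) (δ b) n (fun Y => iteratedDeriv i (fun τ => h b τ Y) t) z ≤ C

/-- Uniform exponential decay of a family of interactions. -/
def HasExpDecay (I : Set ℝ) (Λ : σ → Finset (Site d)) (δ : σ → Site d → Site d → ℝ)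
    (h : σ → ℝ → Finset (Site d) → Obs d r) : Prop :=
  ∃ a > (0 : ℝ), ∃ K : ℝ, 0 ≤ K ∧ ∀ b, ∀ t ∈ I, ∀ y ∈ Λ b, ∀ z ∈ Λ b,
    pairSum (Λ b) (h b t) y z ≤ K * Real.exp (-(a * δ b y z))

/-- All time derivatives of the two families agree near the marked site, up to the distance
`L`. -/
def TimeClose (I : Set ℝ) (Λ : σ → Finset (Site d)) (δ : σ → Site d → Site d → ℝ)
    (x : σ → Site d) (L : σ → ℝ) (h h' : σ → ℝ → Finset (Site d) → Obs d r) : Prop :=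
  ∀ i p : ℕ, ∃ C : ℝ, 0 ≤ C ∧ ∀ b, ∀ t ∈ I, ∀ z ∈ Λ b,
    (∑ Y ∈ (Λ b).powerset with z ∈ Y, ‖iteratedDeriv i (fun τ => h b τ Y) t -
      iteratedDeriv i (fun τ => h' b τ Y) t‖) * (1 + L b) ^ p ≤ C * (1 + δ b (x b) z) ^ p

variable {I : Set ℝ} {Λ : σ → Finset (Site d)} {δ : σ → Site d → Site d → ℝ} {x : σ → Site d}
  {s : ℕ} {ν : ℝ} {h h' c c' : σ → ℝ → Finset (Site d) → Obs d r}

theorem IsTimeFamily.contDiffOn_totalOp (hh : IsTimeFamily I Λ δ h) (b : σ) :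
    ContDiffOn ℝ ∞ (fun t => totalOp (Λ b) (h b t)) I :=
  ContDiffOn.sum fun Y hY => hh.smooth b Y (Finset.mem_powerset.1 hY)

theorem IsTimeFamily.contDiffOn_siteTerm (hc : IsTimeFamily I Λ δ c) (b : σ) (y : Site d) :
    ContDiffOn ℝ ∞ (fun t => siteTerm (Λ b) (c b t) y) I :=
  ContDiffOn.sum fun Y hY => (hc.smooth b Y
    (Finset.mem_powerset.1 (Finset.mem_filter.1 hY).1)).const_smul _

theorem IsTimeFamily.iteratedDeriv_totalOp (hI : IsOpen I) (hh : IsTimeFamily I Λ δ h) (b : σ)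
    (i : ℕ) {t : ℝ} (ht : t ∈ I) : iteratedDeriv i (fun t => totalOp (Λ b) (h b t)) t =
      totalOp (Λ b) (fun Y => iteratedDeriv i (fun τ => h b τ Y) t) :=
  iteratedDeriv_sum_of_contDiffOn hI _ (fun Y hY => hh.smooth b Y (Finset.mem_powerset.1 hY)) i ht

theorem IsTimeFamily.iteratedDeriv_siteTerm (hI : IsOpen I) (hc : IsTimeFamily I Λ δ c) (b : σ)
    (y : Site d) (i : ℕ) {t : ℝ} (ht : t ∈ I) :
    iteratedDeriv i (fun t => siteTerm (Λ b) (c b t) y) t =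
      siteTerm (Λ b) (fun Y => iteratedDeriv i (fun τ => c b τ Y) t) y := by
  have hs : ∀ Y ∈ (Λ b).powerset.filter (fun X => y ∈ X), ContDiffOn ℝ ∞ (fun t => c b t Y) I :=
    fun Y hY => hc.smooth b Y (Finset.mem_powerset.1 (Finset.mem_filter.1 hY).1)
  unfold siteTerm
  rw [iteratedDeriv_sum_of_contDiffOn hI _ (fun Y hY => (hs Y hY).const_smul _) i ht]
  exact Finset.sum_congr rfl fun Y hY =>
    iteratedDeriv_smul_of_contDiffOn hI (hs Y hY) _ i ht

/-- The time derivatives of the interactions, indexed by the points of `I`. -/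
def timeJet (I : Set ℝ) (h : σ → ℝ → Finset (Site d) → Obs d r) (i : ℕ) (b : σ × I)
    (Y : Finset (Site d)) : Obs d r :=
  iteratedDeriv i (fun τ => h b.1 τ Y) b.2

/-- The time derivatives of the evolved operators. -/
def timeFlow (I : Set ℝ) (Λ : σ → Finset (Site d)) (x : σ → Site d)
    (h c : σ → ℝ → Finset (Site d) → Obs d r) (i : ℕ) (b : σ × I) (v : ℝ) : Obs d r :=
  iteratedDeriv i (fun τ => heisenberg (totalOp (Λ b.1) (h b.1 τ)) v
    (siteTerm (Λ b.1) (c b.1 τ) (x b.1))) b.2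

theorem IsTimeFamily.isInteractionJet (hI : IsOpen I) (hh : IsTimeFamily I Λ δ h)
    (hexp : HasExpDecay I Λ δ h) :
    IsInteractionJet (fun b : σ × I => Λ b.1) (fun b => δ b.1) (timeJet I h) where
  isLocal i b Y hY := iteratedDeriv_mem_of_isClosed hI (hh.smooth b.1 Y hY)
    (isClosed_localTerms Y) (fun t ht => hh.isLocal b.1 t ht Y hY) i b.2.2
  bdd i n := by
    obtain ⟨C, hC, h1⟩ := hh.bdd i n
    exact ⟨C, hC, fun b z hz => h1 b.1 b.2 b.2.2 z hz⟩
  exp_decay := by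
    obtain ⟨a, ha, K, hK, h1⟩ := hexp
    refine ⟨a, ha, K, hK, fun b y hy z hz => ?_⟩
    have e : timeJet I h 0 b = h b.1 b.2 := by
      funext Y
      simp [timeJet]
    rw [e]
    exact h1 b.1 b.2 b.2.2 y hy z hz

theorem IsTimeFamily.isFlow (hI : IsOpen I) (hh : IsTimeFamily I Λ δ h)
    (hc : IsTimeFamily I Λ δ c) (x : σ → Site d) :
    IsFlow (fun b : σ × I => Λ b.1) (timeJet I h) (timeFlow I Λ x h c) := by
  intro i b v
  have key := hasDerivAt_iteratedDeriv_heisenberg hI (hh.contDiffOn_totalOp b.1)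
    (hc.contDiffOn_siteTerm b.1 (x b.1)) i b.2.2 v
  refine key.congr_deriv ?_
  rw [Finset.sum_range_succ, add_comm]
  simp only [fun j => hh.iteratedDeriv_totalOp hI b.1 j b.2.2]
  congr 1
  simp only [Nat.choose_self, Nat.cast_one, one_smul, Nat.sub_self]
  rfl

theorem IsTimeFamily.timeFlow_zero (hI : IsOpen I) (hc : IsTimeFamily I Λ δ c) (x : σ → Site d)
    (h : σ → ℝ → Finset (Site d) → Obs d r) (i : ℕ) (b : σ × I) :
    timeFlow I Λ x h c i b 0 =
      siteTerm (Λ b.1) (fun Y => iteratedDeriv i (fun τ => c b.1 τ Y) b.2) (x b.1) := by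
  unfold timeFlow
  simp only [heisenberg_zero]
  exact hc.iteratedDeriv_siteTerm hI b.1 (x b.1) i b.2.2

theorem IsTimeFamily.timeFlow_init (hI : IsOpen I) (hS : IsRegularFamily Λ δ x s ν)
    (hc : IsTimeFamily I Λ δ c) (h : σ → ℝ → Finset (Site d) → Obs d r) (i p : ℕ) :
    ∃ C : ℝ, 0 ≤ C ∧ ∀ b : σ × I,
      LocBd (Λ b.1) (δ b.1) (x b.1) p (timeFlow I Λ x h c i b 0) C := by
  obtain ⟨C, hC, h1⟩ := hc.bdd i p
  refine ⟨2 * C, by positivity, fun b => ?_⟩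
  rw [hc.timeFlow_zero hI]
  have h2 := siteTerm_locBd (Λ := Λ b.1) (δ := δ b.1) (x := x b.1)
    (c := fun Y => iteratedDeriv i (fun τ => c b.1 τ Y) b.2)
    (fun Y hY => iteratedDeriv_mem_of_isClosed hI (hc.smooth b.1 Y hY)
      (isClosed_localTerms Y) (fun t ht => hc.isLocal b.1 t ht Y hY) i b.2.2)
    (fun z hz => (hS.regular b.1).nonneg (hS.mem b.1) hz) p
  exact h2.mono (by linarith [h1 b.1 b.2 b.2.2 (x b.1) (hS.mem b.1)])

theorem IsRegularFamily.prod (hS : IsRegularFamily Λ δ x s ν) (I : Set ℝ) :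
    IsRegularFamily (fun b : σ × I => Λ b.1) (fun b => δ b.1) (fun b => x b.1) s ν :=
  ⟨fun b => hS.regular b.1, fun b => hS.mem b.1⟩

theorem IsTimeFamily.norm_timeFlow_le (hI : IsOpen I) (hS : IsRegularFamily Λ δ x s ν)
    (hh : IsTimeFamily I Λ δ h) (hexp : HasExpDecay I Λ δ h) (hc : IsTimeFamily I Λ δ c) (i : ℕ) :
    ∃ (C : ℝ) (q : ℕ), 0 ≤ C ∧ ∀ (b : σ × I) v, ‖timeFlow I Λ x h c i b v‖ ≤ C * (1 + |v|) ^ q := by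
  obtain ⟨C, q, hC, h1⟩ := (hh.isFlow hI hc x).polyLoc (hS.prod I) (hh.isInteractionJet hI hexp)
    (fun i p => hc.timeFlow_init hI hS h i p) i 0
  exact ⟨C, q, hC, fun b v => (h1 b v).1⟩

variable {μ : Measure α} {κ V : α → ℝ}

theorem IsTimeFamily.hasDerivAt_integral_timeFlow (hI : IsOpen I) (hκ : IsPolyKernel μ κ V)
    (hS : IsRegularFamily Λ δ x s ν) (hh : IsTimeFamily I Λ δ h) (hexp : HasExpDecay I Λ δ h)
    (hc : IsTimeFamily I Λ δ c) (b : σ) (i : ℕ) {t : ℝ} (ht : t ∈ I) :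
    HasDerivAt (fun τ => ∫ p, κ p • iteratedDeriv i (fun τ => heisenberg (totalOp (Λ b) (h b τ))
        (V p) (siteTerm (Λ b) (c b τ) (x b))) τ ∂μ)
      (∫ p, κ p • iteratedDeriv (i + 1) (fun τ => heisenberg (totalOp (Λ b) (h b τ))
        (V p) (siteTerm (Λ b) (c b τ) (x b))) t ∂μ) t := by
  obtain ⟨C, q, -, h1⟩ := hh.norm_timeFlow_le hI hS hexp hc i
  obtain ⟨C', q', -, h2⟩ := hh.norm_timeFlow_le hI hS hexp hc (i + 1)
  have hF := hh.isFlow hI hc x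
  exact hκ.hasDerivAt_integral hI
    (G := fun τ v => iteratedDeriv i (fun τ => heisenberg (totalOp (Λ b) (h b τ))
        v (siteTerm (Λ b) (c b τ) (x b))) τ)
    (G' := fun τ v => iteratedDeriv (i + 1) (fun τ => heisenberg (totalOp (Λ b) (h b τ))
        v (siteTerm (Λ b) (c b τ) (x b))) τ)
    (fun τ hτ => hF.continuous i (b, ⟨τ, hτ⟩)) (fun τ hτ => hF.continuous (i + 1) (b, ⟨τ, hτ⟩))
    (fun τ hτ v => h1 (b, ⟨τ, hτ⟩) v) (fun τ hτ v => h2 (b, ⟨τ, hτ⟩) v)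
    (fun τ hτ v => hasDerivAt_iteratedDeriv_heisenberg_time hI (hh.contDiffOn_totalOp b)
      (hc.contDiffOn_siteTerm b (x b)) i hτ v) ht

theorem IsTimeFamily.contDiffOn_siteAvg (hI : IsOpen I) (hκ : IsPolyKernel μ κ V)
    (hS : IsRegularFamily Λ δ x s ν) (hh : IsTimeFamily I Λ δ h) (hexp : HasExpDecay I Λ δ h)
    (hc : IsTimeFamily I Λ δ c) (b : σ) :
    ContDiffOn ℝ ∞ (fun t => siteAvg μ κ V (Λ b) (h b t) (c b t) (x b)) I := by
  have := contDiffOn_of_hasDerivAt hI fun i t ht =>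
    hh.hasDerivAt_integral_timeFlow hI hκ hS hexp hc b i ht
  simp only [iteratedDeriv_zero] at this
  exact this

theorem IsTimeFamily.iteratedDeriv_siteAvg (hI : IsOpen I) (hκ : IsPolyKernel μ κ V)
    (hS : IsRegularFamily Λ δ x s ν) (hh : IsTimeFamily I Λ δ h) (hexp : HasExpDecay I Λ δ h)
    (hc : IsTimeFamily I Λ δ c) (i : ℕ) (b : σ × I) :
    iteratedDeriv i (fun t => siteAvg μ κ V (Λ b.1) (h b.1 t) (c b.1 t) (x b.1)) b.2 =
      ∫ p, κ p • timeFlow I Λ x h c i b (V p) ∂μ := by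
  have := iteratedDeriv_eq_of_hasDerivAt hI (fun i t ht =>
    hh.hasDerivAt_integral_timeFlow hI hκ hS hexp hc b.1 i ht) i b.2.2
  simp only [iteratedDeriv_zero] at this
  exact this

/-- Uniform bounds for the time derivatives of the averaged evolution. -/
theorem IsTimeFamily.norm_siteAvg_le (hI : IsOpen I) (hκ : IsPolyKernel μ κ V)
    (hS : IsRegularFamily Λ δ x s ν) (hh : IsTimeFamily I Λ δ h) (hexp : HasExpDecay I Λ δ h)
    (hc : IsTimeFamily I Λ δ c) (i : ℕ) : ∃ C : ℝ, 0 ≤ C ∧ ∀ b, ∀ t ∈ I,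
      ‖iteratedDeriv i (fun t => siteAvg μ κ V (Λ b) (h b t) (c b t) (x b)) t‖ ≤ C := by
  obtain ⟨C, q, hC, h1⟩ := hh.norm_timeFlow_le hI hS hexp hc i
  refine ⟨C * ∫ p, |κ p| * (1 + |V p|) ^ q ∂μ, mul_nonneg hC (IsPolyKernel.moment_nonneg q),
    fun b t ht => ?_⟩
  rw [hh.iteratedDeriv_siteAvg hI hκ hS hexp hc i (b, ⟨t, ht⟩)]
  exact hκ.norm_integral_le fun v => h1 (b, ⟨t, ht⟩) v

/-- The averaged evolutions of two systems that agree near the marked site are close. -/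
theorem TimeClose.norm_siteAvg_sub_le (hI : IsOpen I) (hκ : IsPolyKernel μ κ V)
    (hS : IsRegularFamily Λ δ x s ν) {L : σ → ℝ} (hL : ∀ b, 0 ≤ L b)
    (hh : IsTimeFamily I Λ δ h) (hexp : HasExpDecay I Λ δ h) (hc : IsTimeFamily I Λ δ c)
    (hh' : IsTimeFamily I Λ δ h') (hexp' : HasExpDecay I Λ δ h') (hc' : IsTimeFamily I Λ δ c')
    (hhh : TimeClose I Λ δ x L h h') (hcc : TimeClose I Λ δ x L c c') (i p : ℕ) :
    ∃ C : ℝ, 0 ≤ C ∧ ∀ b, ∀ t ∈ I,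
      ‖iteratedDeriv i (fun t => siteAvg μ κ V (Λ b) (h b t) (c b t) (x b)) t -
        iteratedDeriv i (fun t => siteAvg μ κ V (Λ b) (h' b t) (c' b t) (x b)) t‖ *
          (1 + L b) ^ p ≤ C := by
  have hF := hh.isFlow hI hc x
  have hF' := hh'.isFlow hI hc' x
  obtain ⟨C1, q1, -, h1⟩ := hh.norm_timeFlow_le hI hS hexp hc i
  obtain ⟨C2, q2, -, h2⟩ := hh'.norm_timeFlow_le hI hS hexp' hc' i
  obtain ⟨C, q, hC, h3⟩ := hF.polySmall_sub (hS.prod I) (L := fun b => L b.1) (fun b => hL b.1)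
    (hh.isInteractionJet hI hexp) (hh'.isInteractionJet hI hexp')
    (fun i p => by
      obtain ⟨C, hC, h1⟩ := hhh i p
      exact ⟨C, hC, fun b z hz => h1 b.1 b.2 b.2.2 z hz⟩) hF'
    (fun i p => hc.timeFlow_init hI hS h i p) (fun i p => hc'.timeFlow_init hI hS h' i p)
    (fun i p => by
      obtain ⟨C, hC, h1⟩ := hcc i p
      refine ⟨C, hC, fun b => ?_⟩
      -- At the marked site the distance weight equals `1`, so closeness of the interactions bounds
      -- the difference of the initial values.
      have h2 := h1 b.1 b.2 b.2.2 (x b.1) (hS.mem b.1)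
      rw [(hS.regular b.1).self _ (hS.mem b.1), add_zero, one_pow, mul_one] at h2
      rw [hc.timeFlow_zero hI, hc'.timeFlow_zero hI]
      refine le_trans (mul_le_mul_of_nonneg_right (norm_siteTerm_sub_le _ _ _ _) ?_) h2
      exact pow_nonneg (by linarith [hL b.1]) p) i p
  refine ⟨C * ∫ p, |κ p| * (1 + |V p|) ^ q ∂μ, mul_nonneg hC (IsPolyKernel.moment_nonneg q),
    fun b t ht => ?_⟩
  have hL1 : 0 < (1 + L b) ^ p := pow_pos (by linarith [hL b]) p
  rw [hh.iteratedDeriv_siteAvg hI hκ hS hexp hc i (b, ⟨t, ht⟩),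
    hh'.iteratedDeriv_siteAvg hI hκ hS hexp' hc' i (b, ⟨t, ht⟩),
    ← integral_sub (hκ.integrable_smul (hF.continuous i _) (h1 _))
      (hκ.integrable_smul (hF'.continuous i _) (h2 _)), ← le_div_iff₀ hL1]
  simp only [← smul_sub]
  refine (hκ.norm_integral_le (C := C / (1 + L b) ^ p) (q := q)
    (G := fun v => timeFlow I Λ x h c i (b, ⟨t, ht⟩) v - timeFlow I Λ x h' c' i (b, ⟨t, ht⟩) v)
    fun v => ?_).trans (le_of_eq (by ring))
  have := h3 (b, ⟨t, ht⟩) v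
  rw [div_mul_eq_mul_div, le_div_iff₀ hL1]
  exact this

end

end

section

variable {d r : ℕ}

/-! ### The inverse Liouvillian as an average of an evolved commutator -/

/-- The measure on `ℝ × [0,1]`. -/
def stripMeasure : Measure (ℝ × ℝ) :=
  (volume : Measure ℝ).prod ((volume : Measure ℝ).restrict (Set.Ioc 0 1))

/-- The weight of the time `s θ`. -/
def stripKernel (w : ℝ → ℝ) (p : ℝ × ℝ) : ℝ := w p.1 * (p.1 ^ 2 * (1 - p.2))

theorem integrable_mul_one_add_abs_pow {w : ℝ → ℝ} (hw : Integrable w)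
    (hdecay : ∀ n : ℕ, ∃ C, ∀ s, |s| ^ n * |w s| ≤ C) (m : ℕ) :
    Integrable (fun s => |w s| * (1 + |s|) ^ m) := by
  obtain ⟨C0, hC0⟩ := hdecay 0
  -- Two extra powers make the integrand comparable with `1 / (1 + s²)`.
  obtain ⟨C1, hC1⟩ := hdecay (m + 2)
  have hmeas : AEStronglyMeasurable (fun s => |w s| * (1 + |s|) ^ m) volume :=
    hw.aestronglyMeasurable.norm.mul (by fun_prop)
  refine (integrable_inv_one_add_sq.const_mul (2 ^ (m + 2) * (C0 + C1))).mono' hmeas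
    (Filter.Eventually.of_forall fun s => ?_)
  rw [Real.norm_of_nonneg (by positivity), ← div_eq_mul_inv, le_div_iff₀ (by positivity)]
  have h1 : (1 + s ^ 2) ≤ (1 + |s|) ^ 2 := by
    rw [← sq_abs s]; nlinarith [abs_nonneg s]
  have h2 : (1 + |s|) ^ (m + 2) ≤ 2 ^ (m + 2) * (1 + |s| ^ (m + 2)) := by
    have h := add_pow_le (zero_le_one) (abs_nonneg s) (m + 2)
    rw [one_pow] at h
    refine h.trans (mul_le_mul_of_nonneg_right ?_ (by positivity))
    exact pow_le_pow_right₀ (by norm_num) (by omega)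
  have h3 := hC0 s
  rw [pow_zero, one_mul] at h3
  calc |w s| * (1 + |s|) ^ m * (1 + s ^ 2) ≤ |w s| * (1 + |s|) ^ m * (1 + |s|) ^ 2 := by gcongr
    _ = |w s| * (1 + |s|) ^ (m + 2) := by ring
    _ ≤ |w s| * (2 ^ (m + 2) * (1 + |s| ^ (m + 2))) := by gcongr
    _ = 2 ^ (m + 2) * (|w s| + |s| ^ (m + 2) * |w s|) := by ring
    _ ≤ 2 ^ (m + 2) * (C0 + C1) := by
      gcongr
      exact hC1 s

theorem isPolyKernel_strip {w : ℝ → ℝ} (hw : Integrable w)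
    (hdecay : ∀ n : ℕ, ∃ C, ∀ s, |s| ^ n * |w s| ≤ C) :
    IsPolyKernel stripMeasure (stripKernel w) (fun p => p.1 * p.2) where
  aestronglyMeasurable := by
    have h1 : AEStronglyMeasurable (fun p : ℝ × ℝ => w p.1) stripMeasure :=
      hw.aestronglyMeasurable.comp_fst
    exact h1.mul (by fun_prop : Continuous fun p : ℝ × ℝ => p.1 ^ 2 * (1 - p.2)).aestronglyMeasurable
  measurable := by fun_prop
  moment q := by
    have h1 : AEStronglyMeasurable (fun p : ℝ × ℝ => w p.1) stripMeasure :=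
      hw.aestronglyMeasurable.comp_fst
    -- The two additional powers account for the factor `s²` of the strip kernel.
    have h2 := (integrable_mul_one_add_abs_pow hw hdecay (q + 2)).mul_prod
      (integrable_const (μ := (volume : Measure ℝ).restrict (Set.Ioc 0 1)) (1 : ℝ))
    refine h2.mono' ?_ ?_
    · refine AEStronglyMeasurable.mul ?_ (by fun_prop : Continuous fun p : ℝ × ℝ =>
        (1 + |p.1 * p.2|) ^ q).aestronglyMeasurable
      exact (h1.mul (by fun_prop : Continuous fun p : ℝ × ℝ =>
        p.1 ^ 2 * (1 - p.2)).aestronglyMeasurable).norm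
    · have e : stripMeasure = (volume : Measure (ℝ × ℝ)).restrict (Set.univ ×ˢ Set.Ioc 0 1) := by
        rw [stripMeasure, Measure.volume_eq_prod, ← Measure.prod_restrict, Measure.restrict_univ]
      rw [← stripMeasure, e]
      refine ae_restrict_of_forall_mem (MeasurableSet.univ.prod measurableSet_Ioc) fun p hp => ?_
      obtain ⟨h0, h1⟩ := hp.2
      rw [Real.norm_of_nonneg (by positivity), stripKernel, abs_mul, mul_one, abs_mul p.1 p.2,
        abs_of_pos h0, abs_of_nonneg (by nlinarith [sq_nonneg p.1] : 0 ≤ p.1 ^ 2 * (1 - p.2)),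
        ← sq_abs p.1, mul_assoc, pow_add, mul_comm ((1 + |p.1|) ^ q)]
      have a0 := abs_nonneg p.1
      gcongr |w p.1| * ?_
      have h3 : |p.1| ^ 2 * (1 - p.2) ≤ (1 + |p.1|) ^ 2 := by nlinarith [sq_nonneg |p.1|]
      have h4 : (1 + |p.1| * p.2) ^ q ≤ (1 + |p.1|) ^ q :=
        pow_le_pow_left₀ (by positivity) (by nlinarith) q
      exact mul_le_mul h3 h4 (by positivity) (by positivity)

/-- Taylor's formula with integral remainder, obtained by integrating the derivative of `s (1 - θ)
τ_{sθ}(B)` over `θ ∈ [0,1]`. -/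
theorem integral_heisenberg_eq (H B : Obs d r) (s : ℝ) :
    ∫ u in (0 : ℝ)..s, heisenberg H u B = s • B + s ^ 2 • ∫ θ in (0 : ℝ)..1, (1 - θ) •
      heisenberg H (s * θ) (Complex.I • (H * B - B * H)) := by
  have hB : Continuous fun u => heisenberg H u B := continuous_heisenberg H continuous_const
  have hC : Continuous fun u => heisenberg H u (Complex.I • (H * B - B * H)) :=
    continuous_heisenberg H continuous_const
  have hd : ∀ θ : ℝ, HasDerivAt (fun θ : ℝ => (s * (1 - θ)) • heisenberg H (s * θ) B)
      (s ^ 2 • ((1 - θ) • heisenberg H (s * θ) (Complex.I • (H * B - B * H))) -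
        s • heisenberg H (s * θ) B) θ := by
    intro θ
    have h1 : HasDerivAt (fun θ : ℝ => s * (1 - θ)) (-s) θ :=
      (((hasDerivAt_id θ).const_sub 1).const_mul s).congr_deriv (by ring)
    have h2 : HasDerivAt (fun θ : ℝ => s * θ) s θ :=
      ((hasDerivAt_id θ).const_mul s).congr_deriv (by ring)
    have h3 : HasDerivAt (fun θ : ℝ => heisenberg H (s * θ) B)
        (s • heisenberg H (s * θ) (Complex.I • (H * B - B * H))) θ := by
      have h4 := hasDerivAt_heisenberg H (hasDerivAt_const (s * θ) B)
      rw [zero_add] at h4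
      exact h4.scomp θ h2
    refine (h1.smul h3).congr_deriv ?_
    rw [smul_smul, smul_smul, neg_smul, ← sub_eq_add_neg]
    congr 2
    ring
  have h1 := intervalIntegral.integral_eq_sub_of_hasDerivAt (a := 0) (b := 1)
    (fun θ _ => hd θ) ((by fun_prop : Continuous _).intervalIntegrable 0 1)
  rw [intervalIntegral.integral_sub ((by fun_prop : Continuous _).intervalIntegrable 0 1)
    ((by fun_prop : Continuous _).intervalIntegrable 0 1), intervalIntegral.integral_smul,
    intervalIntegral.integral_smul,
    intervalIntegral.smul_integral_comp_mul_left (fun u => heisenberg H u B)] at h1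
  simp only [mul_zero, mul_one, sub_self, zero_smul, sub_zero, heisenberg_zero, zero_sub] at h1
  rw [sub_eq_iff_eq_add] at h1
  rw [h1]
  abel

theorem integral_even_mul_self {w : ℝ → ℝ} (heven : ∀ s, w (-s) = w s) : ∫ s, w s * s = 0 := by
  have h := integral_neg_eq_self (fun s => w s * s) volume
  simp only [heven, mul_neg, integral_neg] at h
  linarith

/-- The term `s B` of Taylor's formula integrates to zero against an even kernel, and in the
remainder `B` occurs only through its commutator with `H`. This matters for potentials, whose values
may grow with the volume while the commutator is a sum of uniformly bounded local terms. -/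
theorem invLiouvillian_eq {w : ℝ → ℝ} (hw : Integrable w) (heven : ∀ s, w (-s) = w s)
    (hdecay : ∀ n : ℕ, ∃ C, ∀ s, |s| ^ n * |w s| ≤ C) {H : Obs d r} (hH : IsSelfAdjoint H)
    (B : Obs d r) : invLiouvillian w H B = evolvedAvg stripMeasure (stripKernel w)
      (fun p => p.1 * p.2) H (Complex.I • (H * B - B * H)) := by
  have hC : Continuous fun u => heisenberg H u (Complex.I • (H * B - B * H)) :=
    continuous_heisenberg H continuous_const
  have hint := (isPolyKernel_strip hw hdecay).integrable_smul hC (q := 0)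
    (C := ‖Complex.I • (H * B - B * H)‖) fun v => by
      rw [norm_heisenberg hH, pow_zero, mul_one]
  have hwi : Integrable fun s => w s * s := by
    refine (integrable_mul_one_add_abs_pow hw hdecay 1).mono'
      (hw.aestronglyMeasurable.mul continuous_id.aestronglyMeasurable)
      (Filter.Eventually.of_forall fun s => ?_)
    rw [Real.norm_eq_abs, abs_mul, pow_one]
    gcongr
    linarith
  unfold invLiouvillian evolvedAvg
  rw [stripMeasure] at hint ⊢
  rw [integral_prod _ hint]
  have e : ∀ s, w s • ∫ u in (0 : ℝ)..s, heisenberg H u B = (w s * s) • B +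
      ∫ θ in Set.Ioc (0 : ℝ) 1, stripKernel w (s, θ) •
        heisenberg H (s * θ) (Complex.I • (H * B - B * H)) := by
    intro s
    rw [integral_heisenberg_eq, smul_add, smul_smul, smul_smul,
      intervalIntegral.integral_of_le zero_le_one, ← integral_smul]
    congr 2
    funext θ
    rw [smul_smul, stripKernel, mul_assoc]
  simp only [e]
  rw [integral_add (hwi.smul_const B) hint.integral_prod_left, integral_smul_const,
    integral_even_mul_self heven, zero_smul, zero_add]

theorem scaleKernel_even {w : ℝ → ℝ} (hw : IsGapKernel w) (g s : ℝ) :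
    scaleKernel w g (-s) = scaleKernel w g s := by
  unfold scaleKernel
  rw [mul_neg, hw.even]

theorem scaleKernel_integrable {w : ℝ → ℝ} (hw : IsGapKernel w) {g : ℝ} (hg : 0 < g) :
    Integrable (scaleKernel w g) :=
  (hw.integrable.comp_mul_left' hg.ne').const_mul g

theorem scaleKernel_decay {w : ℝ → ℝ} (hw : IsGapKernel w) {g : ℝ} (hg : 0 < g) (n : ℕ) :
    ∃ C, ∀ s, |s| ^ n * |scaleKernel w g s| ≤ C := by
  obtain ⟨C, hC⟩ := hw.decay n
  refine ⟨g / g ^ n * C, fun s => ?_⟩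
  have h := mul_le_mul_of_nonneg_left (hC (g * s)) (by positivity : 0 ≤ g / g ^ n)
  refine le_trans (le_of_eq ?_) h
  rw [scaleKernel, abs_mul, abs_mul, abs_of_pos hg, mul_pow]
  field_simp

end

section

variable {d r : ℕ}

/-! ### Geometry of boxes and balls -/

theorem mem_box {k : ℕ} {x : Site d} : x ∈ box d k ↔ ∀ j, |x j| ≤ k := by
  simp [box, Fintype.mem_piFinset, abs_le]

theorem box_mono {k m : ℕ} (h : k ≤ m) : box d k ⊆ box d m := by
  intro x hx
  rw [mem_box] at hx ⊢
  exact fun j => (hx j).trans (by exact_mod_cast h)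

theorem l1Dist_nonneg (x y : Site d) : 0 ≤ l1Dist x y :=
  Finset.sum_nonneg fun _ _ => abs_nonneg _

theorem abs_sub_le_l1Dist (x y : Site d) (j : Fin d) : |((x j - y j : ℤ) : ℝ)| ≤ l1Dist x y :=
  Finset.single_le_sum (f := fun j => |((x j - y j : ℤ) : ℝ)|) (fun _ _ => abs_nonneg _)
    (Finset.mem_univ j)

theorem l1Dist_le_of_mem_box {k : ℕ} {x y : Site d} (hx : x ∈ box d k) (hy : y ∈ box d k) :
    l1Dist x y ≤ 2 * d * k := by
  rw [mem_box] at hx hy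
  unfold l1Dist
  refine (Finset.sum_le_sum (g := fun _ => (2 * k : ℝ)) fun j _ => ?_).trans (le_of_eq ?_)
  · have h : |x j - y j| ≤ 2 * k := (abs_sub _ _).trans (by linarith [hx j, hy j])
    exact_mod_cast h
  · simp
    ring

/-- The `ℓ¹`-ball of radius `l` around `x`. -/
def ball1 (x : Site d) (l : ℕ) : Finset (Site d) :=
  (Fintype.piFinset fun j => Finset.Icc (x j - l) (x j + l)).filter fun y => l1Dist x y ≤ l

theorem mem_ball1 {x y : Site d} {l : ℕ} : y ∈ ball1 x l ↔ l1Dist x y ≤ l := by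
  unfold ball1
  rw [Finset.mem_filter, and_iff_right_iff_imp, Fintype.mem_piFinset]
  intro h j
  have h1 := (abs_sub_le_l1Dist x y j).trans h
  have h2 : |x j - y j| ≤ l := by exact_mod_cast h1
  rw [abs_le] at h2
  rw [Finset.mem_Icc]
  constructor <;> linarith [h2.1, h2.2]

theorem self_mem_ball1 (x : Site d) (l : ℕ) : x ∈ ball1 x l := by
  rw [mem_ball1, (l1Dist_eq_zero_iff x x).2 rfl]
  positivity

theorem ball1_mono (x : Site d) {l m : ℕ} (h : l ≤ m) : ball1 x l ⊆ ball1 x m := by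
  intro y hy
  rw [mem_ball1] at hy ⊢
  exact hy.trans (by exact_mod_cast h)

/-- The site `x` shifted by `m` away from the origin, in direction `j`. -/
def shiftOut (x : Site d) (j : Fin d) (m : ℕ) : Site d :=
  Function.update x j (if 0 ≤ x j then x j + m else x j - m)

theorem abs_shiftOut (x : Site d) (j : Fin d) (m : ℕ) : |shiftOut x j m j| = |x j| + m := by
  unfold shiftOut
  rw [Function.update_self]
  split_ifs with h
  · rw [abs_of_nonneg h, abs_of_nonneg (by positivity)]
  · rw [abs_of_neg (by omega), abs_of_neg (by omega)]
    ring

theorem l1Dist_shiftOut (x : Site d) (j : Fin d) (m : ℕ) : l1Dist x (shiftOut x j m) = m := by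
  unfold l1Dist
  rw [Finset.sum_eq_single j]
  · unfold shiftOut
    rw [Function.update_self]
    split_ifs <;> simp
  · intro i _ hi
    simp [shiftOut, Function.update_of_ne hi]
  · simp

/-- The supremum norm. -/
def supNorm (x : Site d) : ℕ := Finset.univ.sup fun j => (x j).natAbs

theorem mem_box_iff_supNorm {k : ℕ} {x : Site d} : x ∈ box d k ↔ supNorm x ≤ k := by
  rw [mem_box, supNorm, Finset.sup_le_iff]
  refine ⟨fun h j _ => ?_, fun h j => ?_⟩
  · have := h j
    rw [Int.abs_eq_natAbs] at this
    omega
  · have := h j (Finset.mem_univ j)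
    rw [Int.abs_eq_natAbs]
    omega

theorem ball1_subset_box {x : Site d} {l k : ℕ} (h : supNorm x + l ≤ k) : ball1 x l ⊆ box d k := by
  intro y hy
  rw [mem_box]
  intro j
  have h1 := (abs_sub_le_l1Dist x y j).trans (mem_ball1.1 hy)
  have h2 : |x j - y j| ≤ l := by exact_mod_cast h1
  have h3 : (x j).natAbs ≤ supNorm x := Finset.le_sup (f := fun j => (x j).natAbs)
    (Finset.mem_univ j)
  rw [abs_le] at h2 ⊢
  omega

/-- In positive dimension there is a site of the next larger box at the distance to the
complement. -/
theorem exists_mem_box_succ (hd : 0 < d) {x : Site d} {N : ℕ} (hx : x ∈ box d N) :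
    ∃ y ∈ box d (N + 1), y ∉ box d N ∧ l1Dist x y = (N - supNorm x + 1 : ℕ) := by
  obtain ⟨j, -, hj⟩ := Finset.exists_mem_eq_sup (Finset.univ : Finset (Fin d))
    ⟨⟨0, hd⟩, Finset.mem_univ _⟩ (fun j => (x j).natAbs)
  have hle := mem_box_iff_supNorm.1 hx
  change supNorm x = _ at hj
  refine ⟨shiftOut x j (N - supNorm x + 1), ?_, ?_, l1Dist_shiftOut _ _ _⟩
  · rw [mem_box]
    intro i
    by_cases hi : i = j
    · subst hi
      rw [abs_shiftOut, Int.abs_eq_natAbs]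
      omega
    · rw [shiftOut, Function.update_of_ne hi]
      have := mem_box.1 hx i
      omega
  · intro h
    have := mem_box.1 h j
    rw [abs_shiftOut, Int.abs_eq_natAbs] at this
    omega

theorem ball1_subset_box_iff (hd : 0 < d) {x : Site d} {l k : ℕ} :
    ball1 x l ⊆ box d k ↔ supNorm x + l ≤ k := by
  refine ⟨fun h => ?_, ball1_subset_box⟩
  by_contra hlt
  have hx := h (self_mem_ball1 x l)
  have hle := mem_box_iff_supNorm.1 hx
  obtain ⟨y, -, hy, hxy⟩ := exists_mem_box_succ hd hx
  refine hy (h (mem_ball1.2 ?_))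
  rw [hxy]
  exact_mod_cast (by omega : k - supNorm x + 1 ≤ l)

/-- The shifts of `x` by `0, …, l` in one direction are distinct points of the ball. Consequently
the cutoff `l < Z.card` in `limitTerm` omits no ball in positive dimension. -/
theorem lt_card_ball1 (hd : 0 < d) (x : Site d) (l : ℕ) : l < (ball1 x l).card := by
  have h1 : ((Finset.range (l + 1)).image (shiftOut x ⟨0, hd⟩)) ⊆ ball1 x l := by
    intro y hy
    obtain ⟨m, hm, rfl⟩ := Finset.mem_image.1 hy
    rw [mem_ball1, l1Dist_shiftOut]
    exact_mod_cast Finset.mem_range_succ_iff.1 hm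
  have h2 := Finset.card_le_card h1
  rw [Finset.card_image_of_injective, Finset.card_range] at h2
  · omega
  · intro m m' h
    have h3 := l1Dist_shiftOut x ⟨0, hd⟩ m
    rw [h, l1Dist_shiftOut] at h3
    exact_mod_cast h3.symm

theorem ball1_eq_of_dim_zero (x : Site 0) (l : ℕ) : ball1 x l = {x} := by
  ext y
  rw [Finset.mem_singleton, Subsingleton.elim y x]
  simp [self_mem_ball1]

theorem box_subset_of_lt {N k : ℕ} (hd : 0 < d) (h : box d k ⊆ box d N) : k ≤ N := by
  have hx : (fun _ => (k : ℤ) : Site d) ∈ box d k := mem_box.2 fun j => by simp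
  have := mem_box.1 (h hx) ⟨0, hd⟩
  simpa using this

/-! ### Volume growth -/

/-- Bound for the one-dimensional sums. -/
def lineBound : ℝ := ∑' m : ℤ, ((1 + |(m : ℝ)|) ^ 2)⁻¹

theorem summable_line : Summable fun m : ℤ => ((1 + |(m : ℝ)|) ^ 2)⁻¹ := by
  have h : Summable fun n : ℕ => ((1 + (n : ℝ)) ^ 2)⁻¹ := by
    have := (summable_nat_add_iff 1).2 (Real.summable_one_div_nat_pow (p := 2).2 (by norm_num))
    refine this.congr fun n => ?_
    push_cast
    rw [one_div, add_comm]
  refine Summable.of_nat_of_neg ?_ ?_ <;> simpa using h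

theorem lineBound_nonneg : 0 ≤ lineBound := tsum_nonneg fun m => by positivity

theorem sum_line_le (T : Finset ℤ) (a : ℤ) :
    ∑ m ∈ T, ((1 + |((a - m : ℤ) : ℝ)|) ^ 2)⁻¹ ≤ lineBound := by
  have h := Summable.sum_le_tsum (T.map (Equiv.subLeft a).toEmbedding)
    (fun m _ => by positivity) summable_line
  rw [Finset.sum_map] at h
  exact h

/-- The power `2d` of `1 + |x - y|` dominates the product of the squares `(1 + |x_j - y_j|)²`, so
the sum is bounded by a product of `d` one-dimensional sums. -/
theorem sum_inv_l1Dist_le (Z : Finset (Site d)) (x : Site d) :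
    ∑ y ∈ Z, ((1 + l1Dist x y) ^ (2 * d))⁻¹ ≤ lineBound ^ d := by
  classical
  have h1 : ∀ y : Site d, ((1 + l1Dist x y) ^ (2 * d))⁻¹ ≤
      ∏ j, ((1 + |((x j - y j : ℤ) : ℝ)|) ^ 2)⁻¹ := by
    intro y
    rw [Finset.prod_inv_distrib]
    refine inv_anti₀ (Finset.prod_pos fun j _ => by positivity) ?_
    rw [pow_mul]
    calc ∏ j, (1 + |((x j - y j : ℤ) : ℝ)|) ^ 2 ≤ ∏ _j : Fin d, (1 + l1Dist x y) ^ 2 :=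
          Finset.prod_le_prod (fun j _ => by positivity) fun j _ =>
            pow_le_pow_left₀ (by positivity) (by linarith [abs_sub_le_l1Dist x y j]) 2
      _ = _ := by simp
  have h2 : Z ⊆ Fintype.piFinset fun j => Z.image fun y => y j := by
    intro y hy
    exact Fintype.mem_piFinset.2 fun j => Finset.mem_image_of_mem _ hy
  calc ∑ y ∈ Z, ((1 + l1Dist x y) ^ (2 * d))⁻¹
      ≤ ∑ y ∈ Z, ∏ j, ((1 + |((x j - y j : ℤ) : ℝ)|) ^ 2)⁻¹ := Finset.sum_le_sum fun y _ => h1 y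
    _ ≤ ∑ y ∈ Fintype.piFinset fun j => Z.image fun y => y j,
        ∏ j, ((1 + |((x j - y j : ℤ) : ℝ)|) ^ 2)⁻¹ :=
      Finset.sum_le_sum_of_subset_of_nonneg h2 fun y _ _ =>
        Finset.prod_nonneg fun j _ => by positivity
    _ = ∏ j, ∑ m ∈ Z.image fun y => y j, ((1 + |((x j - m : ℤ) : ℝ)|) ^ 2)⁻¹ :=
      (Finset.prod_univ_sum (fun j => Z.image fun y => y j)
        (fun j m => ((1 + |((x j - m : ℤ) : ℝ)|) ^ 2)⁻¹)).symm
    _ ≤ ∏ _j : Fin d, lineBound :=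
      Finset.prod_le_prod (fun j _ => Finset.sum_nonneg fun m _ => by positivity)
        fun j _ => sum_line_le _ _
    _ = lineBound ^ d := by simp

theorem isRegularMetric_l1Dist (Z : Finset (Site d)) :
    IsRegularMetric Z l1Dist (2 * d) (lineBound ^ d) where
  self x _ := (l1Dist_eq_zero_iff x x).2 rfl
  symm x _ y _ := l1Dist_comm x y
  triangle x _ y _ z _ := l1Dist_triangle x y z
  sum_le x _ := sum_inv_l1Dist_le Z x

namespace BoxMetrics

variable (D : BoxMetrics d)

theorem dist_self {k : ℕ} {x : Site d} (hx : x ∈ box d k) : D.dist k x x = 0 :=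
  (D.dist_eq_zero_iff k x hx x hx).2 rfl

theorem dist_nonneg {k : ℕ} {x y : Site d} (hx : x ∈ box d k) (hy : y ∈ box d k) :
    0 ≤ D.dist k x y := by
  have h := D.dist_triangle k x hx y hy x hx
  rw [D.dist_self hx, D.dist_comm k y hy x hx] at h
  linarith

/-- The patch of the box containing `y`; the distances within a patch are `ℓ¹`-distances. -/
def patch (k : ℕ) (y : Site d) : Site d := fun j => (y j + k) / ((k / d + 1 : ℕ) : ℤ)

/-- Points of one patch differ by at most `⌊k/d⌋` in each of the `d` coordinates. Up to distance `k`
the box metric agrees with the `ℓ¹`-distance, which is why patches of this size are chosen. -/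
theorem l1Dist_le_of_patch_eq {k : ℕ} {y z : Site d} (h : patch k y = patch k z) :
    l1Dist y z ≤ k := by
  have h1 : ∀ j, |((y j - z j : ℤ) : ℝ)| ≤ ((k / d : ℕ) : ℝ) := by
    intro j
    have hj : (y j + k) / ((k / d + 1 : ℕ) : ℤ) = (z j + k) / ((k / d + 1 : ℕ) : ℤ) :=
      congrFun h j
    have hp : (0 : ℤ) < ((k / d + 1 : ℕ) : ℤ) := by positivity
    have a1 := Int.mul_ediv_add_emod (y j + k) ((k / d + 1 : ℕ) : ℤ)
    have a2 := Int.mul_ediv_add_emod (z j + k) ((k / d + 1 : ℕ) : ℤ)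
    have b1 := Int.emod_nonneg (y j + k) hp.ne'
    have b2 := Int.emod_nonneg (z j + k) hp.ne'
    have c1 := Int.emod_lt_of_pos (y j + k) hp
    have c2 := Int.emod_lt_of_pos (z j + k) hp
    rw [hj] at a1
    have : |y j - z j| ≤ ((k / d : ℕ) : ℤ) := by
      rw [abs_le]
      push_cast at *
      constructor <;> linarith
    have h3 : ((|y j - z j| : ℤ) : ℝ) ≤ (((k / d : ℕ) : ℤ) : ℝ) := Int.cast_le.2 this
    rwa [Int.cast_abs, Int.cast_natCast] at h3
  calc l1Dist y z ≤ ∑ _j : Fin d, ((k / d : ℕ) : ℝ) := Finset.sum_le_sum fun j _ => h1 j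
    _ = ((d * (k / d) : ℕ) : ℝ) := by simp
    _ ≤ k := by exact_mod_cast Nat.mul_div_le k d

theorem patch_mem {k : ℕ} {y : Site d} (hy : y ∈ box d k) :
    patch k y ∈ Fintype.piFinset fun _ : Fin d => Finset.Icc (0 : ℤ) (2 * d) := by
  rw [Fintype.mem_piFinset]
  intro j
  have hj := abs_le.1 (mem_box.1 hy j)
  rw [Finset.mem_Icc]
  have hp : (0 : ℤ) < ((k / d + 1 : ℕ) : ℤ) := by positivity
  refine ⟨Int.ediv_nonneg (by linarith [hj.1]) hp.le, ?_⟩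
  refine Int.ediv_le_of_le_mul hp ?_
  have hd : 0 < d := j.pos
  have h1 : k < d * (k / d + 1) := by
    have := Nat.div_add_mod k d
    have := Nat.mod_lt k hd
    rw [Nat.mul_add]
    omega
  have h2 : (k : ℤ) < d * ((k / d + 1 : ℕ) : ℤ) := by exact_mod_cast h1
  linarith [hj.2]

/-- Bound for the volume growth of the box metrics. -/
def volBound (d : ℕ) : ℝ := (2 * d + 1) ^ d * (2 ^ (2 * d) * lineBound ^ d)

/-- The box metric may be much smaller than the `ℓ¹`-distance to `x`, so `x` is replaced by the
point `y0` of the patch nearest to it. By the triangle inequality the distance from `y0` to `y` is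
at most twice that from `x` to `y`, and within the patch it is an `ℓ¹`-distance. -/
theorem sum_patch_le {k : ℕ} {x : Site d} (hx : x ∈ box d k) (q : Site d) :
    ∑ y ∈ box d k with patch k y = q, ((1 + D.dist k x y) ^ (2 * d))⁻¹ ≤
      2 ^ (2 * d) * lineBound ^ d := by
  rcases ((box d k).filter fun y => patch k y = q).eq_empty_or_nonempty with h | h
  · rw [h, Finset.sum_empty]
    exact mul_nonneg (by positivity) (pow_nonneg lineBound_nonneg d)
  · obtain ⟨y0, hy0, hmin⟩ := Finset.exists_min_image _ (fun y => D.dist k x y) h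
    obtain ⟨hy0b, hy0q⟩ := Finset.mem_filter.1 hy0
    calc ∑ y ∈ box d k with patch k y = q, ((1 + D.dist k x y) ^ (2 * d))⁻¹
        ≤ ∑ y ∈ box d k with patch k y = q, 2 ^ (2 * d) * ((1 + l1Dist y0 y) ^ (2 * d))⁻¹ := by
          refine Finset.sum_le_sum fun y hy => ?_
          obtain ⟨hyb, hyq⟩ := Finset.mem_filter.1 hy
          have h1 := D.dist_eq_l1 k y0 hy0b y hyb (l1Dist_le_of_patch_eq (hy0q.trans hyq.symm))
          have h2 := D.dist_triangle k y0 hy0b x hx y hyb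
          rw [D.dist_comm k y0 hy0b x hx] at h2
          have h3 := hmin y hy
          have h4 := D.dist_nonneg hx hyb
          have h5 := l1Dist_nonneg y0 y
          rw [← div_eq_mul_inv, ← one_div, div_le_div_iff₀ (by positivity) (by positivity),
            one_mul, ← mul_pow]
          exact pow_le_pow_left₀ (by positivity) (by linarith) _
      _ = 2 ^ (2 * d) * ∑ y ∈ box d k with patch k y = q, ((1 + l1Dist y0 y) ^ (2 * d))⁻¹ := by
          rw [Finset.mul_sum]
      _ ≤ _ := mul_le_mul_of_nonneg_left (sum_inv_l1Dist_le _ _) (by positivity)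

/-- At most `(2d + 1)^d` patches are needed, independently of `k`. -/
theorem isRegularMetric (k : ℕ) : IsRegularMetric (box d k) (D.dist k) (2 * d) (volBound d) where
  self x hx := D.dist_self hx
  symm := D.dist_comm k
  triangle := D.dist_triangle k
  sum_le x hx := by
    rw [← Finset.sum_fiberwise_of_maps_to (fun y hy => patch_mem hy)]
    refine (Finset.sum_le_sum fun q _ => D.sum_patch_le hx q).trans (le_of_eq ?_)
    rw [Finset.sum_const, Fintype.card_piFinset, nsmul_eq_mul, volBound]
    simp
    left
    have : (2 * (d : ℤ) + 1).toNat = 2 * d + 1 := by omega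
    rw [this]
    push_cast
    rfl

end BoxMetrics

end

section

variable {d r : ℕ}

/-! ### Rapidly decaying weights -/

theorem IsRapidWeight.exists_pow_mul_le {ζ : ℝ → ℝ} (hζ : IsRapidWeight ζ) (m : ℕ) :
    ∃ C : ℝ, 0 ≤ C ∧ ∀ s, 0 ≤ s → (1 + s) ^ m * ζ s ≤ C := by
  obtain ⟨C0, hC0⟩ := hζ.bounded
  have hC0' : 0 ≤ C0 := (hζ.pos 0 le_rfl).le.trans (hC0 0 le_rfl)
  have h1 := (hζ.decay m).eventually (gt_mem_nhds one_pos)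
  obtain ⟨s0, hs0⟩ := Filter.eventually_atTop.1 h1
  refine ⟨2 ^ m * (C0 + (|s0| ^ m * C0 + 1)), by positivity, fun s hs => ?_⟩
  have h2 : (1 + s) ^ m ≤ 2 ^ m * (1 + s ^ m) := by
    have h := add_pow_le zero_le_one hs m
    rw [one_pow] at h
    refine h.trans (mul_le_mul_of_nonneg_right ?_ (by positivity))
    exact pow_le_pow_right₀ (by norm_num) (by omega)
  have h3 : s ^ m * ζ s ≤ |s0| ^ m * C0 + 1 := by
    rcases le_total s0 s with h | h
    · have := hs0 s h
      have : 0 ≤ |s0| ^ m * C0 := by positivity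
      linarith
    · have := mul_le_mul (pow_le_pow_left₀ hs (h.trans (le_abs_self s0)) m) (hC0 s hs)
        (hζ.pos s hs).le (by positivity)
      linarith
  calc (1 + s) ^ m * ζ s ≤ 2 ^ m * (1 + s ^ m) * ζ s :=
        mul_le_mul_of_nonneg_right h2 (hζ.pos s hs).le
    _ = 2 ^ m * (ζ s + s ^ m * ζ s) := by ring
    _ ≤ _ := by
      gcongr
      exact hC0 s hs

/-- A supremum of exponentials. -/
def expSup (a : ℕ → ℝ) (s : ℝ) : ℝ := ⨆ n : ℕ, a n * Real.exp (-s / (n + 1))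

/-- For superadditivity, the slower of two exponentials in a product dominates, and the coefficient
of the faster one is at most `1`. Rapid decay holds because the coefficients decay faster than any
power of the decay length `n + 1`. -/
theorem isRapidWeight_expSup {a : ℕ → ℝ} (h0 : ∀ n, 0 < a n) (h1 : ∀ n, a n ≤ 1)
    (hdecay : ∀ m : ℕ, ∃ C, ∀ n : ℕ, a n * (1 + (n : ℝ)) ^ m ≤ C) : IsRapidWeight (expSup a) := by
  have hterm : ∀ s, 0 ≤ s → ∀ n : ℕ, a n * Real.exp (-s / (n + 1)) ≤ 1 := by
    intro s hs n
    refine mul_le_one₀ (h1 n) (Real.exp_pos _).le (Real.exp_le_one_iff.2 ?_)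
    exact div_nonpos_of_nonpos_of_nonneg (by linarith) (by positivity)
  have hbdd : ∀ s, 0 ≤ s → BddAbove (Set.range fun n : ℕ => a n * Real.exp (-s / (n + 1))) :=
    fun s hs => ⟨1, by rintro _ ⟨n, rfl⟩; exact hterm s hs n⟩
  have hpos : ∀ s, 0 ≤ s → 0 < expSup a s := fun s hs =>
    (mul_pos (h0 0) (Real.exp_pos _)).trans_le (le_ciSup (hbdd s hs) 0)
  refine ⟨hpos, ⟨1, fun s hs => ciSup_le (hterm s hs)⟩, ?_, ?_, ?_⟩
  · intro s hs t ht hst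
    refine ciSup_mono (hbdd s hs) fun n => ?_
    refine mul_le_mul_of_nonneg_left (Real.exp_le_exp.2 ?_) (h0 n).le
    exact div_le_div_of_nonneg_right (by linarith) (by positivity)
  · intro s t hs ht
    have key : ∀ n m : ℕ, n ≤ m → ∀ s t : ℝ, 0 ≤ s → 0 ≤ t → a n * Real.exp (-s / (n + 1)) *
        (a m * Real.exp (-t / (m + 1))) ≤ expSup a (s + t) := by
      intro n m hnm s t hs ht
      refine le_trans ?_ (le_ciSup (hbdd (s + t) (by positivity)) m)
      have e1 : Real.exp (-s / (n + 1)) ≤ Real.exp (-s / (m + 1)) := by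
        refine Real.exp_le_exp.2 ?_
        rw [neg_div, neg_div, neg_le_neg_iff]
        exact div_le_div_of_nonneg_left hs (by positivity) (by
          have : (n : ℝ) ≤ m := by exact_mod_cast hnm
          linarith)
      calc a n * Real.exp (-s / (n + 1)) * (a m * Real.exp (-t / (m + 1)))
          ≤ 1 * Real.exp (-s / (m + 1)) * (a m * Real.exp (-t / (m + 1))) := by
            have := h0 m
            gcongr
            exact h1 n
        _ = a m * (Real.exp (-s / (m + 1)) * Real.exp (-t / (m + 1))) := by ring
        _ = a m * Real.exp (-(s + t) / (m + 1)) := by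
            rw [← Real.exp_add]
            congr 2
            ring
    unfold expSup at *
    rw [Real.mul_iSup_of_nonneg (hpos s hs).le]
    refine ciSup_le fun m => ?_
    rw [Real.iSup_mul_of_nonneg (mul_nonneg (h0 m).le (Real.exp_pos _).le)]
    refine ciSup_le fun n => ?_
    rcases le_total n m with h | h
    · exact key n m h s t hs ht
    · rw [mul_comm, add_comm s t]
      exact key m n h t s ht hs
  · intro p
    obtain ⟨C, hC⟩ := hdecay (p + 1)
    have hb : ∀ s, 0 ≤ s → s ^ (p + 1) * expSup a s ≤ (p + 1).factorial * C := by
      intro s hs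
      unfold expSup
      rw [Real.mul_iSup_of_nonneg (by positivity)]
      refine ciSup_le fun n => ?_
      have hn : (0 : ℝ) < n + 1 := by positivity
      have h := Real.pow_div_factorial_le_exp (s / (n + 1)) (by positivity) (p + 1)
      rw [div_le_iff₀ (by positivity), div_pow, div_le_iff₀ (by positivity)] at h
      have e : Real.exp (-s / (n + 1)) = (Real.exp (s / (n + 1)))⁻¹ := by
        rw [neg_div, Real.exp_neg]
      rw [e]
      calc s ^ (p + 1) * (a n * (Real.exp (s / (n + 1)))⁻¹)
          ≤ (Real.exp (s / (n + 1)) * (p + 1).factorial * (n + 1) ^ (p + 1)) *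
            (a n * (Real.exp (s / (n + 1)))⁻¹) := by
            refine mul_le_mul_of_nonneg_right h ?_
            exact mul_nonneg (h0 n).le (by positivity)
        _ = (p + 1).factorial * (a n * (1 + n) ^ (p + 1)) := by
            rw [add_comm (n : ℝ) 1]
            field_simp
        _ ≤ _ := by
            gcongr
            exact hC n
    refine squeeze_zero' (g := fun s => ((p + 1).factorial * C) / s) ?_ ?_
      (Filter.Tendsto.const_div_atTop Filter.tendsto_id _)
    · filter_upwards [Filter.eventually_ge_atTop 0] with s hs
      exact mul_nonneg (by positivity) (hpos s hs).le
    · filter_upwards [Filter.eventually_gt_atTop 0] with s hs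
      rw [le_div_iff₀ hs]
      have := hb s hs.le
      rw [pow_succ] at this
      linarith

/-- Every function decaying faster than any polynomial is dominated by a weight in `𝒮`. -/
theorem exists_dominating_weight {β : Type*} {f ρ : β → ℝ} (hf : ∀ b, 0 ≤ f b)
    (hρ : ∀ b, 0 ≤ ρ b) (h : ∀ m : ℕ, ∃ C, ∀ b, f b * (1 + ρ b) ^ m ≤ C) :
    ∃ ζ, IsRapidWeight ζ ∧ ∃ C > (0 : ℝ), ∀ b, f b ≤ C * ζ (ρ b) := by
  classical
  set G : ℕ → ℝ := fun n => ⨆ b, if (n : ℝ) ≤ ρ b then f b else 0 with hG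
  obtain ⟨C0, hC0⟩ := h 0
  have hbdd : ∀ n : ℕ, BddAbove (Set.range fun b => if (n : ℝ) ≤ ρ b then f b else 0) := by
    intro n
    refine ⟨max C0 0, ?_⟩
    rintro _ ⟨b, rfl⟩
    have := hC0 b
    rw [pow_zero, mul_one] at this
    beta_reduce
    split_ifs
    · exact this.trans (le_max_left _ _)
    · exact le_max_right _ _
  have hG0 : ∀ n, 0 ≤ G n := fun n => Real.iSup_nonneg fun b => by
    split_ifs
    · exact hf b
    · exact le_rfl
  have hGle : ∀ n m : ℕ, ∀ C, (∀ b, f b * (1 + ρ b) ^ m ≤ C) →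
      G n * (1 + (n : ℝ)) ^ m ≤ max C 0 := by
    intro n m C hC
    rw [← le_div_iff₀ (by positivity)]
    refine Real.iSup_le (fun b => ?_) (by positivity)
    split_ifs with hb
    · rw [le_div_iff₀ (by positivity)]
      refine le_trans ?_ ((hC b).trans (le_max_left _ _))
      exact mul_le_mul_of_nonneg_left (pow_le_pow_left₀ (by positivity) (by linarith) m) (hf b)
    · positivity
  set A : ℝ := max C0 0 + 1 with hA
  have hApos : 0 < A := by positivity
  -- The coefficients are the suprema of `f` over `ρ ≥ n`, made positive by `exp(-n)` and normalised
  -- to be at most `1`. For `n = ⌊ρ b⌋` the exponential in `expSup` is at least `exp(-1)`, so the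
  -- `n`-th member alone dominates `f b`.
  set a : ℕ → ℝ := fun n => (G n + Real.exp (-(n : ℝ))) / A with ha
  have ha0 : ∀ n, 0 < a n := fun n => div_pos (by have := hG0 n; positivity) hApos
  have ha1 : ∀ n, a n ≤ 1 := by
    intro n
    rw [ha, div_le_one hApos]
    have h1 := hGle n 0 C0 hC0
    rw [pow_zero, mul_one] at h1
    exact add_le_add h1 (Real.exp_le_one_iff.2 (by simp))
  refine ⟨expSup a, isRapidWeight_expSup ha0 ha1 fun m => ?_, A * Real.exp 1, by positivity,
    fun b => ?_⟩
  · obtain ⟨C, hC⟩ := h m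
    obtain ⟨M, hM0, hM⟩ := exists_pow_mul_exp_neg_le one_pos m
    refine ⟨(max C 0 + M) / A, fun n => ?_⟩
    rw [ha, div_mul_eq_mul_div]
    refine div_le_div_of_nonneg_right ?_ hApos.le
    rw [add_mul]
    have h1 := hM n (by positivity)
    rw [one_mul, mul_comm] at h1
    exact add_le_add (hGle n m C hC) h1
  · set n := ⌊ρ b⌋₊ with hn
    have h1 : f b ≤ G n := by
      have := le_ciSup (hbdd n) b
      rwa [if_pos (Nat.floor_le (hρ b))] at this
    have h2 : a n * Real.exp (-ρ b / (n + 1)) ≤ expSup a (ρ b) := by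
      refine le_ciSup (f := fun n : ℕ => a n * Real.exp (-ρ b / (n + 1))) ⟨1, ?_⟩ n
      rintro _ ⟨j, rfl⟩
      refine mul_le_one₀ (ha1 j) (Real.exp_pos _).le (Real.exp_le_one_iff.2 ?_)
      exact div_nonpos_of_nonpos_of_nonneg (by linarith [hρ b]) (by positivity)
    have h3 : Real.exp (-1) ≤ Real.exp (-ρ b / (n + 1)) := by
      refine Real.exp_le_exp.2 ?_
      rw [neg_div, neg_le_neg_iff, div_le_one (by positivity)]
      exact (Nat.lt_floor_add_one (ρ b)).le
    have h4 : f b ≤ A * a n := by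
      rw [ha]
      beta_reduce
      rw [mul_div_cancel₀ _ hApos.ne']
      linarith [Real.exp_pos (-(n : ℝ))]
    calc f b ≤ A * a n := h4
      _ = A * Real.exp 1 * (a n * Real.exp (-1)) := by
        rw [Real.exp_neg]
        field_simp
      _ ≤ A * Real.exp 1 * expSup a (ρ b) := by
        refine mul_le_mul_of_nonneg_left ?_ (by positivity)
        exact (mul_le_mul_of_nonneg_left h3 (ha0 n).le).trans h2

/-! ### Interpolation of derivatives -/

section

variable {E : Type*} [NormedAddCommGroup E] [NormedSpace ℝ E] {I : Set ℝ}

/-- Some ball around a point `t0` lies in `I`. Every `t` can be moved in the direction of `t0` by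
half of the radius, staying between `t` and a point of that ball, so the admissible length does not
shrink towards the ends of the interval. -/
theorem exists_step (hI : IsOpen I) (hIc : I.OrdConnected) (hne : I.Nonempty) :
    ∃ h0 > (0 : ℝ), ∀ t ∈ I, ∀ h, 0 < h → h ≤ h0 → t + h ∈ I ∨ t - h ∈ I := by
  obtain ⟨t0, ht0⟩ := hne
  obtain ⟨ε, hε, hball⟩ := Metric.isOpen_iff.1 hI t0 ht0
  refine ⟨ε / 2, by positivity, fun t ht h hh hle => ?_⟩
  have h1 : t0 + ε / 2 ∈ I := hball (by
    rw [Metric.mem_ball, Real.dist_eq, add_sub_cancel_left, abs_of_pos (by positivity)]; linarith)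
  have h2 : t0 - ε / 2 ∈ I := hball (by
    rw [Metric.mem_ball, Real.dist_eq, sub_sub_cancel_left, abs_neg, abs_of_pos (by positivity)]
    linarith)
  rcases le_total t t0 with hle' | hle'
  · exact Or.inl (hIc.out ht h1 ⟨by linarith, by linarith⟩)
  · exact Or.inr (hIc.out h2 ht ⟨by linarith, by linarith⟩)

/-- Landau's inequality: the increment of `u` over a step of length `h` differs from `h v(t)` by at
most `h² S2`. The freedom in `h` allows smallness of `u` to be traded for smallness of `v`. -/
theorem norm_deriv_le_of_step (hIc : I.OrdConnected) {u v w : ℝ → E}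
    (huv : ∀ t ∈ I, HasDerivAt u (v t) t) (hvw : ∀ t ∈ I, HasDerivAt v (w t) t) {S0 S2 : ℝ}
    (h0 : ∀ t ∈ I, ‖u t‖ ≤ S0) (h2 : ∀ t ∈ I, ‖w t‖ ≤ S2) {t h : ℝ} (hh : 0 < h) (ht : t ∈ I)
    (hstep : t + h ∈ I ∨ t - h ∈ I) : ‖v t‖ ≤ 2 * S0 / h + h * S2 := by
  obtain ⟨t', ht', habs⟩ : ∃ t' ∈ I, |t' - t| = h := by
    rcases hstep with hs | hs
    · exact ⟨_, hs, by rw [add_sub_cancel_left, abs_of_pos hh]⟩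
    · exact ⟨_, hs, by rw [sub_sub_cancel_left, abs_neg, abs_of_pos hh]⟩
  have hsub : Set.uIcc t t' ⊆ I := hIc.uIcc_subset ht ht'
  have hS2 : 0 ≤ S2 := (norm_nonneg _).trans (h2 t ht)
  have hv : ∀ s ∈ Set.uIcc t t', ‖v s - v t‖ ≤ S2 * h := by
    intro s hs
    have := (convex_uIcc t t').norm_image_sub_le_of_norm_hasDerivWithin_le (f := v) (f' := w)
      (C := S2) (fun s hs => (hvw s (hsub hs)).hasDerivWithinAt) (fun s hs => h2 s (hsub hs))
      Set.left_mem_uIcc hs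
    refine this.trans (mul_le_mul_of_nonneg_left ?_ hS2)
    rw [Real.norm_eq_abs, ← habs]
    exact Set.abs_sub_left_of_mem_uIcc hs
  have hf := (convex_uIcc t t').norm_image_sub_le_of_norm_hasDerivWithin_le
    (f := fun s => u s - s • v t) (f' := fun s => v s - v t) (C := S2 * h)
    (fun s hs => (((huv s (hsub hs)).sub
      (((hasDerivAt_id s).smul_const (v t)).congr_deriv (one_smul ℝ _))).hasDerivWithinAt)) hv
    Set.left_mem_uIcc Set.right_mem_uIcc
  rw [Real.norm_eq_abs, habs] at hf
  have e : (t' - t) • v t = (u t' - u t) - (u t' - t' • v t - (u t - t • v t)) := by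
    rw [sub_smul]
    abel
  have h3 : h * ‖v t‖ ≤ 2 * S0 + S2 * h * h := by
    rw [← habs, ← Real.norm_eq_abs, ← norm_smul, e, Real.norm_eq_abs, habs]
    refine (norm_sub_le _ _).trans (add_le_add ((norm_sub_le _ _).trans ?_) hf)
    linarith [h0 t ht, h0 t' ht']
  have h4 : ‖v t‖ ≤ (2 * S0 + S2 * h * h) / h := by
    rw [le_div_iff₀ hh]
    linarith
  refine h4.trans (le_of_eq ?_)
  field_simp

/-- The estimate is applied to a single curve with values in an `ℓ¹`-sum, so that the number of
summands does not enter. -/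
theorem sum_norm_deriv_le_of_step (hIc : I.OrdConnected) {ι : Type*} (T : Finset ι)
    {u v w : ι → ℝ → E} (huv : ∀ Y ∈ T, ∀ t ∈ I, HasDerivAt (u Y) (v Y t) t)
    (hvw : ∀ Y ∈ T, ∀ t ∈ I, HasDerivAt (v Y) (w Y t) t) {S0 S2 : ℝ}
    (h0 : ∀ t ∈ I, ∑ Y ∈ T, ‖u Y t‖ ≤ S0) (h2 : ∀ t ∈ I, ∑ Y ∈ T, ‖w Y t‖ ≤ S2) {t h : ℝ}
    (hh : 0 < h) (ht : t ∈ I) (hstep : t + h ∈ I ∨ t - h ∈ I) :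
    ∑ Y ∈ T, ‖v Y t‖ ≤ 2 * S0 / h + h * S2 := by
  have hd : ∀ {f g : ι → ℝ → E} {t : ℝ}, (∀ Y ∈ T, HasDerivAt (f Y) (g Y t) t) →
      HasDerivAt (fun s => WithLp.toLp 1 (fun Y : T => f Y s))
        (WithLp.toLp 1 (fun Y : T => g Y t)) t := by
    intro f g t hfg
    have h := hasDerivAt_pi.2 fun Y : T => hfg Y Y.2
    exact ((PiLp.continuousLinearEquiv 1 ℝ (fun _ : T => E)).symm.toContinuousLinearMap.hasFDerivAt
      ).comp_hasDerivAt t h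
  have hn : ∀ (f : ι → ℝ → E) (t : ℝ), ‖WithLp.toLp 1 (fun Y : T => f Y t)‖ =
      ∑ Y ∈ T, ‖f Y t‖ := by
    intro f t
    rw [PiLp.norm_eq_of_L1]
    exact Finset.sum_coe_sort T fun Y => ‖f Y t‖
  rw [← hn]
  exact norm_deriv_le_of_step (E := PiLp 1 fun _ : T => E) hIc
    (u := fun s => WithLp.toLp 1 (fun Y : T => u Y s))
    (v := fun s => WithLp.toLp 1 (fun Y : T => v Y s))
    (w := fun s => WithLp.toLp 1 (fun Y : T => w Y s))
    (fun t ht => hd fun Y hY => huv Y hY t ht) (fun t ht => hd fun Y hY => hvw Y hY t ht)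
    (fun t ht => (hn u t).le.trans (h0 t ht)) (fun t ht => (hn w t).le.trans (h2 t ht)) hh ht hstep

end

end

section

variable {d r : ℕ}

/-! ### Interaction norms in terms of sums over sets -/

/-- `∑ diam(X)^n ‖φ X‖` over the sets `X ⊆ Λ` containing `x` and `y`. -/
def pairDiamSum (Λ : Finset (Site d)) (δ : Site d → Site d → ℝ) (n : ℕ)
    (φ : Finset (Site d) → Obs d r) (x y : Site d) : ℝ :=
  ∑ X ∈ Λ.powerset with x ∈ X ∧ y ∈ X, (finDiam δ X : ℝ) ^ n * ‖φ X‖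

theorem pairDiamSum_nonneg (Λ : Finset (Site d)) (δ : Site d → Site d → ℝ) (n : ℕ)
    (φ : Finset (Site d) → Obs d r) (x y : Site d) : 0 ≤ pairDiamSum Λ δ n φ x y :=
  Finset.sum_nonneg fun X _ => by positivity

theorem sum_div_Fweight (Λ : Finset (Site d)) (δ : Site d → Site d → ℝ) (n : ℕ)
    (φ : Finset (Site d) → Obs d r) (x y : Site d) (F : ℝ) :
    ∑ X ∈ Λ.powerset with x ∈ X ∧ y ∈ X, (finDiam δ X : ℝ) ^ n * (‖φ X‖ / F) =
      pairDiamSum Λ δ n φ x y / F := by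
  unfold pairDiamSum
  rw [Finset.sum_div]
  exact Finset.sum_congr rfl fun X _ => (mul_div_assoc _ _ _).symm

theorem Fweight_pos {ζ : ℝ → ℝ} (hζ : IsRapidWeight ζ) {s : ℝ} (hs : 0 ≤ s) :
    0 < Fweight d ζ s := div_pos (hζ.pos s hs) (by positivity)

theorem Fweight_le {ζ : ℝ → ℝ} (hζ : IsRapidWeight ζ) {s : ℝ} (hs : 0 ≤ s) :
    Fweight d ζ s ≤ ζ s :=
  div_le_self (hζ.pos s hs).le (one_le_pow₀ (by linarith))

theorem pairDiamSum_le_of_setNorm_le {Λ : Finset (Site d)} {δ : Site d → Site d → ℝ} {ζ : ℝ → ℝ}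
    {n : ℕ} {φ : Finset (Site d) → Obs d r} (hζ : IsRapidWeight ζ) {K : ℝ} (hK0 : 0 ≤ K)
    (hK : setNorm δ ζ n Λ φ ≤ ENNReal.ofReal K) {x y : Site d} (hx : x ∈ Λ) (hy : y ∈ Λ)
    (hδ : 0 ≤ δ x y) : pairDiamSum Λ δ n φ x y ≤ K * Fweight d ζ (δ x y) := by
  have h1 : ENNReal.ofReal (pairDiamSum Λ δ n φ x y / Fweight d ζ (δ x y)) ≤ ENNReal.ofReal K := by
    rw [← sum_div_Fweight]
    refine le_trans ?_ hK
    unfold setNorm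
    exact le_iSup₂_of_le x hx (le_iSup₂_of_le y hy le_rfl)
  rw [ENNReal.ofReal_le_ofReal_iff hK0, div_le_iff₀ (Fweight_pos hζ hδ)] at h1
  exact h1

theorem setNorm_le {Λ : Finset (Site d)} {δ : Site d → Site d → ℝ} {ζ : ℝ → ℝ}
    {n : ℕ} {φ : Finset (Site d) → Obs d r} (hζ : IsRapidWeight ζ) {K : ℝ}
    (h : ∀ x ∈ Λ, ∀ y ∈ Λ, 0 ≤ δ x y ∧ pairDiamSum Λ δ n φ x y ≤ K * Fweight d ζ (δ x y)) :
    setNorm δ ζ n Λ φ ≤ ENNReal.ofReal K := by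
  unfold setNorm
  refine iSup₂_le fun x hx => iSup₂_le fun y hy => ENNReal.ofReal_le_ofReal ?_
  rw [sum_div_Fweight, div_le_iff₀ (Fweight_pos hζ (h x hx y hy).1)]
  exact (h x hx y hy).2

theorem one_add_pow_le (n : ℕ) {a : ℝ} (ha : 0 ≤ a) : (1 + a) ^ n ≤ 2 ^ n * (1 + a ^ n) := by
  have h := add_pow_le zero_le_one ha n
  rw [one_pow] at h
  refine h.trans (mul_le_mul_of_nonneg_right ?_ (by positivity))
  exact pow_le_pow_right₀ (by norm_num) (by omega)

theorem diamSum_le_pairDiamSum (Λ : Finset (Site d)) (δ : Site d → Site d → ℝ) (n : ℕ)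
    (φ : Finset (Site d) → Obs d r) (z : Site d) : diamSum Λ δ n φ z ≤
      2 ^ n * (pairDiamSum Λ δ 0 φ z z + pairDiamSum Λ δ n φ z z) := by
  unfold diamSum pairDiamSum
  simp only [and_self]
  rw [← Finset.sum_add_distrib, Finset.mul_sum]
  refine Finset.sum_le_sum fun X _ => ?_
  have := mul_le_mul_of_nonneg_right (one_add_pow_le n (finDiam δ X).coe_nonneg)
    (norm_nonneg (φ X))
  rw [pow_zero]
  linarith

theorem pairSum_eq_pairDiamSum (Λ : Finset (Site d)) (δ : Site d → Site d → ℝ)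
    (φ : Finset (Site d) → Obs d r) (x y : Site d) :
    pairSum Λ φ x y = pairDiamSum Λ δ 0 φ x y := by
  simp [pairSum, pairDiamSum]

variable {I : Set ℝ} {D : BoxMetrics d}

theorem SmoothBounded.exists_pairDiamSum_le {ζs : ℕ → ℝ → ℝ} {n : ℕ} {Φ : ℝ → Interaction d r}
    (h : SmoothBounded D I ζs n Φ) {i : ℕ} (hζ : IsRapidWeight (ζs i)) :
    ∃ K : ℝ, 0 ≤ K ∧ ∀ t ∈ I, ∀ k, ∀ x ∈ box d k, ∀ y ∈ box d k,
      pairDiamSum (box d k) (D.dist k) n (fun X => iteratedDeriv i (fun τ => Φ τ k X) t) x y ≤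
        K * Fweight d (ζs i) (D.dist k x y) := by
  have h1 := h.2 i
  refine ⟨(⨆ t ∈ I, interactionNorm D (ζs i) n
    (fun k X => iteratedDeriv i (fun τ => Φ τ k X) t)).toReal, ENNReal.toReal_nonneg,
    fun t ht k x hx y hy => ?_⟩
  refine pairDiamSum_le_of_setNorm_le hζ ENNReal.toReal_nonneg ?_ hx hy (D.dist_nonneg hx hy)
  rw [ENNReal.ofReal_toReal h1.ne]
  refine le_trans ?_ (le_iSup₂_of_le t ht le_rfl)
  exact le_iSup_of_le k le_rfl

/-! ### A single limit and a single constant for all orders of derivatives. -/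

/-- The consequences of a rapid thermodynamic limit that are used below. -/
structure IsRapidPair (D : BoxMetrics d) (I : Set ℝ) (γ lam : ℝ) (Φ : ℝ → Interaction d r)
    (Ψ : ℝ → Finset (Site d) → Obs d r) : Prop where
  isLocal : IsInteraction I Φ
  isLocal_limit : IsInfiniteInteraction I Ψ
  smooth : ∀ k, ∀ X ⊆ box d k, ContDiffOn ℝ ∞ (fun t => Φ t k X) I
  smooth_limit : ∀ X, ContDiffOn ℝ ∞ (fun t => Ψ t X) I
  bdd : ∀ i n : ℕ, ∃ C : ℝ, 0 ≤ C ∧ ∀ k, ∀ t ∈ I, ∀ z ∈ box d k,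
    diamSum (box d k) (D.dist k) n (fun Y => iteratedDeriv i (fun τ => Φ τ k Y) t) z ≤ C
  bdd_limit : ∀ i n : ℕ, ∃ C : ℝ, 0 ≤ C ∧ ∀ Λ : Finset (Site d), ∀ t ∈ I, ∀ z ∈ Λ,
    diamSum Λ l1Dist n (fun Y => iteratedDeriv i (fun τ => Ψ τ Y) t) z ≤ C
  close : ∀ i p : ℕ, ∃ C : ℝ, 0 ≤ C ∧ ∀ M k : ℕ, (M : ℝ) + lam * (M : ℝ) ^ γ ≤ k → ∀ t ∈ I,
    ∀ z ∈ box d M, (∑ Y ∈ (box d M).powerset with z ∈ Y,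
      ‖iteratedDeriv i (fun τ => Ψ τ Y) t - iteratedDeriv i (fun τ => Φ τ k Y) t‖) *
        (1 + (M : ℝ)) ^ p ≤ C

theorem IsRapidPair.mono {γ lam lam' : ℝ} {Φ : ℝ → Interaction d r}
    {Ψ : ℝ → Finset (Site d) → Obs d r} (h : IsRapidPair D I γ lam Φ Ψ) (hl : lam ≤ lam') :
    IsRapidPair D I γ lam' Φ Ψ :=
  { h with
    close := fun i p => by
      obtain ⟨C, hC, h1⟩ := h.close i p
      refine ⟨C, hC, fun M k hMk => h1 M k (le_trans ?_ hMk)⟩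
      gcongr }

theorem exists_subset_box (X : Finset (Site d)) : ∃ k, X ⊆ box d k :=
  ⟨X.sup supNorm, fun _ hx => mem_box_iff_supNorm.2 (Finset.le_sup (f := supNorm) hx)⟩

/-- Powers of `M` are dominated by weights evaluated at `M^γ`. -/
theorem IsRapidWeight.exists_pow_mul_rpow_le {ζ : ℝ → ℝ} (hζ : IsRapidWeight ζ) {γ : ℝ}
    (hγ : 0 < γ) (p : ℕ) :
    ∃ C : ℝ, 0 ≤ C ∧ ∀ M : ℕ, ζ ((M : ℝ) ^ γ) * (1 + (M : ℝ)) ^ p ≤ C := by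
  -- As `M = (M^γ)^{1/γ}`, decay of order `q p` in `M^γ` gives decay of order `p` in `M`.
  obtain ⟨q, hq⟩ := exists_nat_ge (1 / γ)
  obtain ⟨C, hC, h⟩ := hζ.exists_pow_mul_le (q * p)
  refine ⟨2 ^ p * C, by positivity, fun M => ?_⟩
  have hs : (0 : ℝ) ≤ (M : ℝ) ^ γ := by positivity
  have h1 : (M : ℝ) ≤ (1 + (M : ℝ) ^ γ) ^ q := by
    calc (M : ℝ) = ((M : ℝ) ^ γ) ^ (1 / γ) := by
          rw [← Real.rpow_mul (by positivity), mul_one_div_cancel hγ.ne', Real.rpow_one]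
      _ ≤ (1 + (M : ℝ) ^ γ) ^ (1 / γ) :=
          Real.rpow_le_rpow hs (by linarith) (by positivity)
      _ ≤ (1 + (M : ℝ) ^ γ) ^ (q : ℝ) := Real.rpow_le_rpow_of_exponent_le (by linarith) hq
      _ = _ := Real.rpow_natCast _ _
  have h2 : 1 + (M : ℝ) ≤ 2 * (1 + (M : ℝ) ^ γ) ^ q := by
    have : 1 ≤ (1 + (M : ℝ) ^ γ) ^ q := one_le_pow₀ (by linarith)
    linarith
  have h3 : (1 + (M : ℝ)) ^ p ≤ 2 ^ p * (1 + (M : ℝ) ^ γ) ^ (q * p) := by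
    rw [pow_mul, ← mul_pow]
    exact pow_le_pow_left₀ (by positivity) h2 p
  have h4 := h _ hs
  calc ζ ((M : ℝ) ^ γ) * (1 + (M : ℝ)) ^ p
      ≤ ζ ((M : ℝ) ^ γ) * (2 ^ p * (1 + (M : ℝ) ^ γ) ^ (q * p)) :=
        mul_le_mul_of_nonneg_left h3 (hζ.pos _ hs).le
    _ = 2 ^ p * ((1 + (M : ℝ) ^ γ) ^ (q * p) * ζ ((M : ℝ) ^ γ)) := by ring
    _ ≤ _ := by gcongr

theorem finDiam_congr {δ δ' : Site d → Site d → ℝ} {X : Finset (Site d)}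
    (h : ∀ x ∈ X, ∀ y ∈ X, δ x y = δ' x y) : finDiam δ X = finDiam δ' X :=
  Finset.sup_congr rfl fun p hp => by
    rw [h p.1 (Finset.mem_product.1 hp).1 p.2 (Finset.mem_product.1 hp).2]

theorem finDiam_mono {δ δ' : Site d → Site d → ℝ} {X : Finset (Site d)}
    (h : ∀ x ∈ X, ∀ y ∈ X, δ x y ≤ δ' x y) : finDiam δ X ≤ finDiam δ' X :=
  Finset.sup_mono_fun fun p hp => Real.toNNReal_le_toNNReal
    (h p.1 (Finset.mem_product.1 hp).1 p.2 (Finset.mem_product.1 hp).2)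

/-- Closeness of one time derivative, with a constant that may depend on its order. -/
theorem exists_close_of_bulkNorm {γ : ℝ} (hγ : 0 < γ) {ζ : ℝ → ℝ} (hζ : IsRapidWeight ζ) {i : ℕ}
    (hI : IsOpen I) {Φ : ℝ → Interaction d r} {Ψ : ℝ → Finset (Site d) → Obs d r}
    (hΦ : ∀ k, ∀ X ⊆ box d k, ContDiffOn ℝ ∞ (fun t => Φ t k X) I)
    (hΨ : ∀ X, ContDiffOn ℝ ∞ (fun t => Ψ t X) I) {lam : ℝ} (hlam : 0 < lam) {C : ℝ} (hC : 0 < C)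
    (h : ∀ M k : ℕ, (M : ℝ) + lam * (M : ℝ) ^ γ ≤ k →
        ⨆ t ∈ I, bulkNorm ζ 0 M (fun X => iteratedDeriv i (fun τ => Ψ τ X - Φ τ k X) t)
          ≤ ENNReal.ofReal (C * ζ ((M : ℝ) ^ γ))) (p : ℕ) :
    ∃ C : ℝ, 0 ≤ C ∧ ∀ M k : ℕ, (M : ℝ) + lam * (M : ℝ) ^ γ ≤ k → ∀ t ∈ I,
      ∀ z ∈ box d M, (∑ Y ∈ (box d M).powerset with z ∈ Y,
        ‖iteratedDeriv i (fun τ => Ψ τ Y) t - iteratedDeriv i (fun τ => Φ τ k Y) t‖) *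
          (1 + (M : ℝ)) ^ p ≤ C := by
  obtain ⟨C', hC', h1⟩ := hζ.exists_pow_mul_rpow_le hγ p
  have hz0 := hζ.pos 0 le_rfl
  refine ⟨C * ζ 0 * C', by positivity, fun M k hMk t ht z hz => ?_⟩
  have hs : (0 : ℝ) ≤ (M : ℝ) ^ γ := by positivity
  have hMk' : M ≤ k := by
    have : (M : ℝ) ≤ k := le_trans (by have := mul_nonneg hlam.le hs; linarith) hMk
    exact_mod_cast this
  have h2 := pairDiamSum_le_of_setNorm_le hζ (mul_nonneg hC.le (hζ.pos _ hs).le)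
    ((le_iSup₂_of_le t ht le_rfl).trans (h M k hMk)) hz hz (l1Dist_nonneg z z)
  rw [(l1Dist_eq_zero_iff z z).2 rfl] at h2
  have h3 : Fweight d ζ 0 ≤ ζ 0 := Fweight_le hζ le_rfl
  have h4 : pairDiamSum (box d M) l1Dist 0
      (fun X => iteratedDeriv i (fun τ => Ψ τ X - Φ τ k X) t) z z =
      ∑ Y ∈ (box d M).powerset with z ∈ Y,
        ‖iteratedDeriv i (fun τ => Ψ τ Y) t - iteratedDeriv i (fun τ => Φ τ k Y) t‖ := by
    unfold pairDiamSum
    simp only [and_self, pow_zero, one_mul]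
    refine Finset.sum_congr rfl fun Y hY => ?_
    rw [iteratedDeriv_sub_of_contDiffOn hI (hΨ Y)
      (hΦ k Y ((Finset.mem_powerset.1 (Finset.mem_filter.1 hY).1).trans (box_mono hMk'))) i ht]
  rw [← h4]
  calc _ ≤ C * ζ ((M : ℝ) ^ γ) * Fweight d ζ 0 * (1 + (M : ℝ)) ^ p := by gcongr
    _ ≤ C * ζ ((M : ℝ) ^ γ) * ζ 0 * (1 + (M : ℝ)) ^ p := by
      have := (hζ.pos _ hs).le
      gcongr
    _ = C * ζ 0 * (ζ ((M : ℝ) ^ γ) * (1 + (M : ℝ)) ^ p) := by ring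
    _ ≤ _ := by
      gcongr
      exact h1 M

/-- Bounds for the finite volume interactions carry over to the limit. -/
theorem diamSum_limit_le {γ lam : ℝ} (hlam : 0 < lam) {i n : ℕ} {Φ : ℝ → Interaction d r}
    {Ψ : ℝ → Finset (Site d) → Obs d r} {C : ℝ} {t : ℝ}
    (hbdd : ∀ k, ∀ z ∈ box d k,
      diamSum (box d k) (D.dist k) n (fun Y => iteratedDeriv i (fun τ => Φ τ k Y) t) z ≤ C)
    {C' : ℝ} (hclose : ∀ M k : ℕ, (M : ℝ) + lam * (M : ℝ) ^ γ ≤ k →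
      ∀ z ∈ box d M, (∑ Y ∈ (box d M).powerset with z ∈ Y,
        ‖iteratedDeriv i (fun τ => Ψ τ Y) t - iteratedDeriv i (fun τ => Φ τ k Y) t‖) *
          (1 + (M : ℝ)) ^ 1 ≤ C') {Λ : Finset (Site d)} {z : Site d} (hz : z ∈ Λ) :
    diamSum Λ l1Dist n (fun Y => iteratedDeriv i (fun τ => Ψ τ Y) t) z ≤ C := by
  obtain ⟨M0, hM0⟩ := exists_subset_box Λ
  -- The first box size for which the rapid limit controls the sets in the box of size `M`. Along
  -- these boxes the terms converge.
  set km : ℕ → ℕ := fun M => ⌈(M : ℝ) + lam * (M : ℝ) ^ γ⌉₊ with hkm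
  have hkm1 : ∀ M : ℕ, (M : ℝ) + lam * (M : ℝ) ^ γ ≤ km M := fun M => Nat.le_ceil _
  have hkm2 : ∀ M : ℕ, M ≤ km M := by
    intro M
    have h1 := hkm1 M
    have : 0 ≤ lam * (M : ℝ) ^ γ := by positivity
    have : (M : ℝ) ≤ km M := by linarith
    exact_mod_cast this
  have hlim : ∀ Y ∈ Λ.powerset.filter (fun Y => z ∈ Y), Filter.Tendsto
      (fun M : ℕ => iteratedDeriv i (fun τ => Φ τ (km M) Y) t) Filter.atTop
      (nhds (iteratedDeriv i (fun τ => Ψ τ Y) t)) := by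
    intro Y hY
    obtain ⟨hY1, hY2⟩ := Finset.mem_filter.1 hY
    have hYL := Finset.mem_powerset.1 hY1
    rw [tendsto_iff_norm_sub_tendsto_zero]
    have h0 : Filter.Tendsto (fun M : ℕ => C' / (1 + (M : ℝ))) Filter.atTop (nhds 0) :=
      Filter.Tendsto.const_div_atTop
        (Filter.tendsto_atTop_add_const_left _ _ tendsto_natCast_atTop_atTop) _
    refine squeeze_zero' (Filter.Eventually.of_forall fun M => norm_nonneg _) ?_ h0
    filter_upwards [Filter.eventually_ge_atTop M0] with M hM
    have hb := box_mono (d := d) hM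
    have h1 := hclose M (km M) (hkm1 M) z (hb (hM0 hz))
    rw [pow_one, ← le_div_iff₀ (by positivity)] at h1
    refine le_trans ?_ h1
    rw [norm_sub_rev]
    exact Finset.single_le_sum (f := fun Y => ‖iteratedDeriv i (fun τ => Ψ τ Y) t -
      iteratedDeriv i (fun τ => Φ τ (km M) Y) t‖) (fun _ _ => norm_nonneg _)
      (Finset.mem_filter.2 ⟨Finset.mem_powerset.2 (hYL.trans (hM0.trans hb)), hY2⟩)
  have hsum : Filter.Tendsto (fun M : ℕ => diamSum Λ l1Dist n
      (fun Y => iteratedDeriv i (fun τ => Φ τ (km M) Y) t) z) Filter.atTop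
      (nhds (diamSum Λ l1Dist n (fun Y => iteratedDeriv i (fun τ => Ψ τ Y) t) z)) :=
    tendsto_finsetSum _ fun Y hY => (hlim Y hY).norm.const_mul _
  refine le_of_tendsto hsum ?_
  -- The `ℓ¹`-diameter of `Λ` is at most `2 d M0`. In boxes of at least this size the box metric
  -- coincides with the `ℓ¹`-distance on `Λ`, and so do the diameters.
  filter_upwards [Filter.eventually_ge_atTop (M0 + 2 * d * M0)] with M hM
  have hk : M0 + 2 * d * M0 ≤ km M := hM.trans (hkm2 M)
  have hb : Λ ⊆ box d (km M) := hM0.trans (box_mono (by omega))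
  refine le_trans ?_ (hbdd (km M) z (hb hz))
  unfold diamSum
  have e : ∀ Y ∈ Λ.powerset.filter (fun Y => z ∈ Y), finDiam l1Dist Y =
      finDiam (D.dist (km M)) Y := by
    intro Y hY
    have hYL := Finset.mem_powerset.1 (Finset.mem_filter.1 hY).1
    refine finDiam_congr fun x hx y hy => (D.dist_eq_l1 _ x (hb (hYL hx)) y (hb (hYL hy)) ?_).symm
    refine (l1Dist_le_of_mem_box (hM0 (hYL hx)) (hM0 (hYL hy))).trans ?_
    exact_mod_cast (by omega : 2 * d * M0 ≤ km M)
  rw [Finset.sum_congr rfl fun Y hY => by rw [e Y hY]]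
  refine Finset.sum_le_sum_of_subset_of_nonneg ?_ fun Y _ _ => by positivity
  exact Finset.filter_subset_filter _ (Finset.powerset_mono.2 hb)

/-- The definition of a rapid limit lets the infinite volume interaction depend on `n`, and the
constant `lam` on `n` and on the order of the derivative. The limit for `n = 0` and the constant for
`n = 0`, `i = 0` are used throughout: bounds with other powers of the diameter pass from the boxes
to this limit term by term, and closeness of the next time derivative follows by interpolating
between closeness of the present one and boundedness of the one after. -/
theorem exists_isRapidPair (hI : IsOpen I) (hIc : I.OrdConnected) {γ : ℝ} (hγ : 0 < γ)
    {Φ : ℝ → Interaction d r} {ζ : ℝ → ℝ} (h0 : HasRapidLimit D I ζ 0 γ Φ)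
    (h : ∀ n, ∃ ζ, HasRapidLimit D I ζ n γ Φ) :
    ∃ lam > (0 : ℝ), ∃ Ψ, IsRapidPair D I γ lam Φ Ψ ∧
      ∃ K : ℝ, 0 ≤ K ∧ ∀ t ∈ I, (∀ k, ∀ x ∈ box d k, ∀ y ∈ box d k,
        pairSum (box d k) (Φ t k) x y ≤ K * ζ (D.dist k x y)) ∧
        ∀ Λ : Finset (Site d), ∀ x ∈ Λ, ∀ y ∈ Λ, pairSum Λ (Ψ t) x y ≤ K * ζ (l1Dist x y) := by
  obtain ⟨hloc, ζs, ⟨hζ0, hζ⟩, hsm, Ψ, hlocΨ, hsmΨ, hlim⟩ := h0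
  have hsmooth := hsm.1
  have hsmoothΨ : ∀ X, ContDiffOn ℝ ∞ (fun t => Ψ t X) I := fun X => by
    obtain ⟨k, hk⟩ := exists_subset_box X
    exact hsmΨ.1 k X hk
  have hbdd : ∀ i n : ℕ, ∃ C : ℝ, 0 ≤ C ∧ ∀ k, ∀ t ∈ I, ∀ z ∈ box d k,
      diamSum (box d k) (D.dist k) n (fun Y => iteratedDeriv i (fun τ => Φ τ k Y) t) z ≤ C := by
    intro i n
    obtain ⟨K0, hK0, hb0⟩ := hsm.exists_pairDiamSum_le (hζ i)
    obtain ⟨ζ', -, ζs', ⟨-, hζ'⟩, hsm', -⟩ := h n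
    obtain ⟨K1, hK1, hb1⟩ := hsm'.exists_pairDiamSum_le (hζ' i)
    refine ⟨2 ^ n * (K0 * Fweight d (ζs i) 0 + K1 * Fweight d (ζs' i) 0), ?_,
      fun k t ht z hz => ?_⟩
    · have := Fweight_pos (d := d) (hζ i) le_rfl
      have := Fweight_pos (d := d) (hζ' i) le_rfl
      positivity
    · refine (diamSum_le_pairDiamSum _ _ _ _ _).trans ?_
      have h1 := hb0 t ht k z hz z hz
      have h2 := hb1 t ht k z hz z hz
      rw [D.dist_self hz] at h1 h2
      gcongr
  have hbddΨ : ∀ i n : ℕ, ∃ C : ℝ, 0 ≤ C ∧ ∀ Λ : Finset (Site d), ∀ t ∈ I, ∀ z ∈ Λ,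
      diamSum Λ l1Dist n (fun Y => iteratedDeriv i (fun τ => Ψ τ Y) t) z ≤ C := by
    intro i n
    obtain ⟨C, hC, hb⟩ := hbdd i n
    obtain ⟨lam, hlam, C1, hC1, hl⟩ := hlim i
    obtain ⟨C', hC', hcl⟩ := exists_close_of_bulkNorm hγ (hζ i) hI hsmooth hsmoothΨ hlam hC1 hl 1
    exact ⟨C, hC, fun Λ t ht z hz => diamSum_limit_le hlam (fun k z hz => hb k t ht z hz)
      (fun M k hMk z hz => hcl M k hMk t ht z hz) hz⟩
  obtain ⟨lam, hlam, C1, hC1, hl⟩ := hlim 0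
  refine ⟨lam, hlam, Ψ, ⟨hloc, hlocΨ, hsmooth, hsmoothΨ, hbdd, hbddΨ, fun i => ?_⟩, ?_⟩
  · induction i with
    | zero => exact exists_close_of_bulkNorm hγ (hζ 0) hI hsmooth hsmoothΨ hlam hC1 hl
    | succ i ih =>
      intro p
      rcases I.eq_empty_or_nonempty with rfl | hne
      · exact ⟨0, le_rfl, by simp⟩
      obtain ⟨s0, hs0, hstep⟩ := exists_step hI hIc hne
      -- Order `2p` for the lower derivative and a step length proportional to `(1 + M)^{-p}` leave
      -- order `p` for the next derivative, in both terms of Landau's inequality.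
      obtain ⟨C0, hC0, hc0⟩ := ih (p + p)
      obtain ⟨Ca, hCa, hca⟩ := hbdd (i + 2) 0
      obtain ⟨Cb, hCb, hcb⟩ := hbddΨ (i + 2) 0
      refine ⟨2 * C0 / s0 + s0 * (Cb + Ca), by positivity, fun M k hMk t ht z hz => ?_⟩
      have hMk' : M ≤ k := by
        have : (M : ℝ) ≤ k := le_trans (by
          have : 0 ≤ lam * (M : ℝ) ^ γ := by positivity
          linarith) hMk
        exact_mod_cast this
      have hb := box_mono (d := d) hMk'
      have hM1 : 1 ≤ (1 + (M : ℝ)) ^ p := one_le_pow₀ (by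
        have : (0 : ℝ) ≤ M := by positivity
        linarith)
      have hMpos : 0 < (1 + (M : ℝ)) ^ p := by positivity
      have hY : ∀ Y ∈ (box d M).powerset.filter (fun Y => z ∈ Y), Y ⊆ box d k := fun Y hY =>
        (Finset.mem_powerset.1 (Finset.mem_filter.1 hY).1).trans hb
      have key := sum_norm_deriv_le_of_step hIc ((box d M).powerset.filter fun Y => z ∈ Y)
        (u := fun Y t => iteratedDeriv i (fun τ => Ψ τ Y) t - iteratedDeriv i (fun τ => Φ τ k Y) t)
        (v := fun Y t => iteratedDeriv (i + 1) (fun τ => Ψ τ Y) t -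
          iteratedDeriv (i + 1) (fun τ => Φ τ k Y) t)
        (w := fun Y t => iteratedDeriv (i + 2) (fun τ => Ψ τ Y) t -
          iteratedDeriv (i + 2) (fun τ => Φ τ k Y) t)
        (fun Y hYm t ht => (hasDerivAt_iteratedDeriv hI (hsmoothΨ Y) i ht).sub
          (hasDerivAt_iteratedDeriv hI (hsmooth k Y (hY Y hYm)) i ht))
        (fun Y hYm t ht => (hasDerivAt_iteratedDeriv hI (hsmoothΨ Y) (i + 1) ht).sub
          (hasDerivAt_iteratedDeriv hI (hsmooth k Y (hY Y hYm)) (i + 1) ht))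
        (S0 := C0 / ((1 + (M : ℝ)) ^ p * (1 + (M : ℝ)) ^ p)) (S2 := Cb + Ca)
        (fun t ht => by
          rw [le_div_iff₀ (by positivity), ← pow_add]
          exact hc0 M k hMk t ht z hz)
        (fun t ht => by
          refine (Finset.sum_le_sum fun Y _ => norm_sub_le _ _).trans ?_
          rw [Finset.sum_add_distrib]
          refine add_le_add ((siteSum_le_diamSum _ l1Dist 0 _ z).trans (hcb _ t ht z hz)) ?_
          refine le_trans ?_ ((siteSum_le_diamSum _ (D.dist k) 0 _ z).trans
            (hca k t ht z (hb hz)))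
          exact Finset.sum_le_sum_of_subset_of_nonneg
            (Finset.filter_subset_filter _ (Finset.powerset_mono.2 hb))
            fun Y _ _ => norm_nonneg _)
        (h := s0 / (1 + (M : ℝ)) ^ p) (by positivity) ht
        (hstep t ht _ (by positivity) (div_le_self hs0.le hM1))
      refine (mul_le_mul_of_nonneg_right key hMpos.le).trans (le_of_eq ?_)
      field_simp
  · obtain ⟨K1, hK1, hb1⟩ := hsm.exists_pairDiamSum_le (hζ 0)
    obtain ⟨K2, hK2, hb2⟩ := hsmΨ.exists_pairDiamSum_le (hζ 0)
    refine ⟨K1 + K2, by positivity, fun t ht => ⟨fun k x hx y hy => ?_, fun Λ x hx y hy => ?_⟩⟩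
    · have h1 := hb1 t ht k x hx y hy
      simp only [iteratedDeriv_zero] at h1
      rw [pairSum_eq_pairDiamSum _ (D.dist k), ← hζ0]
      refine h1.trans ?_
      have hδ := D.dist_nonneg hx hy
      have h2 := Fweight_le (d := d) (hζ 0) hδ
      have h3 := Fweight_pos (d := d) (hζ 0) hδ
      exact mul_le_mul (by linarith) h2 h3.le (by positivity)
    · obtain ⟨k, hk⟩ := exists_subset_box Λ
      have h1 := hb2 t ht k x (hk hx) y (hk hy)
      simp only [iteratedDeriv_zero] at h1
      have hδ := l1Dist_nonneg x y
      have h2 := Fweight_le (d := d) (hζ 0) hδ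
      have h3 := Fweight_pos (d := d) (hζ 0) hδ
      rw [← hζ0]
      refine le_trans ?_ (h1.trans (mul_le_mul (by linarith : K2 ≤ K1 + K2) h2 h3.le
        (by positivity)))
      rw [← pairSum_eq_pairDiamSum]
      exact Finset.sum_le_sum_of_subset_of_nonneg
        (Finset.filter_subset_filter _ (Finset.powerset_mono.2 hk)) fun Y _ _ => norm_nonneg _

end

section

variable {d r : ℕ}

/-! ### Restriction of interactions to subregions -/

/-- The terms of the sets contained in `R`. -/
def restrictTo (R : Finset (Site d)) (h : Finset (Site d) → Obs d r) (Y : Finset (Site d)) :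
    Obs d r :=
  if Y ⊆ R then h Y else 0

theorem restrictTo_of_subset {R Y : Finset (Site d)} (hY : Y ⊆ R)
    (h : Finset (Site d) → Obs d r) : restrictTo R h Y = h Y := if_pos hY

theorem restrictTo_of_not_subset {R Y : Finset (Site d)} (hY : ¬ Y ⊆ R)
    (h : Finset (Site d) → Obs d r) : restrictTo R h Y = 0 := if_neg hY

theorem norm_restrictTo_le (R : Finset (Site d)) (h : Finset (Site d) → Obs d r)
    (Y : Finset (Site d)) : ‖restrictTo R h Y‖ ≤ ‖h Y‖ := by
  unfold restrictTo
  split_ifs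
  · exact le_rfl
  · simp

theorem iteratedDeriv_restrictTo (R : Finset (Site d)) (h : ℝ → Finset (Site d) → Obs d r)
    (Y : Finset (Site d)) (i : ℕ) (t : ℝ) :
    iteratedDeriv i (fun τ => restrictTo R (h τ) Y) t =
      restrictTo R (fun Y => iteratedDeriv i (fun τ => h τ Y) t) Y := by
  unfold restrictTo
  split_ifs
  · rfl
  · rw [iteratedDeriv_const]
    simp

theorem totalOp_restrictTo {R Λ : Finset (Site d)} (hR : R ⊆ Λ) (h : Finset (Site d) → Obs d r) :
    totalOp Λ (restrictTo R h) = totalOp R h := by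
  unfold totalOp
  have h1 := Finset.sum_subset (f := restrictTo R h) (Finset.powerset_mono.2 hR) fun Y _ hY =>
    restrictTo_of_not_subset (fun h' => hY (Finset.mem_powerset.2 h')) h
  rw [← h1]
  exact Finset.sum_congr rfl fun Y hY => restrictTo_of_subset (Finset.mem_powerset.1 hY) h

theorem siteTerm_restrictTo {R Λ : Finset (Site d)} (hR : R ⊆ Λ)
    (c : Finset (Site d) → Obs d r) (x : Site d) :
    siteTerm Λ (restrictTo R c) x = siteTerm R c x := by
  unfold siteTerm
  have h1 := Finset.sum_subset (f := fun X => (X.card : ℝ)⁻¹ • restrictTo R c X)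
    (Finset.filter_subset_filter (fun X => x ∈ X) (Finset.powerset_mono.2 hR)) fun Y hY hY' => by
      have : ¬ Y ⊆ R := fun h' => hY'
        (Finset.mem_filter.2 ⟨Finset.mem_powerset.2 h', (Finset.mem_filter.1 hY).2⟩)
      rw [restrictTo_of_not_subset this, smul_zero]
  rw [← h1]
  exact Finset.sum_congr rfl fun Y hY => by
    rw [restrictTo_of_subset (Finset.mem_powerset.1 (Finset.mem_filter.1 hY).1)]

theorem siteAvg_restrictTo {α : Type*} [MeasurableSpace α] (μ : Measure α) (κ V : α → ℝ)
    {R Λ : Finset (Site d)} (hR : R ⊆ Λ) (h c : Finset (Site d) → Obs d r) (x : Site d) :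
    siteAvg μ κ V Λ (restrictTo R h) (restrictTo R c) x = siteAvg μ κ V R h c x := by
  unfold siteAvg
  rw [totalOp_restrictTo hR, siteTerm_restrictTo hR]

section

variable {σ : Type*} {I : Set ℝ} {Λ : σ → Finset (Site d)} {δ : σ → Site d → Site d → ℝ}
  {x : σ → Site d} {s : ℕ} {ν : ℝ} {h h' c c' : σ → ℝ → Finset (Site d) → Obs d r}

theorem IsTimeFamily.restrictTo (hh : IsTimeFamily I Λ δ h) (R : σ → Finset (Site d)) :
    IsTimeFamily I Λ δ (fun b t => restrictTo (R b) (h b t)) where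
  isLocal b t ht Y hY := by
    unfold FermionLattice.restrictTo
    split_ifs
    · exact hh.isLocal b t ht Y hY
    · exact (localTerms r Y).zero_mem
  smooth b Y hY := by
    unfold FermionLattice.restrictTo
    split_ifs
    · exact hh.smooth b Y hY
    · exact contDiffOn_const
  bdd i n := by
    obtain ⟨C, hC, h1⟩ := hh.bdd i n
    refine ⟨C, hC, fun b t ht z hz => le_trans ?_ (h1 b t ht z hz)⟩
    simp only [iteratedDeriv_restrictTo]
    exact Finset.sum_le_sum fun Y _ =>
      mul_le_mul_of_nonneg_left (norm_restrictTo_le _ _ _) (by positivity)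

theorem HasExpDecay.restrictTo (hh : HasExpDecay I Λ δ h) (R : σ → Finset (Site d)) :
    HasExpDecay I Λ δ (fun b t => restrictTo (R b) (h b t)) := by
  obtain ⟨a, ha, K, hK, h1⟩ := hh
  refine ⟨a, ha, K, hK, fun b t ht y hy z hz => le_trans ?_ (h1 b t ht y hy z hz)⟩
  exact Finset.sum_le_sum fun Y _ => norm_restrictTo_le _ _ _

/-- Terms of sets reaching out of a neighbourhood of the marked site. -/
theorem sum_far_mul_le {Λ : Finset (Site d)} {δ : Site d → Site d → ℝ} {s : ℕ} {ν : ℝ}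
    (hm : IsRegularMetric Λ δ s ν) {x : Site d} (hx : x ∈ Λ) {R : Finset (Site d)} {L : ℝ}
    (hL : 0 ≤ L) (hR : ∀ y ∈ Λ, y ∉ R → L ≤ δ x y + 1) (h : Finset (Site d) → Obs d r)
    {z : Site d} (hz : z ∈ Λ) (p : ℕ) :
    (∑ Y ∈ Λ.powerset with z ∈ Y, ‖h Y - restrictTo R h Y‖) * (1 + L) ^ p ≤
      2 ^ p * diamSum Λ δ p h z * (1 + δ x z) ^ p := by
  unfold diamSum
  rw [Finset.sum_mul, Finset.mul_sum, Finset.sum_mul]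
  refine Finset.sum_le_sum fun Y hY => ?_
  obtain ⟨hY1, hzY⟩ := Finset.mem_filter.1 hY
  have hY1 := Finset.mem_powerset.1 hY1
  have hxz := hm.nonneg hx hz
  have hD := (finDiam δ Y).coe_nonneg
  by_cases hYR : Y ⊆ R
  · rw [restrictTo_of_subset hYR, sub_self, norm_zero, zero_mul]
    positivity
  · obtain ⟨u, huY, huR⟩ := Finset.not_subset.1 hYR
    have h1 := hR u (hY1 huY) huR
    have h2 := hm.triangle x hx z hz u (hY1 huY)
    have h3 := le_finDiam (δ := δ) hzY huY
    -- A set that contains `z` and leaves `R` has diameter comparable with `L`, unless `z` itself is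
    -- far from `x`.
    have h4 : 1 + L ≤ 2 * (1 + (finDiam δ Y : ℝ)) * (1 + δ x z) := by nlinarith
    rw [restrictTo_of_not_subset hYR, sub_zero]
    calc ‖h Y‖ * (1 + L) ^ p ≤ ‖h Y‖ * (2 * (1 + (finDiam δ Y : ℝ)) * (1 + δ x z)) ^ p := by
          gcongr
      _ = _ := by
        rw [mul_pow, mul_pow]
        ring

theorem IsTimeFamily.timeClose_restrictTo (hS : IsRegularFamily Λ δ x s ν)
    (hh : IsTimeFamily I Λ δ h) {L : σ → ℝ} (hL : ∀ b, 0 ≤ L b) {R : σ → Finset (Site d)}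
    (hR : ∀ b, ∀ y ∈ Λ b, y ∉ R b → L b ≤ δ b (x b) y + 1) :
    TimeClose I Λ δ x L h (fun b t => FermionLattice.restrictTo (R b) (h b t)) := by
  intro i p
  obtain ⟨C, hC, h1⟩ := hh.bdd i p
  refine ⟨2 ^ p * C, by positivity, fun b t ht z hz => ?_⟩
  simp only [iteratedDeriv_restrictTo]
  refine (sum_far_mul_le (hS.regular b) (hS.mem b) (hL b) (hR b)
    (fun Y => iteratedDeriv i (fun τ => h b τ Y) t) hz p).trans ?_
  have h2 := h1 b t ht z hz
  have := (hS.regular b).nonneg (hS.mem b) hz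
  gcongr

variable {α : Type*} [MeasurableSpace α] {μ : Measure α} {κ V : α → ℝ}

theorem IsTimeFamily.contDiffOn_siteAvg_restrictTo (hI : IsOpen I) (hκ : IsPolyKernel μ κ V)
    (hS : IsRegularFamily Λ δ x s ν) (hh : IsTimeFamily I Λ δ h) (hexp : HasExpDecay I Λ δ h)
    (hc : IsTimeFamily I Λ δ c) {R : σ → Finset (Site d)} (hRΛ : ∀ b, R b ⊆ Λ b) (b : σ) :
    ContDiffOn ℝ ∞ (fun t => siteAvg μ κ V (R b) (h b t) (c b t) (x b)) I := by
  have := (hh.restrictTo R).contDiffOn_siteAvg hI hκ hS (hexp.restrictTo R) (hc.restrictTo R) b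
  simpa only [siteAvg_restrictTo μ κ V (hRΛ b)] using this

theorem IsTimeFamily.norm_siteAvg_sub_restrictTo_le (hI : IsOpen I) (hκ : IsPolyKernel μ κ V)
    (hS : IsRegularFamily Λ δ x s ν) (hh : IsTimeFamily I Λ δ h) (hexp : HasExpDecay I Λ δ h)
    (hc : IsTimeFamily I Λ δ c) {L : σ → ℝ} (hL : ∀ b, 0 ≤ L b) {R : σ → Finset (Site d)}
    (hRΛ : ∀ b, R b ⊆ Λ b) (hR : ∀ b, ∀ y ∈ Λ b, y ∉ R b → L b ≤ δ b (x b) y + 1) (i p : ℕ) :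
    ∃ C : ℝ, 0 ≤ C ∧ ∀ b, ∀ t ∈ I,
      ‖iteratedDeriv i (fun t => siteAvg μ κ V (Λ b) (h b t) (c b t) (x b)) t -
        iteratedDeriv i (fun t => siteAvg μ κ V (R b) (h b t) (c b t) (x b)) t‖ *
          (1 + L b) ^ p ≤ C := by
  obtain ⟨C, hC, h1⟩ := TimeClose.norm_siteAvg_sub_le hI hκ hS hL hh hexp hc (hh.restrictTo R)
    (hexp.restrictTo R) (hc.restrictTo R) (hh.timeClose_restrictTo hS hL hR)
    (hc.timeClose_restrictTo hS hL hR) i p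
  refine ⟨C, hC, fun b t ht => ?_⟩
  have h2 := h1 b t ht
  simp only [siteAvg_restrictTo μ κ V (hRΛ b)] at h2
  exact h2

end

/-! ### Finite and infinite volume systems -/

/-- Uniform exponential decay of an interaction and its limit. -/
def IsExpPair (D : BoxMetrics d) (I : Set ℝ) (Φ : ℝ → Interaction d r)
    (Ψ : ℝ → Finset (Site d) → Obs d r) : Prop :=
  ∃ a > (0 : ℝ), ∃ K : ℝ, 0 ≤ K ∧ ∀ t ∈ I, (∀ k, ∀ x ∈ box d k, ∀ y ∈ box d k,
    pairSum (box d k) (Φ t k) x y ≤ K * Real.exp (-(a * D.dist k x y))) ∧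
    ∀ Λ : Finset (Site d), ∀ x ∈ Λ, ∀ y ∈ Λ,
      pairSum Λ (Ψ t) x y ≤ K * Real.exp (-(a * l1Dist x y))

section

variable {σ : Type*} {I : Set ℝ} {D : BoxMetrics d} {γ lam : ℝ} {Φ Φc : ℝ → Interaction d r}
  {Ψ Ψc : ℝ → Finset (Site d) → Obs d r}

theorem IsRapidPair.isTimeFamily (h : IsRapidPair D I γ lam Φ Ψ) (k : σ → ℕ) :
    IsTimeFamily I (fun b => box d (k b)) (fun b => D.dist (k b)) (fun b t => Φ t (k b)) where
  isLocal b t ht Y hY := h.isLocal t ht (k b) Y hY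
  smooth b Y hY := h.smooth (k b) Y hY
  bdd i n := by
    obtain ⟨C, hC, h1⟩ := h.bdd i n
    exact ⟨C, hC, fun b t ht z hz => h1 (k b) t ht z hz⟩

theorem IsRapidPair.isTimeFamily_limit (h : IsRapidPair D I γ lam Φ Ψ)
    (Λ : σ → Finset (Site d)) :
    IsTimeFamily I Λ (fun _ => l1Dist) (fun _ t => Ψ t) where
  isLocal b t ht Y _ := h.isLocal_limit t ht Y
  smooth b Y _ := h.smooth_limit Y
  bdd i n := by
    obtain ⟨C, hC, h1⟩ := h.bdd_limit i n
    exact ⟨C, hC, fun b t ht z hz => h1 (Λ b) t ht z hz⟩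

theorem IsRapidPair.isTimeFamily_limit_box (h : IsRapidPair D I γ lam Φ Ψ) (k : σ → ℕ) :
    IsTimeFamily I (fun b => box d (k b)) (fun b => D.dist (k b)) (fun _ t => Ψ t) where
  isLocal b t ht Y _ := h.isLocal_limit t ht Y
  smooth b Y _ := h.smooth_limit Y
  bdd i n := by
    obtain ⟨C, hC, h1⟩ := h.bdd_limit i n
    refine ⟨C, hC, fun b t ht z hz => le_trans ?_ (h1 (box d (k b)) t ht z hz)⟩
    refine Finset.sum_le_sum fun Y hY => ?_
    have hY := Finset.mem_powerset.1 (Finset.mem_filter.1 hY).1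
    have h2 : finDiam (D.dist (k b)) Y ≤ finDiam l1Dist Y :=
      finDiam_mono fun x hx y hy => D.dist_le_l1 _ x (hY hx) y (hY hy)
    have h3 : (finDiam (D.dist (k b)) Y : ℝ) ≤ finDiam l1Dist Y := NNReal.coe_le_coe.2 h2
    gcongr

theorem IsExpPair.hasExpDecay (h : IsExpPair D I Φ Ψ) (k : σ → ℕ) :
    HasExpDecay I (fun b => box d (k b)) (fun b => D.dist (k b)) (fun b t => Φ t (k b)) := by
  obtain ⟨a, ha, K, hK, h1⟩ := h
  exact ⟨a, ha, K, hK, fun b t ht y hy z hz => (h1 t ht).1 (k b) y hy z hz⟩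

theorem IsExpPair.hasExpDecay_limit (h : IsExpPair D I Φ Ψ) (Λ : σ → Finset (Site d)) :
    HasExpDecay I Λ (fun _ => l1Dist) (fun _ t => Ψ t) := by
  obtain ⟨a, ha, K, hK, h1⟩ := h
  exact ⟨a, ha, K, hK, fun b t ht y hy z hz => (h1 t ht).2 (Λ b) y hy z hz⟩

theorem IsExpPair.hasExpDecay_limit_box (h : IsExpPair D I Φ Ψ) (k : σ → ℕ) :
    HasExpDecay I (fun b => box d (k b)) (fun b => D.dist (k b)) (fun _ t => Ψ t) := by
  obtain ⟨a, ha, K, hK, h1⟩ := h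
  refine ⟨a, ha, K, hK, fun b t ht y hy z hz => ((h1 t ht).2 _ y hy z hz).trans ?_⟩
  have := D.dist_le_l1 (k b) y hy z hz
  gcongr

variable {α : Type*} [MeasurableSpace α] {μ : Measure α} {κ V : α → ℝ}

theorem isRegularFamily_box (D : BoxMetrics d) (k : σ → ℕ) {x : σ → Site d}
    (hx : ∀ b, x b ∈ box d (k b)) : IsRegularFamily (fun b => box d (k b))
      (fun b => D.dist (k b)) x (2 * d) (BoxMetrics.volBound d) :=
  ⟨fun b => D.isRegularMetric (k b), hx⟩

theorem isRegularFamily_l1Dist (Λ : σ → Finset (Site d)) {x : σ → Site d}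
    (hx : ∀ b, x b ∈ Λ b) : IsRegularFamily Λ (fun _ => l1Dist) x (2 * d) (lineBound ^ d) :=
  ⟨fun b => isRegularMetric_l1Dist (Λ b), hx⟩

theorem contDiffOn_siteAvg_box (hI : IsOpen I) (hκ : IsPolyKernel μ κ V)
    (hH : IsRapidPair D I γ lam Φ Ψ) (hE : IsExpPair D I Φ Ψ) (hC : IsRapidPair D I γ lam Φc Ψc)
    {k : ℕ} {R : Finset (Site d)} (hR : R ⊆ box d k) {x : Site d} (hx : x ∈ box d k) :
    ContDiffOn ℝ ∞ (fun t => siteAvg μ κ V R (Φ t k) (Φc t k) x) I :=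
  (hH.isTimeFamily fun _ : Unit => k).contDiffOn_siteAvg_restrictTo hI hκ
    (isRegularFamily_box D (fun _ => k) (x := fun _ => x) fun _ => hx) (hE.hasExpDecay fun _ => k)
    (hC.isTimeFamily fun _ => k) (R := fun _ => R) (fun _ => hR) ()

theorem contDiffOn_siteAvg_limit (hI : IsOpen I) (hκ : IsPolyKernel μ κ V)
    (hH : IsRapidPair D I γ lam Φ Ψ) (hE : IsExpPair D I Φ Ψ) (hC : IsRapidPair D I γ lam Φc Ψc)
    {R : Finset (Site d)} {x : Site d} (hx : x ∈ R) :
    ContDiffOn ℝ ∞ (fun t => siteAvg μ κ V R (Ψ t) (Ψc t) x) I :=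
  (hH.isTimeFamily_limit fun _ : Unit => R).contDiffOn_siteAvg hI hκ
    (isRegularFamily_l1Dist (fun _ => R) (x := fun _ => x) fun _ => hx)
    (hE.hasExpDecay_limit fun _ => R) (hC.isTimeFamily_limit fun _ => R) ()

/-- Locality of the averaged evolution in the boxes. -/
theorem exists_norm_siteAvg_box_sub_le (hI : IsOpen I) (hκ : IsPolyKernel μ κ V)
    (hH : IsRapidPair D I γ lam Φ Ψ) (hE : IsExpPair D I Φ Ψ) (hC : IsRapidPair D I γ lam Φc Ψc)
    (i p : ℕ) : ∃ C : ℝ, 0 ≤ C ∧ ∀ (k : ℕ) (x : Site d) (R : Finset (Site d)) (l : ℕ),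
      x ∈ box d k → R ⊆ box d k → (∀ y ∈ box d k, y ∉ R → (l : ℝ) ≤ D.dist k x y + 1) → ∀ t ∈ I,
      ‖iteratedDeriv i (fun t => siteAvg μ κ V (box d k) (Φ t k) (Φc t k) x) t -
        iteratedDeriv i (fun t => siteAvg μ κ V R (Φ t k) (Φc t k) x) t‖ *
          (1 + (l : ℝ)) ^ p ≤ C := by
  -- The constants are uniform over the index type of a family. Taking all admissible boxes, sites,
  -- regions and radii as indices makes them uniform in these data.
  let σ := {b : ℕ × Site d × Finset (Site d) × ℕ // b.2.1 ∈ box d b.1 ∧ b.2.2.1 ⊆ box d b.1 ∧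
    ∀ y ∈ box d b.1, y ∉ b.2.2.1 → (b.2.2.2 : ℝ) ≤ D.dist b.1 b.2.1 y + 1}
  obtain ⟨C, hC0, h⟩ := (hH.isTimeFamily fun b : σ => b.1.1).norm_siteAvg_sub_restrictTo_le hI hκ
    (isRegularFamily_box D (fun b : σ => b.1.1) (x := fun b => b.1.2.1) fun b => b.2.1)
    (hE.hasExpDecay fun b : σ => b.1.1) (hC.isTimeFamily fun b : σ => b.1.1)
    (L := fun b => (b.1.2.2.2 : ℝ)) (fun b => by positivity) (R := fun b => b.1.2.2.1)
    (fun b => b.2.2.1) (fun b => b.2.2.2) i p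
  exact ⟨C, hC0, fun k x R l hx hR hl t ht => h ⟨(k, x, R, l), hx, hR, hl⟩ t ht⟩

theorem exists_norm_siteAvg_box_le (hI : IsOpen I) (hκ : IsPolyKernel μ κ V)
    (hH : IsRapidPair D I γ lam Φ Ψ) (hE : IsExpPair D I Φ Ψ) (hC : IsRapidPair D I γ lam Φc Ψc)
    (i : ℕ) : ∃ C : ℝ, 0 ≤ C ∧ ∀ (k : ℕ) (x : Site d) (R : Finset (Site d)),
      x ∈ box d k → R ⊆ box d k → ∀ t ∈ I,
      ‖iteratedDeriv i (fun t => siteAvg μ κ V R (Φ t k) (Φc t k) x) t‖ ≤ C := by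
  let σ := {b : ℕ × Site d // b.2 ∈ box d b.1}
  obtain ⟨C1, hC1, h1⟩ := (hH.isTimeFamily fun b : σ => b.1.1).norm_siteAvg_le hI hκ
    (isRegularFamily_box D (fun b : σ => b.1.1) (x := fun b => b.1.2) fun b => b.2)
    (hE.hasExpDecay fun b : σ => b.1.1) (hC.isTimeFamily fun b : σ => b.1.1) i
  obtain ⟨C2, hC2, h2⟩ := exists_norm_siteAvg_box_sub_le hI hκ hH hE hC i 0
  refine ⟨C1 + C2, by positivity, fun k x R hx hR t ht => ?_⟩
  have h3 := h2 k x R 0 hx hR (fun y hy _ => by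
    have := D.dist_nonneg hx hy
    push_cast
    linarith) t ht
  rw [pow_zero, mul_one] at h3
  have h4 := h1 ⟨(k, x), hx⟩ t ht
  have h5 := norm_le_norm_add_norm_sub
    (iteratedDeriv i (fun t => siteAvg μ κ V (box d k) (Φ t k) (Φc t k) x) t)
    (iteratedDeriv i (fun t => siteAvg μ κ V R (Φ t k) (Φc t k) x) t)
  linarith

/-- Locality of the averaged evolution in infinite volume. -/
theorem exists_norm_siteAvg_limit_sub_le (hI : IsOpen I) (hκ : IsPolyKernel μ κ V)
    (hH : IsRapidPair D I γ lam Φ Ψ) (hE : IsExpPair D I Φ Ψ) (hC : IsRapidPair D I γ lam Φc Ψc)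
    (i p : ℕ) : ∃ C : ℝ, 0 ≤ C ∧ ∀ (Λ : Finset (Site d)) (x : Site d) (R : Finset (Site d))
      (l : ℕ), x ∈ Λ → R ⊆ Λ → (∀ y ∈ Λ, y ∉ R → (l : ℝ) ≤ l1Dist x y + 1) → ∀ t ∈ I,
      ‖iteratedDeriv i (fun t => siteAvg μ κ V Λ (Ψ t) (Ψc t) x) t -
        iteratedDeriv i (fun t => siteAvg μ κ V R (Ψ t) (Ψc t) x) t‖ *
          (1 + (l : ℝ)) ^ p ≤ C := by
  let σ := {b : Finset (Site d) × Site d × Finset (Site d) × ℕ // b.2.1 ∈ b.1 ∧ b.2.2.1 ⊆ b.1 ∧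
    ∀ y ∈ b.1, y ∉ b.2.2.1 → (b.2.2.2 : ℝ) ≤ l1Dist b.2.1 y + 1}
  obtain ⟨C, hC0, h⟩ := (hH.isTimeFamily_limit fun b : σ => b.1.1).norm_siteAvg_sub_restrictTo_le
    hI hκ (isRegularFamily_l1Dist (fun b : σ => b.1.1) (x := fun b => b.1.2.1) fun b => b.2.1)
    (hE.hasExpDecay_limit fun b : σ => b.1.1) (hC.isTimeFamily_limit fun b : σ => b.1.1)
    (L := fun b => (b.1.2.2.2 : ℝ)) (fun b => by positivity) (R := fun b => b.1.2.2.1)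
    (fun b => b.2.2.1) (fun b => b.2.2.2) i p
  exact ⟨C, hC0, fun Λ x R l hx hR hl t ht => h ⟨(Λ, x, R, l), hx, hR, hl⟩ t ht⟩

theorem exists_norm_siteAvg_limit_le (hI : IsOpen I) (hκ : IsPolyKernel μ κ V)
    (hH : IsRapidPair D I γ lam Φ Ψ) (hE : IsExpPair D I Φ Ψ) (hC : IsRapidPair D I γ lam Φc Ψc)
    (i : ℕ) : ∃ C : ℝ, 0 ≤ C ∧ ∀ (Λ : Finset (Site d)) (x : Site d), x ∈ Λ → ∀ t ∈ I,
      ‖iteratedDeriv i (fun t => siteAvg μ κ V Λ (Ψ t) (Ψc t) x) t‖ ≤ C := by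
  let σ := {b : Finset (Site d) × Site d // b.2 ∈ b.1}
  obtain ⟨C, hC0, h⟩ := (hH.isTimeFamily_limit fun b : σ => b.1.1).norm_siteAvg_le hI hκ
    (isRegularFamily_l1Dist (fun b : σ => b.1.1) (x := fun b => b.1.2) fun b => b.2)
    (hE.hasExpDecay_limit fun b : σ => b.1.1) (hC.isTimeFamily_limit fun b : σ => b.1.1) i
  exact ⟨C, hC0, fun Λ x hx t ht => h ⟨(Λ, x), hx⟩ t ht⟩

/-- Restricting `Φ` to sets inside the smaller box costs only terms that reach the distance `L` from
the marked site, while inside that box `Φ` and `Ψ` differ by arbitrary inverse powers of `N`. The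
condition `1 + L ≤ K0 (1 + N)` converts the latter into powers of `L`. -/
theorem IsRapidPair.timeClose_box (hlam : 0 < lam) (h : IsRapidPair D I γ lam Φ Ψ) {K0 : ℝ}
    {k N L : σ → ℕ} {x : σ → Site d} (hx : ∀ b, x b ∈ box d (k b))
    (hN : ∀ b, (N b : ℝ) + lam * (N b : ℝ) ^ γ ≤ k b)
    (hLN : ∀ b, 1 + (L b : ℝ) ≤ K0 * (1 + N b))
    (hL : ∀ b, ∀ y ∈ box d (k b), y ∉ box d (N b) → (L b : ℝ) ≤ D.dist (k b) (x b) y + 1) :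
    TimeClose I (fun b => box d (k b)) (fun b => D.dist (k b)) x (fun b => (L b : ℝ))
      (fun b t => Φ t (k b)) (fun b t => restrictTo (box d (N b)) (Ψ t)) := by
  intro i p
  obtain ⟨C1, hC1, h1⟩ := h.bdd i p
  obtain ⟨C2, hC2, h2⟩ := h.close i p
  refine ⟨2 ^ p * C1 + |K0| ^ p * C2, by positivity, fun b t ht z hz => ?_⟩
  have hm := D.isRegularMetric (k b)
  have hNk : box d (N b) ⊆ box d (k b) := by
    refine box_mono ?_
    have h3 := hN b
    have : 0 ≤ lam * (N b : ℝ) ^ γ := by positivity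
    have : (N b : ℝ) ≤ k b := by linarith
    exact_mod_cast this
  have hfar := sum_far_mul_le hm (hx b) (Nat.cast_nonneg (L b)) (hL b)
    (fun Y => iteratedDeriv i (fun τ => Φ τ (k b) Y) t) hz p
  have hδ := hm.nonneg (hx b) hz
  have hδ1 : 1 ≤ (1 + D.dist (k b) (x b) z) ^ p := one_le_pow₀ (by linarith)
  have hnear : (∑ Y ∈ (box d (k b)).powerset with z ∈ Y,
      ‖restrictTo (box d (N b)) (fun Y => iteratedDeriv i (fun τ => Φ τ (k b) Y) t) Y -
        restrictTo (box d (N b)) (fun Y => iteratedDeriv i (fun τ => Ψ τ Y) t) Y‖) *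
        (1 + (L b : ℝ)) ^ p ≤ |K0| ^ p * C2 := by
    by_cases hzN : z ∈ box d (N b)
    · have e : (∑ Y ∈ (box d (k b)).powerset with z ∈ Y,
          ‖restrictTo (box d (N b)) (fun Y => iteratedDeriv i (fun τ => Φ τ (k b) Y) t) Y -
          restrictTo (box d (N b)) (fun Y => iteratedDeriv i (fun τ => Ψ τ Y) t) Y‖) =
          ∑ Y ∈ (box d (N b)).powerset with z ∈ Y, ‖iteratedDeriv i (fun τ => Ψ τ Y) t -
            iteratedDeriv i (fun τ => Φ τ (k b) Y) t‖ := by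
        symm
        refine Finset.sum_subset_zero_on_sdiff
          (Finset.filter_subset_filter _ (Finset.powerset_mono.2 hNk)) (fun Y hY => ?_)
          fun Y hY => ?_
        · have hY' := Finset.mem_sdiff.1 hY
          have : ¬ Y ⊆ box d (N b) := fun h' => hY'.2 (Finset.mem_filter.2
            ⟨Finset.mem_powerset.2 h', (Finset.mem_filter.1 hY'.1).2⟩)
          rw [restrictTo_of_not_subset this, restrictTo_of_not_subset this, sub_zero, norm_zero]
        · have hY' := Finset.mem_powerset.1 (Finset.mem_filter.1 hY).1
          rw [restrictTo_of_subset hY', restrictTo_of_subset hY', norm_sub_rev]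
      rw [e]
      have h3 := h2 (N b) (k b) (hN b) t ht z hzN
      have h4 : (1 + (L b : ℝ)) ^ p ≤ |K0| ^ p * (1 + (N b : ℝ)) ^ p := by
        rw [← mul_pow]
        refine pow_le_pow_left₀ (by positivity) ((hLN b).trans ?_) p
        gcongr
        exact le_abs_self K0
      calc _ ≤ (∑ Y ∈ (box d (N b)).powerset with z ∈ Y, ‖iteratedDeriv i (fun τ => Ψ τ Y) t -
            iteratedDeriv i (fun τ => Φ τ (k b) Y) t‖) * (|K0| ^ p * (1 + (N b : ℝ)) ^ p) := by
            gcongr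
        _ = |K0| ^ p * ((∑ Y ∈ (box d (N b)).powerset with z ∈ Y,
            ‖iteratedDeriv i (fun τ => Ψ τ Y) t - iteratedDeriv i (fun τ => Φ τ (k b) Y) t‖) *
              (1 + (N b : ℝ)) ^ p) := by ring
        _ ≤ _ := by gcongr
    · rw [Finset.sum_eq_zero fun Y hY => ?_, zero_mul]
      · positivity
      · have : ¬ Y ⊆ box d (N b) := fun h' => hzN (h' (Finset.mem_filter.1 hY).2)
        rw [restrictTo_of_not_subset this, restrictTo_of_not_subset this, sub_zero, norm_zero]
  simp only [iteratedDeriv_restrictTo]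
  have hsplit : (∑ Y ∈ (box d (k b)).powerset with z ∈ Y, ‖iteratedDeriv i (fun τ => Φ τ (k b) Y) t
      - restrictTo (box d (N b)) (fun Y => iteratedDeriv i (fun τ => Ψ τ Y) t) Y‖) ≤
      (∑ Y ∈ (box d (k b)).powerset with z ∈ Y, ‖iteratedDeriv i (fun τ => Φ τ (k b) Y) t -
        restrictTo (box d (N b)) (fun Y => iteratedDeriv i (fun τ => Φ τ (k b) Y) t) Y‖) +
      ∑ Y ∈ (box d (k b)).powerset with z ∈ Y,
      ‖restrictTo (box d (N b)) (fun Y => iteratedDeriv i (fun τ => Φ τ (k b) Y) t) Y -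
        restrictTo (box d (N b)) (fun Y => iteratedDeriv i (fun τ => Ψ τ Y) t) Y‖ := by
    rw [← Finset.sum_add_distrib]
    exact Finset.sum_le_sum fun Y _ => norm_sub_le_norm_sub_add_norm_sub _ _ _
  have h5 := h1 (k b) t ht z hz
  calc _ ≤ _ := mul_le_mul_of_nonneg_right hsplit (by positivity)
    _ ≤ 2 ^ p * C1 * (1 + D.dist (k b) (x b) z) ^ p + |K0| ^ p * C2 := by
      rw [add_mul]
      refine add_le_add (hfar.trans ?_) hnear
      gcongr
    _ ≤ (2 ^ p * C1 + |K0| ^ p * C2) * (1 + D.dist (k b) (x b) z) ^ p := by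
      rw [add_mul]
      exact add_le_add le_rfl (le_mul_of_one_le_right (by positivity) hδ1)

/-- Comparison of the averaged evolution in a box with the one of the limit in a smaller box. -/
theorem exists_norm_siteAvg_box_sub_limit_le (hI : IsOpen I) (hκ : IsPolyKernel μ κ V)
    (hlam : 0 < lam) (hH : IsRapidPair D I γ lam Φ Ψ) (hE : IsExpPair D I Φ Ψ)
    (hC : IsRapidPair D I γ lam Φc Ψc) (K0 : ℝ) (i p : ℕ) :
    ∃ C : ℝ, 0 ≤ C ∧ ∀ (k N L : ℕ) (x : Site d), x ∈ box d k →
      (N : ℝ) + lam * (N : ℝ) ^ γ ≤ k → 1 + (L : ℝ) ≤ K0 * (1 + N) →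
      (∀ y ∈ box d k, y ∉ box d N → (L : ℝ) ≤ D.dist k x y + 1) → ∀ t ∈ I,
      ‖iteratedDeriv i (fun t => siteAvg μ κ V (box d k) (Φ t k) (Φc t k) x) t -
        iteratedDeriv i (fun t => siteAvg μ κ V (box d N) (Ψ t) (Ψc t) x) t‖ *
          (1 + (L : ℝ)) ^ p ≤ C := by
  let σ := {b : ℕ × ℕ × ℕ × Site d // b.2.2.2 ∈ box d b.1 ∧
    (b.2.1 : ℝ) + lam * (b.2.1 : ℝ) ^ γ ≤ b.1 ∧ 1 + (b.2.2.1 : ℝ) ≤ K0 * (1 + b.2.1) ∧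
    ∀ y ∈ box d b.1, y ∉ box d b.2.1 → (b.2.2.1 : ℝ) ≤ D.dist b.1 b.2.2.2 y + 1}
  have hc1 := hH.timeClose_box (σ := σ) hlam (k := fun b => b.1.1) (N := fun b => b.1.2.1)
    (L := fun b => b.1.2.2.1) (x := fun b => b.1.2.2.2) (fun b => b.2.1) (fun b => b.2.2.1)
    (fun b => b.2.2.2.1) (fun b => b.2.2.2.2)
  have hc2 := hC.timeClose_box (σ := σ) hlam (k := fun b => b.1.1) (N := fun b => b.1.2.1)
    (L := fun b => b.1.2.2.1) (x := fun b => b.1.2.2.2) (fun b => b.2.1) (fun b => b.2.2.1)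
    (fun b => b.2.2.2.1) (fun b => b.2.2.2.2)
  obtain ⟨C, hC0, h⟩ := TimeClose.norm_siteAvg_sub_le hI hκ
    (isRegularFamily_box D (fun b : σ => b.1.1) (x := fun b => b.1.2.2.2) fun b => b.2.1)
    (fun b => by positivity)
    (hH.isTimeFamily fun b : σ => b.1.1) (hE.hasExpDecay fun b : σ => b.1.1)
    (hC.isTimeFamily fun b : σ => b.1.1)
    ((hH.isTimeFamily_limit_box fun b : σ => b.1.1).restrictTo _)
    ((hE.hasExpDecay_limit_box fun b : σ => b.1.1).restrictTo _)
    ((hC.isTimeFamily_limit_box fun b : σ => b.1.1).restrictTo _) hc1 hc2 i p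
  refine ⟨C, hC0, fun k N L x hx hN hLN hL t ht => ?_⟩
  have hNk : box d N ⊆ box d k := by
    refine box_mono ?_
    have : 0 ≤ lam * (N : ℝ) ^ γ := by positivity
    have : (N : ℝ) ≤ k := by linarith
    exact_mod_cast this
  have h3 := h ⟨(k, N, L, x), hx, hN, hLN, hL⟩ t ht
  simpa only [siteAvg_restrictTo μ κ V hNk] using h3

end

end

section

variable {d r : ℕ}

/-! ### Telescopic decomposition of local families -/

/-- Operators `A k R x t` (in the box of size `k`) and `a R x t` (in infinite volume) associated
with a site `x` and computed within a region `R`, such that the dependence on the region decays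
rapidly with its distance to `x`, and `A` is close to `a` in the bulk. -/
structure IsSiteFamily (D : BoxMetrics d) (I : Set ℝ) (lam γ : ℝ)
    (A : ℕ → Finset (Site d) → Site d → ℝ → Obs d r)
    (a : Finset (Site d) → Site d → ℝ → Obs d r) : Prop where
  smooth : ∀ k x R, x ∈ box d k → R ⊆ box d k → ContDiffOn ℝ ∞ (A k R x) I
  smooth_limit : ∀ x R, x ∈ R → ContDiffOn ℝ ∞ (a R x) I
  isLocal : ∀ k x R, R ⊆ box d k → ∀ t ∈ I, IsLocalTerm R (A k R x t)
  isLocal_limit : ∀ x R, ∀ t ∈ I, IsLocalTerm R (a R x t)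
  bdd : ∀ i : ℕ, ∃ C : ℝ, 0 ≤ C ∧ ∀ k x R, x ∈ box d k → R ⊆ box d k → ∀ t ∈ I,
    ‖iteratedDeriv i (A k R x) t‖ ≤ C
  bdd_limit : ∀ i : ℕ, ∃ C : ℝ, 0 ≤ C ∧ ∀ x R, x ∈ R → ∀ t ∈ I,
    ‖iteratedDeriv i (a R x) t‖ ≤ C
  near : ∀ i p : ℕ, ∃ C : ℝ, 0 ≤ C ∧ ∀ (k : ℕ) (x : Site d) (R : Finset (Site d)) (l : ℕ),
    x ∈ box d k → R ⊆ box d k → (∀ y ∈ box d k, y ∉ R → (l : ℝ) ≤ D.dist k x y + 1) → ∀ t ∈ I,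
    ‖iteratedDeriv i (A k (box d k) x) t - iteratedDeriv i (A k R x) t‖ * (1 + (l : ℝ)) ^ p ≤ C
  near_limit : ∀ i p : ℕ, ∃ C : ℝ, 0 ≤ C ∧ ∀ (Λ : Finset (Site d)) (x : Site d)
    (R : Finset (Site d)) (l : ℕ), x ∈ Λ → R ⊆ Λ →
    (∀ y ∈ Λ, y ∉ R → (l : ℝ) ≤ l1Dist x y + 1) → ∀ t ∈ I,
    ‖iteratedDeriv i (a Λ x) t - iteratedDeriv i (a R x) t‖ * (1 + (l : ℝ)) ^ p ≤ C
  compare : ∀ (K0 : ℝ) (i p : ℕ), ∃ C : ℝ, 0 ≤ C ∧ ∀ (k N L : ℕ) (x : Site d), x ∈ box d k →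
    (N : ℝ) + lam * (N : ℝ) ^ γ ≤ k → 1 + (L : ℝ) ≤ K0 * (1 + N) →
    (∀ y ∈ box d k, y ∉ box d N → (L : ℝ) ≤ D.dist k x y + 1) → ∀ t ∈ I,
    ‖iteratedDeriv i (A k (box d k) x) t - iteratedDeriv i (a (box d N) x) t‖ *
      (1 + (L : ℝ)) ^ p ≤ C

/-! ### The bulk of a box, neighbourhoods and the distance to the boundary of the bulk. -/

/-- The size of the bulk of the box of size `k`. -/
def bulkSize (lam γ : ℝ) (k : ℕ) : ℕ :=
  open Classical in Nat.findGreatest (fun M => (M : ℝ) + lam * (M : ℝ) ^ γ ≤ k) k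

theorem bulkSize_spec (lam : ℝ) {γ : ℝ} (hγ : 0 < γ) (k : ℕ) :
    (bulkSize lam γ k : ℝ) + lam * (bulkSize lam γ k : ℝ) ^ γ ≤ k := by
  classical
  exact Nat.findGreatest_spec (P := fun M : ℕ => (M : ℝ) + lam * (M : ℝ) ^ γ ≤ k) (m := 0)
    (Nat.zero_le k) (by
      rw [Nat.cast_zero, Real.zero_rpow hγ.ne']
      simp)

theorem bulkSize_le (lam γ : ℝ) (k : ℕ) : bulkSize lam γ k ≤ k := Nat.findGreatest_le k

theorem le_bulkSize {lam γ : ℝ} (hlam : 0 < lam) {M k : ℕ}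
    (h : (M : ℝ) + lam * (M : ℝ) ^ γ ≤ k) : M ≤ bulkSize lam γ k := by
  have h0 : 0 ≤ lam * (M : ℝ) ^ γ := by positivity
  have h1 : (M : ℝ) ≤ k := by linarith
  exact Nat.le_findGreatest (by exact_mod_cast h1) h

theorem bulkSize_lt {lam γ : ℝ} (hlam : 0 < lam) (hγ : 0 < γ) {k : ℕ} (hk : 0 < k) :
    bulkSize lam γ k < k := by
  refine lt_of_le_of_ne (bulkSize_le lam γ k) fun h => ?_
  have h1 := bulkSize_spec lam hγ k
  rw [h] at h1
  have : 0 < lam * (k : ℝ) ^ γ := by positivity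
  linarith

/-- By maximality `N + 1` violates the condition defining the bulk, and `(N + 1)^γ ≤ N + 1` as `γ <
1`. Hence powers of the bulk size are as good as powers of `k`. -/
theorem one_add_le_bulkSize {lam γ : ℝ} (hlam : 0 < lam) (hγ : γ < 1) (k : ℕ) :
    1 + (k : ℝ) ≤ (2 + lam) * (1 + bulkSize lam γ k) := by
  set N := bulkSize lam γ k with hN
  have hN0 : (0 : ℝ) ≤ N := by positivity
  by_contra hlt
  push Not at hlt
  have h1 : ((N + 1 : ℕ) : ℝ) + lam * ((N + 1 : ℕ) : ℝ) ^ γ ≤ k := by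
    have h2 : ((N + 1 : ℕ) : ℝ) ^ γ ≤ (N + 1 : ℕ) := by
      have := Real.rpow_le_rpow_of_exponent_le (x := ((N + 1 : ℕ) : ℝ)) (by simp) hγ.le
      rwa [Real.rpow_one] at this
    have h3 := mul_le_mul_of_nonneg_left h2 hlam.le
    push_cast at h3 ⊢
    linarith
  have := le_bulkSize hlam h1
  omega

section

variable (D : BoxMetrics d) (lam γ : ℝ)

/-- The neighbourhood of radius `l` of the site `x` in the box of size `k`. -/
def nbhd (k : ℕ) (x : Site d) (l : ℕ) : Finset (Site d) :=
  open Classical in if l < k then (box d k).filter fun y => D.dist k x y ≤ l else box d k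

theorem nbhd_subset (k : ℕ) (x : Site d) (l : ℕ) : nbhd D k x l ⊆ box d k := by
  unfold nbhd
  split_ifs
  · exact Finset.filter_subset _ _
  · exact subset_rfl

theorem nbhd_of_le {k l : ℕ} (h : k ≤ l) (x : Site d) : nbhd D k x l = box d k := by
  unfold nbhd
  rw [if_neg (by omega)]

theorem mem_nbhd {k l : ℕ} {x y : Site d} (hy : y ∈ box d k) (h : D.dist k x y ≤ l) :
    y ∈ nbhd D k x l := by
  unfold nbhd
  split_ifs
  · exact Finset.mem_filter.2 ⟨hy, h⟩
  · exact hy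

theorem lt_dist_of_notMem_nbhd {k l : ℕ} {x y : Site d} (hy : y ∈ box d k)
    (h : y ∉ nbhd D k x l) : (l : ℝ) < D.dist k x y := by
  by_contra hle
  exact h (mem_nbhd D hy (not_lt.1 hle))

/-- The neighbourhood of radius `k` is the whole box, where only the `ℓ¹`-bound `2 d k` is
available; this is the origin of the factor. -/
theorem dist_le_of_mem_nbhd {k l : ℕ} {x y : Site d} (hx : x ∈ box d k) (hl : l ≤ k)
    (hy : y ∈ nbhd D k x l) : D.dist k x y ≤ (2 * d + 1) * l := by
  have hyb := nbhd_subset D k x l hy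
  have hl0 : (0 : ℝ) ≤ 2 * d * l := by positivity
  rcases hl.lt_or_eq with h | h
  · unfold nbhd at hy
    rw [if_pos h] at hy
    have := (Finset.mem_filter.1 hy).2
    linarith
  · subst h
    have h1 := (D.dist_le_l1 l x hx y hyb).trans (l1Dist_le_of_mem_box hx hyb)
    have : (0 : ℝ) ≤ l := by positivity
    linarith

theorem ball1_subset_nbhd {k l m : ℕ} {x : Site d} (hx : x ∈ box d k) (hm : m ≤ l)
    (hb : ball1 x m ⊆ box d k) : ball1 x m ⊆ nbhd D k x l := by
  intro y hy
  refine mem_nbhd D (hb hy) ((D.dist_le_l1 k x hx y (hb hy)).trans ((mem_ball1.1 hy).trans ?_))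
  exact_mod_cast hm

/-- The distance from `x` to the complement of the bulk. -/
def exitRadius (k : ℕ) (x : Site d) : ℕ :=
  sInf {l : ℕ | k ≤ l ∨ ∃ y ∈ box d k, y ∉ box d (bulkSize lam γ k) ∧ D.dist k x y ≤ l}

theorem exitRadius_le (k : ℕ) (x : Site d) : exitRadius D lam γ k x ≤ k :=
  Nat.sInf_le (Or.inl le_rfl)

theorem exitRadius_le_dist {k : ℕ} {x y : Site d} (hx : x ∈ box d k) (hy : y ∈ box d k)
    (hy' : y ∉ box d (bulkSize lam γ k)) : (exitRadius D lam γ k x : ℝ) ≤ D.dist k x y + 1 := by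
  have h1 : exitRadius D lam γ k x ≤ ⌈D.dist k x y⌉₊ :=
    Nat.sInf_le (Or.inr ⟨y, hy, hy', Nat.le_ceil _⟩)
  have h2 := Nat.ceil_lt_add_one (D.dist_nonneg hx hy)
  have h3 : (exitRadius D lam γ k x : ℝ) ≤ (⌈D.dist k x y⌉₊ : ℝ) := by exact_mod_cast h1
  linarith

theorem exitRadius_eq_zero {k : ℕ} {x : Site d} (hx : x ∈ box d k)
    (hx' : x ∉ box d (bulkSize lam γ k)) : exitRadius D lam γ k x = 0 := by
  refine Nat.le_zero.1 (Nat.sInf_le (Or.inr ⟨x, hx, hx', ?_⟩))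
  rw [D.dist_self hx]
  simp

/-- From the exit radius on, a neighbourhood contains a site outside the bulk, unless its radius has
reached `k`, when it is the whole box. So the sets that carry the boundary interaction are not
contained in the bulk unless the whole box is. -/
theorem box_subset_of_nbhd_subset {k l : ℕ} {x : Site d} (hl : exitRadius D lam γ k x ≤ l)
    (hlk : l ≤ k) (h : nbhd D k x l ⊆ box d (bulkSize lam γ k)) :
    l = k ∧ box d k ⊆ box d (bulkSize lam γ k) := by
  rcases hlk.lt_or_eq with hlt | rfl
  · exfalso
    have hmem : exitRadius D lam γ k x ∈ {l : ℕ | k ≤ l ∨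
        ∃ y ∈ box d k, y ∉ box d (bulkSize lam γ k) ∧ D.dist k x y ≤ l} :=
      Nat.sInf_mem ⟨k, Or.inl le_rfl⟩
    rcases hmem with h1 | ⟨y, hy, hy', hd⟩
    · omega
    · refine hy' (h (mem_nbhd D hy (hd.trans ?_)))
      exact_mod_cast hl
  · rw [nbhd_of_le D le_rfl] at h
    exact ⟨rfl, h⟩

/-- The bulk size is strictly smaller than a positive `k`, so the bulk can contain the box only if
`k = 0` or `d = 0`, and then there is a single site. -/
theorem eq_of_box_subset_bulk {lam γ : ℝ} (hlam : 0 < lam) (hγ : 0 < γ) {k : ℕ}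
    (h : box d k ⊆ box d (bulkSize lam γ k)) {y z : Site d} (hy : y ∈ box d k)
    (hz : z ∈ box d k) : y = z := by
  rcases Nat.eq_zero_or_pos k with rfl | hk
  · funext j
    have h1 := mem_box.1 hy j
    have h2 := mem_box.1 hz j
    simp only [Nat.cast_zero, abs_nonpos_iff] at h1 h2
    rw [h1, h2]
  · rcases Nat.eq_zero_or_pos d with rfl | hd
    · exact Subsingleton.elim _ _
    · have := box_subset_of_lt hd h
      have := bulkSize_lt hlam hγ hk
      omega

/-- The radius of the largest ball around `x` in the bulk. -/
def bulkRadius (k : ℕ) (x : Site d) : ℕ := bulkSize lam γ k - supNorm x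

theorem ball1_subset_bulk {k l : ℕ} {x : Site d} (hx : x ∈ box d (bulkSize lam γ k))
    (hl : l ≤ bulkRadius lam γ k x) : ball1 x l ⊆ box d (bulkSize lam γ k) := by
  have := mem_box_iff_supNorm.1 hx
  unfold bulkRadius at hl
  exact ball1_subset_box (by omega)

/-- Moving `x` outwards in a coordinate of largest modulus leaves the bulk after `bulkRadius + 1`
steps, and the box metric is no larger than the number of steps. In dimension zero nothing lies
outside the bulk, and the exit radius is bounded through `k` instead. -/
theorem one_add_exitRadius_le {lam γ : ℝ} (hlam : 0 < lam) (hγ : 0 < γ) (hγ1 : γ < 1) {k : ℕ}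
    {x : Site d} (hx : x ∈ box d (bulkSize lam γ k)) :
    1 + (exitRadius D lam γ k x : ℝ) ≤ (2 + lam) * (1 + bulkRadius lam γ k x) := by
  have hJ : (0 : ℝ) ≤ bulkRadius lam γ k x := by positivity
  have hle : (exitRadius D lam γ k x : ℝ) ≤ k := by exact_mod_cast exitRadius_le D lam γ k x
  rcases Nat.eq_zero_or_pos d with rfl | hd
  · have h1 := one_add_le_bulkSize hlam hγ1 k
    have h2 : bulkRadius lam γ k x = bulkSize lam γ k := by
      unfold bulkRadius supNorm
      simp
    rw [h2]
    linarith
  · have h3 : exitRadius D lam γ k x ≤ bulkRadius lam γ k x + 1 := by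
      rcases Nat.eq_zero_or_pos k with rfl | hk
      · have := exitRadius_le D lam γ 0 x
        omega
      · have hlt := bulkSize_lt hlam hγ hk
        obtain ⟨y, hy, hy', hxy⟩ := exists_mem_box_succ hd hx
        have hyk := box_mono (d := d) (by omega : bulkSize lam γ k + 1 ≤ k) hy
        have hxk := box_mono (d := d) hlt.le hx
        refine Nat.sInf_le (Or.inr ⟨y, hyk, hy', ?_⟩)
        refine (D.dist_le_l1 k x hxk y hyk).trans ?_
        rw [hxy]
        rfl
    have h4 : (exitRadius D lam γ k x : ℝ) ≤ bulkRadius lam γ k x + 1 := by exact_mod_cast h3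
    nlinarith

end

theorem sum_telescope {E : Type*} [AddCommGroup E] (f : ℕ → E) {L k : ℕ} (h : L ≤ k) :
    ∑ l ∈ Finset.Icc L k, (f l - if L < l then f (l - 1) else 0) = f k := by
  induction k, h using Nat.le_induction with
  | base => simp
  | succ k hk ih =>
    rw [Finset.sum_Icc_succ_top (by omega), ih, if_pos (by omega)]
    simp

/-! ### Increments and the interactions built from them. -/

variable (D : BoxMetrics d) (lam γ : ℝ) (A : ℕ → Finset (Site d) → Site d → ℝ → Obs d r)
  (a : Finset (Site d) → Site d → ℝ → Obs d r)

/-- The increments of the infinite volume operators. -/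
def limitStep (x : Site d) (l : ℕ) (t : ℝ) : Obs d r :=
  a (ball1 x l) x t - if 0 < l then a (ball1 x (l - 1)) x t else 0

/-- The infinite volume interaction built from the increments. -/
def limitTerm (t : ℝ) (Z : Finset (Site d)) : Obs d r :=
  ∑ x ∈ Z, ∑ l ∈ Finset.range Z.card, if ball1 x l = Z then limitStep a x l t else 0

/-- The difference between the finite and the infinite volume operators. -/
def boundaryOp (k : ℕ) (x : Site d) (l : ℕ) (t : ℝ) : Obs d r :=
  A k (nbhd D k x l) x t -
    if x ∈ box d (bulkSize lam γ k) then a (ball1 x (min l (bulkRadius lam γ k x))) x t else 0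

/-- The increments of the differences. -/
def boundaryStep (k : ℕ) (x : Site d) (l : ℕ) (t : ℝ) : Obs d r :=
  boundaryOp D lam γ A a k x l t -
    if exitRadius D lam γ k x < l then boundaryOp D lam γ A a k x (l - 1) t else 0

/-- The boundary interaction built from the increments of the differences. -/
def boundaryTerm (k : ℕ) (t : ℝ) (Z : Finset (Site d)) : Obs d r :=
  ∑ x ∈ box d k, ∑ l ∈ Finset.Icc (exitRadius D lam γ k x) k,
    if nbhd D k x l = Z then boundaryStep D lam γ A a k x l t else 0

theorem sum_boundaryTerm (k : ℕ) (t : ℝ) :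
    ∑ Z ∈ (box d k).powerset, boundaryTerm D lam γ A a k t Z =
      ∑ x ∈ box d k, boundaryOp D lam γ A a k x k t := by
  unfold boundaryTerm
  rw [Finset.sum_comm]
  refine Finset.sum_congr rfl fun x _ => ?_
  rw [Finset.sum_comm, ← sum_telescope (fun l => boundaryOp D lam γ A a k x l t)
    (exitRadius_le D lam γ k x)]
  refine Finset.sum_congr rfl fun l _ => ?_
  rw [Finset.sum_ite_eq, if_pos (Finset.mem_powerset.2 (nbhd_subset D k x l))]
  rfl

/-- For each site the increments of the balls inside the bulk telescope up to the largest such ball.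
In dimension zero all balls coincide, and the cutoff `l < Z.card` keeps only the increment `l = 0`.
-/
theorem sum_limitTerm (k : ℕ) (t : ℝ) :
    ∑ Z ∈ (box d (bulkSize lam γ k)).powerset, limitTerm a t Z =
      ∑ x ∈ box d (bulkSize lam γ k), a (ball1 x (bulkRadius lam γ k x)) x t := by
  set N := bulkSize lam γ k with hN
  have h1 : ∀ Z ∈ (box d N).powerset, limitTerm a t Z = ∑ x ∈ box d N,
      ∑ l ∈ Finset.range (box d N).card,
        if ball1 x l = Z ∧ l < (ball1 x l).card then limitStep a x l t else 0 := by
    intro Z hZ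
    have hZ := Finset.mem_powerset.1 hZ
    unfold limitTerm
    have h2 : ∀ x, ∑ l ∈ Finset.range Z.card, (if ball1 x l = Z then limitStep a x l t else 0) =
        ∑ l ∈ Finset.range (box d N).card,
        if ball1 x l = Z ∧ l < (ball1 x l).card then limitStep a x l t else 0 := by
      intro x
      refine (Finset.sum_congr rfl fun l hl => ?_).trans (Finset.sum_subset
        (Finset.range_mono (Finset.card_le_card hZ)) fun l _ hl => ?_)
      · by_cases h : ball1 x l = Z
        · rw [if_pos h, if_pos ⟨h, by rw [h]; exact Finset.mem_range.1 hl⟩]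
        · rw [if_neg h, if_neg fun h' => h h'.1]
      · refine if_neg fun h' => hl (Finset.mem_range.2 ?_)
        rw [← h'.1]
        exact h'.2
    rw [Finset.sum_congr rfl fun x _ => h2 x]
    refine Finset.sum_subset hZ fun x _ hx => Finset.sum_eq_zero fun l _ => if_neg fun h' => hx ?_
    rw [← h'.1]
    exact self_mem_ball1 x l
  rw [Finset.sum_congr rfl h1, Finset.sum_comm]
  refine Finset.sum_congr rfl fun x hx => ?_
  rw [Finset.sum_comm]
  have h3 : ∀ l ∈ Finset.range (box d N).card, (∑ Z ∈ (box d N).powerset,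
      if ball1 x l = Z ∧ l < (ball1 x l).card then limitStep a x l t else 0) =
      if ball1 x l ⊆ box d N ∧ l < (ball1 x l).card then limitStep a x l t else 0 := by
    intro l _
    by_cases hlt : l < (ball1 x l).card
    · simp only [hlt, and_true]
      rw [Finset.sum_ite_eq]
      simp only [Finset.mem_powerset]
    · simp [hlt]
  rw [Finset.sum_congr rfl h3, ← Finset.sum_filter]
  have hxN := mem_box_iff_supNorm.1 hx
  rcases Nat.eq_zero_or_pos d with rfl | hd
  · have e : (Finset.range (box 0 N).card).filter
        (fun l => ball1 x l ⊆ box 0 N ∧ l < (ball1 x l).card) = {0} := by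
      ext l
      simp only [ball1_eq_of_dim_zero, Finset.mem_filter, Finset.mem_range, Finset.card_singleton,
        Finset.singleton_subset_iff, Finset.mem_singleton]
      refine ⟨fun h => by omega, fun h => ⟨?_, hx, by omega⟩⟩
      rw [h]
      exact Finset.card_pos.2 ⟨x, hx⟩
    rw [e, Finset.sum_singleton, limitStep, if_neg (lt_irrefl 0), sub_zero,
      ball1_eq_of_dim_zero, ball1_eq_of_dim_zero]
  · have e : (Finset.range (box d N).card).filter
        (fun l => ball1 x l ⊆ box d N ∧ l < (ball1 x l).card) =
        Finset.Icc 0 (bulkRadius lam γ k x) := by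
      ext l
      rw [Finset.mem_filter, Finset.mem_range, Finset.mem_Icc, ball1_subset_box_iff hd]
      have h4 : l ≤ bulkRadius lam γ k x ↔ supNorm x + l ≤ N := by
        unfold bulkRadius
        omega
      rw [h4]
      refine ⟨fun h => ⟨Nat.zero_le _, h.2.1⟩, fun h => ⟨?_, h.2, lt_card_ball1 hd x l⟩⟩
      exact (lt_card_ball1 hd x l).trans_le (Finset.card_le_card (ball1_subset_box h.2))
    rw [e]
    exact sum_telescope (fun l => a (ball1 x l) x t) (Nat.zero_le _)

end

section

variable {d r : ℕ}

/-! ### Estimates for the increments -/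

section

variable {E : Type*} [NormedAddCommGroup E] [NormedSpace ℝ E] {I : Set ℝ}

theorem contDiffOn_ite (p : Prop) [Decidable p] {f : ℝ → E} (hf : p → ContDiffOn ℝ ∞ f I) :
    ContDiffOn ℝ ∞ (fun τ => if p then f τ else 0) I := by
  split_ifs with h
  · exact hf h
  · exact contDiffOn_const

theorem iteratedDeriv_ite (p : Prop) [Decidable p] (f : ℝ → E) (i : ℕ) (t : ℝ) :
    iteratedDeriv i (fun τ => if p then f τ else 0) t = if p then iteratedDeriv i f t else 0 := by
  split_ifs with h
  · rfl
  · rw [iteratedDeriv_const]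
    simp

theorem iteratedDeriv_sub_ite (hI : IsOpen I) (p : Prop) [Decidable p] {f f' : ℝ → E}
    (hf : ContDiffOn ℝ ∞ f I) (hf' : p → ContDiffOn ℝ ∞ f' I) (i : ℕ) {t : ℝ} (ht : t ∈ I) :
    iteratedDeriv i (fun τ => f τ - if p then f' τ else 0) t =
      iteratedDeriv i f t - if p then iteratedDeriv i f' t else 0 := by
  rw [iteratedDeriv_sub_of_contDiffOn hI hf (contDiffOn_ite p hf') i ht, iteratedDeriv_ite]

theorem iteratedDeriv_sum_sum_ite {ι ι' : Type*} (hI : IsOpen I) (s : Finset ι)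
    (s' : ι → Finset ι') (p : ι → ι' → Prop) [∀ j j', Decidable (p j j')] {f : ι → ι' → ℝ → E}
    (hf : ∀ j ∈ s, ∀ j', ContDiffOn ℝ ∞ (f j j') I) (i : ℕ) {t : ℝ} (ht : t ∈ I) :
    iteratedDeriv i (fun τ => ∑ j ∈ s, ∑ j' ∈ s' j, if p j j' then f j j' τ else 0) t =
      ∑ j ∈ s, ∑ j' ∈ s' j, if p j j' then iteratedDeriv i (f j j') t else 0 := by
  have h1 : ∀ j ∈ s, ∀ j' ∈ s' j, ContDiffOn ℝ ∞ (fun τ => if p j j' then f j j' τ else 0) I :=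
    fun j hj j' _ => contDiffOn_ite _ fun _ => hf j hj j'
  rw [iteratedDeriv_sum_of_contDiffOn hI s (fun j hj => ContDiffOn.sum (h1 j hj)) i ht]
  refine Finset.sum_congr rfl fun j hj => ?_
  rw [iteratedDeriv_sum_of_contDiffOn hI (s' j) (h1 j hj) i ht]
  exact Finset.sum_congr rfl fun j' _ => iteratedDeriv_ite _ _ _ _

end

variable {D : BoxMetrics d} {I : Set ℝ} {lam γ : ℝ}
  {A : ℕ → Finset (Site d) → Site d → ℝ → Obs d r} {a : Finset (Site d) → Site d → ℝ → Obs d r}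

namespace IsSiteFamily

section

variable (hA : IsSiteFamily D I lam γ A a)
include hA

theorem contDiffOn_limitStep (x : Site d) (l : ℕ) :
    ContDiffOn ℝ ∞ (fun τ => limitStep a x l τ) I :=
  (hA.smooth_limit x _ (self_mem_ball1 x l)).sub
    (contDiffOn_ite _ fun _ => hA.smooth_limit x _ (self_mem_ball1 x _))

theorem iteratedDeriv_limitStep (hI : IsOpen I) (x : Site d) (l i : ℕ) {t : ℝ} (ht : t ∈ I) :
    iteratedDeriv i (fun τ => limitStep a x l τ) t =
      limitStep (fun R x => iteratedDeriv i (a R x)) x l t :=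
  iteratedDeriv_sub_ite hI _ (hA.smooth_limit x _ (self_mem_ball1 x l))
    (fun _ => hA.smooth_limit x _ (self_mem_ball1 x _)) i ht

theorem contDiffOn_limitTerm (Z : Finset (Site d)) :
    ContDiffOn ℝ ∞ (fun τ => limitTerm a τ Z) I :=
  ContDiffOn.sum fun x _ => ContDiffOn.sum fun l _ =>
    contDiffOn_ite _ fun _ => hA.contDiffOn_limitStep x l

theorem iteratedDeriv_limitTerm (hI : IsOpen I) (Z : Finset (Site d)) (i : ℕ) {t : ℝ}
    (ht : t ∈ I) : iteratedDeriv i (fun τ => limitTerm a τ Z) t =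
      limitTerm (fun R x => iteratedDeriv i (a R x)) t Z := by
  unfold limitTerm
  rw [iteratedDeriv_sum_sum_ite hI Z _ _ (fun x _ l => hA.contDiffOn_limitStep x l) i ht]
  simp_rw [hA.iteratedDeriv_limitStep hI _ _ i ht]

theorem contDiffOn_boundaryOp {k : ℕ} {x : Site d} (hx : x ∈ box d k) (l : ℕ) :
    ContDiffOn ℝ ∞ (fun τ => boundaryOp D lam γ A a k x l τ) I :=
  (hA.smooth k x _ hx (nbhd_subset D k x l)).sub
    (contDiffOn_ite _ fun _ => hA.smooth_limit x _ (self_mem_ball1 x _))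

theorem iteratedDeriv_boundaryOp (hI : IsOpen I) {k : ℕ} {x : Site d} (hx : x ∈ box d k) (l i : ℕ)
    {t : ℝ} (ht : t ∈ I) : iteratedDeriv i (fun τ => boundaryOp D lam γ A a k x l τ) t =
      boundaryOp D lam γ (fun k R x => iteratedDeriv i (A k R x))
        (fun R x => iteratedDeriv i (a R x)) k x l t :=
  iteratedDeriv_sub_ite hI _ (hA.smooth k x _ hx (nbhd_subset D k x l))
    (fun _ => hA.smooth_limit x _ (self_mem_ball1 x _)) i ht

theorem contDiffOn_boundaryStep {k : ℕ} {x : Site d} (hx : x ∈ box d k) (l : ℕ) :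
    ContDiffOn ℝ ∞ (fun τ => boundaryStep D lam γ A a k x l τ) I :=
  (hA.contDiffOn_boundaryOp hx l).sub
    (contDiffOn_ite _ fun _ => hA.contDiffOn_boundaryOp hx _)

theorem iteratedDeriv_boundaryStep (hI : IsOpen I) {k : ℕ} {x : Site d} (hx : x ∈ box d k)
    (l i : ℕ) {t : ℝ} (ht : t ∈ I) :
    iteratedDeriv i (fun τ => boundaryStep D lam γ A a k x l τ) t =
      boundaryStep D lam γ (fun k R x => iteratedDeriv i (A k R x))
        (fun R x => iteratedDeriv i (a R x)) k x l t := by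
  unfold boundaryStep
  rw [iteratedDeriv_sub_ite hI _ (hA.contDiffOn_boundaryOp hx l)
    (fun _ => hA.contDiffOn_boundaryOp hx _) i ht, hA.iteratedDeriv_boundaryOp hI hx _ i ht,
    hA.iteratedDeriv_boundaryOp hI hx _ i ht]

theorem contDiffOn_boundaryTerm (k : ℕ) (Z : Finset (Site d)) :
    ContDiffOn ℝ ∞ (fun τ => boundaryTerm D lam γ A a k τ Z) I :=
  ContDiffOn.sum fun _ hx => ContDiffOn.sum fun l _ =>
    contDiffOn_ite _ fun _ => hA.contDiffOn_boundaryStep hx l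

theorem iteratedDeriv_boundaryTerm (hI : IsOpen I) (k : ℕ) (Z : Finset (Site d)) (i : ℕ) {t : ℝ}
    (ht : t ∈ I) : iteratedDeriv i (fun τ => boundaryTerm D lam γ A a k τ Z) t =
      boundaryTerm D lam γ (fun k R x => iteratedDeriv i (A k R x))
        (fun R x => iteratedDeriv i (a R x)) k t Z := by
  unfold boundaryTerm
  rw [iteratedDeriv_sum_sum_ite hI _ _ _ (fun x hx l => hA.contDiffOn_boundaryStep hx l) i ht]
  refine Finset.sum_congr rfl fun x hx => Finset.sum_congr rfl fun l _ => ?_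
  rw [hA.iteratedDeriv_boundaryStep hI hx l i ht]

theorem isLocalTerm_limitTerm {t : ℝ} (ht : t ∈ I) (Z : Finset (Site d)) :
    IsLocalTerm Z (limitTerm a t Z) := by
  refine (localTerms r Z).sum_mem fun x _ => (localTerms r Z).sum_mem fun l _ => ?_
  split_ifs with h
  · subst h
    refine (localTerms r _).sub_mem (hA.isLocal_limit x _ t ht) ?_
    split_ifs
    · exact (hA.isLocal_limit x _ t ht).mono (ball1_mono x (Nat.sub_le l 1))
    · exact zero_mem _
  · exact zero_mem _

theorem isLocalTerm_boundaryOp {t : ℝ} (ht : t ∈ I) {k : ℕ} {x : Site d} (hx : x ∈ box d k)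
    (l : ℕ) : IsLocalTerm (nbhd D k x l) (boundaryOp D lam γ A a k x l t) := by
  refine (localTerms r _).sub_mem (hA.isLocal k x _ (nbhd_subset D k x l) t ht) ?_
  split_ifs with h
  · refine (hA.isLocal_limit x _ t ht).mono (ball1_subset_nbhd D hx (min_le_left _ _) ?_)
    exact (ball1_subset_bulk lam γ h (min_le_right _ _)).trans (box_mono (bulkSize_le lam γ k))
  · exact zero_mem _

theorem isLocalTerm_boundaryTerm {t : ℝ} (ht : t ∈ I) (k : ℕ) (Z : Finset (Site d)) :
    IsLocalTerm Z (boundaryTerm D lam γ A a k t Z) := by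
  refine (localTerms r Z).sum_mem fun x hx => (localTerms r Z).sum_mem fun l hl => ?_
  split_ifs with h
  · subst h
    refine (localTerms r _).sub_mem (hA.isLocalTerm_boundaryOp ht hx l) ?_
    split_ifs
    · refine (hA.isLocalTerm_boundaryOp ht hx (l - 1)).mono ?_
      rcases (Finset.mem_Icc.1 hl).2.lt_or_eq with hlk | rfl
      · intro y hy
        have hyb := nbhd_subset D k x _ hy
        by_contra hy'
        have h1 := lt_dist_of_notMem_nbhd D hyb hy'
        unfold nbhd at hy
        rw [if_pos (by omega)] at hy
        have h2 := (Finset.mem_filter.1 hy).2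
        have h3 : ((l - 1 : ℕ) : ℝ) ≤ l := by exact_mod_cast Nat.sub_le l 1
        linarith
      · rw [nbhd_of_le D le_rfl]
        exact nbhd_subset D _ _ _
    · exact zero_mem _
  · exact zero_mem _

/-- The increments in infinite volume decay rapidly. -/
theorem exists_norm_limitStep_le (i p : ℕ) : ∃ C : ℝ, 0 ≤ C ∧ ∀ x l, ∀ t ∈ I,
    ‖limitStep (fun R x => iteratedDeriv i (a R x)) x l t‖ * (1 + (l : ℝ)) ^ p ≤ C := by
  obtain ⟨C1, hC1, h1⟩ := hA.bdd_limit i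
  obtain ⟨C2, hC2, h2⟩ := hA.near_limit i p
  refine ⟨C1 + C2, by positivity, fun x l t ht => ?_⟩
  unfold limitStep
  split_ifs with hl
  -- Sites outside the ball of radius `l - 1` have distance more than `l - 1`; the summand `1` in
  -- the hypothesis of `near_limit` accommodates this.
  · refine (h2 (ball1 x l) x (ball1 x (l - 1)) l (self_mem_ball1 x l)
      (ball1_mono x (Nat.sub_le l 1)) (fun y _ hy => ?_) t ht).trans (by linarith)
    rw [mem_ball1, not_le] at hy
    have : ((l - 1 : ℕ) : ℝ) = l - 1 := by
      rw [Nat.cast_sub (by omega)]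
      simp
    linarith
  · have hl : l = 0 := by omega
    subst hl
    have := h1 x _ (self_mem_ball1 x 0) t ht
    simp only [sub_zero, Nat.cast_zero, add_zero, one_pow, mul_one]
    linarith

end

theorem le_dist_add_one_of_notMem_nbhd (D : BoxMetrics d) {k l : ℕ} {x y : Site d} (hy : y ∈ box d k)
    (h : y ∉ nbhd D k x (l - 1)) : (l : ℝ) ≤ D.dist k x y + 1 := by
  have h1 := lt_dist_of_notMem_nbhd D hy h
  have h2 : (l : ℝ) ≤ (l - 1 : ℕ) + 1 := by exact_mod_cast (by omega : l ≤ l - 1 + 1)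
  linarith

/-- The differences between finite and infinite volume are small as long as the boundary is far
away. -/
theorem exists_norm_boundaryOp_exitRadius_le (hA : IsSiteFamily D I lam γ A a) (hlam : 0 < lam)
    (hγ : 0 < γ) (hγ1 : γ < 1) (i p : ℕ) : ∃ C : ℝ, 0 ≤ C ∧ ∀ k, ∀ x ∈ box d k, ∀ t ∈ I,
    ‖boundaryOp D lam γ (fun k R x => iteratedDeriv i (A k R x))
        (fun R x => iteratedDeriv i (a R x)) k x (exitRadius D lam γ k x) t‖ *
      (1 + (exitRadius D lam γ k x : ℝ)) ^ p ≤ C := by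
  obtain ⟨C1, hC1, h1⟩ := hA.bdd i
  obtain ⟨C2, hC2, h2⟩ := hA.near i p
  obtain ⟨C3, hC3, h3⟩ := hA.compare (2 + lam) i p
  obtain ⟨C4, hC4, h4⟩ := hA.near_limit i p
  refine ⟨C1 + C2 + C3 + (2 + lam) ^ p * C4, by positivity, fun k x hx t ht => ?_⟩
  have hp4 : 0 ≤ (2 + lam) ^ p * C4 := by positivity
  set L := exitRadius D lam γ k x with hL
  unfold boundaryOp
  split_ifs with hb
  · set N := bulkSize lam γ k with hN
    set J := min L (bulkRadius lam γ k x) with hJ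
    have hJ0 : (0 : ℝ) ≤ J := by positivity
    have hLJ : 1 + (L : ℝ) ≤ (2 + lam) * (1 + J) := by
      rcases min_choice L (bulkRadius lam γ k x) with h | h
      · rw [hJ, h]
        have : (0 : ℝ) ≤ L := by positivity
        nlinarith
      · rw [hJ, h]
        exact one_add_exitRadius_le D hlam hγ hγ1 hb
    have e1 := h2 k x (nbhd D k x L) L hx (nbhd_subset D k x L) (fun y hy hy' => by
      have := lt_dist_of_notMem_nbhd D hy hy'
      linarith) t ht
    have e2 := h3 k N L x hx (bulkSize_spec lam hγ k) (by
      have ha := one_add_le_bulkSize hlam hγ1 k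
      have hb : (L : ℝ) ≤ k := by exact_mod_cast exitRadius_le D lam γ k x
      linarith) (fun y hy hy' => exitRadius_le_dist D lam γ hx hy hy') t ht
    have e3 := h4 (box d N) x (ball1 x J) J hb
      (ball1_subset_bulk lam γ hb (min_le_right _ _)) (fun y _ hy => by
        rw [mem_ball1, not_le] at hy
        linarith) t ht
    have e4 : ‖iteratedDeriv i (a (box d N) x) t - iteratedDeriv i (a (ball1 x J) x) t‖ *
        (1 + (L : ℝ)) ^ p ≤ (2 + lam) ^ p * C4 := by
      calc _ ≤ ‖iteratedDeriv i (a (box d N) x) t - iteratedDeriv i (a (ball1 x J) x) t‖ *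
            ((2 + lam) * (1 + J)) ^ p := by gcongr
        _ = (2 + lam) ^ p * (‖iteratedDeriv i (a (box d N) x) t -
            iteratedDeriv i (a (ball1 x J) x) t‖ * (1 + (J : ℝ)) ^ p) := by rw [mul_pow]; ring
        _ ≤ _ := by gcongr
    -- Chain of comparisons: from the neighbourhood to the whole box, from there to the infinite
    -- volume operator of the bulk, and from the bulk to the ball.
    have e5 : ‖iteratedDeriv i (A k (nbhd D k x L) x) t - iteratedDeriv i (a (ball1 x J) x) t‖ ≤
        ‖iteratedDeriv i (A k (box d k) x) t - iteratedDeriv i (A k (nbhd D k x L) x) t‖ +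
        ‖iteratedDeriv i (A k (box d k) x) t - iteratedDeriv i (a (box d N) x) t‖ +
        ‖iteratedDeriv i (a (box d N) x) t - iteratedDeriv i (a (ball1 x J) x) t‖ := by
      rw [norm_sub_rev (iteratedDeriv i (A k (box d k) x) t)
        (iteratedDeriv i (A k (nbhd D k x L) x) t)]
      refine le_trans (le_of_eq ?_) (norm_add₃_le ..)
      congr 1
      abel
    have e6 := mul_le_mul_of_nonneg_right e5 (by positivity : 0 ≤ (1 + (L : ℝ)) ^ p)
    rw [add_mul, add_mul] at e6
    linarith
  · have hL0 : L = 0 := exitRadius_eq_zero D lam γ hx hb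
    rw [hL0, sub_zero, Nat.cast_zero, add_zero, one_pow, mul_one]
    have := h1 k x (nbhd D k x 0) hx (nbhd_subset D k x 0) t ht
    linarith

/-- The increments of the differences decay rapidly. -/
theorem exists_norm_boundaryStep_le (hA : IsSiteFamily D I lam γ A a) (hlam : 0 < lam)
    (hγ : 0 < γ) (hγ1 : γ < 1) (i p : ℕ) : ∃ C : ℝ, 0 ≤ C ∧ ∀ k, ∀ x ∈ box d k, ∀ l,
    exitRadius D lam γ k x ≤ l → ∀ t ∈ I,
    ‖boundaryStep D lam γ (fun k R x => iteratedDeriv i (A k R x))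
        (fun R x => iteratedDeriv i (a R x)) k x l t‖ * (1 + (l : ℝ)) ^ p ≤ C := by
  obtain ⟨C1, hC1, h1⟩ := hA.exists_norm_boundaryOp_exitRadius_le hlam hγ hγ1 i p
  obtain ⟨C2, hC2, h2⟩ := hA.near i p
  obtain ⟨C3, hC3, h3⟩ := hA.near_limit i p
  refine ⟨C1 + 2 * C2 + C3, by positivity, fun k x hx l hl t ht => ?_⟩
  unfold boundaryStep
  split_ifs with hlt
  · have hl1 : ((l - 1 : ℕ) : ℝ) = l - 1 := by
      rw [Nat.cast_sub (by omega)]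
      simp
    have e1 := h2 k x (nbhd D k x l) l hx (nbhd_subset D k x l) (fun y hy hy' => by
      have := lt_dist_of_notMem_nbhd D hy hy'
      linarith) t ht
    have e2 := h2 k x (nbhd D k x (l - 1)) l hx (nbhd_subset D k x (l - 1)) (fun y hy hy' =>
      le_dist_add_one_of_notMem_nbhd D hy hy') t ht
    have e3 : ‖(if x ∈ box d (bulkSize lam γ k) then
          iteratedDeriv i (a (ball1 x (min l (bulkRadius lam γ k x))) x) t else 0) -
        (if x ∈ box d (bulkSize lam γ k) then
          iteratedDeriv i (a (ball1 x (min (l - 1) (bulkRadius lam γ k x))) x) t else 0)‖ *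
        (1 + (l : ℝ)) ^ p ≤ C3 := by
      split_ifs with hb
      -- Once the ball has reached the boundary of the bulk it no longer grows, and the infinite
      -- volume part of the increment vanishes.
      · by_cases hJ : l ≤ bulkRadius lam γ k x
        · rw [min_eq_left hJ, min_eq_left (by omega : l - 1 ≤ bulkRadius lam γ k x)]
          refine h3 (ball1 x l) x (ball1 x (l - 1)) l (self_mem_ball1 x l)
            (ball1_mono x (Nat.sub_le l 1)) (fun y _ hy => ?_) t ht
          rw [mem_ball1, not_le] at hy
          linarith
        · rw [min_eq_right (by omega), min_eq_right (by omega), sub_self, norm_zero, zero_mul]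
          exact hC3
      · rw [sub_self, norm_zero, zero_mul]
        exact hC3
    unfold boundaryOp
    set α := iteratedDeriv i (A k (box d k) x) t
    set α1 := iteratedDeriv i (A k (nbhd D k x l) x) t
    set α2 := iteratedDeriv i (A k (nbhd D k x (l - 1)) x) t
    set β1 := (if x ∈ box d (bulkSize lam γ k) then
      iteratedDeriv i (a (ball1 x (min l (bulkRadius lam γ k x))) x) t else 0)
    set β2 := (if x ∈ box d (bulkSize lam γ k) then
      iteratedDeriv i (a (ball1 x (min (l - 1) (bulkRadius lam γ k x))) x) t else 0)
    have e5 : ‖α1 - β1 - (α2 - β2)‖ ≤ ‖α - α1‖ + ‖α - α2‖ + ‖β1 - β2‖ := by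
      rw [norm_sub_rev α α1, norm_sub_rev β1 β2]
      refine le_trans (le_of_eq ?_) (norm_add₃_le ..)
      congr 1
      abel
    have e6 := mul_le_mul_of_nonneg_right e5 (by positivity : 0 ≤ (1 + (l : ℝ)) ^ p)
    rw [add_mul, add_mul] at e6
    linarith
  · have hl' : l = exitRadius D lam γ k x := by omega
    rw [sub_zero, hl']
    have := h1 k x hx t ht
    linarith

end IsSiteFamily

end

section

variable {d r : ℕ}

/-! ### Interactions built from rapidly decaying increments -/

theorem finDiam_le {δ : Site d → Site d → ℝ} {X : Finset (Site d)} {K : ℝ} (hK : 0 ≤ K)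
    (h : ∀ x ∈ X, ∀ y ∈ X, δ x y ≤ K) : (finDiam δ X : ℝ) ≤ K := by
  have h1 : finDiam δ X ≤ K.toNNReal := Finset.sup_le fun p hp =>
    Real.toNNReal_le_toNNReal (h p.1 (Finset.mem_product.1 hp).1 p.2 (Finset.mem_product.1 hp).2)
  calc (finDiam δ X : ℝ) ≤ (K.toNNReal : ℝ) := by exact_mod_cast h1
    _ = K := Real.coe_toNNReal K hK

theorem sum_one_add_sq_inv_le (T : Finset ℕ) : ∑ l ∈ T, ((1 + (l : ℝ)) ^ 2)⁻¹ ≤ lineBound := by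
  have h := sum_line_le (T.map Nat.castEmbedding) 0
  rw [Finset.sum_map] at h
  refine le_trans (le_of_eq (Finset.sum_congr rfl fun l _ => ?_)) h
  simp

theorem pairDiamSum_le_add {Λ : Finset (Site d)} {δ : Site d → Site d → ℝ} {n : ℕ}
    {φ φ₁ φ₂ : Finset (Site d) → Obs d r} {x y : Site d}
    (h : ∀ X ⊆ Λ, x ∈ X → ‖φ X‖ ≤ ‖φ₁ X‖ + ‖φ₂ X‖) :
    pairDiamSum Λ δ n φ x y ≤ pairDiamSum Λ δ n φ₁ x y + pairDiamSum Λ δ n φ₂ x y := by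
  unfold pairDiamSum
  rw [← Finset.sum_add_distrib]
  refine Finset.sum_le_sum fun X hX => ?_
  obtain ⟨h1, h2, -⟩ := Finset.mem_filter.1 hX
  rw [← mul_add]
  exact mul_le_mul_of_nonneg_left (h X (Finset.mem_powerset.1 h1) h2) (by positivity)

/-- An interaction whose terms are sums of rapidly decaying contributions of neighbourhoods has
rapid decay. -/
theorem pairDiamSum_mul_le {Λ : Finset (Site d)} {δ : Site d → Site d → ℝ} {s : ℕ} {ν : ℝ}
    (hm : IsRegularMetric Λ δ s ν) {φ : Finset (Site d) → Obs d r} {T : Site d → Finset ℕ}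
    {N : Site d → ℕ → Finset (Site d)} {e : Site d → ℕ → ℝ} {n m : ℕ} {c C : ℝ} (hc : 1 ≤ c)
    (hC0 : 0 ≤ C)
    (hφ : ∀ Z ⊆ Λ, ‖φ Z‖ ≤ ∑ x ∈ Λ, ∑ l ∈ T x, if N x l = Z then e x l else 0)
    (hN : ∀ x ∈ Λ, ∀ l ∈ T x, ∀ y ∈ N x l, y ∈ Λ → δ x y ≤ c * l)
    (he : ∀ x ∈ Λ, ∀ l ∈ T x, 0 ≤ e x l)
    (hC : ∀ x ∈ Λ, ∀ l ∈ T x, e x l * (1 + (l : ℝ)) ^ (n + m + s + 2) ≤ C)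
    {y z : Site d} (hy : y ∈ Λ) (hz : z ∈ Λ) :
    pairDiamSum Λ δ n φ y z * (1 + δ y z) ^ m ≤
      (2 * c) ^ (n + m + s) * C * lineBound * ν := by
  have hyz := hm.nonneg hy hz
  set W : Finset (Finset (Site d)) := Λ.powerset.filter fun X => y ∈ X ∧ z ∈ X with hW
  set K : ℝ := (2 * c) ^ (n + m + s) * C with hK
  have hK0 : 0 ≤ K := by positivity
  -- Every length occurring here is at most a multiple of `1 + l`. The exponent `n + m + s + 2` of
  -- the decay in `l` is spent on the diameter (`n`), the distance of `y` and `z` (`m`), the sum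
  -- over the centres `x` (`s`) and the sum over the radii (`2`).
  have key : ∀ x ∈ Λ, ∀ l ∈ T x, ∀ Z ∈ W, N x l = Z →
      (finDiam δ Z : ℝ) ^ n * e x l * (1 + δ y z) ^ m ≤
        K * ((1 + (l : ℝ)) ^ 2)⁻¹ * ((1 + δ y x) ^ s)⁻¹ := by
    rintro x hx l hl Z hZ rfl
    obtain ⟨h1, h2, h3⟩ := Finset.mem_filter.1 hZ
    have hsub := Finset.mem_powerset.1 h1
    have hl0 : (0 : ℝ) ≤ l := by positivity
    have hcl : 0 ≤ c * l := by positivity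
    have hd : ∀ u ∈ N x l, ∀ v ∈ N x l, δ u v ≤ 2 * c * (1 + l) - 1 := by
      intro u hu v hv
      have a1 := hm.triangle u (hsub hu) x hx v (hsub hv)
      have a2 := hN x hx l hl u hu (hsub hu)
      have a3 := hN x hx l hl v hv (hsub hv)
      rw [hm.symm u (hsub hu) x hx] at a1
      linarith
    have b1 : (finDiam δ (N x l) : ℝ) ≤ 2 * c * (1 + l) :=
      finDiam_le (by positivity) fun u hu v hv => (hd u hu v hv).trans (by linarith)
    have b2 : 1 + δ y z ≤ 2 * c * (1 + l) := by linarith [hd y h2 z h3]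
    have b4 : 0 ≤ δ y x := hm.nonneg hy hx
    have b3 : 1 + δ y x ≤ 2 * c * (1 + l) := by
      rw [hm.symm y hy x hx]
      linarith [hN x hx l hl y h2 hy]
    have he0 := he x hx l hl
    rw [mul_assoc K, ← mul_inv, ← div_eq_mul_inv, le_div_iff₀ (by positivity)]
    calc (finDiam δ (N x l) : ℝ) ^ n * e x l * (1 + δ y z) ^ m *
          ((1 + (l : ℝ)) ^ 2 * (1 + δ y x) ^ s)
        ≤ (2 * c * (1 + l)) ^ n * e x l * (2 * c * (1 + l)) ^ m *
          ((1 + (l : ℝ)) ^ 2 * (2 * c * (1 + l)) ^ s) := by gcongr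
      _ = (2 * c) ^ (n + m + s) * (e x l * (1 + (l : ℝ)) ^ (n + m + s + 2)) := by
          simp only [mul_pow, pow_add]
          ring
      _ ≤ _ := by
          rw [hK]
          gcongr
          exact hC x hx l hl
  calc pairDiamSum Λ δ n φ y z * (1 + δ y z) ^ m
      ≤ ∑ Z ∈ W, ∑ x ∈ Λ, ∑ l ∈ T x, if N x l = Z then
          K * ((1 + (l : ℝ)) ^ 2)⁻¹ * ((1 + δ y x) ^ s)⁻¹ else 0 := by
        unfold pairDiamSum
        rw [Finset.sum_mul]
        refine Finset.sum_le_sum fun Z hZ => ?_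
        have h1 := Finset.mem_powerset.1 (Finset.mem_filter.1 hZ).1
        calc (finDiam δ Z : ℝ) ^ n * ‖φ Z‖ * (1 + δ y z) ^ m
            ≤ (finDiam δ Z : ℝ) ^ n * (∑ x ∈ Λ, ∑ l ∈ T x, if N x l = Z then e x l else 0) *
              (1 + δ y z) ^ m := by
              gcongr
              exact hφ Z h1
          _ = ∑ x ∈ Λ, ∑ l ∈ T x, (finDiam δ Z : ℝ) ^ n * (if N x l = Z then e x l else 0) *
              (1 + δ y z) ^ m := by
              simp only [Finset.mul_sum, Finset.sum_mul]
          _ ≤ _ := by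
              refine Finset.sum_le_sum fun x hx => Finset.sum_le_sum fun l hl => ?_
              split_ifs with h
              · exact key x hx l hl Z hZ h
              · simp
    _ = ∑ x ∈ Λ, ∑ l ∈ T x, ∑ Z ∈ W, if N x l = Z then
          K * ((1 + (l : ℝ)) ^ 2)⁻¹ * ((1 + δ y x) ^ s)⁻¹ else 0 := by
        rw [Finset.sum_comm]
        exact Finset.sum_congr rfl fun x _ => Finset.sum_comm
    _ ≤ ∑ x ∈ Λ, ∑ l ∈ T x, K * ((1 + (l : ℝ)) ^ 2)⁻¹ * ((1 + δ y x) ^ s)⁻¹ := by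
        refine Finset.sum_le_sum fun x hx => Finset.sum_le_sum fun l _ => ?_
        have b4 : 0 ≤ δ y x := hm.nonneg hy hx
        rw [Finset.sum_ite_eq]
        split_ifs
        · exact le_rfl
        · positivity
    _ = ∑ x ∈ Λ, K * ((1 + δ y x) ^ s)⁻¹ * ∑ l ∈ T x, ((1 + (l : ℝ)) ^ 2)⁻¹ := by
        refine Finset.sum_congr rfl fun x _ => ?_
        rw [Finset.mul_sum]
        exact Finset.sum_congr rfl fun l _ => by ring
    _ ≤ ∑ x ∈ Λ, K * ((1 + δ y x) ^ s)⁻¹ * lineBound := by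
        refine Finset.sum_le_sum fun x hx => ?_
        have b4 : 0 ≤ δ y x := hm.nonneg hy hx
        exact mul_le_mul_of_nonneg_left (sum_one_add_sq_inv_le _) (by positivity)
    _ = K * lineBound * ∑ x ∈ Λ, ((1 + δ y x) ^ s)⁻¹ := by
        rw [Finset.mul_sum]
        exact Finset.sum_congr rfl fun x _ => by ring
    _ ≤ _ := mul_le_mul_of_nonneg_left (hm.sum_le y hy) (mul_nonneg hK0 lineBound_nonneg)

/-- A common weight for three families. -/
theorem exists_common_weight {β₁ β₂ β₃ : Type*} {f₁ ρ₁ : β₁ → ℝ} {f₂ ρ₂ : β₂ → ℝ}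
    {f₃ ρ₃ : β₃ → ℝ} (hf₁ : ∀ b, 0 ≤ f₁ b) (hf₂ : ∀ b, 0 ≤ f₂ b) (hf₃ : ∀ b, 0 ≤ f₃ b)
    (hρ₁ : ∀ b, 0 ≤ ρ₁ b) (hρ₂ : ∀ b, 0 ≤ ρ₂ b) (hρ₃ : ∀ b, 0 ≤ ρ₃ b)
    (h₁ : ∀ m : ℕ, ∃ C, ∀ b, f₁ b * (1 + ρ₁ b) ^ m ≤ C)
    (h₂ : ∀ m : ℕ, ∃ C, ∀ b, f₂ b * (1 + ρ₂ b) ^ m ≤ C)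
    (h₃ : ∀ m : ℕ, ∃ C, ∀ b, f₃ b * (1 + ρ₃ b) ^ m ≤ C) :
    ∃ ζ, IsRapidWeight ζ ∧ ∃ C > (0 : ℝ), (∀ b, f₁ b ≤ C * ζ (ρ₁ b)) ∧
      (∀ b, f₂ b ≤ C * ζ (ρ₂ b)) ∧ ∀ b, f₃ b ≤ C * ζ (ρ₃ b) := by
  obtain ⟨ζ, hζ, C, hC, h⟩ := exists_dominating_weight
    (f := Sum.elim f₁ (Sum.elim f₂ f₃)) (ρ := Sum.elim ρ₁ (Sum.elim ρ₂ ρ₃))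
    (by rintro (b | b | b) <;> simp [hf₁, hf₂, hf₃])
    (by rintro (b | b | b) <;> simp [hρ₁, hρ₂, hρ₃])
    (fun m => by
      obtain ⟨C1, e1⟩ := h₁ m
      obtain ⟨C2, e2⟩ := h₂ m
      obtain ⟨C3, e3⟩ := h₃ m
      refine ⟨max C1 (max C2 C3), ?_⟩
      rintro (b | b | b)
      · exact (e1 b).trans (le_max_left _ _)
      · exact (e2 b).trans ((le_max_left _ _).trans (le_max_right _ _))
      · exact (e3 b).trans ((le_max_right _ _).trans (le_max_right _ _)))
  exact ⟨ζ, hζ, C, hC, fun b => h (Sum.inl b), fun b => h (Sum.inr (Sum.inl b)),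
    fun b => h (Sum.inr (Sum.inr b))⟩

variable {D : BoxMetrics d} {I : Set ℝ} {lam γ : ℝ}
  {A : ℕ → Finset (Site d) → Site d → ℝ → Obs d r} {a : Finset (Site d) → Site d → ℝ → Obs d r}

theorem norm_limitTerm_le {Λ Z : Finset (Site d)} (hZ : Z ⊆ Λ) (t : ℝ) :
    ‖limitTerm a t Z‖ ≤ ∑ x ∈ Λ, ∑ l ∈ Finset.range Λ.card,
      if ball1 x l = Z then ‖limitStep a x l t‖ else 0 := by
  have hn : ∀ x l, 0 ≤ if ball1 x l = Z then ‖limitStep a x l t‖ else 0 := fun x l => by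
    split_ifs
    · positivity
    · exact le_rfl
  unfold limitTerm
  refine (norm_sum_le _ _).trans ?_
  refine le_trans (Finset.sum_le_sum fun x _ => ?_)
    (Finset.sum_le_sum_of_subset_of_nonneg hZ fun x _ _ => Finset.sum_nonneg fun l _ => hn x l)
  refine (norm_sum_le _ _).trans ?_
  refine le_trans (Finset.sum_le_sum fun l _ => ?_) (Finset.sum_le_sum_of_subset_of_nonneg
    (Finset.range_mono (Finset.card_le_card hZ)) fun l _ _ => hn x l)
  split_ifs <;> simp

theorem norm_boundaryTerm_le (k : ℕ) (t : ℝ) (Z : Finset (Site d)) :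
    ‖boundaryTerm D lam γ A a k t Z‖ ≤ ∑ x ∈ box d k,
      ∑ l ∈ Finset.Icc (exitRadius D lam γ k x) k,
        if nbhd D k x l = Z then ‖boundaryStep D lam γ A a k x l t‖ else 0 := by
  unfold boundaryTerm
  refine (norm_sum_le _ _).trans (Finset.sum_le_sum fun x _ => ?_)
  refine (norm_sum_le _ _).trans (Finset.sum_le_sum fun l _ => ?_)
  split_ifs <;> simp

/-- In the bulk the boundary interaction vanishes, unless the box is a single site. -/
theorem boundaryTerm_eq_zero {k : ℕ} {Z : Finset (Site d)} (hZ : Z ⊆ box d (bulkSize lam γ k))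
    (hk : ¬ box d k ⊆ box d (bulkSize lam γ k)) (t : ℝ) :
    boundaryTerm D lam γ A a k t Z = 0 := by
  refine Finset.sum_eq_zero fun x _ => Finset.sum_eq_zero fun l hl => if_neg fun h => hk ?_
  rw [Finset.mem_Icc] at hl
  rw [← h] at hZ
  exact (box_subset_of_nbhd_subset D lam γ hl.1 hl.2 hZ).2

/-- The interaction built from the increments. -/
def stepInteraction (D : BoxMetrics d) (lam γ : ℝ)
    (A : ℕ → Finset (Site d) → Site d → ℝ → Obs d r)
    (a : Finset (Site d) → Site d → ℝ → Obs d r) (s : ℕ → ℝ → Obs d r) :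
    ℝ → Interaction d r := fun t k Z =>
  restrictTo (box d (bulkSize lam γ k)) (limitTerm a t) Z + boundaryTerm D lam γ A a k t Z +
    if Z = ∅ then s k t else 0

/-- For `l = k` the neighbourhood is the whole box, and the operators subtracted in `boundaryOp` are
exactly those to which the infinite volume terms inside the bulk add up. -/
theorem sum_stepInteraction (s : ℕ → ℝ → Obs d r) (k : ℕ) (t : ℝ) :
    ∑ Z ∈ (box d k).powerset, stepInteraction D lam γ A a s t k Z =
      s k t + ∑ x ∈ box d k, A k (box d k) x t := by
  unfold stepInteraction
  rw [Finset.sum_add_distrib, Finset.sum_add_distrib, sum_boundaryTerm, Finset.sum_ite_eq',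
    if_pos (Finset.empty_mem_powerset _), add_comm]
  congr 1
  have hb : box d (bulkSize lam γ k) ⊆ box d k := box_mono (bulkSize_le lam γ k)
  have h1 := totalOp_restrictTo hb (limitTerm a t)
  unfold totalOp at h1
  rw [h1, sum_limitTerm, ← eq_sub_iff_add_eq']
  have h2 : ∀ x, boundaryOp D lam γ A a k x k t = A k (box d k) x t -
      if x ∈ box d (bulkSize lam γ k) then a (ball1 x (bulkRadius lam γ k x)) x t else 0 := by
    intro x
    unfold boundaryOp
    rw [nbhd_of_le D le_rfl, min_eq_right]
    exact (Nat.sub_le _ _).trans (bulkSize_le lam γ k)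
  rw [Finset.sum_congr rfl fun x _ => h2 x, Finset.sum_sub_distrib]
  congr 1
  rw [← Finset.sum_filter, Finset.filter_mem_eq_inter, Finset.inter_eq_right.2 hb]

end

section

variable {d r : ℕ}

/-! ### The rapid thermodynamic limit of sums over local families -/

variable {D : BoxMetrics d} {I : Set ℝ} {lam γ : ℝ}
  {A : ℕ → Finset (Site d) → Site d → ℝ → Obs d r} {a : Finset (Site d) → Site d → ℝ → Obs d r}

namespace IsSiteFamily

/-- Any regular metric below the `ℓ¹`-distance is allowed, because the limit terms are measured both
in infinite volume and, as parts of the box interaction, with the box metrics. -/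
theorem exists_pairDiamSum_limitTerm_le (hA : IsSiteFamily D I lam γ A a) (i n m s : ℕ) (ν : ℝ) :
    ∃ C : ℝ, ∀ (Λ : Finset (Site d)) (δ : Site d → Site d → ℝ), IsRegularMetric Λ δ s ν →
      (∀ x ∈ Λ, ∀ y ∈ Λ, δ x y ≤ l1Dist x y) → ∀ t ∈ I, ∀ y ∈ Λ, ∀ z ∈ Λ,
      pairDiamSum Λ δ n (limitTerm (fun R x => iteratedDeriv i (a R x)) t) y z *
        (1 + δ y z) ^ m ≤ C := by
  obtain ⟨C, hC, h⟩ := hA.exists_norm_limitStep_le i (n + m + s + 2)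
  refine ⟨(2 * 1) ^ (n + m + s) * C * lineBound * ν, fun Λ δ hm hδ t ht y hy z hz => ?_⟩
  refine pairDiamSum_mul_le hm (N := ball1) (T := fun _ => Finset.range Λ.card)
    (e := fun x l => ‖limitStep (fun R x => iteratedDeriv i (a R x)) x l t‖) le_rfl hC
    (fun Z hZ => norm_limitTerm_le hZ t) (fun x hx l _ u hu huL => ?_)
    (fun x _ l _ => norm_nonneg _) (fun x _ l _ => h x l t ht) hy hz
  rw [one_mul]
  exact (hδ x hx u huL).trans (mem_ball1.1 hu)

section

variable (hA : IsSiteFamily D I lam γ A a) (hlam : 0 < lam) (hγ : 0 < γ) (hγ1 : γ < 1)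
include hA hlam hγ hγ1

theorem exists_pairDiamSum_boundaryTerm_le (i n m : ℕ) :
    ∃ C : ℝ, ∀ k, ∀ t ∈ I, ∀ y ∈ box d k, ∀ z ∈ box d k,
      pairDiamSum (box d k) (D.dist k) n (boundaryTerm D lam γ
        (fun k R x => iteratedDeriv i (A k R x)) (fun R x => iteratedDeriv i (a R x)) k t) y z *
        (1 + D.dist k y z) ^ m ≤ C := by
  obtain ⟨C, hC, h⟩ := hA.exists_norm_boundaryStep_le hlam hγ hγ1 i (n + m + 2 * d + 2)
  refine ⟨_, fun k t ht y hy z hz => pairDiamSum_mul_le (D.isRegularMetric k) (N := nbhd D k)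
    (T := fun x => Finset.Icc (exitRadius D lam γ k x) k)
    (e := fun x l => ‖boundaryStep D lam γ (fun k R x => iteratedDeriv i (A k R x))
      (fun R x => iteratedDeriv i (a R x)) k x l t‖) (c := 2 * d + 1) (by
        have : (0 : ℝ) ≤ d := by positivity
        linarith) hC
    (fun Z _ => norm_boundaryTerm_le k t Z) (fun x hx l hl u hu _ => ?_)
    (fun x _ l _ => norm_nonneg _)
    (fun x hx l hl => h k x hx l (Finset.mem_Icc.1 hl).1 t ht) hy hz⟩
  exact dist_le_of_mem_nbhd D hx (Finset.mem_Icc.1 hl).2 hu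

/-- In a box consisting of a single site the boundary term need not vanish in the bulk. Only the
increment of radius `k` contributes to it, and this one is rapidly small in `k`. -/
theorem exists_norm_boundaryTerm_box_le (i m : ℕ) :
    ∃ C : ℝ, ∀ k, box d k ⊆ box d (bulkSize lam γ k) → ∀ t ∈ I,
      ‖boundaryTerm D lam γ (fun k R x => iteratedDeriv i (A k R x))
        (fun R x => iteratedDeriv i (a R x)) k t (box d k)‖ * (1 + (k : ℝ)) ^ m ≤ C := by
  obtain ⟨C, hC, h⟩ := hA.exists_norm_boundaryStep_le hlam hγ hγ1 i m
  refine ⟨C, fun k hk t ht => ?_⟩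
  have hcard : (box d k).card ≤ 1 := Finset.card_le_one.2 fun y hy z hz =>
    eq_of_box_subset_bulk hlam hγ hk hy hz
  have h1 : ∀ x ∈ box d k, ∑ l ∈ Finset.Icc (exitRadius D lam γ k x) k,
      (if nbhd D k x l = box d k then ‖boundaryStep D lam γ
        (fun k R x => iteratedDeriv i (A k R x)) (fun R x => iteratedDeriv i (a R x)) k x l t‖
        else 0) * (1 + (k : ℝ)) ^ m ≤ C := by
    intro x hx
    rw [Finset.sum_eq_single_of_mem k (Finset.right_mem_Icc.2 (exitRadius_le D lam γ k x))
      fun l hl hlk => ?_]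
    · rw [if_pos (nbhd_of_le D le_rfl x)]
      exact h k x hx k (exitRadius_le D lam γ k x) t ht
    · rw [if_neg, zero_mul]
      intro hN
      rw [Finset.mem_Icc] at hl
      rw [← hN] at hk
      exact hlk (box_subset_of_nbhd_subset D lam γ hl.1 hl.2 hk).1
  calc _ ≤ (∑ x ∈ box d k, ∑ l ∈ Finset.Icc (exitRadius D lam γ k x) k,
        if nbhd D k x l = box d k then ‖boundaryStep D lam γ
        (fun k R x => iteratedDeriv i (A k R x)) (fun R x => iteratedDeriv i (a R x)) k x l t‖
        else 0) * (1 + (k : ℝ)) ^ m := by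
        gcongr
        exact norm_boundaryTerm_le k t _
    _ = ∑ x ∈ box d k, ∑ l ∈ Finset.Icc (exitRadius D lam γ k x) k,
        (if nbhd D k x l = box d k then ‖boundaryStep D lam γ
        (fun k R x => iteratedDeriv i (A k R x)) (fun R x => iteratedDeriv i (a R x)) k x l t‖
        else 0) * (1 + (k : ℝ)) ^ m := by
        rw [Finset.sum_mul]
        exact Finset.sum_congr rfl fun x _ => Finset.sum_mul ..
    _ ≤ ∑ x ∈ box d k, C := Finset.sum_le_sum h1
    _ = (box d k).card * C := by rw [Finset.sum_const, nsmul_eq_mul]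
    _ ≤ 1 * C := by
        gcongr
        exact_mod_cast hcard
    _ = C := one_mul C

theorem exists_pairDiamSum_stepInteraction_le (hI : IsOpen I) (s : ℕ → ℝ → Obs d r)
    (i n m : ℕ) : ∃ C : ℝ, ∀ k, ∀ t ∈ I, ∀ y ∈ box d k, ∀ z ∈ box d k,
      pairDiamSum (box d k) (D.dist k) n
        (fun X => iteratedDeriv i (fun τ => stepInteraction D lam γ A a s τ k X) t) y z *
        (1 + D.dist k y z) ^ m ≤ C := by
  obtain ⟨C1, h1⟩ := hA.exists_pairDiamSum_limitTerm_le i n m (2 * d) (BoxMetrics.volBound d)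
  obtain ⟨C2, h2⟩ := hA.exists_pairDiamSum_boundaryTerm_le hlam hγ hγ1 i n m
  refine ⟨C1 + C2, fun k t ht y hy z hz => ?_⟩
  have e1 := h1 (box d k) (D.dist k) (D.isRegularMetric k) (D.dist_le_l1 k) t ht y hy z hz
  have e2 := h2 k t ht y hy z hz
  have hd0 := D.dist_nonneg hy hz
  have hp : 0 ≤ (1 + D.dist k y z) ^ m := by positivity
  refine le_trans (mul_le_mul_of_nonneg_right (pairDiamSum_le_add (φ₁ :=
    limitTerm (fun R x => iteratedDeriv i (a R x)) t) (φ₂ := boundaryTerm D lam γ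
        (fun k R x => iteratedDeriv i (A k R x)) (fun R x => iteratedDeriv i (a R x)) k t)
        fun X hX hyX => ?_) hp) (by rw [add_mul]; linarith)
  -- Sets entering the norm contain `y`, so the scalar placed on the empty set is not seen.
  have hne : X ≠ ∅ := Finset.nonempty_iff_ne_empty.1 ⟨y, hyX⟩
  unfold stepInteraction
  simp only [if_neg hne, add_zero]
  by_cases hXb : X ⊆ box d (bulkSize lam γ k)
  · simp only [restrictTo_of_subset hXb]
    rw [iteratedDeriv_add_of_contDiffOn hI (hA.contDiffOn_limitTerm X)
      (hA.contDiffOn_boundaryTerm k X) i ht, hA.iteratedDeriv_limitTerm hI X i ht,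
      hA.iteratedDeriv_boundaryTerm hI k X i ht]
    exact norm_add_le _ _
  · simp only [restrictTo_of_not_subset hXb, zero_add]
    rw [hA.iteratedDeriv_boundaryTerm hI k X i ht]
    exact le_add_of_nonneg_left (norm_nonneg _)

/-- A common weight for the finite volume interaction, its limit and their difference. -/
theorem exists_stepInteraction_weight (hI : IsOpen I) (s : ℕ → ℝ → Obs d r) (n i : ℕ) :
    ∃ ζ, IsRapidWeight ζ ∧ ∃ C > (0 : ℝ), ∀ t ∈ I,
      (∀ k, ∀ y ∈ box d k, ∀ z ∈ box d k, pairDiamSum (box d k) (D.dist k) n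
        (fun X => iteratedDeriv i (fun τ => stepInteraction D lam γ A a s τ k X) t) y z ≤
          C * Fweight d ζ (D.dist k y z)) ∧
      (∀ k, ∀ y ∈ box d k, ∀ z ∈ box d k, pairDiamSum (box d k) l1Dist n
        (fun X => iteratedDeriv i (fun τ => limitTerm a τ X) t) y z ≤
          C * Fweight d ζ (l1Dist y z)) ∧
      (∀ k, box d k ⊆ box d (bulkSize lam γ k) →
        ‖iteratedDeriv i (fun τ => boundaryTerm D lam γ A a k τ (box d k)) t‖ ≤ C * ζ k) := by
  obtain ⟨ζ, hζ, C, hC, h1, h2, h3⟩ := exists_common_weight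
    (β₁ := {q : ℕ × Site d × Site d × ℝ // q.2.1 ∈ box d q.1 ∧ q.2.2.1 ∈ box d q.1 ∧ q.2.2.2 ∈ I})
    (β₂ := {q : ℕ × Site d × Site d × ℝ // q.2.1 ∈ box d q.1 ∧ q.2.2.1 ∈ box d q.1 ∧ q.2.2.2 ∈ I})
    (β₃ := {q : ℕ × ℝ // box d q.1 ⊆ box d (bulkSize lam γ q.1) ∧ q.2 ∈ I})
    -- The factors `(1 + δ)^(d + 1)` compensate the denominator of `F_ζ`. The third family takes
    -- care of the boxes that consist of a single site.
    (f₁ := fun q => pairDiamSum (box d q.1.1) (D.dist q.1.1) n (fun X => iteratedDeriv i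
      (fun τ => stepInteraction D lam γ A a s τ q.1.1 X) q.1.2.2.2) q.1.2.1 q.1.2.2.1 *
        (1 + D.dist q.1.1 q.1.2.1 q.1.2.2.1) ^ (d + 1))
    (ρ₁ := fun q => D.dist q.1.1 q.1.2.1 q.1.2.2.1)
    (f₂ := fun q => pairDiamSum (box d q.1.1) l1Dist n (fun X => iteratedDeriv i
      (fun τ => limitTerm a τ X) q.1.2.2.2) q.1.2.1 q.1.2.2.1 *
        (1 + l1Dist q.1.2.1 q.1.2.2.1) ^ (d + 1))
    (ρ₂ := fun q => l1Dist q.1.2.1 q.1.2.2.1)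
    (f₃ := fun q => ‖iteratedDeriv i
      (fun τ => boundaryTerm D lam γ A a q.1.1 τ (box d q.1.1)) q.1.2‖)
    (ρ₃ := fun q => (q.1.1 : ℝ))
    (fun q => mul_nonneg (pairDiamSum_nonneg _ _ _ _ _ _)
      (pow_nonneg (by linarith [D.dist_nonneg q.2.1 q.2.2.1]) _))
    (fun q => mul_nonneg (pairDiamSum_nonneg _ _ _ _ _ _)
      (pow_nonneg (by linarith [l1Dist_nonneg q.1.2.1 q.1.2.2.1]) _))
    (fun q => norm_nonneg _) (fun q => D.dist_nonneg q.2.1 q.2.2.1)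
    (fun q => l1Dist_nonneg _ _) (fun q => Nat.cast_nonneg _)
    (fun m => by
      obtain ⟨C, h⟩ := hA.exists_pairDiamSum_stepInteraction_le hlam hγ hγ1 hI s i n (d + 1 + m)
      refine ⟨C, fun q => ?_⟩
      have := h q.1.1 q.1.2.2.2 q.2.2.2 q.1.2.1 q.2.1 q.1.2.2.1 q.2.2.1
      rwa [pow_add, ← mul_assoc] at this)
    (fun m => by
      obtain ⟨C, h⟩ := hA.exists_pairDiamSum_limitTerm_le i n (d + 1 + m) (2 * d) (lineBound ^ d)
      refine ⟨C, fun q => ?_⟩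
      have := h (box d q.1.1) l1Dist (isRegularMetric_l1Dist _) (fun _ _ _ _ => le_rfl)
        q.1.2.2.2 q.2.2.2 q.1.2.1 q.2.1 q.1.2.2.1 q.2.2.1
      rw [pow_add, ← mul_assoc] at this
      simp only [hA.iteratedDeriv_limitTerm hI _ i q.2.2.2]
      exact this)
    (fun m => by
      obtain ⟨C, h⟩ := hA.exists_norm_boundaryTerm_box_le hlam hγ hγ1 i m
      refine ⟨C, fun q => ?_⟩
      rw [hA.iteratedDeriv_boundaryTerm hI _ _ i q.2.2]
      exact h q.1.1 q.2.1 q.1.2 q.2.2)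
  refine ⟨ζ, hζ, C, hC, fun t ht => ⟨fun k y hy z hz => ?_, fun k y hy z hz => ?_, fun k hk =>
    h3 ⟨(k, t), hk, ht⟩⟩⟩
  · have := h1 ⟨(k, y, z, t), hy, hz, ht⟩
    have hd0 := D.dist_nonneg hy hz
    rw [Fweight, ← mul_div_assoc, le_div_iff₀ (by positivity)]
    exact this
  · have := h2 ⟨(k, y, z, t), hy, hz, ht⟩
    have hd0 := l1Dist_nonneg y z
    rw [Fweight, ← mul_div_assoc, le_div_iff₀ (by positivity)]
    exact this

/-- The difference between the finite volume interaction and its limit is small in the bulk. -/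
theorem bulkNorm_sub_le (hI : IsOpen I) (s : ℕ → ℝ → Obs d r) {n i : ℕ} {ζ : ℝ → ℝ}
    (hζ : IsRapidWeight ζ) {C : ℝ} (hC : 0 < C) {t : ℝ} (ht : t ∈ I) {M k : ℕ}
    (h : box d k ⊆ box d (bulkSize lam γ k) →
      ‖iteratedDeriv i (fun τ => boundaryTerm D lam γ A a k τ (box d k)) t‖ ≤ C * ζ k)
    (hMk : (M : ℝ) + lam * (M : ℝ) ^ γ ≤ k) :
    bulkNorm ζ n M (fun X => iteratedDeriv i
      (fun τ => limitTerm a τ X - stepInteraction D lam γ A a s τ k X) t) ≤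
        ENNReal.ofReal (C / ζ 0 * ζ ((M : ℝ) ^ γ)) := by
  have hM := le_bulkSize hlam hMk
  have hk := hM.trans (bulkSize_le lam γ k)
  have hs : (0 : ℝ) ≤ (M : ℝ) ^ γ := by positivity
  have hz0 := hζ.pos 0 le_rfl
  have hzM := hζ.pos _ hs
  have hdiff : ∀ X ⊆ box d M, X.Nonempty → ‖iteratedDeriv i
      (fun τ => limitTerm a τ X - stepInteraction D lam γ A a s τ k X) t‖ =
      ‖iteratedDeriv i (fun τ => boundaryTerm D lam γ A a k τ X) t‖ := by
    intro X hX hne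
    unfold stepInteraction
    simp only [if_neg (Finset.nonempty_iff_ne_empty.1 hne), add_zero,
      restrictTo_of_subset (hX.trans (box_mono hM)), sub_add_cancel_left]
    rw [iteratedDeriv_fun_neg, norm_neg]
  refine setNorm_le hζ fun y hy z hz => ⟨l1Dist_nonneg y z, ?_⟩
  have hF := Fweight_pos (d := d) hζ (l1Dist_nonneg y z)
  -- On nonempty sets of the bulk the two interactions differ by the boundary term, which vanishes
  -- unless the box is a single site. In that case the only set to consider is the box itself, the
  -- division by `ζ 0` comes from `F_ζ(0) = ζ(0)`, and `M^γ ≤ M ≤ k` together with monotonicity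
  -- yields the required weight.
  by_cases hsub : box d k ⊆ box d (bulkSize lam γ k)
  · have hsing : ∀ u ∈ box d k, ∀ v ∈ box d k, u = v := fun u hu v hv =>
      eq_of_box_subset_bulk hlam hγ hsub hu hv
    obtain rfl := hsing y (box_mono hk hy) z (box_mono hk hz)
    have hbox : box d k = {y} := Finset.eq_singleton_iff_unique_mem.2
      ⟨box_mono hk hy, fun u hu => hsing u hu y (box_mono hk hy)⟩
    have hW : (box d M).powerset.filter (fun X => y ∈ X ∧ y ∈ X) ⊆ {box d k} := by
      intro X hX
      obtain ⟨h1, h2, -⟩ := Finset.mem_filter.1 hX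
      rw [Finset.mem_singleton]
      refine Finset.Subset.antisymm ((Finset.mem_powerset.1 h1).trans (box_mono hk)) ?_
      rw [hbox]
      exact Finset.singleton_subset_iff.2 h2
    have hMγ : (M : ℝ) ^ γ ≤ k := by
      refine le_trans ?_ (by exact_mod_cast hk : (M : ℝ) ≤ k)
      rcases Nat.eq_zero_or_pos M with h0 | h0
      · rw [h0, Nat.cast_zero, Real.zero_rpow hγ.ne']
      · have := Real.rpow_le_rpow_of_exponent_le (x := (M : ℝ)) (by exact_mod_cast h0) hγ1.le
        rwa [Real.rpow_one] at this
    have hanti : ζ k ≤ ζ ((M : ℝ) ^ γ) := hζ.antitone hs (hs.trans hMγ) hMγ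
    have hdiam : (finDiam l1Dist (box d k) : ℝ) ^ n ≤ 1 := by
      refine pow_le_one₀ (NNReal.coe_nonneg _) (finDiam_le zero_le_one fun u hu v hv => ?_)
      rw [hsing u hu v hv, (l1Dist_eq_zero_iff v v).2 rfl]
      exact zero_le_one
    rw [(l1Dist_eq_zero_iff y y).2 rfl]
    calc _ ≤ ∑ X ∈ {box d k}, (finDiam l1Dist X : ℝ) ^ n *
          ‖iteratedDeriv i (fun τ => boundaryTerm D lam γ A a k τ X) t‖ := by
          unfold pairDiamSum
          refine le_trans (Finset.sum_le_sum fun X hX => ?_)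
            (Finset.sum_le_sum_of_subset_of_nonneg hW fun _ _ _ => by positivity)
          obtain ⟨h1, h2, -⟩ := Finset.mem_filter.1 hX
          rw [hdiff X (Finset.mem_powerset.1 h1) ⟨y, h2⟩]
      _ = (finDiam l1Dist (box d k) : ℝ) ^ n *
          ‖iteratedDeriv i (fun τ => boundaryTerm D lam γ A a k τ (box d k)) t‖ :=
          Finset.sum_singleton _ _
      _ ≤ 1 * (C * ζ ((M : ℝ) ^ γ)) := by
          gcongr
          exact (h hsub).trans (by gcongr)
      _ = _ := by
          simp only [Fweight, add_zero, one_pow, div_one]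
          field_simp
  · have h0 : pairDiamSum (box d M) l1Dist n (fun X => iteratedDeriv i
        (fun τ => limitTerm a τ X - stepInteraction D lam γ A a s τ k X) t) y z = 0 := by
      unfold pairDiamSum
      refine Finset.sum_eq_zero fun X hX => ?_
      obtain ⟨h1, h2, -⟩ := Finset.mem_filter.1 hX
      have hX := Finset.mem_powerset.1 h1
      rw [hdiff X hX ⟨y, h2⟩, hA.iteratedDeriv_boundaryTerm hI k X i ht,
        boundaryTerm_eq_zero (hX.trans (box_mono hM)) hsub, norm_zero, mul_zero]
    rw [h0]
    positivity

/-- Sums over local families have a rapid thermodynamic limit. -/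
theorem familyHasRapidLimit (hI : IsOpen I) {s : ℕ → ℝ → Obs d r}
    (hs : ∀ k, ContDiffOn ℝ ∞ (s k) I) (hsl : ∀ k, ∀ t ∈ I, IsLocalTerm ∅ (s k t))
    {F : OpFamily d r}
    (hF : ∀ t ∈ I, ∀ k, F t k = s k t + ∑ x ∈ box d k, A k (box d k) x t) :
    FamilyHasRapidLimit D I γ F := by
  refine ⟨stepInteraction D lam γ A a s, fun t ht k => ?_, fun n => ?_⟩
  · rw [sum_stepInteraction, hF t ht k]
  -- For each order of the derivative one weight must serve the box interaction, its limit and their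
  -- difference.
  choose ζs hζ C hC h using hA.exists_stepInteraction_weight hlam hγ hγ1 hI s n
  refine ⟨ζs 0, fun t ht k X _ => ?_, ζs, ⟨rfl, hζ⟩, ⟨fun k X _ => ?_, fun i => ?_⟩,
    fun t => limitTerm a t, fun t ht X => hA.isLocalTerm_limitTerm ht X,
    ⟨fun k X _ => hA.contDiffOn_limitTerm X, fun i => ?_⟩, fun i => ?_⟩
  · refine (localTerms r X).add_mem ((localTerms r X).add_mem ?_
      (hA.isLocalTerm_boundaryTerm ht k X)) ?_
    · by_cases hX : X ⊆ box d (bulkSize lam γ k)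
      · rw [restrictTo_of_subset hX]
        exact hA.isLocalTerm_limitTerm ht X
      · rw [restrictTo_of_not_subset hX]
        exact zero_mem _
    · split_ifs with h0
      · rw [h0]
        exact hsl k t ht
      · exact zero_mem _
  · refine ContDiffOn.add (ContDiffOn.add ?_ (hA.contDiffOn_boundaryTerm k X))
      (contDiffOn_ite _ fun _ => hs k)
    by_cases hX : X ⊆ box d (bulkSize lam γ k)
    · simp only [restrictTo_of_subset hX]
      exact hA.contDiffOn_limitTerm X
    · simp only [restrictTo_of_not_subset hX]
      exact contDiffOn_const
  · refine lt_of_le_of_lt (iSup₂_le fun t ht => iSup_le fun k => ?_)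
      (ENNReal.ofReal_lt_top (r := C i))
    exact setNorm_le (hζ i) fun y hy z hz => ⟨D.dist_nonneg hy hz, (h i t ht).1 k y hy z hz⟩
  · refine lt_of_le_of_lt (iSup₂_le fun t ht => iSup_le fun k => ?_)
      (ENNReal.ofReal_lt_top (r := C i))
    exact setNorm_le (hζ i) fun y hy z hz => ⟨l1Dist_nonneg y z, (h i t ht).2.1 k y hy z hz⟩
  · refine ⟨lam, hlam, C i / ζs i 0, div_pos (hC i) ((hζ i).pos 0 le_rfl), fun M k hMk =>
      iSup₂_le fun t ht => ?_⟩
    exact hA.bulkNorm_sub_le hlam hγ hγ1 hI s (hζ i) (hC i) ht ((h i t ht).2.2 k) hMk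

end

end IsSiteFamily

end

section

variable {d r : ℕ}

/-! ### Averaged evolutions as sums over local families -/

variable {α : Type*} [MeasurableSpace α] {μ : Measure α} {κ V : α → ℝ}

theorem IsPolyKernel.integrable_heisenberg (hκ : IsPolyKernel μ κ V) {H : Obs d r}
    (hH : IsSelfAdjoint H) (C : Obs d r) : Integrable (fun p => κ p • heisenberg H (V p) C) μ :=
  hκ.integrable_smul (G := fun v => heisenberg H v C) (continuous_heisenberg H continuous_const)
    (C := ‖C‖) (q := 0) fun v => by rw [norm_heisenberg hH, pow_zero, mul_one]

theorem evolvedAvg_add (hκ : IsPolyKernel μ κ V) {H : Obs d r} (hH : IsSelfAdjoint H)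
    (B C : Obs d r) :
    evolvedAvg μ κ V H (B + C) = evolvedAvg μ κ V H B + evolvedAvg μ κ V H C := by
  unfold evolvedAvg
  rw [← integral_add (hκ.integrable_heisenberg hH B) (hκ.integrable_heisenberg hH C)]
  simp only [heisenberg_add, smul_add]

theorem evolvedAvg_sum (hκ : IsPolyKernel μ κ V) {H : Obs d r} (hH : IsSelfAdjoint H)
    {ι : Type*} (s : Finset ι) (f : ι → Obs d r) :
    evolvedAvg μ κ V H (∑ j ∈ s, f j) = ∑ j ∈ s, evolvedAvg μ κ V H (f j) := by
  unfold evolvedAvg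
  rw [← integral_finsetSum s fun j _ => hκ.integrable_heisenberg hH (f j)]
  simp only [heisenberg_sum, Finset.smul_sum]

/-- `𝒜_∅` has no generators, so its elements are scalars and do not evolve. -/
theorem evolvedAvg_of_isLocalTerm_empty {H C : Obs d r} (hC : IsLocalTerm ∅ C) :
    evolvedAvg μ κ V H C = (∫ p, κ p ∂μ) • C := by
  have h1 : ∀ Q : Obs d r, Commute C Q := fun Q =>
    commute_of_mem_localAlg hC.1 fun g hg => by simp [localGen] at hg
  have h2 : ∀ v, heisenberg H v C = C := fun v => by
    rw [heisenberg_eq, ← (h1 (expI H v)).eq, mul_assoc, ← expI_add]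
    simp [expI_zero]
  unfold evolvedAvg
  simp only [h2]
  exact integral_smul_const κ C

theorem evolvedAvg_totalOp (hκ : IsPolyKernel μ κ V) {Λ : Finset (Site d)}
    {h c : Finset (Site d) → Obs d r} (hh : ∀ Y ⊆ Λ, IsLocalTerm Y (h Y))
    (hc : IsLocalTerm ∅ (c ∅)) : evolvedAvg μ κ V (totalOp Λ h) (totalOp Λ c) =
      (∫ p, κ p ∂μ) • c ∅ + ∑ x ∈ Λ, siteAvg μ κ V Λ h c x := by
  have hH := totalOp_isSelfAdjoint hh
  rw [totalOp_eq_sum_siteTerm Λ c, evolvedAvg_add hκ hH, evolvedAvg_sum hκ hH,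
    evolvedAvg_of_isLocalTerm_empty hc]
  rfl

variable {I : Set ℝ} {D : BoxMetrics d} {γ lam : ℝ} {Φ Φc : ℝ → Interaction d r}
  {Ψ Ψc : ℝ → Finset (Site d) → Obs d r}

theorem isSiteFamily_siteAvg (hI : IsOpen I) (hκ : IsPolyKernel μ κ V) (hlam : 0 < lam)
    (hH : IsRapidPair D I γ lam Φ Ψ) (hE : IsExpPair D I Φ Ψ)
    (hC : IsRapidPair D I γ lam Φc Ψc) :
    IsSiteFamily D I lam γ (fun k R x t => siteAvg μ κ V R (Φ t k) (Φc t k) x)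
      (fun R x t => siteAvg μ κ V R (Ψ t) (Ψc t) x) where
  smooth _ _ _ hx hR := contDiffOn_siteAvg_box hI hκ hH hE hC hR hx
  smooth_limit _ _ hx := contDiffOn_siteAvg_limit hI hκ hH hE hC hx
  isLocal k x _ hR t ht := IsLocalTerm.siteAvg (fun Y hY => hH.isLocal t ht k Y (hY.trans hR))
    (fun Y hY => hC.isLocal t ht k Y (hY.trans hR)) x μ κ V
  isLocal_limit x _ t ht := IsLocalTerm.siteAvg (fun Y _ => hH.isLocal_limit t ht Y)
    (fun Y _ => hC.isLocal_limit t ht Y) x μ κ V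
  bdd i := exists_norm_siteAvg_box_le hI hκ hH hE hC i
  bdd_limit i := by
    obtain ⟨C, hC0, h⟩ := exists_norm_siteAvg_limit_le hI hκ hH hE hC i
    exact ⟨C, hC0, fun x R => h R x⟩
  near i p := exists_norm_siteAvg_box_sub_le hI hκ hH hE hC i p
  near_limit i p := exists_norm_siteAvg_limit_sub_le hI hκ hH hE hC i p
  compare K0 i p := exists_norm_siteAvg_box_sub_limit_le hI hκ hlam hH hE hC K0 i p

end

end FermionLattice

end

/-! ### The rapid thermodynamic limit of the inverse Liouvillian. -/

theorem lemmaC4 (d r : ℕ) (D : FermionLattice.BoxMetrics d)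
    (I : Set ℝ) (hI : IsOpen I) (hIc : I.OrdConnected)
    (w : ℝ → ℝ) (hw : FermionLattice.IsGapKernel w) (g : ℝ) (hg : 0 < g)
    (a : ℝ) (ha : 0 < a) (γ : ℝ) (hγ : γ ∈ Set.Ioo (0 : ℝ) 1)
    (H B : FermionLattice.OpFamily d r)
    (hH : FermionLattice.FamilyHasRapidLimitWith D I (fun s => Real.exp (-a * s)) γ H)
    (hB : FermionLattice.MemLRapid D I B ∨
      ∃ v : ℝ → ℕ → FermionLattice.Site d → ℝ,
        FermionLattice.IsLipschitzPotential D I v ∧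
        B = FermionLattice.potentialFamily r v)
    (hHB : FermionLattice.FamilyHasRapidLimit D I γ
      (fun t k => Complex.I • (H t k * B t k - B t k * H t k))) :
    FermionLattice.FamilyHasRapidLimit D I γ
      (fun t k => FermionLattice.invLiouvillian (FermionLattice.scaleKernel w g)
        (H t k) (B t k)) := by
  obtain ⟨Φ, hΦsum, hΦ⟩ := hH
  obtain ⟨Φc, hΦcsum, hΦc⟩ := hHB
  -- The weight at `n = 0` is the given exponential; it provides the exponential decay of `H` and of
  -- its limit on which the Lieb-Robinson bound rests.
  obtain ⟨lam₁, hlam₁, Ψ, hP₁, K, hK, hexp⟩ :=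
    FermionLattice.exists_isRapidPair hI hIc hγ.1 (hΦ 0) fun n => ⟨_, hΦ n⟩
  obtain ⟨ζ, hζ⟩ := hΦc 0
  obtain ⟨lam₂, -, Ψc, hP₂, -⟩ := FermionLattice.exists_isRapidPair hI hIc hγ.1 hζ hΦc
  have hE : FermionLattice.IsExpPair D I Φ Ψ :=
    ⟨a, ha, K, hK, by simpa only [neg_mul] using hexp⟩
  -- One constant has to serve both `H` and the commutator. Closeness with some constant implies
  -- closeness with every larger one.
  have hlam : 0 < max lam₁ lam₂ := lt_max_of_lt_left hlam₁
  have hpair := hP₁.mono (le_max_left lam₁ lam₂)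
  have hpairc := hP₂.mono (le_max_right lam₁ lam₂)
  have hint := FermionLattice.scaleKernel_integrable hw hg
  have hdecay := FermionLattice.scaleKernel_decay hw hg
  have hκ := FermionLattice.isPolyKernel_strip hint hdecay
  -- The scalar term of the empty set is invariant under the evolution, so averaging multiplies it
  -- by the total mass of the kernel; it is passed on as the term of the empty set.
  refine (FermionLattice.isSiteFamily_siteAvg hI hκ hlam hpair hE hpairc).familyHasRapidLimit
    hlam hγ.1 hγ.2 hI (s := fun k t => (∫ p, FermionLattice.stripKernel
      (FermionLattice.scaleKernel w g) p ∂FermionLattice.stripMeasure) • Φc t k ∅)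
    (fun k => (hpairc.smooth k ∅ (Finset.empty_subset _)).const_smul _)
    (fun k t ht => (FermionLattice.localTerms r ∅).smul_mem _
      (hpairc.isLocal t ht k ∅ (Finset.empty_subset _))) fun t ht k => ?_
  have hloc := hpair.isLocal t ht k
  have e : H t k = FermionLattice.totalOp (FermionLattice.box d k) (Φ t k) := hΦsum t ht k
  have hsa : IsSelfAdjoint (H t k) := by
    rw [e]
    exact FermionLattice.totalOp_isSelfAdjoint hloc
  have ec : Complex.I • (H t k * B t k - B t k * H t k) =
      FermionLattice.totalOp (FermionLattice.box d k) (Φc t k) := hΦcsum t ht k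
  rw [FermionLattice.invLiouvillian_eq hint (FermionLattice.scaleKernel_even hw g) hdecay hsa, ec,
    e]
  exact FermionLattice.evolvedAvg_totalOp hκ hloc
    (hpairc.isLocal t ht k ∅ (Finset.empty_subset _))
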